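/- Let $F$ be a field, $Sm_F$ the category of smooth schemes of finite type over $F$, $\tau$ the Nisnevich or the étale topology on $Sm_F$, and $R$ a commutative ring. Let $\mathrm{sMod}_R(Sm_F)$ be the category of presheaves of simplicial $R$-modules on $Sm_F$, $\mathrm{scoCAlg}_R(Sm_F)$ the category of presheaves of simplicial cocommutative, coassociative, counital $R$-coalgebras on $Sm_F$, and $U:\mathrm{scoCAlg}_R(Sm_F)\to \mathrm{sMod}_R(Sm_F)$ the forgetful functor. For a simplicial set $K$ and a presheaf $M$ of simplicial modules (or coalgebras) put $(K\otimes M)_n(X)=R[K_n]\otimes_R M_n(X)$, where $R[K_n]$ is the free module on $K_n$ (a coalgebra through the diagonal of $K_n$), and $\mathrm{Map}(M,N)_n=\mathrm{Hom}(\Delta^n\otimes M,N)$. Consider the following three classes of morphisms $f:M\to N$ of $\mathrm{sMod}_R(Sm_F)$: * the object-wise weak equivalences $\mathcal W_R$: $f(X):M(X)\to N(X)$ is a weak equivalence of simplicial modules for every $X\in Sm_F$; * the $\tau$-local weak equivalences $\mathcal W_{R,\tau}$: $x^*f:x^*M\to x^*N$ is a weak equivalence of simplicial modules for every point $x$ of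 the site $(Sm_F,\tau)$; * the $\tau$-$\mathbb A^1$-local weak equivalences $\mathcal W_{R,\tau}^{\mathbb A^1}$: $\mathrm{Map}(N,P)\to\mathrm{Map}(M,P)$ is a weak equivalence for every $\mathbb A^1$-local $P$, where $P$ is $\mathbb A^1$-local if $P\to 0$ has the right lifting property with respect to all monomorphisms in $\mathcal W_{R,\tau}$ (that is, $P$ is fibrant in the $\tau$-local model structure) and $\mathrm{Map}(R[h_X],P)\to\mathrm{Map}(R[h_{X\times\mathbb A^1}],P)$ is a weak equivalence for every $X\in Sm_F$. Here $R[h_X]$ is the free presheaf of modules on the presheaf of sets $h_X$ represented by $X$. Let $\mathcal W$ be one of these three classes. Then: 1. $\mathrm{sMod}_R(Sm_F)$ has a model structure whose cofibrations are the monomorphisms and whose weak equivalences are the morphisms in $\mathcal W$ (the injective, $\tau$-local, respectively $\tau$-$\mathbb A^1$-local model structure). 2. $\mathrm{scoCAlg}_R(Sm_F)$ has all small limits and colimits, $U$ has a right adjoint, and $\mathrm{scoCAlg}_R(Sm_F)$ has a model structure which is left-induced along $U$ from that in (1): a morphism $f$ is a cofibration if and only if $U(f)$ is a cofibration (a monomorphism),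 and it is a weak equivalence if and only if $U(f)$ is a weak equivalence, that is $U(f)\in\mathcal W$. 3. This model structure on $\mathrm{scoCAlg}_R(Sm_F)$ is cofibrantly generated, and it is a simplicial model category for the tensor $K\otimes C$ and the mapping spaces $\mathrm{Map}(C,D)$ above. 4. There is a cardinal $\kappa_0$ such that for every regular cardinal $\kappa\geq\kappa_0$ the $\kappa$-presentable objects of $\mathrm{scoCAlg}_R(Sm_F)$ form a set up to isomorphism, and the morphisms $f$ between $\kappa$-presentable objects such that $U(f)$ is a monomorphism generate the cofibrations: the class of cofibrations is the smallest class of morphisms which contains them and is closed under pushouts, coproducts, transfinite compositions and retracts. -/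

import Mathlib

open CategoryTheory Limits Opposite MonoidalCategory AlgebraicGeometry HomotopicalAlgebra
open scoped TensorProduct

universe w v u

noncomputable section

namespace MotivicCoalgebra

/-! ### Model categories -/

section ModelCategories

variable {𝓒 : Type u} [Category.{v} 𝓒]

/-- A weakly saturated class of morphisms: stable under pushouts, retracts, and
(transfinite) compositions and coproducts indexed by `w`-small sets. -/
structure IsWeaklySaturated (P : MorphismProperty 𝓒) : Prop where
  cobaseChange : P.IsStableUnderCobaseChange
  retracts : P.IsStableUnderRetracts
  coproducts : MorphismProperty.IsStableUnderCoproducts.{w} P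
  transfinite : MorphismProperty.IsStableUnderTransfiniteComposition.{w} P

/-- `P` is the smallest weakly saturated class which contains `I`. -/
structure IsGeneratedBy (I P : MorphismProperty 𝓒) : Prop where
  isWeaklySaturated : IsWeaklySaturated.{w} P
  le : I ≤ P
  minimal : ∀ Q : MorphismProperty 𝓒, IsWeaklySaturated.{w} Q → I ≤ Q → P ≤ Q

variable (𝓒) in
/-- A model category is cofibrantly generated if there are `w`-small sets `I` and `J` of morphisms,
both of which permit the small object argument, such that `I` generates the cofibrations and `J`
generates the trivial cofibrations. -/
def IsCofibrantlyGenerated [ModelCategory 𝓒] : Prop :=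
  ∃ I J : MorphismProperty 𝓒,
    MorphismProperty.HasSmallObjectArgument.{w} I ∧
    MorphismProperty.HasSmallObjectArgument.{w} J ∧
    IsGeneratedBy.{w} I (cofibrations 𝓒) ∧ IsGeneratedBy.{w} J (trivialCofibrations 𝓒)

variable (𝓒) in
/-- A model category with an action `(K, X) ↦ K ⊙ₗ X` of the monoidal category of simplicial sets
(with the cartesian product) is a simplicial model category if the functors `K ⊙ₗ -` and `- ⊙ₗ X`
have right adjoints (so that there are cotensors and simplicial mapping spaces, the latter
given by `Map(X, Y)_n = Hom(Δ[n] ⊙ₗ X, Y)`), and if the pushout-product axiom holds with respect to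
the Kan model structure on simplicial sets: the cofibrations of that structure are the
monomorphisms, its trivial cofibrations are the anodyne extensions. -/
structure IsSimplicialModelCategory [ModelCategory 𝓒] [MonoidalLeftAction SSet.{w} 𝓒] : Prop where
  cotensor (K : SSet.{w}) :
    ((MonoidalLeftAction.curriedAction SSet.{w} 𝓒).obj K).IsLeftAdjoint
  mappingSpace (X : 𝓒) :
    ((MonoidalLeftAction.curriedAction SSet.{w} 𝓒).flip.obj X).IsLeftAdjoint
  cofibration {K L : SSet.{w}} (i : K ⟶ L) {X Y : 𝓒} (j : X ⟶ Y)
    (sq : (MonoidalLeftAction.curriedAction SSet.{w} 𝓒).PushoutObjObj i j) :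
    Mono i → cofibrations 𝓒 j → cofibrations 𝓒 sq.ι
  trivialCofibration {K L : SSet.{w}} (i : K ⟶ L) {X Y : 𝓒} (j : X ⟶ Y)
    (sq : (MonoidalLeftAction.curriedAction SSet.{w} 𝓒).PushoutObjObj i j) :
    Mono i → cofibrations 𝓒 j → (SSet.anodyneExtensions i ∨ weakEquivalences 𝓒 j) →
      weakEquivalences 𝓒 sq.ι

/-- The model structure of `𝓓` is left-induced along `U` from that of `𝓒`: the functor `U` has
a right adjoint, and a morphism is a cofibration, or a weak equivalence, if and only if
its image by `U` is. -/
structure IsLeftInduced {𝓓 : Type*} [Category* 𝓓] [ModelCategory 𝓒] [ModelCategory 𝓓]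
    (U : 𝓓 ⥤ 𝓒) : Prop where
  isLeftAdjoint : U.IsLeftAdjoint
  cofibrations_eq : cofibrations 𝓓 = (cofibrations 𝓒).inverseImage U
  weakEquivalences_eq : weakEquivalences 𝓓 = (weakEquivalences 𝓒).inverseImage U

end ModelCategories

/-! ### Presheaves of simplicial coalgebras -/

section Coalgebras

variable (R : Type w) [CommRing R]

/-- Cocommutativity of an `R`-coalgebra (coalgebras are coassociative and counital). -/
def isCocomm : ObjectProperty (CoalgCat.{w} R) := fun A => Coalgebra.IsCocomm R A

instance : (isCocomm R).IsMonoidal where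
  prop_unit := (inferInstance : Coalgebra.IsCocomm R R)
  prop_tensor X Y hX hY := by
    have : Coalgebra.IsCocomm R X := hX
    have : Coalgebra.IsCocomm R Y := hY
    exact (inferInstance : Coalgebra.IsCocomm R (TensorProduct R X Y))

/-- The category of cocommutative, coassociative, counital `R`-coalgebras. -/
abbrev CoCAlg : Type (w + 1) := (isCocomm R).FullSubcategory

/-- The forgetful functor from coalgebras to modules. -/
def CoCAlg.forget : CoCAlg R ⥤ ModuleCat.{w} R :=
  (isCocomm R).ι ⋙ forget₂ (CoalgCat.{w} R) (ModuleCat.{w} R)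

instance : (CoCAlg.forget R).Faithful := by unfold CoCAlg.forget; infer_instance

/-- The coalgebra `R[X]` on a set `X`: the free module on `X`, whose comultiplication
`x ↦ x ⊗ x` is induced by the diagonal of `X`. -/
abbrev linObj (X : Type w) : CoCAlg R :=
  ⟨CoalgCat.of R (X →₀ R), (inferInstance : Coalgebra.IsCocomm R (X →₀ R))⟩

variable {R}
/-- The morphism of `CoCAlg R` given by a morphism of coalgebras. -/
abbrev CoCAlg.homMk {A B : CoCAlg R} (f : A.obj →ₗc[R] B.obj) : A ⟶ B := ObjectProperty.homMk ⟨f⟩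

/-- The linear map underlying a morphism of `CoCAlg R`. -/
abbrev CoCAlg.lin {A B : CoCAlg R} (f : A ⟶ B) : A.obj →ₗ[R] B.obj := f.hom.toCoalgHom'.toLinearMap

lemma CoCAlg.hom_ext {A B : CoCAlg R} {f g : A ⟶ B} (h : CoCAlg.lin f = CoCAlg.lin g) : f = g := by
  apply ObjectProperty.hom_ext
  apply CoalgCat.hom_ext
  ext x
  exact LinearMap.congr_fun h x

/-- The morphism of coalgebras `R[X] → R[Y]` induced by a map of sets. -/
def linMap {X Y : Type w} (f : X → Y) : (X →₀ R) →ₗc[R] (Y →₀ R) where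
  toLinearMap := Finsupp.lmapDomain R R f
  counit_comp := by ext; simp
  map_comp_comul := by ext; simp

variable (R) in
/-- The functor `X ↦ R[X]` from sets to coalgebras. -/
def linCoalg : Type w ⥤ CoCAlg R where
  obj X := linObj R X
  map f := CoCAlg.homMk (linMap f)
  map_id _ := CoCAlg.hom_ext (Finsupp.lmapDomain_id R R)
  map_comp f g := CoCAlg.hom_ext (Finsupp.lmapDomain_comp R R f g)

variable (R) in
/-- `R ≅ R[pt]`. -/
def linUnit : R ≃ₗc[R] (PUnit.{w + 1} →₀ R) where
  toLinearEquiv := (Finsupp.uniqueLinearEquiv (α := PUnit.{w + 1}) R R PUnit.unit).symm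
  counit_comp := by ext; simp [Finsupp.uniqueLinearEquiv]
  map_comp_comul := by ext; simp [Finsupp.uniqueLinearEquiv]

lemma linUnit_one : linUnit R 1 = Finsupp.single PUnit.unit 1 :=
  Finsupp.uniqueLinearEquiv_symm_apply ..

variable (R) in
/-- `R[X] ⊗ R[Y] ≅ R[X × Y]`. -/
def linTensor (X Y : Type w) : TensorProduct R (X →₀ R) (Y →₀ R) ≃ₗc[R] (X × Y →₀ R) where
  toLinearEquiv := finsuppTensorFinsupp' R X Y
  counit_comp := by ext; simp
  map_comp_comul := by ext; simp

/-- The isomorphism of `CoCAlg R` given by an equivalence of coalgebras. -/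
abbrev CoCAlg.mkIso {A B : CoCAlg R} (e : A.obj ≃ₗc[R] B.obj) : A ≅ B :=
  (isCocomm R).isoMk e.toCoalgIso

/-- `X ↦ R[X]` takes products of sets to tensor products of coalgebras. -/
instance : (linCoalg R).Monoidal :=
  Functor.CoreMonoidal.toMonoidal
    { εIso := CoCAlg.mkIso (linUnit R)
      μIso X Y := CoCAlg.mkIso (linTensor R X Y)
      μIso_hom_natural_left := fun {X Y} f X' ↦ by
        apply CoCAlg.hom_ext
        apply TensorProduct.ext
        refine Finsupp.lhom_ext' fun x => LinearMap.ext_ring ?_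
        refine Finsupp.lhom_ext' fun y => LinearMap.ext_ring ?_
        change finsuppTensorFinsupp' R _ _ (Finsupp.mapDomain f (Finsupp.single x (1 : R)) ⊗ₜ[R] Finsupp.single y (1 : R)) =
          Finsupp.mapDomain _ (finsuppTensorFinsupp' R _ _ (Finsupp.single x (1 : R) ⊗ₜ[R] Finsupp.single y (1 : R)))
        simp
        rfl
      μIso_hom_natural_right := fun {X Y} X' f ↦ by
        apply CoCAlg.hom_ext
        apply TensorProduct.ext
        refine Finsupp.lhom_ext' fun x => LinearMap.ext_ring ?_
        refine Finsupp.lhom_ext' fun y => LinearMap.ext_ring ?_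
        change finsuppTensorFinsupp' R _ _ (Finsupp.single x (1 : R) ⊗ₜ[R] Finsupp.mapDomain f (Finsupp.single y (1 : R))) =
          Finsupp.mapDomain _ (finsuppTensorFinsupp' R _ _ (Finsupp.single x (1 : R) ⊗ₜ[R] Finsupp.single y (1 : R)))
        simp
        rfl
      associativity := fun X Y Z ↦ by
        apply CoCAlg.hom_ext
        apply TensorProduct.ext
        apply TensorProduct.ext
        refine Finsupp.lhom_ext' fun x => LinearMap.ext_ring ?_
        refine Finsupp.lhom_ext' fun y => LinearMap.ext_ring ?_
        refine Finsupp.lhom_ext' fun z => LinearMap.ext_ring ?_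
        change Finsupp.mapDomain _ (finsuppTensorFinsupp' R _ _ (finsuppTensorFinsupp' R _ _ (Finsupp.single x (1 : R) ⊗ₜ[R] Finsupp.single y (1 : R)) ⊗ₜ[R] Finsupp.single z (1 : R))) =
          finsuppTensorFinsupp' R _ _ (Finsupp.single x (1 : R) ⊗ₜ[R] finsuppTensorFinsupp' R _ _ (Finsupp.single y (1 : R) ⊗ₜ[R] Finsupp.single z (1 : R)))
        simp
        rfl
      left_unitality := fun X ↦ by
        apply CoCAlg.hom_ext
        apply TensorProduct.ext
        refine LinearMap.ext_ring ?_
        refine Finsupp.lhom_ext' fun y => LinearMap.ext_ring ?_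
        change (1 : R) • Finsupp.single y (1 : R) = Finsupp.mapDomain _ (finsuppTensorFinsupp' R _ _ ((linUnit R 1) ⊗ₜ[R] Finsupp.single y (1 : R)))
        rw [linUnit_one]
        simp
        rfl
      right_unitality := fun X ↦ by
        apply CoCAlg.hom_ext
        apply TensorProduct.ext
        refine Finsupp.lhom_ext' fun x => LinearMap.ext_ring ?_
        refine LinearMap.ext_ring ?_
        change (1 : R) • Finsupp.single x (1 : R) = Finsupp.mapDomain _ (finsuppTensorFinsupp' R _ _ (Finsupp.single x (1 : R) ⊗ₜ[R] (linUnit R 1)))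
        rw [linUnit_one]
        simp
        rfl }

variable (R) (C : Type u) [Category.{v} C]

/-- Presheaves of simplicial `R`-modules on `C`. -/
abbrev SMod := Cᵒᵖ ⥤ SimplexCategoryᵒᵖ ⥤ ModuleCat.{w} R

/-- Presheaves of simplicial cocommutative `R`-coalgebras on `C` (for the sectionwise tensor
product). -/
abbrev SCoCAlg := Cᵒᵖ ⥤ SimplexCategoryᵒᵖ ⥤ CoCAlg R

/-- The forgetful functor `U`. -/
def SCoCAlg.forget : SCoCAlg R C ⥤ SMod R C :=
  (Functor.whiskeringRight _ _ _).obj ((Functor.whiskeringRight _ _ _).obj (CoCAlg.forget R))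

/-- The constant presheaf functor is monoidal. -/
instance constMonoidal (D : Type*) [Category* D] [MonoidalCategory D] :
    (Functor.const Cᵒᵖ : D ⥤ Cᵒᵖ ⥤ D).Monoidal :=
  Functor.CoreMonoidal.toMonoidal
    { εIso := NatIso.ofComponents (fun _ => Iso.refl _) (by intros; simp)
      μIso _ _ := NatIso.ofComponents (fun _ => Iso.refl _) (by intros; simp)
      μIso_hom_natural_left {X Y} f Z := by
        ext
        change f ▷ Z ≫ 𝟙 (Y ⊗ Z) = 𝟙 (X ⊗ Z) ≫ f ▷ Z
        simp
      μIso_hom_natural_right {X Y} Z f := by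
        ext
        change Z ◁ f ≫ 𝟙 (Z ⊗ Y) = 𝟙 (Z ⊗ X) ≫ Z ◁ f
        simp
      associativity X Y Z := by
        ext
        change 𝟙 (X ⊗ Y) ▷ Z ≫ 𝟙 ((X ⊗ Y) ⊗ Z) ≫ (α_ X Y Z).hom =
          (α_ X Y Z).hom ≫ X ◁ 𝟙 (Y ⊗ Z) ≫ 𝟙 (X ⊗ Y ⊗ Z)
        simp
      left_unitality X := by
        ext
        change (λ_ X).hom = 𝟙 (𝟙_ D) ▷ X ≫ 𝟙 (𝟙_ D ⊗ X) ≫ (λ_ X).hom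
        simp
      right_unitality X := by
        ext
        change (ρ_ X).hom = X ◁ 𝟙 (𝟙_ D) ≫ 𝟙 (X ⊗ 𝟙_ D) ≫ (ρ_ X).hom
        simp }

/-- `K ↦ R[K]`, a simplicial set being sent to the constant presheaf with value the simplicial
coalgebra `n ↦ R[K_n]`. -/
def linSCoCAlg : SSet.{w} ⥤ SCoCAlg R C :=
  (Functor.whiskeringRight SimplexCategoryᵒᵖ _ _).obj (linCoalg R) ⋙ Functor.const Cᵒᵖ

instance : (linSCoCAlg R C).Monoidal :=
  inferInstanceAs (((Functor.whiskeringRight SimplexCategoryᵒᵖ _ _).obj (linCoalg R)) ⋙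
    Functor.const Cᵒᵖ).Monoidal

/-- The simplicial structure `(K, F) ↦ K ⊗ F := R[K] ⊗ F` on presheaves of simplicial
coalgebras, that is `(K ⊗ F)_n(U) = R[K_n] ⊗ F_n(U)`. -/
instance : MonoidalLeftAction SSet.{w} (SCoCAlg R C) :=
  MonoidalLeftAction.actionOfMonoidalFunctorToEndofunctorMop
    (linSCoCAlg R C ⋙ MonoidalLeftAction.curriedActionMop (SCoCAlg R C) (SCoCAlg R C))

lemma actionObj_eq (K : SSet.{w}) (G : SCoCAlg R C) :
    MonoidalLeftActionStruct.actionObj K G = (linSCoCAlg R C).obj K ⊗ G := rfl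

end Coalgebras

/-! ### Weak equivalences of presheaves of simplicial modules -/

section WeakEquivalences

/-- The `n`-th homotopy group, with base point `0`, of a simplicial object in an abelian
category: the `n`-th homology of its normalized Moore complex. -/
def homotopyGroup (A : Type u) [Category.{v} A] [Abelian A] (n : ℕ) :
    (SimplexCategoryᵒᵖ ⥤ A) ⥤ A :=
  AlgebraicTopology.normalizedMooreComplex A ⋙
    HomologicalComplex.homologyFunctor A (ComplexShape.down ℕ) n

/-- The weak equivalences of simplicial objects in an abelian category `A` of modules (over a ring,
or over `ℤ`): the morphisms which induce isomorphisms on all homotopy groups. Since the underlying simplicial sets are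
simplicial groups, base points other than `0` need not be considered. -/
def simplicialWeakEquivalences (A : Type u) [Category.{v} A] [Abelian A] :
    MorphismProperty (SimplexCategoryᵒᵖ ⥤ A) :=
  fun _ _ f => ∀ n, IsIso ((homotopyGroup A n).map f)

variable (R : Type w) [CommRing R] (C : Type u) [Category.{v} C]

/-- The object-wise weak equivalences. -/
def objectwiseWeakEquivalences : MorphismProperty (SMod R C) :=
  fun _ _ f => ∀ U : Cᵒᵖ, simplicialWeakEquivalences (ModuleCat.{w} R) (f.app U)

variable {C} in
/-- The `τ`-local weak equivalences: the morphisms which are weak equivalences on the stalk at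
every point of the site. -/
def localWeakEquivalences (τ : GrothendieckTopology C) : MorphismProperty (SMod R C) :=
  fun _ _ f => ∀ x : GrothendieckTopology.Point.{w} τ,
    simplicialWeakEquivalences (ModuleCat.{w} R) (x.presheafFiber.map f)

variable {R C}

/-- `P` is fibrant for the `τ`-local injective model structure: the morphism `P ⟶ 0` has the right
lifting property with respect to the monomorphisms which are `τ`-local weak equivalences. -/
def IsLocallyFibrant (τ : GrothendieckTopology C) (P : SMod R C) : Prop :=
  ∀ ⦃A B : SMod R C⦄ (i : A ⟶ B), Mono i → localWeakEquivalences R τ i →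
    ∀ g : A ⟶ P, ∃ h : B ⟶ P, i ≫ h = g

/-- The presheaf of simplicial modules `R[K]` attached to a simplicial set `K`. -/
def linSMod (R : Type w) [CommRing R] (C : Type u) [Category.{v} C] : SSet.{w} ⥤ SMod R C :=
  linSCoCAlg R C ⋙ SCoCAlg.forget R C

/-- The mapping space `Map(M, P)`, `Map(M, P)_n = Hom(R[Δ[n]] ⊗ M, P)`. Being the mapping space
between presheaves of simplicial modules, it is a simplicial abelian group. -/
def mapSpace (M P : SMod R C) : SimplexCategoryᵒᵖ ⥤ AddCommGrpCat.{max u w} :=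
  (SSet.stdSimplex.{w} ⋙ linSMod R C ⋙ (tensoringRight (SMod R C)).obj M).op ⋙
    preadditiveYoneda.obj P

/-- The map `Map(N, P) ⟶ Map(M, P)` induced by `f : M ⟶ N`. -/
def mapSpacePrecomp {M N : SMod R C} (f : M ⟶ N) (P : SMod R C) :
    mapSpace N P ⟶ mapSpace M P :=
  Functor.whiskerRight (NatTrans.op (Functor.whiskerLeft (SSet.stdSimplex.{w} ⋙ linSMod R C)
    ((tensoringRight (SMod R C)).map f))) (preadditiveYoneda.obj P)

end WeakEquivalences

/-! ### Smooth schemes over a field, and topologies -/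

section Schemes

/-- The morphisms of schemes which are smooth and quasi-compact. Over a field, these are the
smooth morphisms of finite type. -/
abbrev smoothFiniteType : MorphismProperty Scheme.{u} := @Smooth ⊓ @QuasiCompact

/-- The category `Sm_F` of smooth schemes of finite type over `F`, with all morphisms
of `F`-schemes. -/
abbrev Sm (F : Type u) [Field F] : Type (u + 1) :=
  MorphismProperty.Over smoothFiniteType.{u} ⊤ (Spec (CommRingCat.of F))

variable {F : Type u} [Field F]

lemma smoothFiniteType_affineLine (X : Scheme.{u}) :
    smoothFiniteType (𝔸(PUnit.{u + 1}; X) ↘ X) := by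
  refine ⟨MorphismProperty.IsStableUnderBaseChange.of_isPullback
    (P := (@Smooth : MorphismProperty Scheme.{u}))
    (IsPullback.of_hasPullback (terminal.from X) (terminal.from _)).flip ?_,
    (inferInstance : QuasiCompact _)⟩
  have := isIso_of_isTerminal specULiftZIsTerminal.{u} terminalIsTerminal (terminal.from _)
  rw [← terminal.comp_from (Spec.map (CommRingCat.ofHom MvPolynomial.C))]
  have h : Smooth (Spec.map (CommRingCat.ofHom
      (MvPolynomial.C : ULift.{u} ℤ →+* MvPolynomial PUnit.{u + 1} (ULift.{u} ℤ)))) := by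
    refine (HasRingHomProperty.Spec_iff (P := @Smooth) (Q := RingHom.Smooth)).2 ?_
    change RingHom.Smooth (algebraMap (ULift.{u} ℤ) (MvPolynomial PUnit.{u + 1} (ULift.{u} ℤ)))
    rw [RingHom.smooth_algebraMap]
    exact { }
  exact smooth_comp _ _

/-- `X × 𝔸¹`, the affine line over `X`. -/
def timesA1 (X : Sm F) : Sm F :=
  MorphismProperty.Over.mk ⊤ ((𝔸(PUnit.{u + 1}; X.left) ↘ X.left) ≫ X.hom)
    ⟨MorphismProperty.comp_mem (@Smooth) _ _ (smoothFiniteType_affineLine X.left).1 X.prop.1,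
     MorphismProperty.comp_mem (@QuasiCompact) _ _ (smoothFiniteType_affineLine X.left).2 X.prop.2⟩

/-- The projection `X × 𝔸¹ ⟶ X`. -/
def projA1 (X : Sm F) : timesA1 X ⟶ X :=
  MorphismProperty.Over.homMk (𝔸(PUnit.{u + 1}; X.left) ↘ X.left) rfl trivial

/-- The étale coverings: the jointly surjective families of étale morphisms. -/
def etalePrecoverage (F : Type u) [Field F] : Precoverage (Sm F) where
  coverings X := {T | (∀ ⦃Y : Sm F⦄ ⦃f : Y ⟶ X⦄, T f → Etale f.left) ∧
    ∀ x : X.left, ∃ (Y : Sm F) (f : Y ⟶ X) (_ : T f) (y : Y.left), f.left y = x}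

/-- The Nisnevich coverings: the families of étale morphisms such that every point `x` of the
target is the image of some point `y` with the same residue field. -/
def nisnevichPrecoverage (F : Type u) [Field F] : Precoverage (Sm F) where
  coverings X := {T | (∀ ⦃Y : Sm F⦄ ⦃f : Y ⟶ X⦄, T f → Etale f.left) ∧
    ∀ x : X.left, ∃ (Y : Sm F) (f : Y ⟶ X) (_ : T f) (y : Y.left), f.left y = x ∧
      IsIso (f.left.residueFieldMap y)}

/-- The étale topology on `Sm_F`. -/
def etaleTopology (F : Type u) [Field F] : GrothendieckTopology (Sm F) :=
  (etalePrecoverage F).toGrothendieck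

/-- The Nisnevich topology on `Sm_F`. -/
def nisnevichTopology (F : Type u) [Field F] : GrothendieckTopology (Sm F) :=
  (nisnevichPrecoverage F).toGrothendieck

end Schemes

/-! ### `𝔸¹`-localization -/

section A1

variable {F : Type u} [Field F] {R : Type (u + 1)} [CommRing R]

/-- `R[h_X]`, the free presheaf of modules on the presheaf represented by `X`, as a constant
simplicial object. -/
def freeRepresentable (F : Type u) [Field F] (R : Type (u + 1)) [CommRing R] :
    Sm F ⥤ SMod R (Sm F) :=
  uliftYoneda.{u + 1} ⋙ (Functor.whiskeringRight _ _ _).obj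
    (ModuleCat.free R ⋙ Functor.const SimplexCategoryᵒᵖ)

/-- `P` is `𝔸¹`-local: it is fibrant for the `τ`-local model structure, and for every `X` the map
`Map(R[h_X], P) ⟶ Map(R[h_{X × 𝔸¹}], P)` is a weak equivalence. -/
def IsA1Local (τ : GrothendieckTopology (Sm F)) (P : SMod R (Sm F)) : Prop :=
  IsLocallyFibrant τ P ∧ ∀ X : Sm F, simplicialWeakEquivalences AddCommGrpCat.{u + 1}
    (mapSpacePrecomp ((freeRepresentable F R).map (projA1 X)) P)

/-- The `τ`-`𝔸¹`-local weak equivalences: the morphisms `f : M ⟶ N` such that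
`Map(N, P) ⟶ Map(M, P)` is a weak equivalence for every `𝔸¹`-local `P`, that is the weak
equivalences of the left Bousfield localization of the `τ`-local model structure at the
morphisms `R[h_{X × 𝔸¹}] ⟶ R[h_X]`. -/
def a1WeakEquivalences (R : Type (u + 1)) [CommRing R] (τ : GrothendieckTopology (Sm F)) :
    MorphismProperty (SMod R (Sm F)) :=
  fun _ _ f => ∀ P : SMod R (Sm F), IsA1Local τ P →
    simplicialWeakEquivalences AddCommGrpCat.{u + 1} (mapSpacePrecomp f P)

end A1

end MotivicCoalgebra

end

open MotivicCoalgebra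

/-!
A class `W` of morphisms of presheaves of simplicial modules is called *admissible*
(`IsAdmissible`) if it has the two-out-of-three property and is stable under retracts, contains the
monomorphisms which are object-wise weak equivalences, and if the monomorphisms in `W` are weakly
saturated and restrict to morphisms in `W` over *club many* subobjects of their target
(`HasClub`): the subobjects which are closed under a suitable operation with few values. The proof
shows that admissibility of `W` is all that is needed, and that the three classes are admissible.

**From admissible classes to model structures.** The categories of presheaves of simplicial modules
and of simplicial coalgebras are treated at once, by means of the properties `IsCoalgebraic` of
the functor `U` to presheaves of simplicial modules, which is the identity or the forgetful functor.
The essential one is that club many sets of elements of an object are its subobjects. For coalgebras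
this holds since a submodule which contains solutions of the finite systems of linear equations
solvable in the whole module is pure, and a pure submodule closed under comultiplication is a
subcoalgebra (`hasClub_isSubcoalgebra`). It follows by transfinite induction that lifting properties
with respect to all the morphisms `f` such that `U f` is a monomorphism can be tested on the set of
those between small objects (`rlp_smallMonos`). So these morphisms are generated by a set, the small
objects form a strong generator, and the category is locally presentable; limits and the right
adjoint of `U` exist by the special adjoint functor theorem.

If `W` is admissible, then each morphism from a small monomorphism to a monomorphism in `W`
factors through a small monomorphism in `W` (`IsCoalgebraic.exists_factorization`). Moreover the
cylinders `R[Δ[1]] ⊗ X` show that a morphism with the right lifting property with respect to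
monomorphisms is in `W` (`IsCoalgebraic.rlp_monos_le`). By the method of J. Smith this gives
a cofibrantly generated model structure with these cofibrations and with the weak equivalences
`U⁻¹ W` (`IsCoalgebraic.exists_modelCategory`). The pushout-product axiom
(`isSimplicialModelCategory`) is checked on underlying modules: `R[K] ⟶ R[L]` is a split
monomorphism of flat modules in each degree, the horns are contractible, and tensor products
with `R[Δ[n]]`, hence with `R[K]` for all `K`, preserve trivial cofibrations.

**The three classes.** A monomorphism `A ⟶ B` is an object-wise, respectively local, weak
equivalence if each relative cycle bounds, respectively bounds locally
(`IsLocallyDetected`). A subobject of `B` which contains enough of the bounding chains inherits this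
property, which gives admissibility.

The `𝔸¹`-local weak equivalences are those of a left Bousfield localization of an admissible class
at a set of morphisms (`bousfield`). For a monomorphism `f` and a fibrant `P`, the map
`Map(f, P)` is a weak equivalence if and only if it is a surjective one, which is a lifting property
(`MapTrivial`) of `f`; hence all conditions but the last one hold. For the last one, the monomorphisms
which restrict to weak equivalences over club many subobjects (`clubMonos`) contain the relative cell
complexes on a set of trivial cofibrations, since partial coproducts, pushouts and transfinite
compositions of restrictions are again restrictions. A trivial cofibration becomes a retract of such
a cell complex after composition with a local replacement of its target
(`IsPreadmissible.exists_section`), and `IsAdmissible.bousfield` follows.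
-/

noncomputable section
set_option linter.unusedSectionVars false
namespace MotivicCoalgebra

/-! ### Closure conditions on subsets -/

section Clubs

open Cardinal

/-- The subset `S` is closed under the operation `F`, which sends a finite list of elements to
a set of further elements. -/
def ClosedUnder {γ : Type w} (F : List γ → Set γ) (S : Set γ) : Prop :=
  ∀ l : List γ, (∀ x ∈ l, x ∈ S) → F l ⊆ S

/-- The property `P` of subsets of `α` holds for club many subsets: it holds for the traces on `α`
of the subsets of some larger set `γ` which are closed under an operation which produces
less than `κ` elements from a finite list. Such properties play the role of closed unbounded sets;
the auxiliary set `γ` makes them stable under projections. -/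
def HasClub {α : Type w} (κ : Cardinal.{w}) (P : Set α → Prop) : Prop :=
  ∃ (γ : Type w) (i : α → γ) (F : List γ → Set γ), Function.Injective i ∧ (∀ l, #(F l) < κ) ∧
    ∀ S, ClosedUnder F S → P (i ⁻¹' S)

variable {α β : Type w} {κ : Cardinal.{w}}

/-- The closure of a small set is small: it is exhausted by countably many applications of the
operation to finite lists. -/
lemma ClosedUnder.exists_superset {γ : Type w} {F : List γ → Set γ} (hκ : κ.IsRegular)
    (hκ' : ℵ₀ < κ) (hF : ∀ l, #(F l) < κ) (T : Set γ) (hT : #T < κ) :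
    ∃ S, ClosedUnder F S ∧ T ⊆ S ∧ #S < κ := by
  let step : Set γ → Set γ := fun S => S ∪ ⋃ l : List S, F (l.map Subtype.val)
  have hstep (S : Set γ) (hS : #S < κ) : #(step S) < κ := by
    refine (mk_union_le _ _).trans_lt (add_lt_of_lt hκ.aleph0_le hS ?_)
    refine (card_iUnion_lt_iff_forall_of_isRegular hκ ?_).2 fun l => hF _
    exact (mk_list_le_max _).trans_lt (max_lt hκ' hS)
  let Q : ℕ → Set γ := fun n => step^[n] T
  have hQ (n : ℕ) : Q (n + 1) = step (Q n) := Function.iterate_succ_apply' _ _ _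
  have hmono : Monotone Q := monotone_nat_of_le_succ fun n => by
    rw [hQ]; exact Set.subset_union_left
  have hQκ (n : ℕ) : #(Q n) < κ := by
    induction n with
    | zero => exact hT
    | succ n ih => rw [hQ]; exact hstep _ ih
  refine ⟨⋃ n : ULift.{w} ℕ, Q n.down, fun l hl => ?_, Set.subset_iUnion_of_subset ⟨0⟩ subset_rfl,
    (card_iUnion_lt_iff_forall_of_isRegular hκ (by simpa using hκ')).2 fun n => hQκ _⟩
  have : ∃ n, ∀ x ∈ l, x ∈ Q n := by
    induction l with
    | nil => exact ⟨0, by simp⟩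
    | cons a l ih =>
      obtain ⟨n, hn⟩ := ih fun x hx => hl x (List.mem_cons_of_mem _ hx)
      obtain ⟨⟨m⟩, hm⟩ := Set.mem_iUnion.1 (hl a List.mem_cons_self)
      refine ⟨max n m, fun x hx => ?_⟩
      rcases List.mem_cons.1 hx with rfl | hx
      · exact hmono (le_max_right _ _) hm
      · exact hmono (le_max_left _ _) (hn x hx)
  obtain ⟨n, hn⟩ := this
  refine Set.subset_iUnion_of_subset ⟨n + 1⟩ ?_
  change _ ⊆ Q (n + 1)
  rw [hQ]
  refine (Set.subset_iUnion_of_subset (l.attachWith _ hn) ?_).trans Set.subset_union_right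
  simp

namespace HasClub

lemma of_closedUnder (F : List α → Set α) (hF : ∀ l, #(F l) < κ) :
    HasClub κ (ClosedUnder F) :=
  ⟨α, id, F, Function.injective_id, hF, fun _ h => h⟩

lemma mono {P Q : Set α → Prop} (h : HasClub κ P) (hPQ : ∀ S, P S → Q S) : HasClub κ Q := by
  obtain ⟨γ, i, F, hi, hF, H⟩ := h
  exact ⟨γ, i, F, hi, hF, fun S hS => hPQ _ (H S hS)⟩

lemma of_forall {P : Set α → Prop} (hκ : 0 < κ) (h : ∀ S, P S) : HasClub κ P :=
  ⟨α, id, fun _ => ∅, Function.injective_id, fun _ => by simpa using hκ, fun _ _ => h _⟩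

lemma exists_superset {P : Set α → Prop} (h : HasClub κ P) (hκ : κ.IsRegular) (hκ' : ℵ₀ < κ)
    (T : Set α) (hT : #T < κ) : ∃ S, P S ∧ T ⊆ S ∧ #S < κ := by
  obtain ⟨γ, i, F, hi, hF, H⟩ := h
  obtain ⟨S, hS, hTS, hSκ⟩ := ClosedUnder.exists_superset hκ hκ' hF (i '' T) (mk_image_le.trans_lt hT)
  exact ⟨i ⁻¹' S, H S hS, Set.image_subset_iff.1 hTS,
    (mk_preimage_of_injective i S hi).trans_lt hSκ⟩

/-- The class of properties which hold for club many subsets is stable under conjunctions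
indexed by sets of cardinality less than `κ`. -/
lemma forall_of_lt {ι : Type w} (hκ : κ.IsRegular) (hι : #ι < κ)
    {P : ι → Set α → Prop} (h : ∀ i, HasClub κ (P i)) : HasClub κ (fun S => ∀ i, P i S) := by
  choose γ j F hj hF H using h
  let γ' := α ⊕ Σ i, γ i
  let pr (i : ι) (l : List γ') : List (γ i) := by
    classical
    exact l.filterMap fun x => x.elim (fun _ => none)
      fun y => if hy : y.1 = i then some (hy ▸ y.2) else none
  have hpr (i : ι) (l : List γ') (y : γ i) : y ∈ pr i l ↔ Sum.inr ⟨i, y⟩ ∈ l := by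
    simp only [pr, List.mem_filterMap]
    constructor
    · rintro ⟨x | ⟨k, x⟩, hx, h⟩
      · simp at h
      · by_cases hk : k = i
        · subst hk
          simp only [Sum.elim_inr, dite_true, Option.some.injEq] at h
          exact h ▸ hx
        · simp [hk] at h
    · exact fun h => ⟨_, h, by simp⟩
  -- the operation glues the operations of all the factors, and identifies the copies of `α`
  let G : List γ' → Set γ' := fun l =>
    (⋃ i, (fun y => Sum.inr ⟨i, y⟩) '' F i (pr i l)) ∪
      ((⋃ x : {x // x ∈ l}, ⋃ i : ι, {y | ∃ a : α, x.1 = Sum.inl a ∧ y = Sum.inr ⟨i, j i a⟩}) ∪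
       (⋃ x : {x // x ∈ l}, ⋃ i : ι, {y | ∃ a : α, x.1 = Sum.inr ⟨i, j i a⟩ ∧ y = Sum.inl a}))
  have hfin (l : List γ') : #{x // x ∈ l} < κ := by
    have : Finite {x // x ∈ l} := (List.finite_toSet l).to_subtype
    exact (lt_aleph0_of_finite _).trans_le hκ.aleph0_le
  have hsub {s : Set γ'} (hs : s.Subsingleton) : #s < κ :=
    (mk_le_one_iff_set_subsingleton.2 hs).trans_lt (one_lt_aleph0.trans_le hκ.aleph0_le)
  refine ⟨γ', Sum.inl, G, Sum.inl_injective, fun l => ?_, fun S hS i => ?_⟩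
  · refine (mk_union_le _ _).trans_lt (add_lt_of_lt hκ.aleph0_le ?_
      ((mk_union_le _ _).trans_lt (add_lt_of_lt hκ.aleph0_le ?_ ?_)))
    · exact (card_iUnion_lt_iff_forall_of_isRegular hκ hι).2 fun i => mk_image_le.trans_lt (hF _ _)
    · refine (card_iUnion_lt_iff_forall_of_isRegular hκ (hfin l)).2 fun x =>
        (card_iUnion_lt_iff_forall_of_isRegular hκ hι).2 fun i => hsub ?_
      rintro _ ⟨a, ha, rfl⟩ _ ⟨b, hb, rfl⟩
      rw [Sum.inl_injective (ha.symm.trans hb)]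
    · refine (card_iUnion_lt_iff_forall_of_isRegular hκ (hfin l)).2 fun x =>
        (card_iUnion_lt_iff_forall_of_isRegular hκ hι).2 fun i => hsub ?_
      rintro _ ⟨a, ha, rfl⟩ _ ⟨b, hb, rfl⟩
      rw [hj i (eq_of_heq (Sigma.mk.inj (Sum.inr_injective (ha.symm.trans hb))).2)]
  · have h1 : ClosedUnder (F i) ((fun y => Sum.inr ⟨i, y⟩) ⁻¹' S : Set (γ i)) := by
      intro l hl y hy
      refine hS (l.map fun y => Sum.inr ⟨i, y⟩) ?_ (Or.inl (Set.mem_iUnion.2 ⟨i, y, ?_, rfl⟩))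
      · simpa using hl
      · convert hy
        simp only [pr, List.filterMap_map]
        conv_rhs => rw [← List.filterMap_some (l := l)]
        congr 1
        funext y
        simp
    convert H i _ h1 using 1
    ext a
    constructor
    · intro ha
      exact hS [Sum.inl a] (by simpa using ha) (Or.inr (Or.inl (Set.mem_iUnion.2
        ⟨⟨Sum.inl a, by simp⟩, Set.mem_iUnion.2 ⟨i, a, rfl, rfl⟩⟩)))
    · intro ha
      exact hS [Sum.inr ⟨i, j i a⟩] (by simpa using ha) (Or.inr (Or.inr (Set.mem_iUnion.2
        ⟨⟨Sum.inr ⟨i, j i a⟩, by simp⟩, Set.mem_iUnion.2 ⟨i, a, rfl, rfl⟩⟩)))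

lemma and {P Q : Set α → Prop} (hκ : κ.IsRegular) (hP : HasClub κ P) (hQ : HasClub κ Q) :
    HasClub κ (fun S => P S ∧ Q S) :=
  (forall_of_lt (ι := ULift.{w} Bool) hκ ((lt_aleph0_of_finite _).trans_le hκ.aleph0_le)
    (P := fun b => bif b.down then P else Q) (by rintro ⟨_ | _⟩ <;> assumption)).mono
    fun S h => ⟨h ⟨true⟩, h ⟨false⟩⟩

/-- If a property holds for club many subsets of `β`, then it holds for the traces of club many
subsets of a larger set. -/
lemma preimage {P : Set β → Prop} (hκ : κ.IsRegular) (hP : HasClub κ P) {f : β → α}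
    (hf : Function.Injective f) : HasClub κ (fun S => P (f ⁻¹' S)) := by
  obtain ⟨γ, j, F, hj, hF, H⟩ := hP
  let G : List (α ⊕ γ) → Set (α ⊕ γ) := fun l =>
    (Sum.inr '' F (l.filterMap Sum.getRight?)) ∪
      ((⋃ x : {x // x ∈ l}, {y | ∃ b : β, x.1 = Sum.inl (f b) ∧ y = Sum.inr (j b)}) ∪
       (⋃ x : {x // x ∈ l}, {y | ∃ b : β, x.1 = Sum.inr (j b) ∧ y = Sum.inl (f b)}))
  have hfin (l : List (α ⊕ γ)) : #{x // x ∈ l} < κ := by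
    have : Finite {x // x ∈ l} := (List.finite_toSet l).to_subtype
    exact (lt_aleph0_of_finite _).trans_le hκ.aleph0_le
  have hsub {s : Set (α ⊕ γ)} (hs : s.Subsingleton) : #s < κ :=
    (mk_le_one_iff_set_subsingleton.2 hs).trans_lt (one_lt_aleph0.trans_le hκ.aleph0_le)
  refine ⟨α ⊕ γ, Sum.inl, G, Sum.inl_injective, fun l => ?_, fun S hS => ?_⟩
  · refine (mk_union_le _ _).trans_lt (add_lt_of_lt hκ.aleph0_le (mk_image_le.trans_lt (hF _))
      ((mk_union_le _ _).trans_lt (add_lt_of_lt hκ.aleph0_le ?_ ?_)))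
    · refine (card_iUnion_lt_iff_forall_of_isRegular hκ (hfin l)).2 fun x => hsub ?_
      rintro _ ⟨a, ha, rfl⟩ _ ⟨b, hb, rfl⟩
      rw [hf (Sum.inl_injective (ha.symm.trans hb))]
    · refine (card_iUnion_lt_iff_forall_of_isRegular hκ (hfin l)).2 fun x => hsub ?_
      rintro _ ⟨a, ha, rfl⟩ _ ⟨b, hb, rfl⟩
      rw [hj (Sum.inr_injective (ha.symm.trans hb))]
  · have h1 : ClosedUnder F (Sum.inr ⁻¹' S : Set γ) := by
      intro l hl y hy
      refine hS (l.map Sum.inr) (by simpa using hl) (Or.inl ⟨y, ?_, rfl⟩)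
      convert hy
      simp only [List.filterMap_map]
      conv_rhs => rw [← List.filterMap_some (l := l)]
      rfl
    convert H _ h1 using 1
    ext b
    constructor
    · intro hb
      exact hS [Sum.inl (f b)] (by simpa using hb) (Or.inr (Or.inl (Set.mem_iUnion.2
        ⟨⟨Sum.inl (f b), by simp⟩, b, rfl, rfl⟩)))
    · intro hb
      exact hS [Sum.inr (j b)] (by simpa using hb) (Or.inr (Or.inr (Set.mem_iUnion.2
        ⟨⟨Sum.inr (j b), by simp⟩, b, rfl, rfl⟩)))

/-- The traces on a subset of club many sets are club many; the operation may use elements outside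
the subset. -/
lemma restrict {P : Set α → Prop} (hP : HasClub κ P) {f : β → α} (hf : Function.Injective f) :
    HasClub κ (fun S : Set β => ∃ S' : Set α, f ⁻¹' S' = S ∧ P S') := by
  obtain ⟨γ, j, F, hj, hF, H⟩ := hP
  exact ⟨γ, j ∘ f, F, hj.comp hf, hF, fun S hS => ⟨j ⁻¹' S, rfl, H S hS⟩⟩

end HasClub

end Clubs

/-! ### Quasi-isomorphisms in terms of elements -/

section QuasiIso

section Concrete

variable {A : Type*} [Category.{w} A] {FC : A → A → Type*} {CC : A → Type w}
  [∀ X Y, FunLike (FC X Y) (CC X) (CC Y)] [ConcreteCategory.{w} A FC] [HasForget₂ A Ab.{w}]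
  [Abelian A] [(forget₂ A Ab).Additive] [(forget₂ A Ab).PreservesHomology]

variable (K : ChainComplex A ℕ)

/-- The homology class of a cycle. -/
def homologyClass (n : ℕ) (x : (forget₂ A Ab).obj (K.X n))
    (hx : (forget₂ A Ab).map (K.d n (n - 1)) x = 0) :
    (forget₂ A Ab).obj (K.homology n) :=
  (forget₂ A Ab).map (K.homologyπ n) (K.cyclesMk x (n - 1) (by cases n <;> simp) hx)

variable {K}

lemma exists_homologyClass (n : ℕ) (h : (forget₂ A Ab).obj (K.homology n)) :
    ∃ x hx, homologyClass K n x hx = h := by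
  obtain ⟨z, rfl⟩ := (Preadditive.epi_iff_surjective (K.homologyπ n)).1 inferInstance h
  refine ⟨(forget₂ A Ab).map (K.iCycles n) z, ?_, ?_⟩
  · rw [← ConcreteCategory.comp_apply, ← Functor.map_comp, HomologicalComplex.iCycles_d]
    simp
  · unfold homologyClass
    congr 1
    apply (Preadditive.mono_iff_injective (K.iCycles n)).1 inferInstance
    simp

lemma homologyClass_eq_zero_iff (n : ℕ) (x : (forget₂ A Ab).obj (K.X n)) (hx) :
    homologyClass K n x hx = 0 ↔ ∃ c, (forget₂ A Ab).map (K.d (n + 1) n) c = x := by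
  have hex : (ShortComplex.mk _ _ (K.toCycles_comp_homologyπ (n + 1) n)).Exact :=
    ShortComplex.exact_of_g_is_cokernel _ (K.homologyIsCokernel (n + 1) n (by simp))
  rw [ShortComplex.exact_iff_of_hasForget] at hex
  constructor
  · intro h
    obtain ⟨c, hc⟩ := hex (K.cyclesMk x (n - 1) (by cases n <;> simp) hx) h
    refine ⟨c, ?_⟩
    have := congr_arg ((forget₂ A Ab).map (K.iCycles n)) hc
    rw [HomologicalComplex.i_cyclesMk] at this
    rw [← this, ← ConcreteCategory.comp_apply, ← Functor.map_comp]
    simp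
  · rintro ⟨c, rfl⟩
    unfold homologyClass
    have : K.cyclesMk ((forget₂ A Ab).map (K.d (n + 1) n) c) (n - 1) (by cases n <;> simp) hx =
        (forget₂ A Ab).map (K.toCycles (n + 1) n) c := by
      apply (Preadditive.mono_iff_injective (K.iCycles n)).1 inferInstance
      rw [HomologicalComplex.i_cyclesMk, ← ConcreteCategory.comp_apply, ← Functor.map_comp]
      simp
    rw [this, ← ConcreteCategory.comp_apply, ← Functor.map_comp]
    simp

variable {L : ChainComplex A ℕ} (f : K ⟶ L)

lemma comm_apply (n m : ℕ) (x : (forget₂ A Ab).obj (K.X n)) :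
    (forget₂ A Ab).map (L.d n m) ((forget₂ A Ab).map (f.f n) x) =
      (forget₂ A Ab).map (f.f m) ((forget₂ A Ab).map (K.d n m) x) := by
  simp only [← ConcreteCategory.comp_apply, ← Functor.map_comp, HomologicalComplex.Hom.comm]

lemma d_d_apply (n m k : ℕ) (x : (forget₂ A Ab).obj (K.X n)) :
    (forget₂ A Ab).map (K.d m k) ((forget₂ A Ab).map (K.d n m) x) = 0 := by
  simp only [← ConcreteCategory.comp_apply, ← Functor.map_comp, HomologicalComplex.d_comp_d]
  simp

lemma homologyMap_homologyClass (n : ℕ) (x : (forget₂ A Ab).obj (K.X n)) (hx) :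
    (forget₂ A Ab).map (HomologicalComplex.homologyMap f n) (homologyClass K n x hx) =
      homologyClass L n ((forget₂ A Ab).map (f.f n) x) (by rw [comm_apply, hx, map_zero]) := by
  unfold homologyClass
  rw [← ConcreteCategory.comp_apply, ← Functor.map_comp, HomologicalComplex.homologyπ_naturality,
    Functor.map_comp, ConcreteCategory.comp_apply]
  congr 1
  apply (Preadditive.mono_iff_injective (L.iCycles n)).1 inferInstance
  rw [HomologicalComplex.i_cyclesMk, ← ConcreteCategory.comp_apply, ← Functor.map_comp,
    HomologicalComplex.cyclesMap_i, Functor.map_comp, ConcreteCategory.comp_apply,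
    HomologicalComplex.i_cyclesMk]

/-- A morphism is a quasi-isomorphism if and only if every cycle of the target lifts up to
a boundary, and cycles of the source which become boundaries are boundaries. -/
lemma quasiIso_iff_elements : QuasiIso f ↔
    (∀ n (y : (forget₂ A Ab).obj (L.X n)), (forget₂ A Ab).map (L.d n (n - 1)) y = 0 →
      ∃ x c, (forget₂ A Ab).map (K.d n (n - 1)) x = 0 ∧
        y = (forget₂ A Ab).map (f.f n) x + (forget₂ A Ab).map (L.d (n + 1) n) c) ∧
    (∀ n (x : (forget₂ A Ab).obj (K.X n)) c, (forget₂ A Ab).map (K.d n (n - 1)) x = 0 →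
      (forget₂ A Ab).map (f.f n) x = (forget₂ A Ab).map (L.d (n + 1) n) c →
        ∃ c', x = (forget₂ A Ab).map (K.d (n + 1) n) c') := by
  have hsub (M : ChainComplex A ℕ) (n) (x y : (forget₂ A Ab).obj (M.X n)) (hx hy) :
      homologyClass M n x hx - homologyClass M n y hy =
        homologyClass M n (x - y) (by simp [map_sub, hx, hy]) := by
    unfold homologyClass
    rw [← map_sub]
    congr 1
    apply (Preadditive.mono_iff_injective (M.iCycles n)).1 inferInstance
    simp [map_sub]
  rw [quasiIso_iff, ← forall_and]
  refine forall_congr' fun n => ?_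
  rw [quasiIsoAt_iff_isIso_homologyMap, isIso_iff_mono_and_epi,
    Preadditive.mono_iff_injective, Preadditive.epi_iff_surjective, and_comm]
  refine and_congr ⟨fun h y hy => ?_, fun h y => ?_⟩ ⟨fun h x c hx hxc => ?_, fun h => ?_⟩
  · obtain ⟨z, hz⟩ := h (homologyClass L n y hy)
    obtain ⟨x, hx, rfl⟩ := exists_homologyClass n z
    rw [homologyMap_homologyClass, eq_comm, ← sub_eq_zero, hsub, homologyClass_eq_zero_iff] at hz
    obtain ⟨c, hc⟩ := hz
    exact ⟨x, c, hx, by rw [hc]; abel⟩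
  · obtain ⟨y, hy, rfl⟩ := exists_homologyClass n y
    obtain ⟨x, c, hx, rfl⟩ := h y hy
    refine ⟨homologyClass K n x hx, ?_⟩
    rw [homologyMap_homologyClass, eq_comm, ← sub_eq_zero, hsub, homologyClass_eq_zero_iff]
    exact ⟨c, by abel⟩
  · have : homologyClass K n x hx = 0 := by
      exact h ((homologyMap_homologyClass f n x hx).trans
        (((homologyClass_eq_zero_iff _ _ _).2 ⟨c, hxc.symm⟩).trans (map_zero _).symm))
    obtain ⟨c', hc'⟩ := (homologyClass_eq_zero_iff n x hx).1 this
    exact ⟨c', hc'.symm⟩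
  · rw [injective_iff_map_eq_zero]
    intro z hz
    obtain ⟨x, hx, rfl⟩ := exists_homologyClass n z
    rw [homologyMap_homologyClass, homologyClass_eq_zero_iff] at hz
    obtain ⟨c, hc⟩ := hz
    rw [homologyClass_eq_zero_iff]
    obtain ⟨c', hc'⟩ := h x c hx hc.symm
    exact ⟨c', hc'.symm⟩

/-- A degreewise injective morphism of chain complexes is a quasi-isomorphism if and only if every
relative cycle of the target is, modulo the source, a boundary. -/
lemma quasiIso_iff_of_injective (hf : ∀ n, Function.Injective ((forget₂ A Ab).map (f.f n))) :
    QuasiIso f ↔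
    ∀ n (y : (forget₂ A Ab).obj (L.X n)),
      (∃ a, (forget₂ A Ab).map (f.f (n - 1)) a = (forget₂ A Ab).map (L.d n (n - 1)) y) →
      ∃ a c, y = (forget₂ A Ab).map (f.f n) a + (forget₂ A Ab).map (L.d (n + 1) n) c := by
  rw [quasiIso_iff_elements]
  constructor
  · rintro ⟨h1, h2⟩ n y ⟨a, ha⟩
    rcases n with _ | n
    · obtain ⟨x, c, -, h⟩ := h1 0 y (by
        rw [L.shape 0 (0 - 1) (by simp)]; simp)
      exact ⟨x, c, h⟩
    · change (forget₂ A Ab).obj (K.X n) at a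
      change (forget₂ A Ab).map (f.f n) a = (forget₂ A Ab).map (L.d (n + 1) n) y at ha
      have ha' : (forget₂ A Ab).map (K.d n (n - 1)) a = 0 := by
        apply hf
        rw [← comm_apply, ha, d_d_apply, map_zero]
      obtain ⟨c', rfl⟩ := h2 n a y ha' ha
      obtain ⟨x, c, -, h⟩ := h1 (n + 1) (y - (forget₂ A Ab).map (f.f (n + 1)) c') (by
        rw [map_sub, sub_eq_zero, comm_apply]; exact ha.symm)
      exact ⟨c' + x, c, by rw [map_add, add_assoc, ← h]; abel⟩
  · intro h
    refine ⟨fun n y hy => ?_, fun n x c hx hxc => ?_⟩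
    · obtain ⟨a, c, rfl⟩ := h n y ⟨0, by rw [hy, map_zero]⟩
      refine ⟨a, c, ?_, rfl⟩
      apply hf
      rw [← comm_apply, map_zero]
      rwa [map_add, d_d_apply, add_zero] at hy
    · obtain ⟨a, c', rfl⟩ := h (n + 1) c ⟨x, hxc⟩
      refine ⟨a, ?_⟩
      apply hf
      rw [hxc, map_add, d_d_apply, add_zero, comm_apply]

/-- A morphism of chain complexes is a surjective quasi-isomorphism if and only if it has the right
lifting property with respect to the inclusions of spheres into disks. -/
lemma quasiIso_and_surjective_iff :
    (QuasiIso f ∧ ∀ n, Function.Surjective ((forget₂ A Ab).map (f.f n))) ↔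
    Function.Surjective ((forget₂ A Ab).map (f.f 0)) ∧
    ∀ n (y : (forget₂ A Ab).obj (L.X (n + 1))) (x : (forget₂ A Ab).obj (K.X n)),
      (forget₂ A Ab).map (K.d n (n - 1)) x = 0 →
      (forget₂ A Ab).map (f.f n) x = (forget₂ A Ab).map (L.d (n + 1) n) y →
        ∃ x', (forget₂ A Ab).map (f.f (n + 1)) x' = y ∧
          (forget₂ A Ab).map (K.d (n + 1) n) x' = x := by
  rw [quasiIso_iff_elements]
  constructor
  · rintro ⟨⟨h1, h2⟩, hs⟩
    refine ⟨hs 0, fun n y x hx hxy => ?_⟩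
    obtain ⟨x₀, rfl⟩ := hs _ y
    obtain ⟨c, hc⟩ := h2 n (x - (forget₂ A Ab).map (K.d (n + 1) n) x₀) 0
      (by rw [map_sub, hx, d_d_apply, sub_zero])
      (by rw [map_sub, hxy, map_zero, sub_eq_zero, comm_apply])
    have hc' : (forget₂ A Ab).map (L.d (n + 1) (n + 1 - 1))
        ((forget₂ A Ab).map (f.f (n + 1)) c) = 0 := by
      rw [comm_apply]
      change (forget₂ A Ab).map (f.f n) ((forget₂ A Ab).map (K.d (n + 1) n) c) = 0
      rw [← hc, map_sub, hxy, sub_eq_zero, comm_apply]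
    obtain ⟨z, w, hz, hzw⟩ := h1 (n + 1) _ hc'
    change (forget₂ A Ab).map (K.d (n + 1) n) z = 0 at hz
    obtain ⟨w, rfl⟩ := hs _ w
    refine ⟨x₀ + (c - z - (forget₂ A Ab).map (K.d (n + 1 + 1) (n + 1)) w), ?_, ?_⟩
    · rw [map_add, map_sub, map_sub, hzw, ← comm_apply]
      abel
    · rw [map_add, map_sub, map_sub, hz, d_d_apply, ← hc]
      abel
  · rintro ⟨h0, h⟩
    have hlift : ∀ n (y : (forget₂ A Ab).obj (L.X n)),
        (forget₂ A Ab).map (L.d n (n - 1)) y = 0 →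
        ∃ x, (forget₂ A Ab).map (K.d n (n - 1)) x = 0 ∧ (forget₂ A Ab).map (f.f n) x = y := by
      rintro (_ | n) y hy
      · obtain ⟨x, rfl⟩ := h0 y
        exact ⟨x, by rw [K.shape 0 (0 - 1) (by simp)]; simp, rfl⟩
      · obtain ⟨x, hx, hx'⟩ := h n y 0 (map_zero _) (by rw [map_zero]; exact hy.symm)
        exact ⟨x, hx', hx⟩
    refine ⟨⟨fun n y hy => ?_, fun n x c hx hxc => ?_⟩, ?_⟩
    · obtain ⟨x, hx, rfl⟩ := hlift n y hy
      exact ⟨x, 0, hx, by rw [map_zero, add_zero]⟩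
    · obtain ⟨x', -, rfl⟩ := h n c x hx hxc
      exact ⟨x', rfl⟩
    · rintro (_ | n) y
      · exact h0 y
      · obtain ⟨x, hx, hxy⟩ := hlift n ((forget₂ A Ab).map (L.d (n + 1) n) y) (d_d_apply _ _ _ _)
        obtain ⟨x', hx', -⟩ := h n y x hx hxy
        exact ⟨x', hx'⟩

end Concrete

/-- The normalized and the alternating face map complexes are homotopy equivalent, so either of
them detects weak equivalences. -/
lemma simplicialWeakEquivalences_iff {A : Type u} [Category.{v} A] [Abelian A]
    {X Y : SimplexCategoryᵒᵖ ⥤ A} (f : X ⟶ Y) :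
    simplicialWeakEquivalences A f ↔
      QuasiIso ((AlgebraicTopology.alternatingFaceMapComplex A).map f) := by
  have key (Z : SimplicialObject A) :
      QuasiIso ((AlgebraicTopology.inclusionOfMooreComplex A).app Z) :=
    open AlgebraicTopology.DoldKan in
    inferInstanceAs
      (QuasiIso (homotopyEquivNormalizedMooreComplexAlternatingFaceMapComplex (Y := Z)).hom)
  have h1 : simplicialWeakEquivalences A f ↔
      QuasiIso ((AlgebraicTopology.normalizedMooreComplex A).map f) := by
    rw [quasiIso_iff]
    refine forall_congr' fun n => ?_
    rw [quasiIsoAt_iff_isIso_homologyMap]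
    rfl
  have := key X
  have := key Y
  rw [h1, ← quasiIso_iff_comp_right _ ((AlgebraicTopology.inclusionOfMooreComplex A).app Y),
    ← quasiIso_iff_comp_left ((AlgebraicTopology.inclusionOfMooreComplex A).app X)]
  erw [(AlgebraicTopology.inclusionOfMooreComplex A).naturality f]

instance (A : Type u) [Category.{v} A] [Abelian A] :
    (simplicialWeakEquivalences A).HasTwoOutOfThreeProperty where
  comp_mem f g hf hg n := by
    have := hf n; have := hg n
    rw [Functor.map_comp]; infer_instance
  of_postcomp f g hg hfg n := by
    have := hg n
    have h := hfg n
    rw [Functor.map_comp] at h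
    exact IsIso.of_isIso_comp_right _ ((homotopyGroup A n).map g)
  of_precomp f g hf hfg n := by
    have := hf n
    have h := hfg n
    rw [Functor.map_comp] at h
    exact IsIso.of_isIso_comp_left ((homotopyGroup A n).map f) _

instance (A : Type u) [Category.{v} A] [Abelian A] :
    (simplicialWeakEquivalences A).IsStableUnderRetracts where
  of_retract h hg n :=
    (MorphismProperty.isomorphisms A).of_retract (RetractArrow.map h (homotopyGroup A n)) (hg n)

end QuasiIso

/-! ### Colimits of modules in terms of elements -/

section ModuleColimits

variable {R : Type w} [CommRing R]

lemma exists_of_isPushout {X₁ X₂ X₃ X₄ : ModuleCat.{w} R} {t : X₁ ⟶ X₂} {l : X₁ ⟶ X₃} {r : X₂ ⟶ X₄}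
    {b : X₃ ⟶ X₄} (h : IsPushout t l r b) (y : X₄) : ∃ x₂ x₃, y = r x₂ + b x₃ := by
  obtain ⟨x, rfl⟩ := (ModuleCat.epi_iff_surjective _).1 h.epi_shortComplex_g y
  refine ⟨(biprod.fst : X₂ ⊞ X₃ ⟶ X₂) x, (biprod.snd : X₂ ⊞ X₃ ⟶ X₃) x, ?_⟩
  have : (biprod.desc r b : X₂ ⊞ X₃ ⟶ X₄) = biprod.fst ≫ r + biprod.snd ≫ b := by
    apply biprod.hom_ext' <;> simp
  change (biprod.desc r b : X₂ ⊞ X₃ ⟶ X₄) x = _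
  rw [this]
  rfl

lemma exists_of_isPushout_of_eq_zero {X₁ X₂ X₃ X₄ : ModuleCat.{w} R} {t : X₁ ⟶ X₂} {l : X₁ ⟶ X₃}
    {r : X₂ ⟶ X₄} {b : X₃ ⟶ X₄} (h : IsPushout t l r b) (x₂ : X₂) (x₃ : X₃)
    (hx : r x₂ + b x₃ = 0) : ∃ x₁, t x₁ = x₂ ∧ l x₁ = - x₃ := by
  have hex := h.exact_shortComplex
  rw [ShortComplex.moduleCat_exact_iff] at hex
  have h1 : ((biprod.inl : X₂ ⟶ X₂ ⊞ X₃) ≫ biprod.fst : X₂ ⟶ X₂) = 𝟙 _ := by simp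
  have h2 : ((biprod.inr : X₃ ⟶ X₂ ⊞ X₃) ≫ biprod.fst : X₃ ⟶ X₂) = 0 := by simp
  have h3 : ((biprod.inl : X₂ ⟶ X₂ ⊞ X₃) ≫ biprod.snd : X₂ ⟶ X₃) = 0 := by simp
  have h4 : ((biprod.inr : X₃ ⟶ X₂ ⊞ X₃) ≫ biprod.snd : X₃ ⟶ X₃) = 𝟙 _ := by simp
  have h5 : (biprod.inl ≫ biprod.desc r b : X₂ ⟶ X₄) = r := by simp
  have h6 : (biprod.inr ≫ biprod.desc r b : X₃ ⟶ X₄) = b := by simp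
  have h7 : (biprod.lift t (-l) ≫ biprod.fst : X₁ ⟶ X₂) = t := by simp
  have h8 : (biprod.lift t (-l) ≫ biprod.snd : X₁ ⟶ X₃) = -l := by simp
  obtain ⟨x₁, hx₁⟩ := hex ((biprod.inl : X₂ ⟶ X₂ ⊞ X₃) x₂ + (biprod.inr : X₃ ⟶ X₂ ⊞ X₃) x₃) (by
    change (biprod.desc r b : X₂ ⊞ X₃ ⟶ X₄) _ = 0
    rw [map_add]
    refine Eq.trans ?_ hx
    exact congr_arg₂ (· + ·) (congr($h5 x₂)) (congr($h6 x₃)))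
  change (biprod.lift t (-l) : X₁ ⟶ X₂ ⊞ X₃) x₁ = _ at hx₁
  refine ⟨x₁, ?_, ?_⟩
  · have := congr_arg (biprod.fst : X₂ ⊞ X₃ ⟶ X₂) hx₁
    rw [map_add] at this
    exact congr($h7.symm x₁).trans (this.trans ((congr_arg₂ (· + ·) congr($h1 x₂) congr($h2 x₃)).trans
      (add_zero _)))
  · have := congr_arg (biprod.snd : X₂ ⊞ X₃ ⟶ X₃) hx₁
    rw [map_add] at this
    have h9 := congr($h8.symm x₁).trans (this.trans ((congr_arg₂ (· + ·) congr($h3 x₂)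
      congr($h4 x₃)).trans (zero_add _)))
    change -(l x₁) = x₃ at h9
    rw [← h9, neg_neg]

/-- A commutative square of modules is a pushout as soon as the sum map is surjective and its kernel
is accounted for. -/
lemma isPushout_of_elements {X₁ X₂ X₃ X₄ : ModuleCat.{w} R} {t : X₁ ⟶ X₂} {l : X₁ ⟶ X₃}
    {r : X₂ ⟶ X₄} {b : X₃ ⟶ X₄} (w : t ≫ r = l ≫ b) (h : ∀ y : X₄, ∃ x₂ x₃, y = r x₂ + b x₃)
    (h' : ∀ x₂ x₃, r x₂ + b x₃ = 0 → ∃ x₁, t x₁ = x₂ ∧ l x₁ = - x₃) : IsPushout t l r b := by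
  have hp := IsPushout.of_hasPushout t l
  let p := hp.desc r b w
  have hp1 : pushout.inl t l ≫ p = r := hp.inl_desc _ _ _
  have hp2 : pushout.inr t l ≫ p = b := hp.inr_desc _ _ _
  have : IsIso p := by
    rw [ConcreteCategory.isIso_iff_bijective]
    constructor
    · refine (injective_iff_map_eq_zero p.hom).2 fun z hz => ?_
      obtain ⟨x₂, x₃, rfl⟩ := exists_of_isPushout hp z
      rw [map_add] at hz
      obtain ⟨x₁, rfl, hx₁⟩ := h' x₂ x₃ ((congr_arg₂ (· + ·) congr($hp1 x₂) congr($hp2 x₃)).symm.trans hz)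
      obtain rfl : x₃ = -(l x₁) := by rw [hx₁, neg_neg]
      rw [map_neg, ← sub_eq_add_neg, sub_eq_zero]
      exact congr($(hp.w) x₁)
    · intro y
      obtain ⟨x₂, x₃, rfl⟩ := h y
      refine ⟨pushout.inl t l x₂ + pushout.inr t l x₃, ?_⟩
      rw [← hp1, ← hp2]
      exact map_add p.hom _ _
  exact IsPushout.of_iso hp (Iso.refl _) (Iso.refl _) (Iso.refl _) (asIso p) (by simp) (by simp)
    (by simp [hp1]) (by simp [hp2])

lemma exists_of_isColimit_cofan {ι : Type*} {X : ι → ModuleCat.{w} R} {c : Cofan X}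
    (hc : IsColimit c) (y : c.pt) : ∃ (s : Finset ι) (x : ∀ i, X i), y = ∑ i ∈ s, c.inj i (x i) := by
  classical
  let N : Submodule R c.pt := ⨆ i, LinearMap.range (c.inj i).hom
  have hN : (ModuleCat.ofHom N.mkQ : c.pt ⟶ ModuleCat.of R (c.pt ⧸ N)) = 0 := by
    refine hc.hom_ext fun ⟨i⟩ => ?_
    ext x
    exact (Submodule.Quotient.mk_eq_zero N).2 (Submodule.mem_iSup_of_mem i ⟨x, rfl⟩)
  have hy : y ∈ N := (Submodule.Quotient.mk_eq_zero N).1 congr($hN y)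
  obtain ⟨f, hf, hfy⟩ := (Submodule.mem_iSup_iff_exists_finsupp _ _).1 hy
  choose x hx using hf
  refine ⟨f.support, x, ?_⟩
  rw [← hfy]
  exact Finset.sum_congr rfl fun i _ => (hx i).symm

end ModuleColimits

/-! ### Trivial cofibrations of simplicial modules -/

section RelAcyclic

variable {R : Type w} [CommRing R]

/-- The (unnormalized) chain complex of a simplicial module. -/
abbrev altK (X : SimplexCategoryᵒᵖ ⥤ ModuleCat.{w} R) : ChainComplex (ModuleCat.{w} R) ℕ :=
  (AlgebraicTopology.alternatingFaceMapComplex (ModuleCat.{w} R)).obj X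

/-- The morphism of chain complexes induced by a morphism of simplicial modules. -/
abbrev altMap {X Y : SimplexCategoryᵒᵖ ⥤ ModuleCat.{w} R} (f : X ⟶ Y) : altK X ⟶ altK Y :=
  (AlgebraicTopology.alternatingFaceMapComplex (ModuleCat.{w} R)).map f

variable {X Y : SimplexCategoryᵒᵖ ⥤ ModuleCat.{w} R}

/-- Every relative cycle of `f` is, modulo the source, a boundary. -/
def RelAcyclic (f : X ⟶ Y) : Prop :=
  ∀ (n : ℕ) (y : (altK Y).X n), (∃ a, (altMap f).f (n - 1) a = (altK Y).d n (n - 1) y) →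
    ∃ a c, y = (altMap f).f n a + (altK Y).d (n + 1) n c

/-- The monomorphisms of simplicial modules which are weak equivalences, in terms of elements. -/
def relTriv (R : Type w) [CommRing R] : MorphismProperty (SimplexCategoryᵒᵖ ⥤ ModuleCat.{w} R) :=
  fun _ _ f => (∀ n, Function.Injective (f.app n)) ∧ RelAcyclic f

lemma mono_iff_injective (f : X ⟶ Y) : Mono f ↔ ∀ n, Function.Injective (f.app n) := by
  rw [NatTrans.mono_iff_mono_app]
  exact forall_congr' fun n => ModuleCat.mono_iff_injective _

lemma simplicialWeakEquivalences_iff_relAcyclic (f : X ⟶ Y)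
    (hf : ∀ n, Function.Injective (f.app n)) :
    simplicialWeakEquivalences _ f ↔ RelAcyclic f := by
  rw [simplicialWeakEquivalences_iff]
  exact quasiIso_iff_of_injective (altMap f) fun n => hf _

lemma relTriv_iff (f : X ⟶ Y) : relTriv R f ↔ Mono f ∧ simplicialWeakEquivalences _ f := by
  rw [mono_iff_injective]
  exact and_congr_right fun h => (simplicialWeakEquivalences_iff_relAcyclic f h).symm

lemma altMap_d_apply (f : X ⟶ Y) (n m : ℕ) (x : (altK X).X n) :
    (altK Y).d n m ((altMap f).f n x) = (altMap f).f m ((altK X).d n m x) :=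
  congr($((altMap f).comm n m) x)

instance : (relTriv R).IsMultiplicative where
  id_mem X := ⟨fun _ _ _ h => h, fun n y _ => ⟨y, 0, by rw [map_zero, add_zero]; rfl⟩⟩
  comp_mem f g hf hg := by
    rw [relTriv_iff] at *
    have := hf.1; have := hg.1
    exact ⟨mono_comp f g, MorphismProperty.comp_mem _ _ _ hf.2 hg.2⟩

instance : (relTriv R).RespectsIso :=
  MorphismProperty.respectsIso_of_isStableUnderComposition fun X Y f (hf : IsIso f) => by
    rw [relTriv_iff]
    exact ⟨inferInstance, fun n => inferInstance⟩

instance : (relTriv R).IsStableUnderCobaseChange where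
  of_isPushout {A A' B B' f g f' g'} sq hf := by
    have sqn (n) : IsPushout (g.app n) (f.app n) (f'.app n) (g'.app n) :=
      sq.map ((evaluation _ _).obj n)
    have hinj (n) : Function.Injective (f'.app n) := by
      refine (injective_iff_map_eq_zero (f'.app n).hom).2 fun x hx => ?_
      obtain ⟨a, rfl, ha⟩ := exists_of_isPushout_of_eq_zero (sqn n) x 0 (by
        rw [map_zero, add_zero]; exact hx)
      rw [neg_zero] at ha
      rw [hf.1 n (ha.trans (map_zero _).symm), map_zero]
    refine ⟨hinj, fun n y hy => ?_⟩
    obtain ⟨b, a', rfl⟩ := exists_of_isPushout (sqn _) y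
    obtain ⟨z, hz⟩ := hy
    rw [map_add] at hz
    have h1 : (altK B').d n (n - 1) (f'.app _ b) = (altMap f').f (n - 1) ((altK B).d n (n - 1) b) :=
      altMap_d_apply f' n (n - 1) b
    have h2 : (altK B').d n (n - 1) (g'.app _ a') = (altMap g').f (n - 1) ((altK A').d n (n - 1) a') :=
      altMap_d_apply g' n (n - 1) a'
    have hz' : f'.app _ (z - (altK B).d n (n - 1) b) =
        g'.app _ ((altK A').d n (n - 1) a') := by
      rw [map_sub]
      exact sub_eq_iff_eq_add'.2 (hz.trans (congr_arg₂ (· + ·) h1 h2))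
    obtain ⟨x, -, hx⟩ := exists_of_isPushout_of_eq_zero (sqn _)
      (-(z - (altK B).d n (n - 1) b)) ((altK A').d n (n - 1) a') (by
        rw [map_neg, hz', neg_add_cancel])
    obtain ⟨a, c, rfl⟩ := hf.2 n a' ⟨-x, by
      refine (map_neg (f.app _).hom x).trans ?_
      rw [← neg_eq_iff_eq_neg] at hx
      exact hx⟩
    refine ⟨b + g.app _ a, (altMap g').f (n + 1) c, ?_⟩
    rw [altMap_d_apply, map_add, map_add, add_assoc]
    congr 2
    exact congr($((sqn (op (SimplexCategory.mk n))).w) a).symm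

section Filtered

variable {J : Type v} [Category.{u} J] [IsFiltered J]
  [HasColimitsOfShape J (ModuleCat.{w} R)] [PreservesColimitsOfShape J (forget (ModuleCat.{w} R))]
  {F G : J ⥤ SimplexCategoryᵒᵖ ⥤ ModuleCat.{w} R} (α : F ⟶ G) {c : Cocone F} {c' : Cocone G}
  (hc : IsColimit c) (hc' : IsColimit c') (f : c.pt ⟶ c'.pt)
  (hf : ∀ j, c.ι.app j ≫ f = α.app j ≫ c'.ι.app j)

include hc in
lemma exists_rep_of_isColimit (n : SimplexCategoryᵒᵖ) (x : c.pt.obj n) :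
    ∃ j y, (c.ι.app j).app n y = x :=
  Concrete.isColimit_exists_rep (F ⋙ (evaluation _ _).obj n)
    (isColimitOfPreserves ((evaluation _ _).obj n) hc) x

include hc in
lemma exists_map_eq_of_isColimit (n : SimplexCategoryᵒᵖ) {i : J} (x y : (F.obj i).obj n)
    (h : (c.ι.app i).app n x = (c.ι.app i).app n y) :
    ∃ (j : J) (g : i ⟶ j), (F.map g).app n x = (F.map g).app n y := by
  obtain ⟨k, g, g', h'⟩ := Concrete.isColimit_exists_of_rep_eq (F ⋙ (evaluation _ _).obj n)
    (isColimitOfPreserves ((evaluation _ _).obj n) hc) x y h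
  refine ⟨IsFiltered.coeq g g', g ≫ IsFiltered.coeqHom g g', ?_⟩
  have h2 : (F.map (IsFiltered.coeqHom g g')).app n ((F.map g).app n x) =
    (F.map (IsFiltered.coeqHom g g')).app n ((F.map g').app n y) := congr_arg _ h'
  have h3 : ∀ {a b d : J} (s : a ⟶ b) (t : b ⟶ d) z, (F.map t).app n ((F.map s).app n z) =
    (F.map (s ≫ t)).app n z := fun s t z => by rw [F.map_comp]; rfl
  rw [h3, h3, ← IsFiltered.coeq_condition] at h2
  exact h2

lemma cocone_w_apply (c : Cocone F) {i j : J} (g : i ⟶ j) (n : SimplexCategoryᵒᵖ)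
    (x : (F.obj i).obj n) :
    (c.ι.app j).app n ((F.map g).app n x) = (c.ι.app i).app n x :=
  congr(NatTrans.app $(c.w g) n x)

include hc hc' hf in
lemma injective_of_isColimit (hα : ∀ j n, Function.Injective ((α.app j).app n)) (n) :
    Function.Injective (f.app n) := by
  refine (injective_iff_map_eq_zero (f.app n).hom).2 fun x hx => ?_
  obtain ⟨j, y, rfl⟩ := exists_rep_of_isColimit hc n x
  have h1 : (c'.ι.app j).app n ((α.app j).app n y) = (c'.ι.app j).app n 0 := by
    rw [map_zero]
    exact congr(NatTrans.app $(hf j) n y).symm.trans hx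
  obtain ⟨k, g, h2⟩ := exists_map_eq_of_isColimit hc' n _ _ h1
  rw [map_zero] at h2
  have h3 : (F.map g).app n y = 0 := by
    apply hα k n
    rw [map_zero, ← h2]
    exact congr(NatTrans.app $(α.naturality g) n y)
  rw [← cocone_w_apply c g, h3, map_zero]

include hc hc' hf in
/-- Relative acyclicity of a filtered colimit can be checked on the elements at each stage. -/
lemma relAcyclic_iff_of_isColimit : RelAcyclic f ↔
    ∀ j (n : ℕ) (b : (altK (G.obj j)).X n),
      (∃ a, (altMap (α.app j)).f (n - 1) a = (altK (G.obj j)).d n (n - 1) b) →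
        ∃ (k : J) (g : j ⟶ k) (a : _) (c : _), (altMap (G.map g)).f n b =
          (altMap (α.app k)).f n a + (altK (G.obj k)).d (n + 1) n c := by
  have hw (j) (n : ℕ) (a : (altK (F.obj j)).X n) : (altMap f).f n ((altMap (c.ι.app j)).f n a) =
      (altMap (c'.ι.app j)).f n ((altMap (α.app j)).f n a) :=
    congr(NatTrans.app $(hf j) (op (SimplexCategory.mk n)) a)
  have hα {i j} (g : i ⟶ j) (n : ℕ) (a : (altK (F.obj i)).X n) :
      (altMap (α.app j)).f n ((altMap (F.map g)).f n a) =
        (altMap (G.map g)).f n ((altMap (α.app i)).f n a) :=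
    congr(NatTrans.app $(α.naturality g) (op (SimplexCategory.mk n)) a)
  have hw' {i j} (g : i ⟶ j) (n : ℕ) (a : (altK (G.obj i)).X n) :
      (altMap (c'.ι.app j)).f n ((altMap (G.map g)).f n a) = (altMap (c'.ι.app i)).f n a :=
    cocone_w_apply c' g _ _
  have hwF {i j} (g : i ⟶ j) (n : ℕ) (a : (altK (F.obj i)).X n) :
      (altMap (c.ι.app j)).f n ((altMap (F.map g)).f n a) = (altMap (c.ι.app i)).f n a :=
    cocone_w_apply c g _ _
  have hcomp {i j k} (g : i ⟶ j) (h : j ⟶ k) (n : ℕ) (a : (altK (G.obj i)).X n) :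
      (altMap (G.map h)).f n ((altMap (G.map g)).f n a) = (altMap (G.map (g ≫ h))).f n a := by
    rw [G.map_comp]; rfl
  constructor
  · rintro H j n b ⟨a, ha⟩
    obtain ⟨a', c₁, h⟩ := H n ((altMap (c'.ι.app j)).f n b)
      ⟨(altMap (c.ι.app j)).f _ a, by rw [hw, ha, altMap_d_apply]⟩
    obtain ⟨i₁, a₁, rfl⟩ := exists_rep_of_isColimit hc _ a'
    obtain ⟨i₂, c₂, rfl⟩ := exists_rep_of_isColimit hc' _ c₁
    change (altMap (c'.ι.app j)).f n b = (altMap f).f n ((altMap (c.ι.app i₁)).f n a₁) +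
      (altK c'.pt).d (n + 1) n ((altMap (c'.ι.app i₂)).f (n + 1) c₂) at h
    obtain ⟨k, g, g₁, g₂, -⟩ : ∃ (k : J) (_ : j ⟶ k) (_ : i₁ ⟶ k) (_ : i₂ ⟶ k), True := by
      let k₁ := IsFiltered.max j i₁
      exact ⟨IsFiltered.max k₁ i₂, IsFiltered.leftToMax j i₁ ≫ IsFiltered.leftToMax _ _,
        IsFiltered.rightToMax j i₁ ≫ IsFiltered.leftToMax _ _, IsFiltered.rightToMax _ _, trivial⟩
    rw [← hw' g, ← hwF g₁, hw, hα, ← hw' g₂, altMap_d_apply, ← map_add, altMap_d_apply] at h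
    obtain ⟨l, s, h⟩ := exists_map_eq_of_isColimit hc' _ _ _ h
    change (altMap (G.map s)).f n _ = (altMap (G.map s)).f n _ at h
    rw [hcomp, map_add, hcomp, ← hα, ← altMap_d_apply, ← altMap_d_apply] at h
    exact ⟨l, g ≫ s, _, _, h⟩
  · rintro H n y ⟨a, ha⟩
    obtain ⟨j, b, rfl⟩ := exists_rep_of_isColimit hc' _ y
    obtain ⟨i, a, rfl⟩ := exists_rep_of_isColimit hc _ a
    change (altMap f).f (n - 1) ((altMap (c.ι.app i)).f (n - 1) a) =
      (altK c'.pt).d n (n - 1) ((altMap (c'.ι.app j)).f n b) at ha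
    rw [← hw' (IsFiltered.leftToMax j i), ← hwF (IsFiltered.rightToMax j i), hw,
      altMap_d_apply] at ha
    obtain ⟨l, s, ha⟩ := exists_map_eq_of_isColimit hc' _ _ _ ha
    change (altMap (G.map s)).f (n - 1) _ = (altMap (G.map s)).f (n - 1) _ at ha
    rw [← hα, ← altMap_d_apply] at ha
    obtain ⟨k, g, a', d, h⟩ := H l n _ ⟨_, ha⟩
    rw [hcomp, hcomp] at h
    refine ⟨(altMap (c.ι.app k)).f n a', (altMap (c'.ι.app k)).f (n + 1) d, ?_⟩
    rw [hw, altMap_d_apply, ← map_add, ← h, hw']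
    rfl

end Filtered

instance : MorphismProperty.IsStableUnderFilteredColimits.{w, w} (relTriv R) where
  isStableUnderColimitsOfShape J _ _ :=
    { condition := fun F G c c' hc hc' α hα f hf => by
        refine ⟨injective_of_isColimit α hc hc' f hf fun j => (hα j).1, ?_⟩
        rw [relAcyclic_iff_of_isColimit α hc hc' f hf]
        intro j n b hb
        obtain ⟨a, d, rfl⟩ := (hα j).2 n b hb
        exact ⟨j, 𝟙 j, a, d, by simp⟩ }

instance : MorphismProperty.IsStableUnderCoproducts.{w} (relTriv R) where
  isStableUnderCoproductsOfShape J := by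
    refine MorphismProperty.IsStableUnderCoproductsOfShape.mk _ _ fun X Y _ _ f hf => ?_
    have hmono : Mono (Limits.Sigma.map f) := by
      have : ∀ j, Mono (f j) := fun j => ((relTriv_iff _).1 (hf j)).1
      exact MorphismProperty.colimitsOfShape_le (W := MorphismProperty.monomorphisms _)
        (J := Discrete J) _ (MorphismProperty.colimitsOfShape.mk' _ _ _ _ (colimit.isColimit _)
          (colimit.isColimit _) (Discrete.natTrans fun ⟨j⟩ => f j) (fun ⟨j⟩ => this j) _ (by simp))
    refine ⟨(mono_iff_injective _).1 hmono, fun n y ⟨a, ha⟩ => ?_⟩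
    classical
    -- the components of `y` with respect to the decomposition into a coproduct are relative cycles
    have h1 (j : J) : Limits.Sigma.map f ≫ Limits.Sigma.π Y j = Limits.Sigma.π X j ≫ f j := by
      refine Limits.Sigma.hom_ext _ _ fun i => ?_
      by_cases h : i = j
      · subst h; simp
      · simp [Limits.Sigma.ι_π_of_ne_assoc _ h, Limits.Sigma.ι_π_of_ne _ h]
    have h2 (j : J) : ∃ (a : (altK (X j)).X n) (c : (altK (Y j)).X (n + 1)),
        (altMap (Limits.Sigma.π Y j)).f n y = (altMap (f j)).f n a + (altK (Y j)).d (n + 1) n c := by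
      refine (hf j).2 n _ ⟨(altMap (Limits.Sigma.π X j)).f _ a, ?_⟩
      rw [altMap_d_apply, ← ha]
      exact congr(NatTrans.app $(h1 j) _ a).symm
    choose a' c' h2 using h2
    obtain ⟨s, x, hx⟩ := exists_of_isColimit_cofan (c := Cofan.mk _ fun j =>
      (Limits.Sigma.ι Y j).app (op (SimplexCategory.mk n)))
      ((isColimitMapCoconeCofanMkEquiv ((evaluation _ _).obj _) _ _)
        (isColimitOfPreserves ((evaluation _ _).obj (op (SimplexCategory.mk n)))
          (coproductIsCoproduct Y))) y
    change y = ∑ i ∈ s, (altMap (Limits.Sigma.ι Y i)).f n (x i) at hx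
    have h3 (j : J) (hj : j ∈ s) : (altMap (Limits.Sigma.π Y j)).f n y = x j := by
      rw [hx, map_sum, Finset.sum_eq_single_of_mem j hj]
      · exact congr(NatTrans.app $(Limits.Sigma.ι_π_eq_id Y j) _ (x j))
      · exact fun i _ hi => congr(NatTrans.app $(Limits.Sigma.ι_π_of_ne Y hi) _ (x i))
    refine ⟨∑ j ∈ s, (altMap (Limits.Sigma.ι X j)).f n (a' j),
      ∑ j ∈ s, (altMap (Limits.Sigma.ι Y j)).f (n + 1) (c' j), ?_⟩
    rw [hx, map_sum, map_sum, ← Finset.sum_add_distrib]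
    refine Finset.sum_congr rfl fun j hj => ?_
    rw [← h3 j hj, h2, map_add, altMap_d_apply]
    congr 1
    exact congr(NatTrans.app $(Limits.Sigma.ι_map f j) _ (a' j)).symm

end RelAcyclic

section
open Cardinal

/-! ### Presheaves of simplicial modules: elements and subobjects -/

namespace HasClub

variable {α : Type w} {κ : Cardinal.{w}}

lemma of_unary (F : α → Set α) (hF : ∀ x, #(F x) < κ) (hκ : 0 < κ) :
    HasClub κ (fun S => ∀ x ∈ S, F x ⊆ S) :=
  (of_closedUnder (fun l => match l with | [x] => F x | _ => ∅) (by
    intro l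
    match l with
    | [] => simpa using hκ
    | [x] => exact hF x
    | _ :: _ :: _ => simpa using hκ)).mono fun S hS x hx => hS [x] (by simpa using hx)

lemma of_binary (F : α → α → Set α) (hF : ∀ x y, #(F x y) < κ) (hκ : 0 < κ) :
    HasClub κ (fun S => ∀ x ∈ S, ∀ y ∈ S, F x y ⊆ S) :=
  (of_closedUnder (fun l => match l with | [x, y] => F x y | _ => ∅) (by
    intro l
    match l with
    | [] | [_] => simpa using hκ
    | [x, y] => exact hF x y
    | _ :: _ :: _ :: _ => simpa using hκ)).mono
      fun S hS x hx y hy => hS [x, y] (by simpa using ⟨hx, hy⟩)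

lemma of_const (T : Set α) (hT : #T < κ) : HasClub κ (fun S => T ⊆ S) :=
  (of_closedUnder (fun _ => T) (fun _ => hT)).mono fun S hS => hS [] (by simp)

end HasClub

variable {R : Type (u + 1)} [CommRing R] {C : Type (u + 1)} [Category.{u} C]

variable (R C) in
/-- The regular cardinals which exceed the size of the ring `R` and of the category `C`. -/
structure IsLarge (κ : Cardinal.{u + 1}) : Prop where
  isRegular : κ.IsRegular
  aleph0_lt : ℵ₀ < κ
  ring_lt : #R < κ
  arrow_lt : #(Arrow C) < κ

namespace IsLarge

variable {κ : Cardinal.{u + 1}}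

lemma pos (h : IsLarge R C κ) : 0 < κ := h.isRegular.pos

lemma obj_lt (h : IsLarge R C κ) : #C < κ :=
  (mk_le_of_injective (f := fun X : C => Arrow.mk (𝟙 X))
    fun _ _ h => congrArg (fun a : Arrow C => a.left) h).trans_lt h.arrow_lt

lemma singleton_lt (h : IsLarge R C κ) {α : Type (u + 1)} (x : α) : #({x} : Set α) < κ := by
  rw [mk_singleton]
  exact (one_lt_aleph0).trans h.aleph0_lt

lemma under_lt (h : IsLarge R C κ) (U : Cᵒᵖ) : #(Σ V : Cᵒᵖ, U ⟶ V) < κ := by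
  refine (mk_le_of_injective (f := fun p : Σ V : Cᵒᵖ, U ⟶ V => Arrow.mk p.2.unop) ?_).trans_lt
    h.arrow_lt
  rintro ⟨⟨V⟩, f⟩ ⟨⟨V'⟩, g⟩ hfg
  have hV : V = V' := congrArg (fun a : Arrow C => a.left) hfg
  subst hV
  have hfg' : f = g := Quiver.Hom.unop_inj ((Arrow.mk_inj V U.unop).1 hfg)
  rw [hfg']

lemma countable_lt (h : IsLarge R C κ) (α : Type (u + 1)) [Countable α] : #α < κ :=
  mk_le_aleph0.trans_lt h.aleph0_lt

lemma sigma_lt (h : IsLarge R C κ) {α : Type (u + 1)} {β : α → Type (u + 1)} (hα : #α < κ)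
    (hβ : ∀ a, #(β a) < κ) : #(Sigma β) < κ := by
  rw [mk_sigma]
  exact sum_lt_of_isRegular h.isRegular hα hβ

end IsLarge

instance : Countable SimplexCategory :=
  Function.Injective.countable (f := SimplexCategory.len) fun _ _ h => SimplexCategory.ext h

instance : Countable SimplexCategoryᵒᵖ :=
  Function.Injective.countable (f := Opposite.unop) Opposite.unop_injective

instance (n m : SimplexCategoryᵒᵖ) : Countable (n ⟶ m) :=
  Function.Injective.countable (f := fun f => (SimplexCategory.Hom.toOrderHom f.unop : _ → _))
    fun _ _ h => Quiver.Hom.unop_inj (SimplexCategory.Hom.ext _ _ (OrderHom.ext _ _ h))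

/-- The elements of a presheaf of simplicial modules. -/
abbrev El (M : SMod R C) : Type (u + 1) :=
  Σ p : Cᵒᵖ × SimplexCategoryᵒᵖ, (M.obj p.1).obj p.2

/-- The element given by a simplex of a section. -/
abbrev El.mk {M : SMod R C} {U : Cᵒᵖ} {n : SimplexCategoryᵒᵖ} (x : (M.obj U).obj n) : El M :=
  ⟨(U, n), x⟩

lemma El.mk_inj {M : SMod R C} {U : Cᵒᵖ} {n : SimplexCategoryᵒᵖ} {x y : (M.obj U).obj n} :
    El.mk x = El.mk y ↔ x = y := by simp [El.mk]

/-- The map induced on elements by a morphism. -/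
def El.map {M N : SMod R C} (f : M ⟶ N) (x : El M) : El N := El.mk ((f.app x.1.1).app x.1.2 x.2)

lemma mono_iff_app_injective {M N : SMod R C} (f : M ⟶ N) :
    Mono f ↔ ∀ U n, Function.Injective ((f.app U).app n) := by
  rw [NatTrans.mono_iff_mono_app]
  exact forall_congr' fun U => mono_iff_injective _

lemma El.map_injective {M N : SMod R C} (f : M ⟶ N) [hf : Mono f] :
    Function.Injective (El.map f) := by
  rintro ⟨⟨U, n⟩, x⟩ ⟨⟨V, m⟩, y⟩ h
  obtain ⟨rfl, rfl⟩ : U = V ∧ n = m := Prod.ext_iff.1 (congrArg Sigma.fst h)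
  exact El.mk_inj.2 ((mono_iff_app_injective f).1 hf U n (El.mk_inj.1 h))

lemma naturality_apply {M N : SMod R C} (f : M ⟶ N) {U V : Cᵒᵖ} (a : U ⟶ V)
    (n : SimplexCategoryᵒᵖ) (x : (M.obj U).obj n) :
    (f.app V).app n ((M.map a).app n x) = (N.map a).app n ((f.app U).app n x) :=
  congr(NatTrans.app $(f.naturality a) n x)

lemma naturality_apply' {M N : SMod R C} (f : M ⟶ N) (U : Cᵒᵖ) {n m : SimplexCategoryᵒᵖ}
    (a : n ⟶ m) (x : (M.obj U).obj n) :
    (f.app U).app m ((M.obj U).map a x) = (N.obj U).map a ((f.app U).app n x) :=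
  congr($((f.app U).naturality a) x)

/-- A subobject of a presheaf of simplicial modules, given by its sections. -/
structure Sub (M : SMod R C) where
  carrier (U : Cᵒᵖ) (n : SimplexCategoryᵒᵖ) : Submodule R ((M.obj U).obj n)
  map_mem {U V : Cᵒᵖ} (a : U ⟶ V) (n : SimplexCategoryᵒᵖ) (x : (M.obj U).obj n) :
    x ∈ carrier U n → (M.map a).app n x ∈ carrier V n
  map_mem' (U : Cᵒᵖ) {n m : SimplexCategoryᵒᵖ} (a : n ⟶ m) (x : (M.obj U).obj n) :
    x ∈ carrier U n → (M.obj U).map a x ∈ carrier U m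

namespace Sub

variable {M N : SMod R C}

/-- The elements of a subobject. -/
def set (S : Sub M) : Set (El M) := {x | x.2 ∈ S.carrier x.1.1 x.1.2}

lemma ext_set {S T : Sub M} (h : S.set = T.set) : S = T := by
  cases S; cases T
  congr
  funext U n
  ext x
  exact Set.ext_iff.1 h (El.mk x)

/-- A subobject as a presheaf of simplicial modules. -/
@[simps]
def toSMod (S : Sub M) : SMod R C where
  obj U :=
    { obj n := ModuleCat.of R (S.carrier U n)
      map {n m} a := ModuleCat.ofHom (((M.obj U).map a).hom.restrict (S.map_mem' U a)) }
  map a :=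
    { app n := ModuleCat.ofHom (((M.map a).app n).hom.restrict (S.map_mem a n))
      naturality n m b := by
        ext x
        exact congr($((M.map a).naturality b) x.1) }
  map_id U := by
    ext n x
    exact congr(NatTrans.app $(M.map_id U) n x.1)
  map_comp a b := by
    ext n x
    exact congr(NatTrans.app $(M.map_comp a b) n x.1)

/-- The inclusion of a subobject. -/
def ι (S : Sub M) : S.toSMod ⟶ M where
  app U := { app n := ModuleCat.ofHom (S.carrier U n).subtype }

instance (S : Sub M) : Mono S.ι :=
  (mono_iff_app_injective _).2 fun _ _ _ _ h => Subtype.ext h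

/-- A morphism with values in a subobject factors through it. -/
def lift (S : Sub N) (f : M ⟶ N) (h : ∀ U n x, (f.app U).app n x ∈ S.carrier U n) :
    M ⟶ S.toSMod where
  app U :=
    { app n := ModuleCat.ofHom (((f.app U).app n).hom.codRestrict _ (h U n))
      naturality n m a := by
        ext x
        exact Subtype.ext (naturality_apply' f U a x) }
  naturality U V a := by
    ext n x
    exact Subtype.ext (naturality_apply f a n x)

@[simp]
lemma lift_ι (S : Sub N) (f : M ⟶ N) (h) : S.lift f h ≫ S.ι = f := rfl

/-- The inverse image of a subobject. -/
def comap (f : M ⟶ N) (S : Sub N) : Sub M where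
  carrier U n := (S.carrier U n).comap ((f.app U).app n).hom
  map_mem {U V} a n x hx := by
    change (f.app V).app n ((M.map a).app n x) ∈ S.carrier V n
    rw [naturality_apply]
    exact S.map_mem a n _ hx
  map_mem' U n m a x hx := by
    change (f.app U).app m ((M.obj U).map a x) ∈ S.carrier U m
    rw [naturality_apply']
    exact S.map_mem' U a _ hx

lemma set_comap (f : M ⟶ N) (S : Sub N) : (S.comap f).set = El.map f ⁻¹' S.set := rfl

/-- The morphism from the inverse image of a subobject to this subobject. -/
def comapHom (f : M ⟶ N) (S : Sub N) : (S.comap f).toSMod ⟶ S.toSMod :=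
  S.lift ((S.comap f).ι ≫ f) fun _ _ x => x.2

lemma comapHom_ι (f : M ⟶ N) (S : Sub N) : S.comapHom f ≫ S.ι = (S.comap f).ι ≫ f := rfl

instance (f : M ⟶ N) [Mono f] (S : Sub N) : Mono (S.comapHom f) :=
  have : Mono (S.comapHom f ≫ S.ι) := by rw [comapHom_ι]; infer_instance
  mono_of_mono _ S.ι

/-- The image of a morphism. -/
def range (f : M ⟶ N) : Sub N where
  carrier U n := LinearMap.range ((f.app U).app n).hom
  map_mem a n x := by
    rintro ⟨y, rfl⟩
    exact ⟨(M.map a).app n y, naturality_apply f a n y⟩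
  map_mem' U n m a x := by
    rintro ⟨y, rfl⟩
    exact ⟨(M.obj U).map a y, naturality_apply' f U a y⟩

lemma set_range (f : M ⟶ N) : (range f).set = Set.range (El.map f) := by
  ext ⟨⟨U, n⟩, x⟩
  constructor
  · rintro ⟨y, h⟩
    exact ⟨El.mk y, El.mk_inj.2 h⟩
  · rintro ⟨⟨⟨V, m⟩, y⟩, h⟩
    obtain ⟨rfl, rfl⟩ : V = U ∧ m = n := Prod.ext_iff.1 (congrArg Sigma.fst h)
    exact ⟨y, El.mk_inj.1 h⟩

/-- The sets of elements which are stable under the module operations and the structure maps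
are the subobjects. -/
lemma exists_set_eq (S : Set (El M)) (h0 : ∀ U n, El.mk (0 : (M.obj U).obj n) ∈ S)
    (hadd : ∀ U n (x y : (M.obj U).obj n), El.mk x ∈ S → El.mk y ∈ S → El.mk (x + y) ∈ S)
    (hsmul : ∀ U n (r : R) (x : (M.obj U).obj n), El.mk x ∈ S → El.mk (r • x) ∈ S)
    (hmap : ∀ U V (a : U ⟶ V) n (x : (M.obj U).obj n), El.mk x ∈ S → El.mk ((M.map a).app n x) ∈ S)
    (hmap' : ∀ U n m (a : n ⟶ m) (x : (M.obj U).obj n),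
      El.mk x ∈ S → El.mk ((M.obj U).map a x) ∈ S) : ∃ N : Sub M, N.set = S :=
  ⟨{  carrier U n :=
        { carrier := {x | El.mk x ∈ S}
          zero_mem' := h0 U n
          add_mem' := hadd U n _ _
          smul_mem' r _ := hsmul U n r _ }
      map_mem a n x := hmap _ _ a n x
      map_mem' U _ _ a x := hmap' U _ _ a x }, rfl⟩

/-- Club many sets of elements of a presheaf of simplicial modules are subobjects. -/
lemma hasClub {κ : Cardinal.{u + 1}} (hκ : IsLarge R C κ) (M : SMod R C) :
    HasClub κ (fun S : Set (El M) => ∃ N : Sub M, N.set = S) := by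
  have h0 := HasClub.of_const (Set.range fun p : Cᵒᵖ × SimplexCategoryᵒᵖ =>
    (El.mk (0 : (M.obj p.1).obj p.2) : El M)) (κ := κ) (by
      refine mk_range_le.trans_lt ?_
      rw [mk_prod, lift_uzero, mk_congr (equivToOpposite (α := C)).symm]
      refine mul_lt_of_lt hκ.aleph0_lt.le hκ.obj_lt ?_
      exact (lift_le_aleph0.2 mk_le_aleph0).trans_lt hκ.aleph0_lt)
  have h1 := HasClub.of_binary (fun x y : El M => {z | ∃ h : x.1 = y.1, z = ⟨y.1, (h ▸ x.2) + y.2⟩})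
    (κ := κ) (fun x y => by
      refine lt_of_le_of_lt (mk_le_one_iff_set_subsingleton.2 ?_)
        ((one_lt_aleph0).trans hκ.aleph0_lt)
      rintro _ ⟨_, rfl⟩ _ ⟨_, rfl⟩
      rfl) hκ.pos
  have h2 := HasClub.of_unary (fun x : El M => Set.range fun r : R => (⟨x.1, r • x.2⟩ : El M))
    (κ := κ) (fun x => mk_range_le.trans_lt hκ.ring_lt) hκ.pos
  have h3 := HasClub.of_unary (fun x : El M => Set.range fun p : Σ V : Cᵒᵖ, x.1.1 ⟶ V =>
      (El.mk ((M.map p.2).app x.1.2 x.2) : El M))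
    (κ := κ) (fun x => mk_range_le.trans_lt (hκ.under_lt _)) hκ.pos
  have h4 := HasClub.of_unary (fun x : El M => Set.range fun p : Σ m : SimplexCategoryᵒᵖ, x.1.2 ⟶ m =>
      (El.mk ((M.obj x.1.1).map p.2 x.2) : El M))
    (κ := κ) (fun x => by
      have := (Set.countable_range fun p : Σ m : SimplexCategoryᵒᵖ, x.1.2 ⟶ m =>
        (El.mk ((M.obj x.1.1).map p.2 x.2) : El M)).to_subtype
      exact hκ.countable_lt _) hκ.pos
  refine (((h0.and hκ.isRegular h1).and hκ.isRegular h2).and hκ.isRegular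
    (h3.and hκ.isRegular h4)).mono ?_
  rintro S ⟨⟨⟨h0, h1⟩, h2⟩, h3, h4⟩
  exact exists_set_eq S (fun U n => h0 ⟨(U, n), rfl⟩)
    (fun U n x y hx hy => h1 _ hx _ hy ⟨rfl, rfl⟩) (fun U n r x hx => h2 _ hx ⟨r, rfl⟩)
    (fun U V a n x hx => h3 _ hx ⟨⟨V, a⟩, rfl⟩) (fun U n m a x hx => h4 _ hx ⟨⟨m, a⟩, rfl⟩)

end Sub
end

section
open Cardinal Simplicial

/-! ### Weakly saturated classes -/

namespace IsWeaklySaturated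

variable {𝓒 : Type*} [Category* 𝓒] {𝓓 : Type*} [Category* 𝓓]

lemma inverseImage {P : MorphismProperty 𝓓} (hP : IsWeaklySaturated.{w} P) (F : 𝓒 ⥤ 𝓓)
    [PreservesColimitsOfSize.{w, w} F] : IsWeaklySaturated.{w} (P.inverseImage F) := by
  obtain ⟨_, _, _, _⟩ := hP
  have : PreservesColimitsOfSize.{0, 0} F := preservesColimitsOfSize_shrink.{0, w, 0, w} F
  refine ⟨⟨fun sq h => ?_⟩, ⟨fun r h => ?_⟩, ⟨fun J => ⟨?_⟩⟩, ⟨fun J _ _ _ _ => ⟨?_⟩⟩⟩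
  · exact P.of_isPushout (sq.map F) h
  · exact P.of_retract (r.map F) h
  · intro X₁ X₂ c₁ c₂ h₁ h₂ f hf φ hφ
    exact MorphismProperty.IsStableUnderColimitsOfShape.condition _ _ _ _
      (isColimitOfPreserves F h₁) (isColimitOfPreserves F h₂) (Functor.whiskerRight f F) hf
      (F.map φ) fun j => by
        have := congrArg F.map (hφ j)
        simpa using this
  · rintro X Y f ⟨hf⟩
    have : PreservesWellOrderContinuousOfShape J F := ⟨fun j hj => inferInstance⟩
    exact P.transfiniteCompositionsOfShape_le J _ ⟨hf.map⟩

lemma iInf {ι : Type*} {P : ι → MorphismProperty 𝓒} (hP : ∀ i, IsWeaklySaturated.{w} (P i)) :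
    IsWeaklySaturated.{w} (⨅ i, P i) := by
  refine ⟨⟨fun sq h => ?_⟩, ⟨fun r h => ?_⟩, ⟨fun J => ⟨?_⟩⟩, ⟨fun J _ _ _ _ => ⟨?_⟩⟩⟩
  · rw [MorphismProperty.iInf_iff] at *
    intro i
    have := (hP i).cobaseChange
    exact (P i).of_isPushout sq (h i)
  · rw [MorphismProperty.iInf_iff] at *
    intro i
    have := (hP i).retracts
    exact (P i).of_retract r (h i)
  · intro X₁ X₂ c₁ c₂ h₁ h₂ f hf φ hφ
    rw [MorphismProperty.iInf_iff]
    intro i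
    have := (hP i).coproducts
    refine MorphismProperty.IsStableUnderColimitsOfShape.condition (W := P i) _ _ _ _
      h₁ h₂ f (fun j => ?_) φ hφ
    have := hf j
    rw [MorphismProperty.iInf_iff] at this
    exact this i
  · rintro X Y f ⟨hf⟩
    rw [MorphismProperty.iInf_iff]
    intro i
    have := (hP i).transfinite
    exact (P i).transfiniteCompositionsOfShape_le J _ ⟨hf.ofLE (iInf_le P i)⟩

lemma inf {P Q : MorphismProperty 𝓒} (hP : IsWeaklySaturated.{w} P)
    (hQ : IsWeaklySaturated.{w} Q) : IsWeaklySaturated.{w} (P ⊓ Q) := by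
  have : P ⊓ Q = ⨅ b : Bool, bif b then P else Q := by rw [iInf_bool_eq]; rfl
  rw [this]
  exact iInf (by rintro (_ | _) <;> assumption)

lemma llp (P : MorphismProperty 𝓒) : IsWeaklySaturated.{w} P.llp where
  cobaseChange := inferInstance
  retracts := inferInstance
  coproducts := inferInstance
  transfinite := inferInstance

end IsWeaklySaturated

lemma isWeaklySaturated_monomorphisms_module (R : Type w) [CommRing R] :
    IsWeaklySaturated.{w} (MorphismProperty.monomorphisms (ModuleCat.{w} R)) where
  cobaseChange := inferInstance
  retracts := inferInstance
  coproducts := ⟨fun _ => inferInstance⟩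
  transfinite := inferInstance

lemma isWeaklySaturated_relTriv (R : Type w) [CommRing R] :
    IsWeaklySaturated.{w} (relTriv R) where
  cobaseChange := inferInstance
  retracts := by
    have : relTriv R = MorphismProperty.monomorphisms _ ⊓ simplicialWeakEquivalences _ := by
      ext; exact relTriv_iff _
    rw [this]
    infer_instance
  coproducts := inferInstance
  transfinite := inferInstance

variable {R : Type (u + 1)} [CommRing R] {C : Type (u + 1)} [Category.{u} C]

lemma isWeaklySaturated_monomorphisms :
    IsWeaklySaturated.{u + 1} (MorphismProperty.monomorphisms (SMod R C)) := by
  have : MorphismProperty.monomorphisms (SMod R C) = ⨅ (U : Cᵒᵖ) (n : SimplexCategoryᵒᵖ),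
      (MorphismProperty.monomorphisms (ModuleCat.{u + 1} R)).inverseImage
        ((evaluation _ _).obj U ⋙ (evaluation _ _).obj n) := by
    ext X Y f
    simp only [MorphismProperty.iInf_iff]
    exact (mono_iff_app_injective f).trans
      (forall₂_congr fun U n => (ModuleCat.mono_iff_injective _).symm)
  rw [this]
  exact .iInf fun U => .iInf fun n => (isWeaklySaturated_monomorphisms_module R).inverseImage _

/-! ### Classes of weak equivalences defined by a family of functors -/

/-- The conditions on a class `W` of morphisms of presheaves of simplicial modules under which `W`
is the class of weak equivalences of a model structure whose cofibrations are the monomorphisms,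
and which is left-induced on presheaves of simplicial coalgebras. The last condition says that
a monomorphism in `W` has many small subobjects in `W`. -/
structure IsAdmissible (W : MorphismProperty (SMod R C)) : Prop where
  twoOutOfThree : W.HasTwoOutOfThreeProperty
  retracts : W.IsStableUnderRetracts
  saturated : IsWeaklySaturated.{u + 1} (MorphismProperty.monomorphisms _ ⊓ W)
  of_objectwise ⦃A B : SMod R C⦄ (f : A ⟶ B) [Mono f] : objectwiseWeakEquivalences R C f → W f
  exists_hasClub : ∃ κ₀ : Cardinal.{u + 1}, ∀ κ : Cardinal.{u + 1}, κ.IsRegular → κ₀ ≤ κ →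
    ∀ ⦃A B : SMod R C⦄ (f : A ⟶ B) [Mono f], W f →
      HasClub κ (fun S : Set (El B) => ∃ N : Sub B, N.set = S ∧ W (N.comapHom f))

variable (R C) in
/-- All sufficiently large regular cardinals are large. -/
lemma exists_isLarge : ∃ κ₀ : Cardinal.{u + 1}, ∀ κ : Cardinal.{u + 1}, κ.IsRegular → κ₀ ≤ κ →
    IsLarge R C κ := by
  refine ⟨Order.succ (ℵ₀ + #R + #(Arrow C)), fun κ hκ h => ?_⟩
  have h := Order.succ_le_iff.1 h
  refine ⟨hκ, lt_of_le_of_lt ?_ h, lt_of_le_of_lt ?_ h, lt_of_le_of_lt ?_ h⟩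
  · rw [add_assoc]; exact le_self_add
  · exact le_add_self.trans le_self_add
  · exact le_add_self

section Solvable

variable {A B : SMod R C} (f : A ⟶ B)

/-- The boundary of `b` lies in `A`. -/
def IsRelCycle {U : Cᵒᵖ} {n : ℕ} (b : (altK (B.obj U)).X n) : Prop :=
  ∃ a, (altMap (f.app U)).f (n - 1) a = (altK (B.obj U)).d n (n - 1) b

/-- `b` is a boundary, modulo `A`. -/
def IsRelBoundary {U : Cᵒᵖ} {n : ℕ} (b : (altK (B.obj U)).X n) : Prop :=
  ∃ a c, b = (altMap (f.app U)).f n a + (altK (B.obj U)).d (n + 1) n c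

/-- The morphisms towards `U` along which `b` becomes a boundary, modulo `A`. -/
def solutionSet {U : Cᵒᵖ} {n : ℕ} (b : (altK (B.obj U)).X n) : Set (Σ V : Cᵒᵖ, U ⟶ V) :=
  {p | IsRelBoundary f ((altMap (B.map p.2)).f n b)}

/-- A class of morphisms such that a monomorphism `A ⟶ B` belongs to it if and only if
every relative cycle becomes a boundary, modulo `A`, locally for some notion of coverings. -/
def IsLocallyDetected (W : MorphismProperty (SMod R C)) : Prop :=
  ∃ Q : ∀ U : Cᵒᵖ, Set (Σ V : Cᵒᵖ, U ⟶ V) → Prop,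
    (∀ U S T, S ⊆ T → Q U S → Q U T) ∧ (∀ U S, ⟨U, 𝟙 U⟩ ∈ S → Q U S) ∧
    ∀ ⦃A B : SMod R C⦄ (f : A ⟶ B) [Mono f], W f ↔
      ∀ U n (b : (altK (B.obj U)).X n), IsRelCycle f b → Q U (solutionSet f b)

open Classical in
/-- The solutions of the problem which the element `x` defines, and their boundaries. -/
def solutions (x : El B) : Set (El B) :=
  Set.range fun p : Σ V : Cᵒᵖ, x.1.1 ⟶ V =>
    if h : IsRelBoundary f (n := x.1.2.unop.len) ((altMap (B.map p.2)).f x.1.2.unop.len x.2) then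
      El.mk (U := p.1) (n := op ⦋x.1.2.unop.len + 1⦌) h.choose_spec.choose else x

/-- The chosen bounding chain of `b` over `V` belongs to the set of solutions of `b`. -/
lemma exists_mem_solutions {U V : Cᵒᵖ} {n : ℕ} (b : (altK (B.obj U)).X n) (g : U ⟶ V)
    (h : IsRelBoundary f ((altMap (B.map g)).f n b)) :
    ∃ a c, (altMap (B.map g)).f n b = (altMap (f.app V)).f n a + (altK (B.obj V)).d (n + 1) n c ∧
      El.mk (M := B) (U := V) (n := op ⦋n + 1⦌) c ∈
        solutions f (El.mk (M := B) (U := U) (n := op ⦋n⦌) b) :=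
  ⟨h.choose, h.choose_spec.choose, h.choose_spec.choose_spec, ⟨V, g⟩, dif_pos h⟩

lemma Sub.ι_d (N : Sub B) {U : Cᵒᵖ} {n m : ℕ} (b : (altK (N.toSMod.obj U)).X n) :
    (altMap (N.ι.app U)).f m ((altK (N.toSMod.obj U)).d n m b) =
      (altK (B.obj U)).d n m ((altMap (N.ι.app U)).f n b) :=
  (altMap_d_apply _ _ _ _).symm

/-- A subobject of `B` which contains, with each relative cycle, the chosen chains which bound it
locally inherits the property of belonging to `W`. -/
lemma IsLocallyDetected.hasClub {W : MorphismProperty (SMod R C)} (hW : IsLocallyDetected W)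
    {κ : Cardinal.{u + 1}} (hκ : IsLarge R C κ) [Mono f] (hf : W f) :
    HasClub κ (fun S : Set (El B) => ∃ N : Sub B, N.set = S ∧ W (N.comapHom f)) := by
  obtain ⟨Q, hQ, -, hQW⟩ := hW
  refine ((Sub.hasClub hκ B).and hκ.isRegular (HasClub.of_unary (solutions f)
    (fun x => mk_range_le.trans_lt (hκ.under_lt _)) hκ.pos)).mono ?_
  rintro _ ⟨⟨N, rfl⟩, hN⟩
  refine ⟨N, rfl, (hQW _).2 fun U n b ⟨a, ha⟩ => ?_⟩
  have hb : IsRelCycle f ((altMap (N.ι.app U)).f n b) := by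
    refine ⟨(altMap ((N.comap f).ι.app U)).f (n - 1) a, ?_⟩
    rw [← N.ι_d, ← ha]
    rfl
  refine hQ U _ _ ?_ ((hQW f).1 hf U n _ hb)
  rintro ⟨V, g⟩ hg
  obtain ⟨a', c, h, hc⟩ := exists_mem_solutions f _ g hg
  have hc' := hN (El.mk (M := B) (U := U) (n := op ⦋n⦌) ((altMap (N.ι.app U)).f n b)) b.2 hc
  let c' : (altK (N.toSMod.obj V)).X (n + 1) := ⟨c, hc'⟩
  let b' : (altK (N.toSMod.obj V)).X n := (altMap (N.toSMod.map g)).f n b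
  have ha' : (altMap (f.app V)).f n a' ∈ N.carrier V (op ⦋n⦌) := by
    have : (altMap (f.app V)).f n a' = (altMap (N.ι.app V)).f n
        (b' - (altK (N.toSMod.obj V)).d (n + 1) n c') := by
      rw [map_sub, N.ι_d]
      exact eq_sub_of_add_eq h.symm
    rw [this]
    exact Subtype.property _
  refine ⟨⟨a', ha'⟩, c', Subtype.ext (h.trans ?_)⟩
  exact congrArg₂ (· + ·) rfl (N.ι_d c').symm

end Solvable
end

section
open Simplicial

/-! ### Simplicial homotopies and tensor products -/

section Homotopies

/-- The tensor product of two simplicial homotopies. -/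
def tensorHomotopy {A : Type*} [Category* A] [MonoidalCategory A] {X Y X' Y' : SimplexCategoryᵒᵖ ⥤ A}
    {f g : X ⟶ Y} {f' g' : X' ⟶ Y'} (H : SimplicialObject.Homotopy f g)
    (H' : SimplicialObject.Homotopy f' g') : SimplicialObject.Homotopy (f ⊗ₘ f') (g ⊗ₘ g') where
  h i := H.h i ⊗ₘ H'.h i
  h_zero_comp_δ_zero n := by
    refine (tensorHom_comp_tensorHom ..).trans ?_
    exact congrArg₂ _ (H.h_zero_comp_δ_zero n) (H'.h_zero_comp_δ_zero n)
  h_last_comp_δ_last n := by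
    refine (tensorHom_comp_tensorHom ..).trans ?_
    exact congrArg₂ _ (H.h_last_comp_δ_last n) (H'.h_last_comp_δ_last n)
  h_succ_comp_δ_castSucc_of_lt i j hij := by
    refine (tensorHom_comp_tensorHom ..).trans (Eq.trans ?_ (tensorHom_comp_tensorHom ..).symm)
    exact congrArg₂ _ (H.h_succ_comp_δ_castSucc_of_lt i j hij)
      (H'.h_succ_comp_δ_castSucc_of_lt i j hij)
  h_succ_comp_δ_castSucc_succ j := by
    refine (tensorHom_comp_tensorHom ..).trans (Eq.trans ?_ (tensorHom_comp_tensorHom ..).symm)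
    exact congrArg₂ _ (H.h_succ_comp_δ_castSucc_succ j) (H'.h_succ_comp_δ_castSucc_succ j)
  h_castSucc_comp_δ_succ_of_lt i j hji := by
    refine (tensorHom_comp_tensorHom ..).trans (Eq.trans ?_ (tensorHom_comp_tensorHom ..).symm)
    exact congrArg₂ _ (H.h_castSucc_comp_δ_succ_of_lt i j hji)
      (H'.h_castSucc_comp_δ_succ_of_lt i j hji)
  h_comp_σ_castSucc_of_le i j hij := by
    refine (tensorHom_comp_tensorHom ..).trans (Eq.trans ?_ (tensorHom_comp_tensorHom ..).symm)
    exact congrArg₂ _ (H.h_comp_σ_castSucc_of_le i j hij) (H'.h_comp_σ_castSucc_of_le i j hij)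
  h_comp_σ_succ_of_lt i j hji := by
    refine (tensorHom_comp_tensorHom ..).trans (Eq.trans ?_ (tensorHom_comp_tensorHom ..).symm)
    exact congrArg₂ _ (H.h_comp_σ_succ_of_lt i j hji) (H'.h_comp_σ_succ_of_lt i j hji)

variable {A : Type u} [Category.{v} A] [Abelian A] {X Y : SimplexCategoryᵒᵖ ⥤ A}

/-- Two morphisms of simplicial objects induce the same maps on homology. -/
def HomologyEq (f g : X ⟶ Y) : Prop :=
  ∀ n, (HomologicalComplex.homologyFunctor A _ n).map
      ((AlgebraicTopology.alternatingFaceMapComplex A).map f) =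
    (HomologicalComplex.homologyFunctor A _ n).map
      ((AlgebraicTopology.alternatingFaceMapComplex A).map g)

lemma simplicialWeakEquivalences_of_homologyEq (f : X ⟶ Y) (g : Y ⟶ X)
    (h : HomologyEq (f ≫ g) (𝟙 X)) (h' : HomologyEq (g ≫ f) (𝟙 Y)) :
    simplicialWeakEquivalences A f := by
  rw [simplicialWeakEquivalences_iff, quasiIso_iff]
  intro n
  rw [quasiIsoAt_iff_isIso_homologyMap]
  have h := h n
  have h' := h' n
  rw [CategoryTheory.Functor.map_comp, CategoryTheory.Functor.map_comp,
    CategoryTheory.Functor.map_id, CategoryTheory.Functor.map_id] at h h'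
  exact ⟨_, h, h'⟩

end Homotopies

variable {R : Type (u + 1)} [CommRing R] {C : Type (u + 1)} [Category.{u} C]

variable (R) in
/-- The simplicial module `n ↦ R[K_n] ⊗ Z_n`, as a functor of the simplicial set `K`. -/
def linTens (Z : SimplexCategoryᵒᵖ ⥤ ModuleCat.{u + 1} R) :
    SSet.{u + 1} ⥤ SimplexCategoryᵒᵖ ⥤ ModuleCat.{u + 1} R :=
  (SimplicialObject.whiskering _ _).obj (linCoalg R ⋙ CoCAlg.forget R) ⋙ tensorRight Z

lemma homologyEq_linTens_map (Z : SimplexCategoryᵒᵖ ⥤ ModuleCat.{u + 1} R) {K L : SSet.{u + 1}}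
    {f g : K ⟶ L} (H : SSet.Homotopy f g) :
    HomologyEq ((linTens R Z).map f) ((linTens R Z).map g) := by
  intro n
  have h := (tensorHomotopy
    (H.toSimplicialObjectHomotopy.whiskerRight (linCoalg R ⋙ CoCAlg.forget R))
    (SimplicialObject.Homotopy.refl (𝟙 Z))).map_homology_eq n
  simp only [tensorHom_id] at h
  exact h

/-! ### Contractions of simplices and horns -/

section Contraction

variable {n : ℕ} (k : Fin (n + 1)) (X : (Δ[n] : SSet.{w}).Subcomplex)

/-- A subcomplex of a simplex such that any simplex obtained by replacing vertices of one of its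
simplices by `k` belongs to it. -/
def IsStableUnderVertex : Prop :=
  ∀ m (s s' : (Δ[n] : SSet.{w}).obj m), s ∈ X.obj m →
    (∀ j, SSet.stdSimplex.asOrderHom s' j = SSet.stdSimplex.asOrderHom s j ∨
      SSet.stdSimplex.asOrderHom s' j = k) →
    s' ∈ X.obj m

lemma isStableUnderVertex_horn : IsStableUnderVertex k (SSet.horn.{w} n k) := by
  intro m s s' hs h
  rw [SSet.mem_horn_iff, Set.ne_univ_iff_exists_notMem] at hs ⊢
  obtain ⟨x, hx⟩ := hs
  refine ⟨x, fun hx' => hx ?_⟩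
  rcases hx' with ⟨j, rfl⟩ | hx'
  · rcases h j with h | h
    · exact Or.inl ⟨j, h.symm⟩
    · exact Or.inr h
  · exact Or.inr hx'

lemma isStableUnderVertex_top : IsStableUnderVertex k (⊤ : (Δ[n] : SSet.{w}).Subcomplex) :=
  fun _ _ _ _ _ => trivial

variable {k X} (hX : IsStableUnderVertex k X)

/-- The endomorphism of `X` which is induced by a monotone map of the vertices. -/
def vertexMap (φ : Fin (n + 1) →o Fin (n + 1)) (hφ : ∀ i, φ i = i ∨ φ i = k) :
    (X : SSet.{w}) ⟶ X where
  app m := ↾fun s => ⟨SSet.stdSimplex.objMk (φ.comp (SSet.stdSimplex.asOrderHom s.1)),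
    hX m s.1 _ s.2 fun _ => hφ _⟩
  naturality _ _ _ := rfl

/-- The homotopy between the endomorphisms which are induced by two monotone maps of the
vertices one of which is smaller than the other one. -/
def vertexHomotopy (φ ψ : Fin (n + 1) →o Fin (n + 1)) (hφ : ∀ i, φ i = i ∨ φ i = k)
    (hψ : ∀ i, ψ i = i ∨ ψ i = k) (h : φ ≤ ψ) :
    SSet.Homotopy (vertexMap hX φ hφ) (vertexMap hX ψ hψ) where
  h :=
    { app m := ↾fun p => ⟨SSet.stdSimplex.objMk
          { toFun j := if SSet.stdSimplex.asOrderHom p.2 j = 0 then φ (SSet.stdSimplex.asOrderHom p.1.1 j)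
              else ψ (SSet.stdSimplex.asOrderHom p.1.1 j)
            monotone' i j hij := by
              have h1 := (SSet.stdSimplex.asOrderHom p.1.1).monotone hij
              have h2 := (SSet.stdSimplex.asOrderHom p.2).monotone hij
              dsimp only
              split_ifs with hi hj hj
              · exact φ.monotone h1
              · exact (φ.monotone h1).trans (h _)
              · rw [hj] at h2
                exact (hi (Fin.le_zero_iff.1 h2)).elim
              · exact ψ.monotone h1 },
        hX m p.1.1 _ p.1.2 fun j => by
          change (if _ then _ else _) = _ ∨ (if _ then _ else _) = _
          split_ifs
          · exact hφ _
          · exact hψ _⟩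
      naturality _ _ _ := rfl }
  h₀ := rfl
  h₁ := rfl
  rel := by
    ext m x
    exact x.1.2.elim

/-- The contraction of `X` to the vertex `k`. -/
abbrev vertexConst : (X : SSet.{w}) ⟶ X :=
  vertexMap hX (OrderHom.const _ k) fun _ => Or.inr rfl

lemma vertexMap_id : vertexMap hX OrderHom.id (fun _ => Or.inl rfl) = 𝟙 _ := by
  ext m x
  refine Subtype.ext (SSet.stdSimplex.objEquiv.injective (SimplexCategory.Hom.ext _ _
    (OrderHom.ext _ _ (funext fun j => ?_))))
  rfl

lemma homologyEq_vertexConst {R : Type (u + 1)} [CommRing R] {X : (Δ[n] : SSet.{u + 1}).Subcomplex}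
    (hX : IsStableUnderVertex k X) (Z : SimplexCategoryᵒᵖ ⥤ ModuleCat.{u + 1} R) :
    HomologyEq ((linTens R Z).map (vertexConst hX)) (𝟙 _) := by
  let φ : Fin (n + 1) →o Fin (n + 1) := ⟨fun i => max i k, fun _ _ h => max_le_max_right _ h⟩
  have hφ (i) : φ i = i ∨ φ i = k := max_choice i k
  have h1 := homologyEq_linTens_map Z (vertexHomotopy hX OrderHom.id φ (fun _ => Or.inl rfl) hφ
    fun i => le_max_left i k)
  have h2 := homologyEq_linTens_map Z (vertexHomotopy hX (OrderHom.const _ k) φ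
    (fun _ => Or.inr rfl) hφ fun i => le_max_right i k)
  intro m
  rw [h2 m, ← h1 m, vertexMap_id, CategoryTheory.Functor.map_id]

end Contraction

/-- A morphism `i` such that `R[i] ⊗ M` is an object-wise weak equivalence for all `M`. -/
def linEquivalences (R : Type (u + 1)) [CommRing R] : MorphismProperty SSet.{u + 1} :=
  fun _ _ i => ∀ Z : SimplexCategoryᵒᵖ ⥤ ModuleCat.{u + 1} R,
    simplicialWeakEquivalences _ ((linTens R Z).map i)

lemma linEquivalences_of_homologyEq {K L : SSet.{u + 1}} (i : K ⟶ L) (r : L ⟶ K)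
    (h : ∀ Z, HomologyEq ((linTens R Z).map (i ≫ r)) (𝟙 _))
    (h' : ∀ Z, HomologyEq ((linTens R Z).map (r ≫ i)) (𝟙 _)) : linEquivalences R i :=
  fun Z => simplicialWeakEquivalences_of_homologyEq _ ((linTens R Z).map r)
    (by rw [← CategoryTheory.Functor.map_comp]; exact h Z)
    (by rw [← CategoryTheory.Functor.map_comp]; exact h' Z)

/-- The constant endomorphism of a simplex. -/
def simplexConst {n : ℕ} (k : Fin (n + 1)) : (Δ[n] : SSet.{w}) ⟶ Δ[n] where
  app _ := ↾fun _ => SSet.stdSimplex.objMk (OrderHom.const _ k)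
  naturality _ _ _ := rfl

lemma homologyEq_simplexConst {n : ℕ} (k : Fin (n + 1))
    (Z : SimplexCategoryᵒᵖ ⥤ ModuleCat.{u + 1} R) :
    HomologyEq ((linTens R Z).map (simplexConst k)) (𝟙 _) := by
  let e : (Δ[n] : SSet.{u + 1}) ⟶ (⊤ : (Δ[n] : SSet.{u + 1}).Subcomplex) :=
    { app m := ↾fun s => ⟨s, trivial⟩
      naturality _ _ _ := rfl }
  intro m
  have h := homologyEq_vertexConst (isStableUnderVertex_top k) Z m
  have h1 : simplexConst k = e ≫ vertexConst (isStableUnderVertex_top k) ≫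
    (⊤ : (Δ[n] : SSet.{u + 1}).Subcomplex).ι := rfl
  have h2 : e ≫ (⊤ : (Δ[n] : SSet.{u + 1}).Subcomplex).ι = 𝟙 _ := rfl
  rw [← (linTens R Z).map_id, ← h2, h1]
  simp only [CategoryTheory.Functor.map_comp, h, CategoryTheory.Functor.map_id]
  exact congrArg _ (Category.id_comp _)

/-- The inclusion of a subcomplex which is stable under the insertion of a vertex. -/
lemma linEquivalences_ι {n : ℕ} {k : Fin (n + 1)} {X : (Δ[n] : SSet.{u + 1}).Subcomplex}
    (hX : IsStableUnderVertex k X)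
    (hk : ∀ m, SSet.stdSimplex.objMk (OrderHom.const _ k) ∈ X.obj m) :
    linEquivalences R X.ι := by
  let r : (Δ[n] : SSet.{u + 1}) ⟶ X :=
    { app m := ↾fun s => ⟨SSet.stdSimplex.objMk (OrderHom.const _ k), hk m⟩
      naturality _ _ _ := rfl }
  exact linEquivalences_of_homologyEq _ r (fun Z => homologyEq_vertexConst hX Z)
    fun Z => homologyEq_simplexConst k Z

lemma linEquivalences_stdSimplex_map_δ (e : Fin 2) :
    linEquivalences R (SSet.stdSimplex.{u + 1}.map (SimplexCategory.δ e)) := by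
  refine linEquivalences_of_homologyEq _ (SSet.stdSimplex.map (SimplexCategory.σ 0))
    (fun Z => ?_) fun Z => ?_
  · have : SSet.stdSimplex.{u + 1}.map (SimplexCategory.δ e) ≫
        SSet.stdSimplex.map (SimplexCategory.σ 0) = 𝟙 _ :=
      (CategoryTheory.Functor.map_comp _ _ _).symm.trans
        ((congrArg _ (Subsingleton.elim _ _)).trans (CategoryTheory.Functor.map_id _ _))
    rw [this, CategoryTheory.Functor.map_id]
    exact fun _ => rfl
  · have : SSet.stdSimplex.{u + 1}.map (SimplexCategory.σ 0) ≫
        SSet.stdSimplex.map (SimplexCategory.δ e) = simplexConst (e.succAbove 0) := by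
      refine (CategoryTheory.Functor.map_comp _ _ _).symm.trans ?_
      ext m x
      refine SSet.stdSimplex.objEquiv.injective (SimplexCategory.Hom.ext _ _ (OrderHom.ext _ _
        (funext fun j => ?_)))
      change e.succAbove _ = e.succAbove 0
      congr 1
      exact Subsingleton.elim _ _
    rw [this]
    exact homologyEq_simplexConst _ Z

lemma linEquivalences_horn_ι {n : ℕ} (i : Fin (n + 2)) :
    linEquivalences R (SSet.horn.{u + 1} (n + 1) i).ι := by
  refine linEquivalences_ι (isStableUnderVertex_horn i) fun m => ?_
  rw [SSet.mem_horn_iff, Set.ne_univ_iff_exists_notMem]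
  obtain ⟨j, hj⟩ := exists_ne i
  refine ⟨j, ?_⟩
  rintro (⟨l, rfl⟩ | h)
  · exact hj rfl
  · exact hj h

/-! ### Object-wise and local weak equivalences -/

/-- Here the only covering which is allowed is the identity. -/
lemma isLocallyDetected_objectwise :
    IsLocallyDetected (objectwiseWeakEquivalences R C) := by
  refine ⟨fun U S => ⟨U, 𝟙 U⟩ ∈ S, fun _ _ _ h h' => h h', fun _ _ h => h, fun A B f hf => ?_⟩
  rw [mono_iff_app_injective] at hf
  refine forall_congr' fun U => ?_
  rw [simplicialWeakEquivalences_iff_relAcyclic _ (hf U)]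
  refine forall₂_congr fun n b => imp_congr Iff.rfl ?_
  change _ ↔ IsRelBoundary f ((altMap (B.map (𝟙 U))).f n b)
  have : (altMap (B.map (𝟙 U))).f n b = b := by
    change ((B.map (𝟙 U)).app _) b = b
    rw [B.map_id]
    rfl
  rw [this]
  rfl

section

variable (τ : GrothendieckTopology C) (x : GrothendieckTopology.Point.{u + 1} τ) {A B : SMod R C}
  (f : A ⟶ B)

instance : IsFiltered x.fiber.Elementsᵒᵖ :=
  have := x.isCofiltered
  inferInstance

lemma presheafFiber_map_injective [hf : Mono f] (n) :
    Function.Injective ((x.presheafFiber.map f).app n) := by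
  rw [mono_iff_app_injective] at hf
  exact injective_of_isColimit
    (Functor.whiskerLeft (CategoryOfElements.π x.fiber).op f)
    (x.isColimitPresheafFiberCocone A) (x.isColimitPresheafFiberCocone B) (x.presheafFiber.map f)
    (fun j => x.toPresheafFiber_naturality f j.unop.1 j.unop.2) (fun j => hf _) n

/-- Since the fiber at a point is a filtered colimit, a relative cycle bounds in it if and only if
it bounds after restriction to some neighbourhood of the point. -/
lemma relAcyclic_presheafFiber_map_iff : RelAcyclic (x.presheafFiber.map f) ↔
    ∀ (U : Cᵒᵖ) (s : x.fiber.obj U.unop) n (b : (altK (B.obj U)).X n), IsRelCycle f b →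
      ∃ p ∈ solutionSet f b, ∃ t, x.fiber.map p.2.unop t = s := by
  refine (relAcyclic_iff_of_isColimit
    (Functor.whiskerLeft (CategoryOfElements.π x.fiber).op f)
    (x.isColimitPresheafFiberCocone A) (x.isColimitPresheafFiberCocone B) (x.presheafFiber.map f)
    (fun j => x.toPresheafFiber_naturality f j.unop.1 j.unop.2)).trans ?_
  constructor
  · intro h U s n b hb
    obtain ⟨k, g, a, c, h⟩ := h (op ⟨U.unop, s⟩) n b hb
    exact ⟨⟨op k.unop.1, g.unop.1.op⟩, ⟨a, c, h⟩, k.unop.2, g.unop.2⟩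
  · intro h j n b hb
    obtain ⟨⟨V, g⟩, ⟨a, c, h⟩, t, ht⟩ := h (op j.unop.1) j.unop.2 n b hb
    exact ⟨op ⟨V.unop, t⟩, (CategoryOfElements.homMk ⟨V.unop, t⟩ j.unop g.unop ht).op, a, c, h⟩

end

/-- Here a set of morphisms towards `U` is a covering if each point of each fiber of `U` lifts to
the source of one of them. -/
lemma isLocallyDetected_local (τ : GrothendieckTopology C) :
    IsLocallyDetected (localWeakEquivalences R τ) := by
  refine ⟨fun U S => ∀ (x : GrothendieckTopology.Point.{u + 1} τ) (s : x.fiber.obj U.unop),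
    ∃ p ∈ S, ∃ t, x.fiber.map p.2.unop t = s, ?_, ?_, ?_⟩
  · intro U S T hST h x s
    obtain ⟨p, hp, hp'⟩ := h x s
    exact ⟨p, hST hp, hp'⟩
  · intro U S hS x s
    exact ⟨_, hS, s, by simp⟩
  · intro A B f hf
    have (x : GrothendieckTopology.Point.{u + 1} τ) :=
      (simplicialWeakEquivalences_iff_relAcyclic _ (presheafFiber_map_injective τ x f)).trans
        (relAcyclic_presheafFiber_map_iff τ x f)
    exact ⟨fun h U n b hb x s => (this x).1 (h x) U s n b hb,
      fun h x => (this x).2 fun U s n b hb => h U n b hb x s⟩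

lemma IsLocallyDetected.of_objectwise {W : MorphismProperty (SMod R C)} (hW : IsLocallyDetected W)
    {A B : SMod R C} (f : A ⟶ B) [Mono f] (hf : objectwiseWeakEquivalences R C f) : W f := by
  obtain ⟨Q, hQ, hQ', h⟩ := hW
  rw [h]
  intro U n b hb
  refine hQ' U _ ?_
  obtain ⟨_, h1, h2, h3⟩ := isLocallyDetected_objectwise (R := R) (C := C)
  have := (simplicialWeakEquivalences_iff_relAcyclic _
    ((mono_iff_app_injective f).1 inferInstance U)).1 (hf U) n b hb
  change IsRelBoundary f ((altMap (B.map (𝟙 U))).f n b)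
  have hb' : (altMap (B.map (𝟙 U))).f n b = b := by
    change ((B.map (𝟙 U)).app _) b = b
    rw [B.map_id]
    rfl
  rw [hb']
  exact this

lemma isAdmissible_objectwise : IsAdmissible (objectwiseWeakEquivalences R C) where
  twoOutOfThree :=
    { comp_mem f g hf hg U := MorphismProperty.comp_mem _ _ _ (hf U) (hg U)
      of_postcomp f g hg hfg U := MorphismProperty.of_postcomp _ _ (g.app U) (hg U) (hfg U)
      of_precomp f g hf hfg U := MorphismProperty.of_precomp _ (f.app U) _ (hf U) (hfg U) }
  retracts :=
    { of_retract r h U := MorphismProperty.of_retract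
        (r.map ((evaluation _ _).obj U)) (h U) }
  saturated := by
    have : MorphismProperty.monomorphisms _ ⊓ objectwiseWeakEquivalences R C =
        ⨅ U : Cᵒᵖ, (relTriv R).inverseImage ((evaluation _ _).obj U) := by
      ext A B f
      simp only [MorphismProperty.iInf_iff]
      refine (and_congr (NatTrans.mono_iff_mono_app f) Iff.rfl).trans ?_
      exact forall_and.symm.trans (forall_congr' fun U => (relTriv_iff _).symm)
    rw [this]
    exact .iInf fun U => (isWeaklySaturated_relTriv R).inverseImage _
  of_objectwise _ _ _ _ hf := hf
  exists_hasClub := by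
    obtain ⟨κ₀, h⟩ := exists_isLarge R C
    exact ⟨κ₀, fun κ hκ hκ' A B f _ hf => isLocallyDetected_objectwise.hasClub f (h κ hκ hκ') hf⟩

lemma isAdmissible_local (τ : GrothendieckTopology C) :
    IsAdmissible (localWeakEquivalences R τ) where
  twoOutOfThree :=
    { comp_mem f g hf hg x := by
        rw [CategoryTheory.Functor.map_comp]
        exact MorphismProperty.comp_mem _ _ _ (hf x) (hg x)
      of_postcomp f g hg hfg x := by
        have := hfg x
        rw [CategoryTheory.Functor.map_comp] at this
        exact MorphismProperty.of_postcomp _ _ _ (hg x) this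
      of_precomp f g hf hfg x := by
        have := hfg x
        rw [CategoryTheory.Functor.map_comp] at this
        exact MorphismProperty.of_precomp _ _ _ (hf x) this }
  retracts :=
    { of_retract r h x := MorphismProperty.of_retract
        (r.map x.presheafFiber) (h x) }
  saturated := by
    have : MorphismProperty.monomorphisms _ ⊓ localWeakEquivalences R τ =
        MorphismProperty.monomorphisms _ ⊓ ⨅ x : GrothendieckTopology.Point.{u + 1} τ,
          (relTriv R).inverseImage x.presheafFiber := by
      ext A B f
      refine and_congr_right fun (hf : Mono f) => ?_
      simp only [MorphismProperty.iInf_iff]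
      refine forall_congr' fun x => ?_
      change _ ↔ relTriv R _
      rw [relTriv_iff, mono_iff_injective]
      exact (and_iff_right (presheafFiber_map_injective τ x f)).symm
    rw [this]
    exact isWeaklySaturated_monomorphisms.inf
      (.iInf fun x => (isWeaklySaturated_relTriv R).inverseImage _)
  of_objectwise _ _ f _ hf := (isLocallyDetected_local τ).of_objectwise f hf
  exists_hasClub := by
    obtain ⟨κ₀, h⟩ := exists_isLarge R C
    exact ⟨κ₀, fun κ hκ hκ' A B f _ hf => (isLocallyDetected_local τ).hasClub f (h κ hκ hκ') hf⟩
end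

/-! ### Pure submodules and subcoalgebras -/

section Pure

variable {R : Type w} [CommRing R]

/-- A linear map which remains injective after tensoring with any module. -/
def IsUniversallyInjective {A B : Type w} [AddCommGroup A] [Module R A] [AddCommGroup B]
    [Module R B] (f : A →ₗ[R] B) : Prop :=
  ∀ (M : Type w) [AddCommGroup M] [Module R M], Function.Injective (f.rTensor M)

variable {A B A' B' D : Type w} [AddCommGroup A] [Module R A] [AddCommGroup B] [Module R B]
  [AddCommGroup A'] [Module R A'] [AddCommGroup B'] [Module R B'] [AddCommGroup D] [Module R D]

namespace IsUniversallyInjective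

lemma injective {f : A →ₗ[R] B} (hf : IsUniversallyInjective f) : Function.Injective f := by
  intro x y h
  have := hf R (a₁ := x ⊗ₜ 1) (a₂ := y ⊗ₜ 1) (by simp [h])
  simpa using congrArg (TensorProduct.rid R A) this

lemma comp {f : A →ₗ[R] B} {g : B →ₗ[R] D} (hg : IsUniversallyInjective g)
    (hf : IsUniversallyInjective f) : IsUniversallyInjective (g ∘ₗ f) := fun M _ _ => by
  rw [LinearMap.rTensor_comp]
  exact (hg M).comp (hf M)

lemma of_equiv (e : A ≃ₗ[R] B) : IsUniversallyInjective (e : A →ₗ[R] B) := fun M _ _ =>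
  (TensorProduct.congr e (LinearEquiv.refl R M)).injective

lemma rTensor {f : A →ₗ[R] B} (hf : IsUniversallyInjective f) :
    IsUniversallyInjective (f.rTensor D) := fun M _ _ => by
  have h := hf (D ⊗[R] M)
  rw [LinearMap.rTensor_tensor] at h
  have h' := (TensorProduct.assoc R B D M).symm.injective.comp
    (h.comp (TensorProduct.assoc R A D M).injective)
  convert! h' using 1
  ext x
  simp

lemma lTensor {f : A →ₗ[R] B} (hf : IsUniversallyInjective f) :
    IsUniversallyInjective (f.lTensor D) := by
  have : f.lTensor D = (TensorProduct.comm R B D : _ →ₗ[R] _) ∘ₗ f.rTensor D ∘ₗ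
      (TensorProduct.comm R D A : _ →ₗ[R] _) := by
    ext; rfl
  rw [this]
  exact (of_equiv _).comp (hf.rTensor.comp (of_equiv _))

lemma map {f : A →ₗ[R] B} {g : A' →ₗ[R] B'} (hf : IsUniversallyInjective f)
    (hg : IsUniversallyInjective g) : IsUniversallyInjective (TensorProduct.map f g) := by
  rw [← LinearMap.lTensor_comp_rTensor]
  exact hg.lTensor.comp hf.rTensor

end IsUniversallyInjective

/-- A submodule such that each finite system of linear equations with constants in it has a
solution in it if it has a solution at all. -/
def IsPure (N : Submodule R D) : Prop :=
  ∀ (l k : ℕ) (m : Fin l → N) (a : Fin l → Fin k → R) (y : Fin k → D),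
    (∀ i, (m i : D) = ∑ j, a i j • y j) → ∃ y' : Fin k → N, ∀ i, m i = ∑ j, a i j • y' j

/-- The inclusion of a pure submodule is universally injective. -/
lemma IsPure.isUniversallyInjective {N : Submodule R D} (hN : IsPure N) :
    IsUniversallyInjective N.subtype := by
  intro M _ _
  refine (injective_iff_map_eq_zero _).2 fun x hx => ?_
  obtain ⟨l, m, n, rfl⟩ : ∃ (l : ℕ) (m : Fin l → N) (n : Fin l → M), x = ∑ i, m i ⊗ₜ[R] n i := by
    obtain ⟨s, rfl⟩ := TensorProduct.exists_finset x
    refine ⟨s.card, fun i => (s.equivFin.symm i).1.1, fun i => (s.equivFin.symm i).1.2, ?_⟩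
    rw [← Finset.sum_coe_sort]
    exact (s.equivFin.symm.sum_comp (fun i : s => i.1.1 ⊗ₜ[R] i.1.2)).symm
  -- The relation already holds over a finitely generated submodule `Q` of `M`. Adding generators
  -- of `Q`, with coefficient `0`, allows to apply the equational criterion for vanishing.
  let P : Submodule R M := Submodule.span R (Set.range n)
  have hnP (i) : n i ∈ P := Submodule.subset_span ⟨i, rfl⟩
  obtain ⟨Q, hPQ, hQ, h⟩ := TensorProduct.eq_zero_of_fg_of_subtype_eq_zero
    (P := P) (t := ∑ i, (⟨n i, hnP i⟩ : P) ⊗ₜ[R] (m i : D)) (Submodule.fg_span (Set.finite_range n))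
    (by simpa using congrArg (TensorProduct.comm R D M) hx)
  obtain ⟨q, s, hs⟩ := Submodule.fg_iff_exists_fin_generating_family.1 hQ
  let nn : Fin l ⊕ Fin q → Q := Sum.elim (fun i => ⟨n i, hPQ (hnP i)⟩)
    (fun j => ⟨s j, hs ▸ Submodule.subset_span ⟨j, rfl⟩⟩)
  let mm : Fin l ⊕ Fin q → N := Sum.elim m (fun _ => 0)
  have hspan : Submodule.span R (Set.range nn) = ⊤ := by
    apply Submodule.map_injective_of_injective Q.injective_subtype
    rw [Submodule.map_span, Submodule.map_top, Submodule.range_subtype]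
    refine le_antisymm (Submodule.span_le.2 ?_) (hs.symm.le.trans (Submodule.span_mono ?_))
    · rintro _ ⟨x, -, rfl⟩
      exact x.2
    · rintro _ ⟨j, rfl⟩
      exact ⟨_, ⟨Sum.inr j, rfl⟩, rfl⟩
  have hsum : ∑ i, nn i ⊗ₜ[R] (mm i : D) = 0 := by
    rw [Fintype.sum_sum_type]
    simpa [nn, mm, Submodule.inclusion_apply] using! h
  obtain ⟨k, a, y, h₁, h₂⟩ := (finSumFinEquiv.symm.vanishesTrivially_comp).2
    (TensorProduct.vanishesTrivially_of_sum_tmul_eq_zero R hspan hsum)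
  obtain ⟨y', hy'⟩ := hN _ k (mm ∘ finSumFinEquiv.symm) a y h₁
  have := TensorProduct.sum_tmul_eq_zero_of_vanishesTrivially R
    ((finSumFinEquiv.symm.vanishesTrivially_comp (m := nn) (n := mm)).1 ⟨k, a, y', hy', h₂⟩)
  rw [Fintype.sum_sum_type] at this
  simpa [nn, mm] using congrArg ((TensorProduct.comm R M N) ∘ Q.subtype.rTensor N) this

end Pure

section
open Cardinal

/-! ### Subcoalgebras -/

section CoalgebraNaturality

variable {R : Type w} [CommRing R] {A B : Type w} [AddCommGroup A] [Module R A]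
  [AddCommGroup B] [Module R B] {ΔA : A →ₗ[R] A ⊗[R] A} {ΔB : B →ₗ[R] B ⊗[R] B}
  {εA : A →ₗ[R] R} {εB : B →ₗ[R] R} {f : A →ₗ[R] B}

lemma map_comp_coassoc_left (h : TensorProduct.map f f ∘ₗ ΔA = ΔB ∘ₗ f) :
    TensorProduct.map f (TensorProduct.map f f) ∘ₗ
      ((TensorProduct.assoc R A A A : _ →ₗ[R] _) ∘ₗ ΔA.rTensor A ∘ₗ ΔA) =
    ((TensorProduct.assoc R B B B : _ →ₗ[R] _) ∘ₗ ΔB.rTensor B ∘ₗ ΔB) ∘ₗ f := by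
  rw [← LinearMap.comp_assoc, TensorProduct.map_map_comp_assoc_eq, LinearMap.comp_assoc,
    LinearMap.comp_assoc, LinearMap.comp_assoc, ← h,
    ← LinearMap.comp_assoc ΔA (LinearMap.rTensor A ΔA),
    ← LinearMap.comp_assoc ΔA _ (LinearMap.rTensor B ΔB),
    LinearMap.map_comp_rTensor, LinearMap.rTensor_comp_map, h]

lemma map_comp_coassoc_right (h : TensorProduct.map f f ∘ₗ ΔA = ΔB ∘ₗ f) :
    TensorProduct.map f (TensorProduct.map f f) ∘ₗ (ΔA.lTensor A ∘ₗ ΔA) =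
    (ΔB.lTensor B ∘ₗ ΔB) ∘ₗ f := by
  rw [LinearMap.comp_assoc, ← h, ← LinearMap.comp_assoc, ← LinearMap.comp_assoc,
    LinearMap.map_comp_lTensor, LinearMap.lTensor_comp_map, h]

lemma lTensor_comp_rTensor_counit (h : TensorProduct.map f f ∘ₗ ΔA = ΔB ∘ₗ f)
    (hε : εA = εB ∘ₗ f) :
    f.lTensor R ∘ₗ (εA.rTensor A ∘ₗ ΔA) = (εB.rTensor B ∘ₗ ΔB) ∘ₗ f := by
  rw [LinearMap.comp_assoc, ← h, ← LinearMap.comp_assoc, ← LinearMap.comp_assoc,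
    LinearMap.lTensor_comp_rTensor, LinearMap.rTensor_comp_map, hε]

lemma rTensor_comp_lTensor_counit (h : TensorProduct.map f f ∘ₗ ΔA = ΔB ∘ₗ f)
    (hε : εA = εB ∘ₗ f) :
    f.rTensor R ∘ₗ (εA.lTensor A ∘ₗ ΔA) = (εB.lTensor B ∘ₗ ΔB) ∘ₗ f := by
  rw [LinearMap.comp_assoc, ← h, ← LinearMap.comp_assoc, ← LinearMap.comp_assoc,
    LinearMap.rTensor_comp_lTensor, LinearMap.lTensor_comp_map, hε]

lemma map_comp_comm (h : TensorProduct.map f f ∘ₗ ΔA = ΔB ∘ₗ f) :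
    TensorProduct.map f f ∘ₗ ((TensorProduct.comm R A A : _ →ₗ[R] _) ∘ₗ ΔA) =
      ((TensorProduct.comm R B B : _ →ₗ[R] _) ∘ₗ ΔB) ∘ₗ f := by
  rw [LinearMap.comp_assoc, ← h, ← LinearMap.comp_assoc, ← LinearMap.comp_assoc,
    TensorProduct.map_comp_comm_eq]

/-- A linear map to the source of a universally injective coalgebra morphism `f` is compatible
with the comultiplications as soon as its composition with `f` is. -/
lemma comul_comp_of_injective {E : Type w} [AddCommGroup E] [Module R E] {ΔE : E →ₗ[R] E ⊗[R] E}
    (hf : IsUniversallyInjective f) (h : TensorProduct.map f f ∘ₗ ΔA = ΔB ∘ₗ f) (g : E →ₗ[R] A)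
    (hg : TensorProduct.map (f ∘ₗ g) (f ∘ₗ g) ∘ₗ ΔE = ΔB ∘ₗ (f ∘ₗ g)) :
    TensorProduct.map g g ∘ₗ ΔE = ΔA ∘ₗ g := by
  refine (LinearMap.cancel_left (hf.map hf).injective).1 ?_
  rw [← LinearMap.comp_assoc, ← TensorProduct.map_comp, ← LinearMap.comp_assoc, h, hg,
    LinearMap.comp_assoc]

end CoalgebraNaturality

section CoalgebraConstructions

variable {R : Type w} [CommRing R]

/-- The cocommutative coalgebra structure on a universally injective submodule which is preserved
by the comultiplication. -/
def CoCAlg.ofInjective {A : Type w} [AddCommGroup A] [Module R A] (B : CoCAlg R)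
    (i : A →ₗ[R] B.obj) (hi : IsUniversallyInjective i) (Δ : A →ₗ[R] A ⊗[R] A)
    (h : TensorProduct.map i i ∘ₗ Δ = Coalgebra.comul ∘ₗ i) : CoCAlg R :=
  letI : Coalgebra R A :=
    { comul := Δ
      counit := Coalgebra.counit ∘ₗ i
      coassoc := by
        refine (LinearMap.cancel_left (hi.map (hi.map hi)).injective).1 ?_
        rw [map_comp_coassoc_left h, map_comp_coassoc_right h, Coalgebra.coassoc]
      rTensor_counit_comp_comul := by
        refine (LinearMap.cancel_left hi.lTensor.injective).1 ?_
        rw [lTensor_comp_rTensor_counit h rfl, Coalgebra.rTensor_counit_comp_comul]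
        ext; simp
      lTensor_counit_comp_comul := by
        refine (LinearMap.cancel_left hi.rTensor.injective).1 ?_
        rw [rTensor_comp_lTensor_counit h rfl, Coalgebra.lTensor_counit_comp_comul]
        ext; simp }
  ⟨CoalgCat.of R A, ⟨by
    have : Coalgebra.IsCocomm R B.obj := B.property
    refine (LinearMap.cancel_left (hi.map hi).injective).1 ?_
    change TensorProduct.map i i ∘ₗ ((TensorProduct.comm R A A : _ →ₗ[R] _) ∘ₗ Δ) = _ ∘ₗ Δ
    rw [map_comp_comm h, h, Coalgebra.comm_comp_comul]⟩⟩

/-- A cocommutative coalgebra structure on a module which is covered by the coalgebras `D j`. -/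
def CoCAlg.ofJointlySurjective {A : Type w} [AddCommGroup A] [Module R A] {J : Type*}
    (D : J → CoCAlg R) (q : ∀ j, (D j).obj →ₗ[R] A)
    (hq : ∀ {E : Type w} [AddCommGroup E] [Module R E] (f g : A →ₗ[R] E),
      (∀ j, f ∘ₗ q j = g ∘ₗ q j) → f = g) (Δ : A →ₗ[R] A ⊗[R] A) (ε : A →ₗ[R] R)
    (h : ∀ j, TensorProduct.map (q j) (q j) ∘ₗ Coalgebra.comul = Δ ∘ₗ q j)
    (hε : ∀ j, Coalgebra.counit = ε ∘ₗ q j) : CoCAlg R :=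
  letI : Coalgebra R A :=
    { comul := Δ
      counit := ε
      coassoc := hq _ _ fun j => by
        rw [← map_comp_coassoc_left (h j), ← map_comp_coassoc_right (h j), Coalgebra.coassoc]
      rTensor_counit_comp_comul := hq _ _ fun j => by
        rw [← lTensor_comp_rTensor_counit (h j) (hε j), Coalgebra.rTensor_counit_comp_comul]
        ext; simp
      lTensor_counit_comp_comul := hq _ _ fun j => by
        rw [← rTensor_comp_lTensor_counit (h j) (hε j), Coalgebra.lTensor_counit_comp_comul]
        ext; simp }
  ⟨CoalgCat.of R A, ⟨hq _ _ fun j => by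
    have : Coalgebra.IsCocomm R (D j).obj := (D j).property
    change ((TensorProduct.comm R A A : _ →ₗ[R] _) ∘ₗ Δ) ∘ₗ q j = Δ ∘ₗ q j
    rw [← map_comp_comm (h j), Coalgebra.comm_comp_comul, h j]⟩⟩

namespace CoCAlg

variable (B : CoCAlg R) (N : Submodule R B.obj)

/-- The submodule `N` of a coalgebra is a subcoalgebra, whose inclusion is universally injective. -/
structure IsSubcoalgebra : Prop where
  subtype : IsUniversallyInjective N.subtype
  comul_mem (x) : x ∈ N → Coalgebra.comul (R := R) x ∈
    LinearMap.range (TensorProduct.map N.subtype N.subtype)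

variable {B N}

/-- By purity, `N ⊗ N` embeds into `B ⊗ B`, so that the comultiplication restricts to `N`. -/
lemma IsSubcoalgebra.exists_comul (h : B.IsSubcoalgebra N) : ∃ Δ : N →ₗ[R] N ⊗[R] N,
    TensorProduct.map N.subtype N.subtype ∘ₗ Δ = Coalgebra.comul ∘ₗ N.subtype := by
  let e := LinearEquiv.ofInjective _ (h.subtype.map h.subtype).injective
  refine ⟨e.symm.toLinearMap ∘ₗ LinearMap.codRestrict _ (Coalgebra.comul ∘ₗ N.subtype)
    fun x => h.comul_mem _ x.2, LinearMap.ext fun x => ?_⟩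
  exact congrArg Subtype.val (e.apply_symm_apply _)

variable (h : B.IsSubcoalgebra N)

/-- A subcoalgebra, as a coalgebra. -/
def sub : CoCAlg R := ofInjective B N.subtype h.subtype _ h.exists_comul.choose_spec

lemma map_comp_comul_sub : TensorProduct.map N.subtype N.subtype ∘ₗ
    (Coalgebra.comul (R := R) (A := (sub h).obj)) = Coalgebra.comul ∘ₗ N.subtype :=
  h.exists_comul.choose_spec

/-- The inclusion of a subcoalgebra. -/
def subι : sub h ⟶ B := homMk ⟨N.subtype, rfl, map_comp_comul_sub h⟩

/-- The corestriction of a morphism to a subcoalgebra. -/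
def codRestrict {E : CoCAlg R} (f : E ⟶ B) (hf : ∀ x, lin f x ∈ N) : E ⟶ sub h :=
  homMk ⟨(lin f).codRestrict N hf, f.hom.toCoalgHom'.counit_comp, by
    exact comul_comp_of_injective h.subtype (map_comp_comul_sub h) _
      f.hom.toCoalgHom'.map_comp_comul⟩

end CoCAlg

end CoalgebraConstructions

section

variable {R : Type (u + 1)} [CommRing R] {C : Type (u + 1)} [Category.{u} C]

instance : (SCoCAlg.forget R C).Faithful where
  map_injective {X Y} f g h := by
    refine NatTrans.ext (funext fun U => NatTrans.ext (funext fun n => ?_))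
    exact (CoCAlg.forget R).map_injective congr(($h : (SCoCAlg.forget R C).obj X ⟶ _).app U |>.app n)

namespace Sub

variable {D : SCoCAlg R C} (N : Sub ((SCoCAlg.forget R C).obj D))

/-- All sections of the subobject are subcoalgebras. -/
def IsSubcoalgebra : Prop :=
  ∀ (U : Cᵒᵖ) (n : SimplexCategoryᵒᵖ), ((D.obj U).obj n).IsSubcoalgebra (N.carrier U n)

variable {N} (h : N.IsSubcoalgebra)

/-- A presheaf of subcoalgebras, as a presheaf of simplicial coalgebras. -/
def toSCoCAlg : SCoCAlg R C where
  obj U :=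
    { obj n := CoCAlg.sub (h U n)
      map {n m} a := CoCAlg.codRestrict (h U m) (CoCAlg.subι (h U n) ≫ (D.obj U).map a)
        fun x => N.map_mem' U a x.1 x.2
      map_id n := CoCAlg.hom_ext (LinearMap.ext fun x => Subtype.ext
        congr(CoCAlg.lin $((D.obj U).map_id n) x.1))
      map_comp {n m k} a b := CoCAlg.hom_ext (LinearMap.ext fun x => Subtype.ext
        congr(CoCAlg.lin $((D.obj U).map_comp a b) x.1)) }
  map {U V} a :=
    { app n := CoCAlg.codRestrict (h V n) (CoCAlg.subι (h U n) ≫ (D.map a).app n)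
        fun x => N.map_mem a n x.1 x.2
      naturality {n m} b := CoCAlg.hom_ext (LinearMap.ext fun x => Subtype.ext
        congr(CoCAlg.lin $((D.map a).naturality b) x.1)) }
  map_id U := by
    refine NatTrans.ext (funext fun n => ?_)
    exact CoCAlg.hom_ext (LinearMap.ext fun x : N.carrier U n => Subtype.ext
        congr(CoCAlg.lin (NatTrans.app $(D.map_id U) n) x.1))
  map_comp {U V W} a b := by
    refine NatTrans.ext (funext fun n => ?_)
    exact CoCAlg.hom_ext (LinearMap.ext fun x : N.carrier U n => Subtype.ext
        congr(CoCAlg.lin (NatTrans.app $(D.map_comp a b) n) x.1))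

/-- The inclusion of a presheaf of subcoalgebras. -/
def coalgι : toSCoCAlg h ⟶ D where
  app U := { app n := CoCAlg.subι (h U n) }

/-- The corestriction of a morphism to a presheaf of subcoalgebras. -/
def coalgLift {E : SCoCAlg R C} (f : E ⟶ D)
    (hf : ∀ U n x, (((SCoCAlg.forget R C).map f).app U).app n x ∈ N.carrier U n) :
    E ⟶ toSCoCAlg h where
  app U :=
    { app n := CoCAlg.codRestrict (h U n) ((f.app U).app n) (hf U n)
      naturality n m a := CoCAlg.hom_ext (LinearMap.ext fun x => Subtype.ext
        congr(CoCAlg.lin $((f.app U).naturality a) x)) }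
  naturality U V a := by
    refine NatTrans.ext (funext fun n => ?_)
    exact CoCAlg.hom_ext (LinearMap.ext fun x : ((E.obj U).obj n).obj => Subtype.ext
        congr(CoCAlg.lin (NatTrans.app $(f.naturality a) n) x))

/-- Club many sets of elements of a presheaf of simplicial coalgebras are presheaves of
subcoalgebras. -/
lemma hasClub_isSubcoalgebra {κ : Cardinal.{u + 1}} (hκ : IsLarge R C κ) (D : SCoCAlg R C) :
    HasClub κ (fun S : Set (El ((SCoCAlg.forget R C).obj D)) =>
      ∃ N : Sub ((SCoCAlg.forget R C).obj D), N.set = S ∧ N.IsSubcoalgebra) := by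
  classical
  let M := (SCoCAlg.forget R C).obj D
  -- solutions of the solvable finite systems of equations
  let F (l : List (El M)) : Set (El M) :=
    {z | ∃ (p : Cᵒᵖ × SimplexCategoryᵒᵖ) (k : ULift.{u + 1} ℕ) (a : Fin l.length → Fin k.down → R)
      (h : ∃ y : Fin k.down → (M.obj p.1).obj p.2,
        ∀ i, l.get i = ⟨p, ∑ j, a i j • y j⟩) (j : ULift.{u + 1} (Fin k.down)),
      z = ⟨p, h.choose j.down⟩}
  have h1 := HasClub.of_closedUnder F (κ := κ) fun l => by
    have hfin {α : Type (u + 1)} (hα : #α < κ) (n : ℕ) : #(Fin n → α) < κ :=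
      ((mk_le_of_injective List.ofFn_injective).trans (mk_list_le_max α)).trans_lt
        (max_lt hκ.aleph0_lt hα)
    refine lt_of_le_of_lt (b := #(Σ (p : Cᵒᵖ × SimplexCategoryᵒᵖ) (k : ULift.{u + 1} ℕ)
      (_ : Fin l.length → Fin k.down → R), ULift.{u + 1} (Fin k.down))) ?_ ?_
    · let G : (Σ (p : Cᵒᵖ × SimplexCategoryᵒᵖ) (k : ULift.{u + 1} ℕ)
          (_ : Fin l.length → Fin k.down → R), ULift.{u + 1} (Fin k.down)) → El M :=
        fun q => if h : ∃ y : Fin q.2.1.down → (M.obj q.1.1).obj q.1.2,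
          ∀ i, l.get i = ⟨q.1, ∑ j, q.2.2.1 i j • y j⟩ then ⟨q.1, h.choose q.2.2.2.down⟩ else
            ⟨q.1, 0⟩
      refine (mk_le_mk_of_subset ?_).trans (mk_range_le (f := G))
      rintro _ ⟨p, k, a, h, j, rfl⟩
      exact ⟨⟨p, k, a, j⟩, dif_pos h⟩
    · refine hκ.sigma_lt ?_ fun p => hκ.sigma_lt (hκ.countable_lt _) fun k =>
        hκ.sigma_lt (hfin (hfin hκ.ring_lt _) _) fun _ => hκ.countable_lt _
      rw [mk_prod, lift_uzero, mk_congr (equivToOpposite (α := C)).symm]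
      refine mul_lt_of_lt hκ.aleph0_lt.le hκ.obj_lt ?_
      exact (lift_le_aleph0.2 mk_le_aleph0).trans_lt hκ.aleph0_lt
  -- the coordinates of the comultiplications
  have hfg (x : El M) : ∃ T : Finset (((D.obj x.1.1).obj x.1.2).obj),
      ∀ P : Submodule R ((D.obj x.1.1).obj x.1.2).obj, (∀ y ∈ T, y ∈ P) →
      Coalgebra.comul (R := R) (A := ((D.obj x.1.1).obj x.1.2).obj) x.2 ∈
        LinearMap.range (TensorProduct.map P.subtype P.subtype) := by
    classical
    obtain ⟨T, hT⟩ := TensorProduct.exists_finset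
      (Coalgebra.comul (R := R) (A := ((D.obj x.1.1).obj x.1.2).obj) x.2)
    refine ⟨T.image Prod.fst ∪ T.image Prod.snd, fun P hP => ?_⟩
    rw [hT]
    refine Submodule.sum_mem _ fun t ht => ?_
    exact ⟨⟨t.1, hP _ (Finset.mem_union_left _ (Finset.mem_image_of_mem _ ht))⟩ ⊗ₜ
      ⟨t.2, hP _ (Finset.mem_union_right _ (Finset.mem_image_of_mem _ ht))⟩, rfl⟩
  choose T hT using hfg
  have h2 := HasClub.of_unary (fun x : El M => (fun y => (⟨x.1, y⟩ : El M)) '' {y | y ∈ T x})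
    (κ := κ) (fun x => (mk_le_aleph0_iff.2
      (((T x).countable_toSet.image _).to_subtype)).trans_lt hκ.aleph0_lt) hκ.pos
  refine ((Sub.hasClub hκ M).and hκ.isRegular (h1.and hκ.isRegular h2)).mono ?_
  rintro _ ⟨⟨N, rfl⟩, h1, h2⟩
  refine ⟨N, rfl, fun U n => ⟨IsPure.isUniversallyInjective fun l k m a y h => ?_, fun x hx => ?_⟩⟩
  · let L : List (El M) := List.ofFn fun i => (El.mk (m i).1 : El M)
    have hL : L.length = l := List.length_ofFn
    have hex : ∃ y : Fin k → (M.obj U).obj n,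
        ∀ i : Fin L.length, L.get i = ⟨(U, n), ∑ j, a (i.cast hL) j • y j⟩ :=
      ⟨y, fun i => (by simp [L, Fin.cast] : L.get i = El.mk (m (i.cast hL)).1).trans
        (congrArg (El.mk (M := M)) (h _))⟩
    have hmem (j : Fin k) : hex.choose j ∈ N.carrier U n := by
      refine h1 L (fun x hx => ?_) ⟨(U, n), ⟨k⟩, fun i => a (i.cast hL), hex, ⟨j⟩, rfl⟩
      obtain ⟨i, rfl⟩ := (List.mem_ofFn' _ _).1 hx
      exact (m i).2
    refine ⟨fun j => ⟨_, hmem j⟩, fun i => Subtype.ext ?_⟩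
    have h := hex.choose_spec (i.cast hL.symm)
    have h' : L.get (i.cast hL.symm) = El.mk (m i).1 := by simp [L]
    rw [h'] at h
    exact (El.mk_inj.1 h).trans (map_sum (N.carrier U n).subtype
      (fun j => a i j • (⟨hex.choose j, hmem j⟩ : N.carrier U n)) Finset.univ).symm
  · refine hT (El.mk x) (N.carrier U n) fun y hy => ?_
    exact h2 (El.mk x) hx ⟨y, hy, rfl⟩

end Sub

end
end

section
open Cardinal

/-! ### Colimits of coalgebras -/

section Colimits

variable {R : Type w} [CommRing R] {J : Type w} [Category.{w} J] (F : J ⥤ CoCAlg R)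

namespace CoCAlg

variable (R) in
/-- The functor `M ↦ M ⊗ M`. -/
def square : ModuleCat.{w} R ⥤ ModuleCat.{w} R where
  obj M := ModuleCat.of R (M ⊗[R] M)
  map f := ModuleCat.ofHom (TensorProduct.map f.hom f.hom)
  map_id _ := ModuleCat.hom_ext (TensorProduct.map_id ..)
  map_comp _ _ := ModuleCat.hom_ext (TensorProduct.map_comp ..)

variable (R) in
/-- The comultiplication, as a natural transformation. -/
def comulNatTrans : forget R ⟶ forget R ⋙ square R where
  app A := ModuleCat.ofHom (Coalgebra.comul (R := R) (A := A.obj))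
  naturality _ _ f := ModuleCat.hom_ext f.hom.toCoalgHom'.map_comp_comul.symm

variable (R) in
/-- The counit, as a natural transformation. -/
def counitNatTrans : forget R ⟶ (Functor.const _).obj (ModuleCat.of R R) where
  app A := ModuleCat.ofHom (Coalgebra.counit (R := R) (A := A.obj))
  naturality _ _ f := ModuleCat.hom_ext f.hom.toCoalgHom'.counit_comp

/-- A linear map which is compatible with the structures of coalgebras, as a morphism. -/
lemma exists_forget_map_eq {A B : CoCAlg R} (f : (forget R).obj A ⟶ (forget R).obj B)
    (h : f ≫ (comulNatTrans R).app B = (comulNatTrans R).app A ≫ (square R).map f)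
    (h' : f ≫ (counitNatTrans R).app B = (counitNatTrans R).app A) :
    ∃ g : A ⟶ B, (forget R).map g = f :=
  ⟨homMk ⟨f.hom, congrArg ModuleCat.Hom.hom h', (congrArg ModuleCat.Hom.hom h).symm⟩, rfl⟩

variable {F} {c : Cocone (F ⋙ forget R)} (hc : IsColimit c)

variable (c) in
/-- The cocone which defines the comultiplication of a colimit. -/
def comulCocone : Cocone (F ⋙ forget R) :=
  (Cocone.precompose (Functor.whiskerLeft F (comulNatTrans R) :
    F ⋙ forget R ⟶ (F ⋙ forget R) ⋙ square R)).obj ((square R).mapCocone c)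

variable (F) in
/-- The cocone which defines the counit of a colimit. -/
def counitCocone : Cocone (F ⋙ forget R) where
  pt := ModuleCat.of R R
  ι :=
    { app j := (counitNatTrans R).app (F.obj j)
      naturality _ _ f := (counitNatTrans R).naturality (F.map f) }

variable (c) in
/-- The components of a cocone, as linear maps. -/
def coconeMap (j : J) : (F.obj j).obj →ₗ[R] c.pt := (c.ι.app j).hom

/-- The comultiplication of a colimit. -/
def colimitComul : c.pt →ₗ[R] c.pt ⊗[R] c.pt := (hc.desc (comulCocone c)).hom

/-- The counit of a colimit. -/
def colimitCounit : c.pt →ₗ[R] R := (hc.desc (counitCocone F)).hom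

lemma map_coconeMap_comp_comul (j : J) :
    TensorProduct.map (coconeMap c j) (coconeMap c j) ∘ₗ
      (Coalgebra.comul (R := R) (A := (F.obj j).obj)) = colimitComul hc ∘ₗ coconeMap c j :=
  congrArg ModuleCat.Hom.hom (hc.fac (comulCocone c) j).symm

lemma colimitCounit_comp_coconeMap (j : J) :
    (Coalgebra.counit (R := R) (A := (F.obj j).obj)) = colimitCounit hc ∘ₗ coconeMap c j :=
  congrArg ModuleCat.Hom.hom (hc.fac (counitCocone F) j).symm

include hc in
lemma coconeMap_ext {E : Type w} [AddCommGroup E] [Module R E] (f g : c.pt →ₗ[R] E)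
    (h : ∀ j, f ∘ₗ coconeMap c j = g ∘ₗ coconeMap c j) : f = g := by
  have := hc.hom_ext (f := ModuleCat.ofHom f) (f' := ModuleCat.ofHom g)
    fun j => ModuleCat.hom_ext (h j)
  exact congrArg ModuleCat.Hom.hom this

/-- The coalgebra structure on a colimit of modules. -/
def colimitObj : CoCAlg R :=
  ofJointlySurjective F.obj (coconeMap c) (coconeMap_ext hc) (colimitComul hc) (colimitCounit hc)
    (map_coconeMap_comp_comul hc) (colimitCounit_comp_coconeMap hc)

/-- The colimit cocone of coalgebras above a colimit cocone of modules. -/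
def colimitCocone : Cocone F where
  pt := colimitObj hc
  ι :=
    { app j := homMk ⟨coconeMap c j, (colimitCounit_comp_coconeMap hc j).symm,
        map_coconeMap_comp_comul hc j⟩
      naturality _ _ f := hom_ext (congrArg ModuleCat.Hom.hom (c.ι.naturality f)) }

/-- The morphism out of the colimit. -/
lemma exists_colimitDesc (s : Cocone F) : ∃ f : colimitObj hc ⟶ s.pt,
    (forget R).map f = hc.desc ((forget R).mapCocone s) := by
  refine exists_forget_map_eq (A := colimitObj hc) _ (hc.hom_ext fun j => ?_)
    (hc.hom_ext fun j => ?_)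
  · refine (hc.fac_assoc ((forget R).mapCocone s) j _).trans ?_
    refine ((comulNatTrans R).naturality (s.ι.app j)).trans ?_
    refine Eq.trans ?_ (congrArg (· ≫ (square R).map (hc.desc ((forget R).mapCocone s)))
      ((comulNatTrans R).naturality ((colimitCocone hc).ι.app j)).symm)
    refine (congrArg ((comulNatTrans R).app (F.obj j) ≫ ·) ?_).trans (Category.assoc _ _ _).symm
    refine (congrArg (square R).map (hc.fac ((forget R).mapCocone s) j).symm).trans ?_
    exact CategoryTheory.Functor.map_comp _ _ _
  · refine (hc.fac_assoc ((forget R).mapCocone s) j _).trans ?_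
    refine ((counitNatTrans R).naturality (s.ι.app j)).trans ?_
    exact ((counitNatTrans R).naturality ((colimitCocone hc).ι.app j)).symm

/-- `colimitCocone` is a colimit. -/
def isColimitColimitCocone : IsColimit (colimitCocone hc) where
  desc s := (exists_colimitDesc hc s).choose
  fac s j := (forget R).map_injective
    ((CategoryTheory.Functor.map_comp _ _ _).trans ((congrArg (c.ι.app j ≫ ·)
      (exists_colimitDesc hc s).choose_spec).trans (hc.fac ((forget R).mapCocone s) j)))
  uniq s m h := (forget R).map_injective
    ((hc.uniq ((forget R).mapCocone s) ((forget R).map m)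
      fun j => congrArg (forget R).map (h j)).trans (exists_colimitDesc hc s).choose_spec.symm)

instance : HasColimitsOfSize.{w, w} (CoCAlg R) where
  has_colimits_of_shape _ _ :=
    ⟨fun F => ⟨⟨_, isColimitColimitCocone (colimit.isColimit (F ⋙ forget R))⟩⟩⟩

instance : PreservesColimitsOfSize.{w, w} (forget R) where
  preservesColimitsOfShape :=
    ⟨fun {F} => preservesColimit_of_preserves_colimit_cocone
      (isColimitColimitCocone (colimit.isColimit (F ⋙ forget R)))
      (colimit.isColimit (F ⋙ forget R))⟩

lemma isIso_of_bijective {A B : CoCAlg R} (f : A ⟶ B) (hf : Function.Bijective (lin f)) :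
    IsIso f :=
  (mkIso (CoalgEquiv.ofBijective (f := f.hom.toCoalgHom') hf)).isIso_hom

end CoCAlg

end Colimits

section

variable {R : Type (u + 1)} [CommRing R] {C : Type (u + 1)} [Category.{u} C]

instance : PreservesColimitsOfSize.{u + 1, u + 1} (SCoCAlg.forget R C) := by
  unfold SCoCAlg.forget
  infer_instance

end

/-! ### Presentability of presheaves of simplicial coalgebras -/

section Presentable

variable {R : Type (u + 1)} [CommRing R] {C : Type (u + 1)} [Category.{u} C]

instance (S : Type w) [CommRing S] : IsLocallyPresentable.{w} (ModuleCat.{w} S) := by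
  have : Fact (ℵ₀ : Cardinal.{w}).IsRegular := Cardinal.fact_isRegular_aleph0
  refine ⟨ℵ₀, inferInstance, ?_⟩
  rw [IsCardinalLocallyPresentable.iff_exists_isStrongGenerator]
  refine ⟨ObjectProperty.singleton (ModuleCat.of S S), inferInstance,
    ObjectProperty.isStrongGenerator_iff.2 ⟨?_, fun X Y i _ hi => ?_⟩, ?_⟩
  · intro X Y f g h
    refine ModuleCat.hom_ext (LinearMap.ext fun x => ?_)
    have := h _ (by simp) (ModuleCat.ofHom (LinearMap.toSpanSingleton S X x))
    simpa using congr($this (1 : S))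
  · have : Epi i := (ModuleCat.epi_iff_surjective _).2 fun y => by
      obtain ⟨x, hx⟩ := hi _ (by simp) (ModuleCat.ofHom (LinearMap.toSpanSingleton S Y y))
      refine ⟨x (1 : S), ?_⟩
      simpa using congr($hx (1 : S))
    exact isIso_of_mono_of_epi i
  · rintro _ ⟨⟩
    refine ⟨fun J _ _ => ?_⟩
    have := isFiltered_of_isCardinalFiltered J ℵ₀
    let e : forget (ModuleCat.{w} S) ≅ coyoneda.obj (op (ModuleCat.of S S)) :=
      NatIso.ofComponents (fun X => Equiv.toIso
        { toFun x := ModuleCat.ofHom (LinearMap.toSpanSingleton S X x)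
          invFun g := g.hom (1 : S)
          left_inv x := LinearMap.toSpanSingleton_apply_one S X x
          right_inv g := ModuleCat.hom_ext (LinearMap.ext_ring
            (LinearMap.toSpanSingleton_apply_one S X _)) }) (fun {X Y} f => by
          ext x
          refine ModuleCat.hom_ext (LinearMap.ext_ring ?_)
          exact (LinearMap.toSpanSingleton_apply_one S Y _).trans
            (congrArg f.hom (LinearMap.toSpanSingleton_apply_one S X x)).symm)
    exact preservesColimitsOfShape_of_natIso e

lemma isLocallyPresentable_presheaf (D : Type w) [Category.{v} D] [EssentiallySmall.{u} D]
    (A : Type*) [Category* A] [IsLocallyPresentable.{u} A] [HasPullbacks A] :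
    IsLocallyPresentable.{u} (Dᵒᵖ ⥤ A) :=
  ((equivSmallModel.{u} D).op.congrLeft (E := A)).symm.isLocallyPresentable

instance : IsLocallyPresentable.{u + 1} (SMod R C) := by
  have := isLocallyPresentable_presheaf.{0, 0, u + 1, u + 1, u + 2} SimplexCategory (ModuleCat.{u + 1} R)
  exact isLocallyPresentable_presheaf.{u + 1, u, u + 1, u + 1, u + 2} C _

end Presentable
end

section
open Cardinal

section Square

variable (R : Type w) [CommRing R]

lemma square_map_eq {M N : ModuleCat.{w} R} (f : M ⟶ N) :
    (CoCAlg.square R).map f = f ▷ M ≫ N ◁ f :=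
  (tensorHom_def f f)

instance (J : Type w) [Category.{w} J] [IsFiltered J] :
    PreservesColimitsOfShape J (CoCAlg.square R) where
  preservesColimit {K} := ⟨fun {c} hc => by
    have (M : ModuleCat.{w} R) : PreservesColimit K ((curriedTensor _).flip.obj M) :=
      inferInstanceAs (PreservesColimit K (tensorRight M))
    have (M : ModuleCat.{w} R) : PreservesColimit K ((curriedTensor _).obj M) :=
      inferInstanceAs (PreservesColimit K (tensorLeft M))
    have h := isColimitOfPreserves₂ (curriedTensor (ModuleCat.{w} R)) hc hc
    have h' := (Functor.Final.isColimitWhiskerEquiv (Functor.diag J) _).symm h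
    let e : Functor.diag J ⋙ Functor.uncurry.obj
        ((((Functor.whiskeringLeft₂ (ModuleCat R)).obj K).obj K).obj (curriedTensor (ModuleCat R))) ≅
        K ⋙ CoCAlg.square R :=
      NatIso.ofComponents (fun j => Iso.refl (K.obj j ⊗ K.obj j)) fun {i j} f =>
        (Category.comp_id _).trans (Eq.trans (square_map_eq R _).symm (Category.id_comp _).symm)
    let w : (Cocone.precompose e.inv).obj (Cocone.whisker (Functor.diag J)
        ((curriedTensor (ModuleCat R)).mapCocone₂ c c)) ≅ (CoCAlg.square R).mapCocone c :=
      Cocone.ext (Iso.refl (c.pt ⊗ c.pt)) fun j =>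
        (Category.comp_id _).trans ((Category.id_comp _).trans (square_map_eq R _).symm)
    exact ⟨IsColimit.equivOfNatIsoOfIso e _ _ w h'⟩⟩

end Square

section

variable {R : Type (u + 1)} [CommRing R] {C : Type (u + 1)} [Category.{u} C]

namespace SCoCAlg

variable (R C) in
/-- The sectionwise tensor square. -/
def square : SMod R C ⥤ SMod R C :=
  (Functor.whiskeringRight _ _ _).obj ((Functor.whiskeringRight _ _ _).obj (CoCAlg.square R))

instance (J : Type (u + 1)) [Category.{u + 1} J] [IsFiltered J] :
    PreservesColimitsOfShape J (square R C) := by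
  unfold square
  infer_instance

variable (R C) in
/-- The sectionwise comultiplication. -/
def comul : forget R C ⟶ forget R C ⋙ square R C where
  app D :=
    { app U := Functor.whiskerLeft (D.obj U) (CoCAlg.comulNatTrans R)
      naturality U V a := by
        refine NatTrans.ext (funext fun n => ?_)
        exact (CoCAlg.comulNatTrans R).naturality ((D.map a).app n) }
  naturality D E f := by
    refine NatTrans.ext (funext fun U => NatTrans.ext (funext fun n => ?_))
    exact (CoCAlg.comulNatTrans R).naturality ((f.app U).app n)

lemma exists_forget_map_eq {D E : SCoCAlg R C} (f : (forget R C).obj D ⟶ (forget R C).obj E)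
    (h : f ≫ (comul R C).app E = (comul R C).app D ≫ (square R C).map f)
    (h' : ∀ U n, (f.app U).app n ≫ (CoCAlg.counitNatTrans R).app _ =
      (CoCAlg.counitNatTrans R).app ((D.obj U).obj n)) :
    ∃ g : D ⟶ E, (forget R C).map g = f := by
  choose g hg using fun U n => CoCAlg.exists_forget_map_eq (A := (D.obj U).obj n)
    (B := (E.obj U).obj n) ((f.app U).app n) congr(NatTrans.app (NatTrans.app $h U) n) (h' U n)
  refine ⟨{ app U := { app n := g U n, naturality n m a := ?_ }, naturality U V a := ?_ }, ?_⟩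
  · apply (CoCAlg.forget R).map_injective
    rw [CategoryTheory.Functor.map_comp, CategoryTheory.Functor.map_comp, hg, hg]
    exact (f.app U).naturality a
  · refine NatTrans.ext (funext fun n => (CoCAlg.forget R).map_injective ?_)
    refine (CategoryTheory.Functor.map_comp _ _ _).trans
      (Eq.trans ?_ (CategoryTheory.Functor.map_comp _ _ _).symm)
    rw [hg, hg]
    exact congr(NatTrans.app $(f.naturality a) n)
  · refine NatTrans.ext (funext fun U => NatTrans.ext (funext fun n => hg U n))

/-- A presheaf of simplicial coalgebras is presentable if its underlying presheaf of simplicial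
modules is: the conditions on a linear map to be compatible with the comultiplications can be
achieved at some stage of a filtered colimit. -/
lemma isCardinalPresentable_of_forget (D : SCoCAlg R C) (κ : Cardinal.{u + 1})
    [Fact κ.IsRegular] [IsCardinalPresentable ((forget R C).obj D) κ] :
    IsCardinalPresentable D κ where
  preservesColimitOfShape J _ _ := ⟨fun {F} => ⟨fun {c} hc => ⟨by
    have := isFiltered_of_isCardinalFiltered J κ
    have hc' := isColimitOfPreserves (forget R C) hc
    refine Types.FilteredColimit.isColimitOf' _ _ (fun f => ?_) fun i f g h => ?_
    · obtain ⟨j, f', hf'⟩ := IsCardinalPresentable.exists_hom_of_isColimit κ hc'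
        ((forget R C).map f)
      obtain ⟨k, u, hu⟩ := IsCardinalPresentable.exists_eq_of_isColimit' κ
        (isColimitOfPreserves (square R C) hc') (i := j)
        (f' ≫ (comul R C).app (F.obj j))
        ((comul R C).app D ≫ (square R C).map f') (by
          refine (Category.assoc _ _ _).trans ?_
          refine (congrArg (f' ≫ ·) ((comul R C).naturality (c.ι.app j)).symm).trans ?_
          refine (Category.assoc _ _ _).symm.trans ?_
          refine (congrArg (· ≫ (comul R C).app c.pt) hf').trans ?_
          refine ((comul R C).naturality f).trans ?_
          refine Eq.trans ?_ (Category.assoc _ _ _).symm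
          refine congrArg ((comul R C).app D ≫ ·) ?_
          refine (congrArg (square R C).map hf'.symm).trans ?_
          exact CategoryTheory.Functor.map_comp _ _ _)
      have hfu : (f' ≫ (forget R C).map (F.map u)) ≫ (forget R C).map (c.ι.app k) =
          (forget R C).map f := by
        rw [Category.assoc, ← CategoryTheory.Functor.map_comp, c.w]
        exact hf'
      obtain ⟨g, hg⟩ := exists_forget_map_eq (f' ≫ (forget R C).map (F.map u)) (by
          refine (Category.assoc _ _ _).trans ?_
          refine (congrArg (f' ≫ ·) ((comul R C).naturality (F.map u))).trans ?_
          refine (Category.assoc _ _ _).symm.trans (hu.trans ?_)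
          refine (Category.assoc _ _ _).trans ?_
          refine congrArg ((comul R C).app D ≫ ·) ?_
          exact (CategoryTheory.Functor.map_comp _ _ _).symm) (fun U n => by
          refine Eq.trans ?_ ((CoCAlg.counitNatTrans R).naturality ((f.app U).app n))
          refine Eq.trans ?_ (congrArg (· ≫ (CoCAlg.counitNatTrans R).app ((c.pt.obj U).obj n))
            congr(NatTrans.app (NatTrans.app $hfu U) n))
          refine Eq.trans ?_ (Category.assoc _ _ _).symm
          exact congrArg (((f' ≫ (forget R C).map (F.map u)).app U).app n ≫ ·)
            ((CoCAlg.counitNatTrans R).naturality (((c.ι.app k).app U).app n)).symm)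
      refine ⟨k, g, (forget R C).map_injective ?_⟩
      refine Eq.trans ?_ (CategoryTheory.Functor.map_comp _ _ _).symm
      rw [hg]
      exact hfu.symm
    · obtain ⟨k, u, hu⟩ := IsCardinalPresentable.exists_eq_of_isColimit' κ hc' (i := i)
        ((forget R C).map f) ((forget R C).map g) (by
          refine (CategoryTheory.Functor.map_comp _ _ _).symm.trans
            (Eq.trans ?_ (CategoryTheory.Functor.map_comp _ _ _))
          exact congrArg (forget R C).map h)
      refine ⟨k, u, (forget R C).map_injective ?_⟩
      exact (CategoryTheory.Functor.map_comp _ _ _).trans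
        (hu.trans (CategoryTheory.Functor.map_comp _ _ _).symm)⟩⟩⟩

instance (D : SCoCAlg R C) : IsPresentable.{u + 1} D := by
  obtain ⟨κ, _, h⟩ := Functor.IsAccessible.exists_cardinal.{u + 1}
    (F := coyoneda.obj (op ((forget R C).obj D)))
  have : IsCardinalPresentable ((forget R C).obj D) κ := h
  have := isCardinalPresentable_of_forget D κ
  exact ⟨κ, inferInstance, this⟩

end SCoCAlg

end
end

section
open Cardinal

/-! ### Essential smallness -/

section EssentiallySmall

/-- The functors on a small category whose values belong to an essentially small class form an
essentially small class. -/
lemma essentiallySmall_functor {J : Type*} [Category* J] {A : Type*} [Category* A]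
    [LocallySmall.{w} A] [Small.{w} J] [LocallySmall.{w} J] (P : ObjectProperty A)
    [ObjectProperty.EssentiallySmall.{w} P] :
    ObjectProperty.EssentiallySmall.{w} (fun F : J ⥤ A => ∀ j, P (F.obj j)) := by
  obtain ⟨Q, hQ, hPQ⟩ := ObjectProperty.EssentiallySmall.exists_small_le'.{w} P
  have : Small.{w} (Subtype Q) := hQ
  have hs (i j : J) : Small.{w} (i ⟶ j) := LocallySmall.hom_small i j
  have hs' (X Y : A) : Small.{w} (X ⟶ Y) := LocallySmall.hom_small X Y
  refine ⟨fun F => ∀ j, Q (F.obj j), ?_, fun F hF => ?_⟩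
  · let T := Σ (o : J → Subtype Q), { m : ∀ i j, (i ⟶ j) → ((o i).1 ⟶ (o j).1) //
      (∀ i, m i i (𝟙 i) = 𝟙 _) ∧ ∀ i j k (f : i ⟶ j) (g : j ⟶ k),
        m i k (f ≫ g) = m i j f ≫ m j k g }
    have : Small.{w} T := inferInstance
    refine small_of_surjective (α := T) (f := fun t =>
      ⟨{ obj j := (t.1 j).1
         map f := t.2.1 _ _ f
         map_id := t.2.2.1
         map_comp := t.2.2.2 _ _ _ }, fun j => (t.1 j).2⟩) ?_
    rintro ⟨F, hF⟩
    exact ⟨⟨fun j => ⟨F.obj j, hF j⟩, fun _ _ f => F.map f, F.map_id,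
      fun _ _ _ => F.map_comp⟩, rfl⟩
  · choose o ho e using fun j => hPQ _ (hF j)
    exact ⟨F.copyObj o fun j => (e j).some, ho, ⟨F.isoCopyObj o fun j => (e j).some⟩⟩

variable (R : Type w) [CommRing R] (κ : Cardinal.{w})

instance essentiallySmall_module :
    ObjectProperty.EssentiallySmall.{w} (fun M : ModuleCat.{w} R => #M < κ) := by
  let T := Σ (S : Set κ.out) (_ : AddCommGroup S), Module R S
  refine ⟨.ofObj (fun t : T => letI := t.2.1; letI := t.2.2; ModuleCat.of R t.1), inferInstance,
    fun M hM => ?_⟩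
  obtain ⟨f⟩ : Nonempty (M ↪ κ.out) := by
    rw [← le_def, mk_out]
    exact hM.le
  let e : Set.range f ≃ M := (Equiv.ofInjective f f.injective).symm
  let := e.addCommGroup
  let := e.module R
  exact ⟨_, ⟨(⟨Set.range f, inferInstance, inferInstance⟩ : T)⟩,
    ⟨(e.linearEquiv R).symm.toModuleIso⟩⟩

instance essentiallySmall_coCAlg :
    ObjectProperty.EssentiallySmall.{w} (fun A : CoCAlg R => #A.obj < κ) := by
  obtain ⟨Q, hQ, hPQ⟩ := ObjectProperty.EssentiallySmall.exists_small_le'.{w}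
    (fun M : ModuleCat.{w} R => #M < κ)
  have : Small.{w} (Subtype Q) := hQ
  let T := Σ M : Subtype Q, { c : Coalgebra R M.1 // Coalgebra.IsCocomm R M.1 }
  refine ⟨.ofObj (fun t : T => ⟨⟨t.1.1, t.2.1⟩, t.2.2⟩), inferInstance, fun A hA => ?_⟩
  obtain ⟨M, hM, ⟨i⟩⟩ := hPQ ((CoCAlg.forget R).obj A) hA
  let e : M ≃ₗ[R] A.obj := i.symm.toLinearEquiv
  let Δ : M →ₗ[R] M ⊗[R] M := TensorProduct.map e.symm.toLinearMap e.symm.toLinearMap ∘ₗ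
    Coalgebra.comul ∘ₗ e.toLinearMap
  have hΔ : TensorProduct.map e.toLinearMap e.toLinearMap ∘ₗ Δ =
      Coalgebra.comul ∘ₗ e.toLinearMap := by
    rw [← LinearMap.comp_assoc, ← TensorProduct.map_comp]
    simp
  let B := CoCAlg.ofInjective A e.toLinearMap (.of_equiv e) Δ hΔ
  let f : B ⟶ A := CoCAlg.homMk ⟨e.toLinearMap, rfl, hΔ⟩
  have : IsIso f := CoCAlg.isIso_of_bijective f e.bijective
  exact ⟨B, ⟨(⟨⟨M, hM⟩, B.obj.instCoalgebra, B.property⟩ : T)⟩, ⟨(asIso f).symm⟩⟩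

end EssentiallySmall

/-! ### Categories which are similar to that of coalgebras -/

section

variable {R : Type (u + 1)} [CommRing R] {C : Type (u + 1)} [Category.{u} C]
  {𝓓 : Type (u + 2)} [Category.{u + 1} 𝓓]

/-- A morphism `e : E ⟶ D` such that `E` is the largest subobject of `D` with given elements. -/
structure IsEmbedding (U : 𝓓 ⥤ SMod R C) {E D : 𝓓} (e : E ⟶ D) : Prop where
  mono : Mono (U.map e)
  exists_lift ⦃E' : 𝓓⦄ (f : E' ⟶ D) :
    Set.range (El.map (U.map f)) ⊆ Set.range (El.map (U.map e)) → ∃ g : E' ⟶ E, g ≫ e = f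

/-- The properties of the forgetful functor from presheaves of simplicial coalgebras to presheaves
of simplicial modules which are used in the construction of model structures. The identity functor
of the category of presheaves of simplicial modules also has them. -/
structure IsCoalgebraic (U : 𝓓 ⥤ SMod R C) : Prop where
  hasColimits : HasColimitsOfSize.{u + 1, u + 1} 𝓓
  faithful : U.Faithful
  preservesColimits : PreservesColimitsOfSize.{u + 1, u + 1} U
  isPresentable (D : 𝓓) : IsPresentable.{u + 1} D
  exists_hasClub : ∃ κ₀ : Cardinal.{u + 1}, ∀ κ : Cardinal.{u + 1}, κ.IsRegular → κ₀ ≤ κ →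
    ∀ D : 𝓓, HasClub κ (fun S : Set (El (U.obj D)) => ∃ (E : 𝓓) (e : E ⟶ D),
      Set.range (El.map (U.map e)) = S ∧ IsEmbedding U e)
  essentiallySmall (κ : Cardinal.{u + 1}) :
    ObjectProperty.EssentiallySmall.{u + 1} (fun D : 𝓓 => #(El (U.obj D)) < κ)
  exists_map_eq_of_epi ⦃X Y Z : 𝓓⦄ (e : X ⟶ Y) (f : X ⟶ Z) (φ : U.obj Y ⟶ U.obj Z) :
    Epi (U.map e) → U.map e ≫ φ = U.map f → ∃ g, U.map g = φ

lemma mk_obj_lt_of_mk_El_lt {κ : Cardinal.{u + 1}} {M : SMod R C} (h : #(El M) < κ) (U : Cᵒᵖ)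
    (n : SimplexCategoryᵒᵖ) : #((M.obj U).obj n) < κ :=
  (mk_le_of_injective (f := fun x => (El.mk x : El M)) fun _ _ => El.mk_inj.1).trans_lt h

lemma Sub.range_map_ι {M : SMod R C} (N : Sub M) : Set.range (El.map N.ι) = N.set := by
  ext ⟨⟨U, n⟩, x⟩
  constructor
  · rintro ⟨⟨⟨V, m⟩, y⟩, h⟩
    rw [← h]
    exact y.2
  · intro h
    exact ⟨El.mk (⟨x, h⟩ : N.carrier U n), rfl⟩

lemma Sub.mem_of_range_subset {M M' : SMod R C} (N : Sub M) (f : M' ⟶ M)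
    (h : Set.range (El.map f) ⊆ N.set) (U : Cᵒᵖ) (n : SimplexCategoryᵒᵖ) (x : (M'.obj U).obj n) :
    (f.app U).app n x ∈ N.carrier U n :=
  h ⟨El.mk x, rfl⟩

variable (R C) in
lemma isCoalgebraic_id : IsCoalgebraic (𝟭 (SMod R C)) where
  hasColimits := inferInstance
  faithful := inferInstance
  preservesColimits := inferInstance
  isPresentable _ := inferInstance
  exists_hasClub := by
    obtain ⟨κ₀, h⟩ := exists_isLarge (R := R) (C := C)
    refine ⟨κ₀, fun κ hκ hκ' D => (Sub.hasClub (h κ hκ hκ') D).mono ?_⟩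
    rintro _ ⟨N, rfl⟩
    refine ⟨N.toSMod, N.ι, N.range_map_ι, ⟨inferInstanceAs (Mono N.ι), fun E' f hf => ?_⟩⟩
    exact ⟨N.lift f (N.mem_of_range_subset f (hf.trans N.range_map_ι.subset)), rfl⟩
  essentiallySmall κ := by
    have := essentiallySmall_functor.{u + 1} (J := SimplexCategoryᵒᵖ)
      (fun M : ModuleCat.{u + 1} R => #M < κ)
    have := essentiallySmall_functor.{u + 1} (J := Cᵒᵖ) (fun F : SimplexCategoryᵒᵖ ⥤ _ =>
      ∀ j, (fun M : ModuleCat.{u + 1} R => #M < κ) (F.obj j))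
    exact ObjectProperty.EssentiallySmall.of_le.{u + 1} (P := fun D : SMod R C => #(El D) < κ)
      fun D hD => mk_obj_lt_of_mk_El_lt hD
  exists_map_eq_of_epi _ _ _ _ _ φ _ _ := ⟨φ, rfl⟩

lemma epi_iff_app_surjective {M N : SMod R C} (f : M ⟶ N) :
    Epi f ↔ ∀ U n, Function.Surjective ((f.app U).app n) := by
  rw [NatTrans.epi_iff_epi_app]
  refine forall_congr' fun U => ?_
  rw [NatTrans.epi_iff_epi_app]
  exact forall_congr' fun n => ModuleCat.epi_iff_surjective _

section

variable {A B : Type*} [Category* A] [Category* B] {F : A ⥤ B} {X Y Z : A} (e : X ⟶ Y) (f : X ⟶ Z)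
  (φ : F.obj Y ⟶ F.obj Z) [Epi (F.map e)] (h : F.map e ≫ φ = F.map f)

include h

/-- A morphism `φ` between the images by `F` of two objects, which becomes the image of a morphism
after composition with an epimorphism `F.map e`, is compatible with each operation `α` carried by
the objects in the image of `F`. This is used for the comultiplication. -/
lemma comp_app_of_epi_map {T : B ⥤ B} (α : F ⟶ F ⋙ T) :
    φ ≫ α.app Z = α.app Y ≫ T.map φ := by
  have h1 := α.naturality f
  have h2 := α.naturality_assoc e (T.map φ)
  dsimp at h1 h2
  rw [← cancel_epi (F.map e), ← Category.assoc, h, h1, h2, ← CategoryTheory.Functor.map_comp, h]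

/-- The same for operations with values in a fixed object, such as the counit. -/
lemma comp_app_of_epi_map' {b : B} (α : F ⟶ (Functor.const A).obj b) :
    φ ≫ α.app Z = α.app Y := by
  have h1 := α.naturality f
  have h2 := α.naturality e
  dsimp at h1 h2
  rw [← cancel_epi (F.map e), ← Category.assoc, h, h1, h2]

end

variable (R C) in
/-- Subcoalgebras are the distinguished subobjects; they contain any given small set of elements
since, up to enlarging it, a small submodule is a pure submodule which is closed under
comultiplication. -/
lemma isCoalgebraic_forget : IsCoalgebraic (SCoCAlg.forget R C) where
  hasColimits := inferInstance
  faithful := inferInstance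
  preservesColimits := inferInstance
  isPresentable _ := inferInstance
  exists_hasClub := by
    obtain ⟨κ₀, h⟩ := exists_isLarge (R := R) (C := C)
    refine ⟨κ₀, fun κ hκ hκ' D => (Sub.hasClub_isSubcoalgebra (h κ hκ hκ') D).mono ?_⟩
    rintro _ ⟨N, rfl, hN⟩
    refine ⟨Sub.toSCoCAlg hN, Sub.coalgι hN, N.range_map_ι,
      ⟨inferInstanceAs (Mono N.ι), fun E' f hf => ?_⟩⟩
    exact ⟨Sub.coalgLift hN f (N.mem_of_range_subset _ (hf.trans N.range_map_ι.subset)), rfl⟩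
  essentiallySmall κ := by
    have : ObjectProperty.EssentiallySmall.{u + 1}
        (fun F : SimplexCategoryᵒᵖ ⥤ CoCAlg R => ∀ j, #(F.obj j).obj < κ) :=
      essentiallySmall_functor.{u + 1} (fun A : CoCAlg R => #A.obj < κ)
    have : ObjectProperty.EssentiallySmall.{u + 1}
        (fun F : SCoCAlg R C => ∀ j k, #((F.obj j).obj k).obj < κ) :=
      essentiallySmall_functor.{u + 1}
        (fun F : SimplexCategoryᵒᵖ ⥤ CoCAlg R => ∀ j, #(F.obj j).obj < κ)
    exact ObjectProperty.EssentiallySmall.of_le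
      (Q := fun F : SCoCAlg R C => ∀ j k, #((F.obj j).obj k).obj < κ)
      fun D hD => mk_obj_lt_of_mk_El_lt hD
  exists_map_eq_of_epi X Y Z e f φ he h := by
    have hs := (epi_iff_app_surjective _).1 he
    refine SCoCAlg.exists_forget_map_eq φ (comp_app_of_epi_map e f φ h (SCoCAlg.comul R C))
      fun U n => ?_
    have : Epi ((CoCAlg.forget R).map ((e.app U).app n)) :=
      (ModuleCat.epi_iff_surjective _).2 (hs U n)
    have h' : (CoCAlg.forget R).map ((e.app U).app n) ≫ (φ.app U).app n =
      (CoCAlg.forget R).map ((f.app U).app n) := congr(NatTrans.app (NatTrans.app $h U) n)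
    exact comp_app_of_epi_map' (F := CoCAlg.forget R) ((e.app U).app n) ((f.app U).app n)
      ((φ.app U).app n) h' (CoCAlg.counitNatTrans R)

namespace IsCoalgebraic

variable {U : 𝓓 ⥤ SMod R C} (hU : IsCoalgebraic U)

include hU

lemma epi_map {X Y : 𝓓} (f : X ⟶ Y) [Epi f] : Epi (U.map f) := by
  have := hU.preservesColimits
  have : PreservesColimitsOfSize.{0, 0} U := preservesColimitsOfSize_shrink.{0, u + 1, 0, u + 1} U
  infer_instance

/-- A quotient of `X` is determined by its kernel in `U.obj X`. -/
lemma wellPowered_op : WellPowered.{u + 1} 𝓓ᵒᵖ where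
  subobject_small X := by
    have := hU.faithful
    let Φ (P : Subobject X) : Set (El (U.obj X.unop)) :=
      {a | ((U.map P.arrow.unop).app a.1.1).app a.1.2 a.2 = 0}
    have key (P Q : Subobject X) (h : Φ P = Φ Q) : P ≤ Q := by
      have := hU.epi_map Q.arrow.unop
      have hk : kernel.ι (U.map Q.arrow.unop) ≫ U.map P.arrow.unop = 0 := by
        refine NatTrans.ext (funext fun V => NatTrans.ext (funext fun n => ?_))
        refine ModuleCat.hom_ext (LinearMap.ext fun x => ?_)
        have hx : El.mk (((kernel.ι (U.map Q.arrow.unop)).app V).app n x) ∈ Φ Q :=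
          congr((NatTrans.app (NatTrans.app $(kernel.condition (U.map Q.arrow.unop)) V) n) x)
        rw [← h] at hx
        exact hx
      obtain ⟨g, hg⟩ := hU.exists_map_eq_of_epi Q.arrow.unop P.arrow.unop
        (Abelian.epiDesc _ _ hk) inferInstance (Abelian.comp_epiDesc _ _ hk)
      refine Subobject.le_of_comm g.op (Quiver.Hom.unop_inj (U.map_injective ?_))
      change U.map (Q.arrow.unop ≫ g) = _
      rw [CategoryTheory.Functor.map_comp, hg]
      exact Abelian.comp_epiDesc _ _ hk
    exact small_of_injective (f := Φ) fun P Q h => le_antisymm (key P Q h) (key Q P h.symm)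

end IsCoalgebraic

end
end

section
open Cardinal

/-! ### Lifting properties with respect to small monomorphisms -/

section

variable {R : Type (u + 1)} [CommRing R] {C : Type (u + 1)} [Category.{u} C]
  {𝓓 : Type (u + 2)} [Category.{u + 1} 𝓓]

/-- The regular cardinals which are large enough for the constructions of subobjects in `𝓓`. -/
structure IsLargeFor (U : 𝓓 ⥤ SMod R C) (κ : Cardinal.{u + 1}) : Prop extends IsLarge R C κ where
  hasClub (D : 𝓓) : HasClub κ (fun S : Set (El (U.obj D)) => ∃ (E : 𝓓) (e : E ⟶ D),
    Set.range (El.map (U.map e)) = S ∧ IsEmbedding U e)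

lemma IsCoalgebraic.exists_isLargeFor {U : 𝓓 ⥤ SMod R C} (hU : IsCoalgebraic U) :
    ∃ κ₀ : Cardinal.{u + 1}, ∀ κ : Cardinal.{u + 1}, κ.IsRegular → κ₀ ≤ κ → IsLargeFor U κ := by
  obtain ⟨κ₁, h₁⟩ := exists_isLarge (R := R) (C := C)
  obtain ⟨κ₂, h₂⟩ := hU.exists_hasClub
  exact ⟨max κ₁ κ₂, fun κ hκ h => ⟨h₁ κ hκ (le_of_max_le_left h), h₂ κ hκ (le_of_max_le_right h)⟩⟩

/-- The morphisms whose images by `U` are monomorphisms. -/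
abbrev monos (U : 𝓓 ⥤ SMod R C) : MorphismProperty 𝓓 :=
  (MorphismProperty.monomorphisms _).inverseImage U

/-- The morphisms between objects with less than `κ` elements whose images by `U` are
monomorphisms. -/
def smallMonos (U : 𝓓 ⥤ SMod R C) (κ : Cardinal.{u + 1}) : MorphismProperty 𝓓 :=
  fun X Y f => #(El (U.obj X)) < κ ∧ #(El (U.obj Y)) < κ ∧ Mono (U.map f)

lemma El.map_comp {L M N : SMod R C} (f : L ⟶ M) (g : M ⟶ N) (x : El L) :
    El.map (f ≫ g) x = El.map g (El.map f x) := rfl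

lemma isIso_of_app_bijective {M N : SMod R C} (f : M ⟶ N) [Mono f]
    (hf : ∀ y : El N, y ∈ Set.range (El.map f)) : IsIso f := by
  have : Epi f := (epi_iff_app_surjective f).2 fun U n y => by
    have : El.mk y ∈ Set.range (El.map f) := hf _
    rw [← Sub.set_range] at this
    exact this
  exact isIso_of_mono_of_epi f

namespace IsCoalgebraic

variable {U : 𝓓 ⥤ SMod R C} (hU : IsCoalgebraic U)

include hU

lemma reflectsIsomorphisms : U.ReflectsIsomorphisms where
  reflects {X Y} f _ := by
    have := hU.faithful
    obtain ⟨g, hg⟩ := hU.exists_map_eq_of_epi f (𝟙 X) (inv (U.map f)) inferInstance (by simp)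
    exact ⟨g, U.map_injective (by simp [hg]), U.map_injective (by simp [hg])⟩

lemma mono_of_mono_map {X Y : 𝓓} (f : X ⟶ Y) [Mono (U.map f)] : Mono f :=
  have := hU.faithful
  U.mono_of_mono_map inferInstance

variable {κ : Cardinal.{u + 1}} (hκ : IsLargeFor U κ)

include hκ

/-- Given a monomorphism `A ⟶ B`, a small set of elements of `B` is contained in a small subobject
which belongs to a given club and whose intersection with `A` is a subobject of `A`. -/
lemma exists_small_square {A B : 𝓓} (m : A ⟶ B) [Mono (U.map m)] {P : Set (El (U.obj B)) → Prop}
    (hP : HasClub κ P) (T : Set (El (U.obj B))) (hT : #T < κ) :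
    ∃ (D E : 𝓓) (d : D ⟶ A) (e : E ⟶ B) (t : D ⟶ E), IsEmbedding U d ∧ IsEmbedding U e ∧
      t ≫ e = d ≫ m ∧ smallMonos U κ t ∧ T ⊆ Set.range (El.map (U.map e)) ∧
      P (Set.range (El.map (U.map e))) ∧
      Set.range (El.map (U.map d)) = El.map (U.map m) ⁻¹' Set.range (El.map (U.map e)) := by
  obtain ⟨S, ⟨⟨⟨E, e, rfl, he⟩, ⟨D, d, hd, hd'⟩⟩, hPS⟩, hTS, hS⟩ :=
    (((hκ.hasClub B).and hκ.isRegular ((hκ.hasClub A).preimage hκ.isRegular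
      (El.map_injective (U.map m)))).and hκ.isRegular hP).exists_superset hκ.isRegular
        hκ.aleph0_lt T hT
  obtain ⟨t, ht⟩ := he.exists_lift (d ≫ m) (by
    rintro _ ⟨x, rfl⟩
    rw [CategoryTheory.Functor.map_comp, El.map_comp]
    have : El.map (U.map d) x ∈ Set.range (El.map (U.map d)) := ⟨x, rfl⟩
    rw [hd] at this
    exact this)
  have := he.mono
  have := hd'.mono
  have ht' : Mono (U.map t ≫ U.map e) := by
    rw [← CategoryTheory.Functor.map_comp, ht, CategoryTheory.Functor.map_comp]
    infer_instance
  have hE : #(El (U.obj E)) < κ := by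
    rwa [mk_range_eq _ (El.map_injective (U.map e))] at hS
  have hD : #(El (U.obj D)) < κ := by
    rw [← mk_range_eq _ (El.map_injective (U.map d)), hd]
    exact (mk_preimage_of_injective _ _ (El.map_injective _)).trans_lt hS
  exact ⟨D, E, d, e, t, hd', he, ht, ⟨hD, hE, mono_of_mono _ (U.map e)⟩, hTS, hPS, hd⟩

end IsCoalgebraic

/-- A partial solution of a lifting problem for a monomorphism `i : A ⟶ B`: a solution on a
subobject of `B` which contains `A`. -/
structure PartialLift (U : 𝓓 ⥤ SMod R C) {A B X Y : 𝓓} (i : A ⟶ B) (p : X ⟶ Y) (f : A ⟶ X)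
    (g : B ⟶ Y) (E : 𝓓) where
  ι : E ⟶ B
  a : A ⟶ E
  l : E ⟶ X
  mono : Mono (U.map ι)
  a_ι : a ≫ ι = i
  a_l : a ≫ l = f
  l_p : l ≫ p = ι ≫ g

attribute [instance] PartialLift.mono

namespace PartialLift

variable {U : 𝓓 ⥤ SMod R C} {A B X Y : 𝓓} {i : A ⟶ B} {p : X ⟶ Y} {f : A ⟶ X} {g : B ⟶ Y}

/-- The relation of extension between partial solutions. -/
def Extends {E E' : 𝓓} (s : PartialLift U i p f g E) (s' : PartialLift U i p f g E') : Prop :=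
  ∃ h : E ⟶ E', h ≫ s'.ι = s.ι ∧ h ≫ s'.l = s.l

lemma Extends.refl {E : 𝓓} (s : PartialLift U i p f g E) : s.Extends s := ⟨𝟙 _, by simp, by simp⟩

lemma Extends.trans {E E' E'' : 𝓓} {s : PartialLift U i p f g E} {s' : PartialLift U i p f g E'}
    {s'' : PartialLift U i p f g E''} (h : s.Extends s') (h' : s'.Extends s'') : s.Extends s'' := by
  obtain ⟨a, ha, ha'⟩ := h
  obtain ⟨b, hb, hb'⟩ := h'
  exact ⟨a ≫ b, by rw [Category.assoc, hb, ha], by rw [Category.assoc, hb', ha']⟩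

/-- A partial solution which is not defined on `B` can be extended, by a small subobject. -/
lemma exists_extends (hU : IsCoalgebraic U) {κ : Cardinal.{u + 1}} (hκ : IsLargeFor U κ)
    (hp : (smallMonos U κ).rlp p) {E : 𝓓} (s : PartialLift U i p f g E) (x : El (U.obj B)) :
    ∃ (E' : 𝓓) (s' : PartialLift U i p f g E'), s.Extends s' ∧
      x ∈ Set.range (El.map (U.map s'.ι)) := by
  obtain ⟨D, C', d, c, t, hd, hc, sq, ht, hx, -, hr⟩ := hU.exists_small_square hκ s.ι
    (HasClub.of_forall (P := fun _ => True) hκ.pos fun _ => trivial) {x} (hκ.singleton_lt x)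
  have := hc.mono
  have := hU.hasColimits
  have := hU.preservesColimits
  have : HasColimitsOfSize.{0, 0} 𝓓 := hasColimitsOfSizeShrink.{0, 0, u + 1, u + 1} 𝓓
  have : PreservesColimitsOfSize.{0, 0} U := preservesColimitsOfSize_shrink.{0, u + 1, 0, u + 1} U
  have := hp _ ht
  have sq' : CommSq (d ≫ s.l) t p (c ≫ g) :=
    ⟨by rw [Category.assoc, s.l_p, reassoc_of% sq]⟩
  have hpo := IsPushout.of_hasPushout d t
  let ι' := hpo.desc s.ι c sq.symm
  let l' := hpo.desc s.l sq'.lift sq'.fac_left.symm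
  have h1 : pushout.inl d t ≫ ι' = s.ι := hpo.inl_desc _ _ _
  have h2 : pushout.inr d t ≫ ι' = c := hpo.inr_desc _ _ _
  have h3 : pushout.inl d t ≫ l' = s.l := hpo.inl_desc _ _ _
  have h4 : pushout.inr d t ≫ l' = sq'.lift := hpo.inr_desc _ _ _
  have hmono : Mono (U.map ι') := by
    refine (mono_iff_app_injective _).2 fun V n => (injective_iff_map_eq_zero _).2 fun y hy => ?_
    have hpo' := ((hpo.map U).map ((evaluation _ _).obj V)).map ((evaluation _ _).obj n)
    obtain ⟨y₁, y₂, rfl⟩ := exists_of_isPushout hpo' y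
    rw [map_add] at hy
    have h1' : ((U.map ι').app V).app n (((U.map (pushout.inl d t)).app V).app n y₁) =
        ((U.map s.ι).app V).app n y₁ := by
      rw [← h1, CategoryTheory.Functor.map_comp]; rfl
    have h2' : ((U.map ι').app V).app n (((U.map (pushout.inr d t)).app V).app n y₂) =
        ((U.map c).app V).app n y₂ := by
      rw [← h2, CategoryTheory.Functor.map_comp]; rfl
    have hy' : ((U.map s.ι).app V).app n y₁ + ((U.map c).app V).app n y₂ = 0 := by
      rw [← h1', ← h2']; exact hy
    have hy₁ : El.mk y₁ ∈ Set.range (El.map (U.map d)) := by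
      rw [hr]
      refine ⟨El.mk (-y₂), El.mk_inj.2 ?_⟩
      rw [map_neg]
      exact (eq_neg_of_add_eq_zero_left hy').symm
    rw [← Sub.set_range] at hy₁
    obtain ⟨z, hz⟩ := hy₁
    have hz : ((U.map d).app V).app n z = y₁ := hz
    have hz2 : ((U.map t).app V).app n z = - y₂ := by
      refine (mono_iff_app_injective _).1 hc.mono V n ?_
      rw [map_neg, ← eq_neg_of_add_eq_zero_left hy', ← hz]
      have := congr(((U.map $sq).app V).app n z)
      rw [CategoryTheory.Functor.map_comp, CategoryTheory.Functor.map_comp] at this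
      exact this
    have hw : ((U.map (pushout.inl d t)).app V).app n (((U.map d).app V).app n z) =
        ((U.map (pushout.inr d t)).app V).app n (((U.map t).app V).app n z) := by
      have := congr(((U.map $(hpo.w)).app V).app n z)
      rw [CategoryTheory.Functor.map_comp, CategoryTheory.Functor.map_comp] at this
      exact this
    rw [hz, hz2, map_neg] at hw
    exact add_eq_zero_iff_eq_neg.2 hw
  refine ⟨_, ⟨ι', s.a ≫ pushout.inl d t, l', hmono, by rw [Category.assoc, h1, s.a_ι],
    by rw [Category.assoc, h3, s.a_l], hpo.hom_ext ?_ ?_⟩, ⟨pushout.inl d t, h1, h3⟩, ?_⟩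
  · rw [reassoc_of% h1, reassoc_of% h3, s.l_p]
  · rw [reassoc_of% h2, reassoc_of% h4, sq'.fac_right]
  · obtain ⟨y, hy⟩ := hx rfl
    refine ⟨El.map (U.map (pushout.inr d t)) y, ?_⟩
    rw [← El.map_comp, ← CategoryTheory.Functor.map_comp]
    change El.map (U.map (pushout.inr d t ≫ ι')) y = x
    rw [h2, hy]

/-- A chain of partial solutions has an upper bound, defined on the colimit. -/
lemma exists_forall_extends (hU : IsCoalgebraic U) {J : Type (u + 1)} [Nonempty J] (E : J → 𝓓)
    (s : ∀ j, PartialLift U i p f g (E j))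
    (hs : ∀ j k, (s j).Extends (s k) ∨ (s k).Extends (s j)) :
    ∃ (E' : 𝓓) (s' : PartialLift U i p f g E'), ∀ j, (s j).Extends s' := by
  have := hU.hasColimits
  have := hU.preservesColimits
  have hm (j) : Mono (s j).ι := hU.mono_of_mono_map _
  let _ : Preorder J :=
    { le j k := (s j).Extends (s k)
      le_refl j := .refl _
      le_trans _ _ _ := .trans }
  have : IsDirectedOrder J := ⟨fun j k => (hs j k).elim (fun h => ⟨k, h, .refl _⟩)
    fun h => ⟨j, .refl _, h⟩⟩
  choose φ hφ hφ' using fun (j k : J) (h : j ≤ k) => h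
  let F : J ⥤ 𝓓 :=
    { obj := E
      map {j k} h := φ j k h.le
      map_id j := by rw [← cancel_mono (s j).ι, hφ, Category.id_comp]
      map_comp {j k l} h h' := by
        rw [← cancel_mono (s l).ι, Category.assoc, hφ, hφ, hφ] }
  let cι : Cocone F := ⟨B, { app j := (s j).ι, naturality j k h := by simp [F, hφ] }⟩
  let cl : Cocone F := ⟨X, { app j := (s j).l, naturality j k h := by simp [F, hφ'] }⟩
  let j₀ : J := Classical.arbitrary J
  have h1 (j) : colimit.ι F j ≫ colimit.desc F cι = (s j).ι := colimit.ι_desc cι j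
  have h2 (j) : colimit.ι F j ≫ colimit.desc F cl = (s j).l := colimit.ι_desc cl j
  have hmono : Mono (U.map (colimit.desc F cι)) := by
    refine (mono_iff_app_injective _).2 fun V n => ?_
    let G : 𝓓 ⥤ SimplexCategoryᵒᵖ ⥤ ModuleCat R := U ⋙ (evaluation _ _).obj V
    have := IsFiltered.isConnected J
    have hc := isColimitOfPreserves G (colimit.isColimit F)
    have hc' : IsColimit (constCocone J (G.obj B)) := isColimitConstCocone _ _
    let α : F ⋙ G ⟶ (Functor.const J).obj (G.obj B) :=
      { app j := G.map (s j).ι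
        naturality j k h := (G.map_comp _ _).symm.trans
          ((congrArg G.map (hφ j k h.le)).trans (Category.comp_id _).symm) }
    exact injective_of_isColimit hc hc' (α := α)
      (f := G.map (colimit.desc F cι))
      (fun j => (G.map_comp _ _).symm.trans
        ((congrArg G.map (h1 j)).trans (Category.comp_id _).symm))
      (fun j n => (mono_iff_app_injective _).1 (s j).mono V n) n
  refine ⟨colimit F, ⟨colimit.desc F cι, (s j₀).a ≫ colimit.ι F j₀, colimit.desc F cl, hmono, ?_,
    ?_, ?_⟩, fun j => ⟨colimit.ι F j, h1 j, h2 j⟩⟩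
  · rw [Category.assoc, h1, (s j₀).a_ι]
  · rw [Category.assoc, h2, (s j₀).a_l]
  · exact colimit.hom_ext fun j => by rw [reassoc_of% h1 j, reassoc_of% h2 j, (s j).l_p]

end PartialLift

/-- The right lifting property with respect to all monomorphisms follows from the one with respect
to small monomorphisms: by Zorn's lemma there is a maximal partial solution of a given lifting
problem. -/
lemma IsCoalgebraic.rlp_smallMonos {U : 𝓓 ⥤ SMod R C} (hU : IsCoalgebraic U)
    {κ : Cardinal.{u + 1}} (hκ : IsLargeFor U κ) : (smallMonos U κ).rlp = (monos U).rlp := by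
  refine le_antisymm ?_ (MorphismProperty.antitone_rlp fun X Y f hf => hf.2.2)
  intro X Y p hp A B i (hi : Mono (U.map i))
  refine ⟨fun {f g} sq => ?_⟩
  -- the partial solutions form a small set up to isomorphism
  have := hU.essentiallySmall (Order.succ #(El (U.obj B)))
  obtain ⟨Q, _, -, hQ⟩ := ObjectProperty.EssentiallySmall.exists_small_le.{u + 1}
    (fun D : 𝓓 => #(El (U.obj D)) < Order.succ #(El (U.obj B)))
  have hrep {E : 𝓓} (s : PartialLift U i p f g E) : ∃ (E' : Subtype Q)
      (s' : PartialLift U i p f g E'.1), s.Extends s' := by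
    obtain ⟨E', hE', ⟨e⟩⟩ := hQ E (Order.lt_succ_iff.2 (mk_le_of_injective
      (El.map_injective (U.map s.ι))))
    exact ⟨⟨E', hE'⟩, ⟨e.inv ≫ s.ι, s.a ≫ e.hom, e.inv ≫ s.l, by
      rw [CategoryTheory.Functor.map_comp]; infer_instance, by simp [s.a_ι], by simp [s.a_l], by
      simp [s.l_p]⟩, e.hom, by simp, by simp⟩
  let T := Σ E : Subtype Q, PartialLift U i p f g E.1
  have : Small.{u + 1} T := by
    have (E : 𝓓) : Small.{u + 1} (PartialLift U i p f g E) :=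
      small_of_injective (f := fun s : PartialLift U i p f g E => (s.ι, s.a, s.l)) (by
        rintro ⟨⟩ ⟨⟩ h
        simp only [Prod.mk.injEq] at h
        obtain ⟨rfl, rfl, rfl⟩ := h
        rfl)
    infer_instance
  let e := equivShrink.{u + 1} T
  let r (x : Shrink.{u + 1} T) := (e.symm x).2
  let _ : Preorder (Shrink.{u + 1} T) :=
    { le x y := (r x).Extends (r y)
      le_refl x := .refl _
      le_trans _ _ _ := .trans }
  have hr {E : 𝓓} (s : PartialLift U i p f g E) : ∃ x, s.Extends (r x) := by
    obtain ⟨E', s', h⟩ := hrep s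
    refine ⟨e ⟨E', s'⟩, ?_⟩
    dsimp only [r]
    rw [Equiv.symm_apply_apply]
    exact h
  have s₀ : PartialLift U i p f g A := ⟨i, 𝟙 A, f, hi, by simp, by simp, sq.w⟩
  obtain ⟨m, hm⟩ := zorn_le (α := Shrink.{u + 1} T) fun c hc => by
    obtain rfl | hne := c.eq_empty_or_nonempty
    · exact ⟨(hr s₀).choose, by simp [upperBounds]⟩
    have := hne.to_subtype
    obtain ⟨E', s', hs'⟩ := PartialLift.exists_forall_extends hU (J := c) _ (fun x => r x.1)
      (fun j k => hc.total j.2 k.2)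
    obtain ⟨x, hx⟩ := hr s'
    exact ⟨x, fun y hy => (hs' ⟨y, hy⟩).trans hx⟩
  have hιm : IsIso (U.map (r m).ι) := isIso_of_app_bijective _ fun x => by
    obtain ⟨E', s', h, y, hy⟩ := (r m).exists_extends hU hκ hp x
    obtain ⟨z, hz⟩ := hr s'
    obtain ⟨a, ha, -⟩ := hz.trans (hm (h.trans hz))
    exact ⟨El.map (U.map a) y, by
      rw [← El.map_comp, ← CategoryTheory.Functor.map_comp, ha, hy]⟩
  have := hU.reflectsIsomorphisms
  have : IsIso (r m).ι := isIso_of_reflects_iso _ U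
  refine ⟨⟨⟨inv (r m).ι ≫ (r m).l, ?_, ?_⟩⟩⟩
  · have h := (r m).a_ι =≫ (inv (r m).ι ≫ (r m).l)
    rw [← h, Category.assoc, IsIso.hom_inv_id_assoc, (r m).a_l]
  · simp [(r m).l_p]

end
end

section
open Cardinal

/-! ### Model structures from generating classes -/

section

variable {𝓒 : Type u} [Category.{v} 𝓒]

/-- By the small object argument, the morphisms in `I.rlp.llp` are retracts of transfinite
compositions of pushouts of coproducts of morphisms in `I`. -/
lemma IsWeaklySaturated.llp_rlp_le {I P : MorphismProperty 𝓒}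
    [MorphismProperty.HasSmallObjectArgument.{w} I] (hP : IsWeaklySaturated.{w} P) (h : I ≤ P) :
    I.rlp.llp ≤ P := by
  obtain ⟨_, _, _, _⟩ := hP
  rw [MorphismProperty.llp_rlp_of_hasSmallObjectArgument]
  refine (MorphismProperty.retracts_monotone ?_).trans P.retracts_le
  rw [MorphismProperty.transfiniteCompositions_le_iff, MorphismProperty.pushouts_le_iff,
    MorphismProperty.coproducts_le_iff]
  exact h

lemma isGeneratedBy_llp_rlp (I : MorphismProperty 𝓒)
    [MorphismProperty.HasSmallObjectArgument.{w} I] : IsGeneratedBy.{w} I I.rlp.llp where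
  isWeaklySaturated := .llp _
  le := I.le_llp_rlp
  minimal _ hQ h := hQ.llp_rlp_le h

/-- Recognition of cofibrantly generated model structures. -/
theorem exists_modelCategory_of_generators [HasFiniteLimits 𝓒] [HasFiniteColimits 𝓒]
    (I J W : MorphismProperty 𝓒) [MorphismProperty.HasSmallObjectArgument.{w} I]
    [MorphismProperty.HasSmallObjectArgument.{w} J] [W.HasTwoOutOfThreeProperty]
    (hI : I.rlp ≤ W) (hIJ : J ≤ I.rlp.llp) (hJ : J.rlp.llp ≤ W) (hJI : J.rlp ⊓ W ≤ I.rlp) :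
    ∃ _ : ModelCategory 𝓒, cofibrations 𝓒 = I.rlp.llp ∧ weakEquivalences 𝓒 = W ∧
      IsCofibrantlyGenerated.{w} 𝓒 := by
  have hIJ' : I.rlp ≤ J.rlp := (J.le_llp_iff_le_rlp _).1 hIJ
  let _ : CategoryWithCofibrations 𝓒 := ⟨I.rlp.llp⟩
  let _ : CategoryWithFibrations 𝓒 := ⟨J.rlp⟩
  let _ : CategoryWithWeakEquivalences 𝓒 := ⟨W⟩
  have hW : weakEquivalences 𝓒 = W := rfl
  have hc : cofibrations 𝓒 = I.rlp.llp := rfl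
  have hf : fibrations 𝓒 = J.rlp := rfl
  have htf : trivialFibrations 𝓒 = I.rlp := le_antisymm hJI fun _ _ p hp => ⟨hIJ' _ hp, hI _ hp⟩
  have htc : trivialCofibrations 𝓒 = J.rlp.llp := by
    refine le_antisymm ?_ fun _ _ i hi => ⟨MorphismProperty.antitone_llp hIJ' _ hi, hJ _ hi⟩
    rintro A B i ⟨hi, hi'⟩
    have h := MorphismProperty.factorizationData J.rlp.llp J.rlp i
    have hp : I.rlp h.p := hJI _ ⟨h.hp, MorphismProperty.of_precomp W _ _ (hJ _ h.hi)
      (by rw [h.fac]; exact hi')⟩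
    have := hi _ hp
    exact MorphismProperty.of_retract (RetractArrow.ofLeftLiftingProperty h.fac) h.hi
  have : (weakEquivalences 𝓒).HasTwoOutOfThreeProperty := by rwa [hW]
  have : MorphismProperty.IsWeakFactorizationSystem (cofibrations 𝓒) (trivialFibrations 𝓒) := by
    rw [hc, htf]
    exact ⟨I.rlp_llp_rlp, rfl, inferInstance⟩
  have : MorphismProperty.IsWeakFactorizationSystem (trivialCofibrations 𝓒) (fibrations 𝓒) := by
    rw [hf, htc]
    exact ⟨J.rlp_llp_rlp, rfl, inferInstance⟩
  let M : ModelCategory 𝓒 := ModelCategory.mk' 𝓒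
  refine ⟨M, hc, hW, I, J, inferInstance, inferInstance, hc ▸ isGeneratedBy_llp_rlp I, ?_⟩
  have : trivialCofibrations 𝓒 = J.rlp.llp := htc
  rw [this]
  exact isGeneratedBy_llp_rlp J

/-- The morphisms in `V` between objects in `Q`. -/
def between (Q : ObjectProperty 𝓒) (V : MorphismProperty 𝓒) : MorphismProperty 𝓒 :=
  fun X Y f => Q X ∧ Q Y ∧ V f

instance isSmall_between [LocallySmall.{w} 𝓒] (Q : ObjectProperty 𝓒) [ObjectProperty.Small.{w} Q]
    (V : MorphismProperty 𝓒) : MorphismProperty.IsSmall.{w} (between Q V) where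
  small_toSet := by
    have (X Y : 𝓒) : Small.{w} (X ⟶ Y) := LocallySmall.hom_small X Y
    refine small_of_injective (β := Σ X Y : Subtype Q, (X.1 ⟶ Y.1))
      (f := fun f => ⟨⟨_, f.2.1⟩, ⟨_, f.2.2.1⟩, f.1.hom⟩) ?_
    rintro ⟨⟨X, Y, f⟩, hf⟩ ⟨⟨X', Y', f'⟩, hf'⟩ h
    simp only [Sigma.mk.injEq, Subtype.mk.injEq] at h
    obtain ⟨hX, h⟩ := h
    have hX : X = X' := hX
    subst hX
    simp only [heq_eq_eq, Sigma.mk.injEq, Subtype.mk.injEq] at h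
    obtain ⟨hY, h⟩ := h
    have hY : Y = Y' := hY
    subst hY
    obtain rfl : f = f' := eq_of_heq h
    rfl

/-- Replacing a class of objects by a set of representatives of its isomorphism classes does not
change the lifting property. -/
lemma rlp_between {Q Q' : ObjectProperty 𝓒} (h : Q ≤ Q') (h' : Q' ≤ Q.isoClosure)
    (V : MorphismProperty 𝓒) [V.RespectsIso] : (between Q V).rlp = (between Q' V).rlp := by
  refine le_antisymm ?_ (MorphismProperty.antitone_rlp fun X Y f hf => ⟨h _ hf.1, h _ hf.2.1, hf.2.2⟩)
  rw [← MorphismProperty.le_llp_iff_le_rlp]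
  rintro X Y f ⟨hX, hY, hf⟩
  obtain ⟨X', hX', ⟨a⟩⟩ := h' X hX
  obtain ⟨Y', hY', ⟨b⟩⟩ := h' Y hY
  have : f = a.hom ≫ (a.inv ≫ f ≫ b.hom) ≫ b.inv := by simp
  rw [this, MorphismProperty.cancel_left_of_respectsIso (P := (between Q V).rlp.llp),
    MorphismProperty.cancel_right_of_respectsIso (P := (between Q V).rlp.llp)]
  refine MorphismProperty.le_llp_rlp _ _ ⟨hX', hY', ?_⟩
  rwa [MorphismProperty.cancel_left_of_respectsIso (P := V),
    MorphismProperty.cancel_right_of_respectsIso (P := V)]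

end

/-! ### Local presentability -/

section

variable {R : Type (u + 1)} [CommRing R] {C : Type (u + 1)} [Category.{u} C]
  {𝓓 : Type (u + 2)} [Category.{u + 1} 𝓓]

lemma exists_forall_isCardinalPresentable (Q : ObjectProperty 𝓓)
    [ObjectProperty.Small.{u + 1} Q] (h : ∀ X, Q X → IsPresentable.{u + 1} X) :
    ∃ κ₀ : Cardinal.{u + 1}, ∀ (κ : Cardinal.{u + 1}) [Fact κ.IsRegular], κ₀ ≤ κ →
      Q ≤ isCardinalPresentable 𝓓 κ := by
  choose μ hμ hμ' using fun X : Subtype Q => (h X.1 X.2).exists_cardinal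
  have : BddAbove (Set.range μ) := bddAbove_of_small
  refine ⟨⨆ X, μ X, fun κ _ hκ X hX => ?_⟩
  have := hμ ⟨X, hX⟩
  have : IsCardinalPresentable X (μ ⟨X, hX⟩) := hμ' ⟨X, hX⟩
  exact isCardinalPresentable_of_le X ((le_ciSup ‹BddAbove _› ⟨X, hX⟩).trans hκ)

lemma exists_isRegular_ge (κ₀ : Cardinal.{w}) : ∃ κ : Cardinal.{w}, κ.IsRegular ∧ κ₀ ≤ κ :=
  ⟨Order.succ (max κ₀ ℵ₀), isRegular_succ (le_max_right _ _),
    (le_max_left _ _).trans (Order.le_succ _)⟩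

/-- If all objects are presentable, then the small object argument applies to any set of
morphisms. -/
lemma hasSmallObjectArgument_of_isSmall [HasColimitsOfSize.{u + 1, u + 1} 𝓓]
    (h : ∀ X : 𝓓, IsPresentable.{u + 1} X) (I : MorphismProperty 𝓓)
    [MorphismProperty.IsSmall.{u + 1} I] : MorphismProperty.HasSmallObjectArgument.{u + 1} I := by
  obtain ⟨κ₀, hκ₀⟩ := exists_forall_isCardinalPresentable
    (.ofObj fun f : I.toSet => f.1.left) fun X _ => h X
  obtain ⟨κ, hκ, hκ'⟩ := exists_isRegular_ge κ₀
  have : Fact κ.IsRegular := ⟨hκ⟩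
  have : Nonempty κ.ord.ToType := by simpa using hκ.ne_zero
  have := WellFoundedLT.toOrderBot κ.ord.ToType
  have : HasColimitsOfSize.{0, 0} 𝓓 := hasColimitsOfSizeShrink.{0, 0, u + 1, u + 1} 𝓓
  refine ⟨κ, inferInstance, inferInstance, { preservesColimit := fun {A B X Y} i hi f hf => ?_ }⟩
  have : IsCardinalPresentable A κ := hκ₀ κ hκ' A ⟨(⟨Arrow.mk i, hi⟩ : I.toSet)⟩
  have := preservesColimitsOfShape_of_isCardinalPresentable A κ κ.ord.ToType
  infer_instance

namespace IsCoalgebraic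

variable {U : 𝓓 ⥤ SMod R C} (hU : IsCoalgebraic U)

include hU

instance : (monos U).RespectsIso := inferInstance

lemma hasSmallObjectArgument (I : MorphismProperty 𝓓) [MorphismProperty.IsSmall.{u + 1} I] :
    MorphismProperty.HasSmallObjectArgument.{u + 1} I :=
  have := hU.hasColimits
  hasSmallObjectArgument_of_isSmall hU.isPresentable I

lemma mono_map_initial [HasInitial 𝓓] (Y : 𝓓) : Mono (U.map (initial.to Y)) := by
  have := hU.preservesColimits
  have : PreservesColimitsOfSize.{0, 0} U := preservesColimitsOfSize_shrink.{0, u + 1, 0, u + 1} U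
  have hI : IsInitial (U.obj (⊥_ 𝓓)) := initialIsInitial.isInitialObj U
  have h0 : 𝟙 (U.obj (⊥_ 𝓓)) = 0 := hI.hom_ext _ _
  exact ⟨fun f g _ => by rw [← Category.comp_id f, ← Category.comp_id g, h0, comp_zero, comp_zero]⟩

/-- The small objects form a strong generator: a monomorphism through which all morphisms from
small objects factor has the right lifting property with respect to small monomorphisms, hence
with respect to all monomorphisms, and is a split epimorphism. -/
lemma isStrongGenerator {κ : Cardinal.{u + 1}} (hκ : IsLargeFor U κ) {Q : ObjectProperty 𝓓}
    (hQ : (fun D => #(El (U.obj D)) < κ) ≤ Q.isoClosure) : Q.IsStrongGenerator := by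
  have := hU.faithful
  have := hU.hasColimits
  have : HasColimitsOfSize.{0, 0} 𝓓 := hasColimitsOfSizeShrink.{0, 0, u + 1, u + 1} 𝓓
  refine ObjectProperty.isStrongGenerator_iff.2 ⟨fun X Y f g hfg => U.map_injective ?_,
    fun X Y i _ hi => ?_⟩
  · refine NatTrans.ext (funext fun V => NatTrans.ext (funext fun n => ?_))
    refine ModuleCat.hom_ext (LinearMap.ext fun x => ?_)
    obtain ⟨S, ⟨E, e, rfl, he⟩, hx, hE⟩ := (hκ.hasClub X).exists_superset hκ.isRegular
      hκ.aleph0_lt {El.mk x} (hκ.singleton_lt _)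
    have := he.mono
    rw [mk_range_eq _ (El.map_injective (U.map e))] at hE
    obtain ⟨E', hE', ⟨a⟩⟩ := hQ E hE
    have h1 : e ≫ f = e ≫ g := by
      rw [← cancel_epi a.inv]
      simpa using hfg E' hE' (a.inv ≫ e)
    have hx : El.mk x ∈ Set.range (El.map (U.map e)) := hx rfl
    rw [← Sub.set_range] at hx
    obtain ⟨y, hy⟩ := hx
    have hy : ((U.map e).app V).app n y = x := hy
    rw [← hy]
    have := congr(((U.map $h1).app V).app n y)
    rw [CategoryTheory.Functor.map_comp, CategoryTheory.Functor.map_comp] at this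
    exact this
  · have hp : (smallMonos U κ).rlp i := fun K L s hs => ⟨fun {f g} sq => by
      obtain ⟨L', hL', ⟨a⟩⟩ := hQ L hs.2.1
      obtain ⟨l, hl⟩ := hi L' hL' (a.inv ≫ g)
      have hl : l ≫ i = a.inv ≫ g := hl
      have hl' : (a.hom ≫ l) ≫ i = g := by rw [Category.assoc, hl, a.hom_inv_id_assoc]
      exact ⟨⟨⟨a.hom ≫ l, by rw [← cancel_mono i, Category.assoc, hl', sq.w], hl'⟩⟩⟩⟩
    rw [hU.rlp_smallMonos hκ] at hp
    have := hp _ (hU.mono_map_initial Y)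
    have sq : CommSq (initial.to X) (initial.to Y) i (𝟙 Y) := ⟨initial.hom_ext _ _⟩
    have : IsSplitEpi i := ⟨⟨⟨sq.lift, sq.fac_right⟩⟩⟩
    exact isIso_of_mono_of_isSplitEpi i

/-- A small strong generator. -/
lemma exists_isStrongGenerator : ∃ (Q : ObjectProperty 𝓓) (_ : ObjectProperty.Small.{u + 1} Q),
    Q.IsStrongGenerator := by
  obtain ⟨κ₀, hκ₀⟩ := hU.exists_isLargeFor
  obtain ⟨κ, hκ, hκ'⟩ := exists_isRegular_ge κ₀
  have := hU.essentiallySmall κ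
  obtain ⟨Q, hQ, -, hQ'⟩ := ObjectProperty.EssentiallySmall.exists_small_le.{u + 1}
    (fun D : 𝓓 => #(El (U.obj D)) < κ)
  exact ⟨Q, hQ, hU.isStrongGenerator (hκ₀ κ hκ hκ') hQ'⟩

lemma hasLimits : HasLimitsOfSize.{u + 1, u + 1} 𝓓 := by
  obtain ⟨Q, _, hQ⟩ := hU.exists_isStrongGenerator
  have := hU.hasColimits
  have := hU.wellPowered_op
  exact hasLimits_of_hasColimits_of_isSeparating hQ.1

/-- The special adjoint functor theorem. -/
lemma isLeftAdjoint {𝓔 : Type*} [Category.{u + 1} 𝓔] (F : 𝓓 ⥤ 𝓔)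
    [PreservesColimitsOfSize.{u + 1, u + 1} F] : F.IsLeftAdjoint := by
  obtain ⟨Q, _, hQ⟩ := hU.exists_isStrongGenerator
  have := hU.hasColimits
  have := hU.wellPowered_op
  exact isLeftAdjoint_of_preservesColimits_of_isSeparating hQ.1 F

lemma exists_isCardinalLocallyPresentable : ∃ κ₀ : Cardinal.{u + 1},
    ∀ (κ : Cardinal.{u + 1}) [Fact κ.IsRegular], κ₀ ≤ κ → IsCardinalLocallyPresentable 𝓓 κ := by
  obtain ⟨Q, _, hQ⟩ := hU.exists_isStrongGenerator
  obtain ⟨κ₀, hκ₀⟩ := exists_forall_isCardinalPresentable Q fun X _ => hU.isPresentable X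
  have := hU.hasColimits
  exact ⟨κ₀, fun κ _ hκ => (IsCardinalLocallyPresentable.iff_exists_isStrongGenerator 𝓓 κ).2
    ⟨Q, inferInstance, hQ, hκ₀ κ hκ⟩⟩

/-- A small generating class of the class of monomorphisms. -/
lemma exists_generator : ∃ (Q : ObjectProperty 𝓓) (_ : ObjectProperty.Small.{u + 1} Q),
    (between Q (monos U)).rlp = (monos U).rlp := by
  obtain ⟨κ₀, hκ₀⟩ := hU.exists_isLargeFor
  obtain ⟨κ, hκ, hκ'⟩ := exists_isRegular_ge κ₀
  have := hU.essentiallySmall κ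
  obtain ⟨Q, hQ, hQ₁, hQ₂⟩ := ObjectProperty.EssentiallySmall.exists_small_le.{u + 1}
    (fun D : 𝓓 => #(El (U.obj D)) < κ)
  exact ⟨Q, hQ, (rlp_between hQ₁ hQ₂ _).trans (hU.rlp_smallMonos (hκ₀ κ hκ hκ'))⟩

lemma isWeaklySaturated_monos : IsWeaklySaturated.{u + 1} (monos U) :=
  have := hU.preservesColimits
  isWeaklySaturated_monomorphisms.inverseImage U

lemma llp_rlp_of_rlp_eq {I : MorphismProperty 𝓓} [MorphismProperty.IsSmall.{u + 1} I]
    (hI : I ≤ monos U) (h : I.rlp = (monos U).rlp) : I.rlp.llp = monos U := by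
  have := hU.hasSmallObjectArgument I
  refine le_antisymm (hU.isWeaklySaturated_monos.llp_rlp_le hI) ?_
  rw [h]
  exact MorphismProperty.le_llp_rlp _

/-- The monomorphisms between `κ`-presentable objects generate all the monomorphisms as soon as
the objects of a fixed generating set of monomorphisms are `κ`-presentable. -/
lemma exists_isGeneratedBy_monos : ∃ κ₀ : Cardinal.{u + 1}, ∀ (κ : Cardinal.{u + 1})
    [Fact κ.IsRegular], κ₀ ≤ κ →
      ObjectProperty.EssentiallySmall.{u + 1} (isCardinalPresentable 𝓓 κ) ∧
      IsGeneratedBy.{u + 1}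
        (fun X Y f => IsCardinalPresentable X κ ∧ IsCardinalPresentable Y κ ∧ Mono (U.map f))
        (monos U) := by
  obtain ⟨Q, _, hQ⟩ := hU.exists_generator
  obtain ⟨κ₁, hκ₁⟩ := exists_forall_isCardinalPresentable Q fun X _ => hU.isPresentable X
  obtain ⟨κ₂, hκ₂⟩ := hU.exists_isCardinalLocallyPresentable
  refine ⟨max κ₁ κ₂, fun κ _ hκ => ?_⟩
  have := hκ₂ κ (le_of_max_le_right hκ)
  refine ⟨inferInstance, hU.isWeaklySaturated_monos, fun X Y f hf => hf.2.2, fun P hP h => ?_⟩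
  have := hU.hasSmallObjectArgument (between Q (monos U))
  rw [← hU.llp_rlp_of_rlp_eq (fun X Y f hf => hf.2.2) hQ]
  refine hP.llp_rlp_le fun X Y f hf => h _ ?_
  exact ⟨hκ₁ κ (le_of_max_le_left hκ) X hf.1, hκ₁ κ (le_of_max_le_left hκ) Y hf.2.1, hf.2.2⟩

end IsCoalgebraic

end
end

section
open Cardinal

/-! ### Left-induced model structures -/

section

variable {R : Type (u + 1)} [CommRing R] {C : Type (u + 1)} [Category.{u} C]
  {𝓓 : Type (u + 2)} [Category.{u + 1} 𝓓]

/-- Each object `X` has a cylinder object: there is a factorization of the codiagonal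
`X ⨿ X ⟶ X` through a monomorphism such that the inclusions of `X` are object-wise weak
equivalences. -/
def HasCylinders [HasBinaryCoproducts 𝓓] (U : 𝓓 ⥤ SMod R C) : Prop :=
  ∀ X : 𝓓, ∃ (Z : 𝓓) (i₀ i₁ : X ⟶ Z) (r : Z ⟶ X), i₀ ≫ r = 𝟙 X ∧ i₁ ≫ r = 𝟙 X ∧
    Mono (U.map (coprod.desc i₀ i₁)) ∧ objectwiseWeakEquivalences R C (U.map i₀)

lemma IsAdmissible.hasTwoOutOfThreeProperty {W : MorphismProperty (SMod R C)} (hW : IsAdmissible W)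
    (U : 𝓓 ⥤ SMod R C) : (W.inverseImage U).HasTwoOutOfThreeProperty :=
  have := hW.twoOutOfThree
  inferInstance

variable {U : 𝓓 ⥤ SMod R C} {W : MorphismProperty (SMod R C)}

lemma IsAdmissible.containsIdentities (hW : IsAdmissible W) : W.ContainsIdentities where
  id_mem M := hW.of_objectwise _ fun V n =>
    inferInstanceAs (IsIso ((homotopyGroup (ModuleCat.{u + 1} R) n).map (𝟙 (M.obj V))))

/-- A morphism `p` which has the right lifting property with respect to monomorphisms is a weak
equivalence: it has a section `s`, and `p ≫ s` is homotopic to the identity. -/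
lemma IsCoalgebraic.rlp_monos_le (hU : IsCoalgebraic U) (hW : IsAdmissible W)
    [HasBinaryCoproducts 𝓓] (hc : HasCylinders U) : (monos U).rlp ≤ W.inverseImage U := by
  intro X Y p hp
  have := hU.hasColimits
  have : HasColimitsOfSize.{0, 0} 𝓓 := hasColimitsOfSizeShrink.{0, 0, u + 1, u + 1} 𝓓
  have := hW.hasTwoOutOfThreeProperty U
  have := hW.retracts
  have := hp _ (hU.mono_map_initial Y)
  have sq : CommSq (initial.to X) (initial.to Y) p (𝟙 Y) := ⟨initial.hom_ext _ _⟩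
  let s := sq.lift
  have hs : s ≫ p = 𝟙 Y := sq.fac_right
  obtain ⟨Z, i₀, i₁, r, h₀, h₁, hm, hi⟩ := hc X
  have := hp _ hm
  have sq' : CommSq (coprod.desc (p ≫ s) (𝟙 X)) (coprod.desc i₀ i₁) p (r ≫ p) :=
    ⟨coprod.hom_ext (by rw [coprod.inl_desc_assoc, coprod.inl_desc_assoc, reassoc_of% h₀,
      Category.assoc, hs, Category.comp_id])
      (by rw [coprod.inr_desc_assoc, coprod.inr_desc_assoc, reassoc_of% h₁, Category.id_comp])⟩
  let H := sq'.lift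
  have hH₀ : i₀ ≫ H = p ≫ s := by
    have := coprod.inl ≫= sq'.fac_left
    rwa [coprod.inl_desc_assoc, coprod.inl_desc] at this
  have hH₁ : i₁ ≫ H = 𝟙 X := by
    have := coprod.inr ≫= sq'.fac_left
    rwa [coprod.inr_desc_assoc, coprod.inr_desc] at this
  have hWid : (W.inverseImage U) (𝟙 X) := by
    have := hW.containsIdentities
    exact MorphismProperty.id_mem _ X
  have hW₀ : (W.inverseImage U) i₀ := by
    have : Mono (U.map i₀) := by
      have : Mono (U.map i₀ ≫ U.map r) := by
        rw [← CategoryTheory.Functor.map_comp, h₀, CategoryTheory.Functor.map_id]; infer_instance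
      exact mono_of_mono _ (U.map r)
    exact hW.of_objectwise _ hi
  have hWr : (W.inverseImage U) r :=
    MorphismProperty.of_precomp _ i₀ _ hW₀ (by rw [h₀]; exact hWid)
  have hW₁ : (W.inverseImage U) i₁ :=
    MorphismProperty.of_postcomp _ _ r hWr (by rw [h₁]; exact hWid)
  have hWH : (W.inverseImage U) H :=
    MorphismProperty.of_precomp _ i₁ _ hW₁ (by rw [hH₁]; exact hWid)
  have hWps : (W.inverseImage U) (p ≫ s) := by
    rw [← hH₀]
    exact MorphismProperty.comp_mem _ _ _ hW₀ hWH
  have hr : RetractArrow p (p ≫ s) :=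
    { i := Arrow.homMk (𝟙 X) s
      r := Arrow.homMk (𝟙 X) p (by simp [hs])
      retract := by ext <;> simp [hs] }
  exact MorphismProperty.of_retract hr hWps

/-- Monomorphisms with the same image are isomorphic to the inclusion of a subobject. -/
lemma Sub.exists_iso {M B : SMod R C} (f : M ⟶ B) [Mono f] (N : Sub B)
    (h : Set.range (El.map f) = N.set) : ∃ e : M ≅ N.toSMod, e.hom ≫ N.ι = f := by
  have hf : N.lift f (N.mem_of_range_subset f h.subset) ≫ N.ι = f := N.lift_ι f _
  have : Mono (N.lift f (N.mem_of_range_subset f h.subset) ≫ N.ι) := by rw [hf]; infer_instance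
  have := mono_of_mono (N.lift f (N.mem_of_range_subset f h.subset)) N.ι
  have : IsIso (N.lift f (N.mem_of_range_subset f h.subset)) := isIso_of_app_bijective _ fun y => by
    have hy : El.map N.ι y ∈ Set.range (El.map f) := h ▸ y.2.2
    obtain ⟨x, hx⟩ := hy
    refine ⟨x, El.map_injective N.ι ?_⟩
    rw [← El.map_comp, hf, hx]
  exact ⟨asIso (N.lift f (N.mem_of_range_subset f h.subset)), hf⟩

/-- If `m : A ⟶ B` is a monomorphism in `W`, then each morphism from a small
monomorphism to `m` factors through a small monomorphism in `W`. -/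
lemma IsCoalgebraic.exists_factorization (hU : IsCoalgebraic U) (hW : IsAdmissible W)
    {κ : Cardinal.{u + 1}} (hκ : IsLargeFor U κ) {A B : 𝓓} (m : A ⟶ B) [Mono (U.map m)]
    (hm : HasClub κ (fun S : Set (El (U.obj B)) => ∃ N : Sub (U.obj B), N.set = S ∧
      W (N.comapHom (U.map m))))
    {K L : 𝓓} (s : K ⟶ L) (hL : #(El (U.obj L)) < κ) (f : K ⟶ A) (g : L ⟶ B)
    (sq : f ≫ m = s ≫ g) :
    ∃ (D E : 𝓓) (t : D ⟶ E) (d : D ⟶ A) (e : E ⟶ B) (f' : K ⟶ D) (g' : L ⟶ E),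
      smallMonos U κ t ∧ W (U.map t) ∧ t ≫ e = d ≫ m ∧ f' ≫ d = f ∧ g' ≫ e = g ∧
        f' ≫ t = s ≫ g' := by
  obtain ⟨D, E, d, e, t, hd, he, hte, ht, hT, ⟨N, hN, hNW⟩, hr⟩ := hU.exists_small_square hκ m hm
    (Set.range (El.map (U.map g))) (mk_range_le.trans_lt hL)
  have := hd.mono
  have := he.mono
  have := hU.mono_of_mono_map e
  obtain ⟨g', hg'⟩ := he.exists_lift g hT
  obtain ⟨f', hf'⟩ := hd.exists_lift f (by
    rw [hr]
    rintro _ ⟨x, rfl⟩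
    refine hT ⟨El.map (U.map s) x, ?_⟩
    rw [← El.map_comp, ← El.map_comp, ← CategoryTheory.Functor.map_comp,
      ← CategoryTheory.Functor.map_comp, sq])
  refine ⟨D, E, t, d, e, f', g', ht, ?_, hte, hf', hg', ?_⟩
  · obtain ⟨φ, hφ⟩ := Sub.exists_iso (U.map e) N hN.symm
    obtain ⟨ψ, hψ⟩ := Sub.exists_iso (U.map d) (N.comap (U.map m)) (by rw [hr, ← hN]; rfl)
    have := hW.retracts
    have h : ψ.hom ≫ N.comapHom (U.map m) = U.map t ≫ φ.hom := by
      rw [← cancel_mono N.ι, Category.assoc, Category.assoc, hφ, N.comapHom_ι, ← Category.assoc, hψ,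
        ← CategoryTheory.Functor.map_comp, ← CategoryTheory.Functor.map_comp, hte]
    exact (W.arrow_mk_iso_iff (Arrow.isoMk ψ φ h)).2 hNW
  · rw [← cancel_mono e, Category.assoc, hte, reassoc_of% hf', sq, Category.assoc, hg']

/-- A weak equivalence `p` which has the right lifting property with respect to small monomorphisms
in `W` also has it with respect to all monomorphisms. -/
lemma IsCoalgebraic.rlp_inf_le (hU : IsCoalgebraic U) (hW : IsAdmissible W)
    [HasBinaryCoproducts 𝓓] (hc : HasCylinders U) {κ : Cardinal.{u + 1}} (hκ : IsLargeFor U κ)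
    (hκW : ∀ ⦃A B : SMod R C⦄ (f : A ⟶ B) [Mono f], W f →
      HasClub κ (fun S : Set (El B) => ∃ N : Sub B, N.set = S ∧ W (N.comapHom f))) :
    (smallMonos U κ ⊓ W.inverseImage U).rlp ⊓ W.inverseImage U ≤ (monos U).rlp := by
  obtain ⟨Q, _, hQ⟩ := hU.exists_generator
  have : MorphismProperty.IsSmall.{u + 1} (between Q (monos U)) := isSmall_between.{u + 1} Q _
  have := hU.hasSmallObjectArgument (between Q (monos U))
  have hIc := hU.llp_rlp_of_rlp_eq (I := between Q (monos U)) (fun X Y f hf => hf.2.2) hQ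
  have := hW.hasTwoOutOfThreeProperty U
  rintro X Y p ⟨hp, hpW⟩
  rw [← hU.rlp_smallMonos hκ]
  intro K L s hs
  refine ⟨fun {f g} sq => ?_⟩
  have h := MorphismProperty.factorizationData (between Q (monos U)).rlp.llp
    (between Q (monos U)).rlp p
  have hi : Mono (U.map h.i) := hIc.le _ h.hi
  have hq : (monos U).rlp h.p := hQ ▸ h.hp
  have hiW : (W.inverseImage U) h.i := MorphismProperty.of_postcomp _ _ h.p
    (hU.rlp_monos_le hW hc _ hq) (by rw [h.fac]; exact hpW)
  have := hq s hs.2.2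
  have sq' : CommSq (f ≫ h.i) s h.p g := ⟨by rw [Category.assoc, h.fac, sq.w]⟩
  obtain ⟨D, E, t, d, e, f', g', ht, htW, hte, hf', hg', hft⟩ := hU.exists_factorization hW hκ h.i
    (hκW _ hiW) s hs.2.1 f sq'.lift sq'.fac_left.symm
  have := hp t ⟨ht, htW⟩
  have sq'' : CommSq d t p (e ≫ h.p) := ⟨by rw [reassoc_of% hte, h.fac]⟩
  refine ⟨⟨⟨g' ≫ sq''.lift, ?_, ?_⟩⟩⟩
  · rw [← reassoc_of% hft, sq''.fac_left, hf']
  · rw [Category.assoc, sq''.fac_right, reassoc_of% hg', sq'.fac_right]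

/-- A class `W` of weak equivalences which is admissible induces a model structure. -/
theorem IsCoalgebraic.exists_modelCategory (hU : IsCoalgebraic U) (hW : IsAdmissible W)
    [HasBinaryCoproducts 𝓓] (hc : HasCylinders U) :
    ∃ _ : ModelCategory 𝓓, cofibrations 𝓓 = monos U ∧ weakEquivalences 𝓓 = W.inverseImage U ∧
      IsCofibrantlyGenerated.{u + 1} 𝓓 := by
  obtain ⟨Q, _, hQ⟩ := hU.exists_generator
  have : MorphismProperty.IsSmall.{u + 1} (between Q (monos U)) := isSmall_between.{u + 1} Q _
  obtain ⟨κ₁, hκ₁⟩ := hU.exists_isLargeFor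
  obtain ⟨κ₂, hκ₂⟩ := hW.exists_hasClub
  obtain ⟨κ, hκ, hκ'⟩ := exists_isRegular_ge (max κ₁ κ₂)
  have := hU.essentiallySmall κ
  obtain ⟨Q', hQ', hQ₁, hQ₂⟩ := ObjectProperty.EssentiallySmall.exists_small_le.{u + 1}
    (fun D : 𝓓 => #(El (U.obj D)) < κ)
  have := hW.retracts
  have := hW.hasTwoOutOfThreeProperty U
  let I := between Q (monos U)
  let J := between Q' (monos U ⊓ W.inverseImage U)
  have hJ : J.rlp = (smallMonos U κ ⊓ W.inverseImage U).rlp := by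
    refine (rlp_between hQ₁ hQ₂ _).trans (congrArg _ ?_)
    ext X Y f
    exact ⟨fun h => ⟨⟨h.1, h.2.1, h.2.2.1⟩, h.2.2.2⟩, fun h => ⟨h.1.1, h.1.2.1, h.1.2.2, h.2⟩⟩
  have : MorphismProperty.HasSmallObjectArgument.{u + 1} I := hU.hasSmallObjectArgument _
  have : MorphismProperty.HasSmallObjectArgument.{u + 1} J :=
    have : MorphismProperty.IsSmall.{u + 1} J := isSmall_between.{u + 1} Q' _
    hU.hasSmallObjectArgument _
  have := hU.hasColimits
  have := hU.hasLimits
  have := hU.preservesColimits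
  have : HasColimitsOfSize.{0, 0} 𝓓 := hasColimitsOfSizeShrink.{0, 0, u + 1, u + 1} 𝓓
  have : HasLimitsOfSize.{0, 0} 𝓓 := hasLimitsOfSizeShrink.{0, 0, u + 1, u + 1} 𝓓
  have hIc : I.rlp.llp = monos U :=
    hU.llp_rlp_of_rlp_eq (I := between Q (monos U)) (fun X Y f hf => hf.2.2) hQ
  obtain ⟨M, h1, h2, h3⟩ := exists_modelCategory_of_generators I J (W.inverseImage U)
    (hQ.le.trans (hU.rlp_monos_le hW hc)) (by rw [hIc]; exact fun X Y f hf => hf.2.2.1)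
    (((hW.saturated.inverseImage U).llp_rlp_le
      (fun X Y f (hf : J f) => hf.2.2)).trans fun X Y f hf => hf.2) (by
      rw [hJ]
      exact (hU.rlp_inf_le hW hc (hκ₁ κ hκ (le_of_max_le_left hκ'))
        (hκ₂ κ hκ (le_of_max_le_right hκ'))).trans hQ.ge)
  exact ⟨M, h1.trans hIc, h2, h3⟩

end
end

section
open Cardinal Simplicial

/-! ### Lifting properties of pushout-products -/

section Leibniz

variable {𝓐 𝓑 : Type*} [Category* 𝓐] [Category* 𝓑] {F G : 𝓐 ⥤ 𝓑} (α : F ⟶ G)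

/-- The lifting property with respect to `p` of the morphism from the pushout of
`F B ⟵ F A ⟶ G A` to `G B`. -/
def PushoutProductLift {A B : 𝓐} (i : A ⟶ B) {E D : 𝓑} (p : E ⟶ D) : Prop :=
  ∀ (a : G.obj A ⟶ E) (b : F.obj B ⟶ E) (d : G.obj B ⟶ D), F.map i ≫ b = α.app A ≫ a →
    a ≫ p = G.map i ≫ d → b ≫ p = α.app B ≫ d →
      ∃ l : G.obj B ⟶ E, G.map i ≫ l = a ∧ α.app B ≫ l = b ∧ l ≫ p = d

/-- `PushoutProductLift` is a lifting property against the morphism from the pushout, whenever the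
pushout is given. -/
lemma hasLiftingProperty_iff_pushoutProductLift {A B : 𝓐} (i : A ⟶ B) {E D P : 𝓑} (p : E ⟶ D)
    {inl : F.obj B ⟶ P} {inr : G.obj A ⟶ P} (h : IsPushout (F.map i) (α.app A) inl inr)
    (j : P ⟶ G.obj B) (hl : inl ≫ j = α.app B) (hr : inr ≫ j = G.map i) :
    HasLiftingProperty j p ↔ PushoutProductLift α i p := by
  constructor
  · intro hj a b d h₁ h₂ h₃
    have sq : CommSq (h.desc b a h₁) j p d := ⟨h.hom_ext
      (by rw [h.inl_desc_assoc, reassoc_of% hl, h₃]) (by rw [h.inr_desc_assoc, reassoc_of% hr, h₂])⟩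
    refine ⟨sq.lift, ?_, ?_, sq.fac_right⟩
    · rw [← hr, Category.assoc, sq.fac_left, h.inr_desc]
    · rw [← hl, Category.assoc, sq.fac_left, h.inl_desc]
  · refine fun H => ⟨fun {f g} sq => ?_⟩
    obtain ⟨l, h₁, h₂, h₃⟩ := H (inr ≫ f) (inl ≫ f) g (by rw [h.w_assoc])
      (by rw [Category.assoc, sq.w, reassoc_of% hr]) (by rw [Category.assoc, sq.w, reassoc_of% hl])
    exact ⟨⟨⟨l, h.hom_ext (by rw [reassoc_of% hl, h₂]) (by rw [reassoc_of% hr, h₁]), h₃⟩⟩⟩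

variable {F' G' : 𝓑 ⥤ 𝓐} (adjF : F ⊣ F') (adjG : G ⊣ G') [HasPullbacks 𝓐]

/-- The morphism from `G' E` to the pullback of `F' E ⟶ F' D ⟵ G' D`. -/
def pullbackHom {E D : 𝓑} (p : E ⟶ D) :
    G'.obj E ⟶ pullback (F'.map p) ((conjugateEquiv adjG adjF α).app D) :=
  pullback.lift ((conjugateEquiv adjG adjF α).app E) (G'.map p)
    ((conjugateEquiv adjG adjF α).naturality p).symm

lemma homEquiv_app_comp {B : 𝓐} {E : 𝓑} (l : G.obj B ⟶ E) :
    adjF.homEquiv B E (α.app B ≫ l) =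
      adjG.homEquiv B E l ≫ (conjugateEquiv adjG adjF α).app E := by
  rw [adjF.homEquiv_unit, adjG.homEquiv_unit, CategoryTheory.Functor.map_comp, Category.assoc,
    (conjugateEquiv adjG adjF α).naturality, ← Category.assoc, ← Category.assoc,
    unit_conjugateEquiv]

/-- Adjointness between pushout-products and pullback-homs. -/
lemma pushoutProductLift_iff {A B : 𝓐} (i : A ⟶ B) {E D : 𝓑} (p : E ⟶ D) :
    PushoutProductLift α i p ↔ HasLiftingProperty i (pullbackHom α adjF adjG p) := by
  let q := pullbackHom α adjF adjG p
  have hq₁ : q ≫ pullback.fst _ _ = (conjugateEquiv adjG adjF α).app E := pullback.lift_fst _ _ _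
  have hq₂ : q ≫ pullback.snd _ _ = G'.map p := pullback.lift_snd _ _ _
  constructor
  · refine fun H => ⟨fun {f g} sq => ?_⟩
    have sq : f ≫ q = i ≫ g := sq.w
    obtain ⟨a, rfl⟩ := (adjG.homEquiv A E).surjective f
    obtain ⟨b, hb⟩ := (adjF.homEquiv B E).surjective (g ≫ pullback.fst _ _)
    obtain ⟨d, hd⟩ := (adjG.homEquiv B D).surjective (g ≫ pullback.snd _ _)
    obtain ⟨l, h₁, h₂, h₃⟩ := H a b d
      ((adjF.homEquiv A E).injective (by
        rw [adjF.homEquiv_naturality_left, hb, homEquiv_app_comp _ _ adjG, ← hq₁,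
          reassoc_of% sq]))
      ((adjG.homEquiv A D).injective (by
        rw [adjG.homEquiv_naturality_right, adjG.homEquiv_naturality_left, hd, ← hq₂,
          reassoc_of% sq]))
      ((adjF.homEquiv B D).injective (by
        rw [adjF.homEquiv_naturality_right, hb, homEquiv_app_comp _ _ adjG, hd, Category.assoc,
          Category.assoc, pullback.condition]))
    refine ⟨⟨⟨adjG.homEquiv B E l, ?_, ?_⟩⟩⟩
    · rw [← adjG.homEquiv_naturality_left, h₁]
    · refine pullback.hom_ext ?_ ?_
      · refine (Category.assoc _ _ _).trans ?_
        erw [hq₁]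
        rw [← homEquiv_app_comp _ adjF, h₂, hb]
      · refine (Category.assoc _ _ _).trans ?_
        erw [hq₂]
        rw [← adjG.homEquiv_naturality_right, h₃, hd]
  · intro H a b d h₁ h₂ h₃
    have w : adjF.homEquiv B E b ≫ F'.map p =
        adjG.homEquiv B D d ≫ (conjugateEquiv adjG adjF α).app D := by
      rw [← adjF.homEquiv_naturality_right, h₃, homEquiv_app_comp _ adjF adjG]
    have sq : CommSq (adjG.homEquiv A E a) i q (pullback.lift _ _ w) := ⟨by
      refine pullback.hom_ext ?_ ?_
      · rw [Category.assoc, Category.assoc, hq₁, pullback.lift_fst, ← homEquiv_app_comp _ adjF, ← h₁,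
          adjF.homEquiv_naturality_left]
      · rw [Category.assoc, Category.assoc, hq₂, pullback.lift_snd, ← adjG.homEquiv_naturality_right,
          h₂, adjG.homEquiv_naturality_left]⟩
    have : HasLiftingProperty i q := H
    refine ⟨(adjG.homEquiv B E).symm sq.lift, (adjG.homEquiv A E).injective ?_,
      (adjF.homEquiv B E).injective ?_, (adjG.homEquiv B D).injective ?_⟩
    · rw [adjG.homEquiv_naturality_left, Equiv.apply_symm_apply, sq.fac_left]
    · rw [homEquiv_app_comp _ adjF adjG, Equiv.apply_symm_apply, ← hq₁, sq.fac_right_assoc,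
        pullback.lift_fst]
    · rw [adjG.homEquiv_naturality_right, Equiv.apply_symm_apply, ← hq₂, sq.fac_right_assoc,
        pullback.lift_snd]

/-- The morphisms `i` whose pushout-products have the left lifting property with respect to a class
of morphisms are characterized by a left lifting property. -/
lemma exists_llp_iff_pushoutProductLift [F.IsLeftAdjoint] [G.IsLeftAdjoint]
    (Q : MorphismProperty 𝓑) : ∃ Q' : MorphismProperty 𝓐, ∀ ⦃A B : 𝓐⦄ (i : A ⟶ B),
      Q'.llp i ↔ ∀ ⦃E D : 𝓑⦄ (p : E ⟶ D), Q p → PushoutProductLift α i p := by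
  refine ⟨.ofHoms fun p : { p : Arrow 𝓑 // Q p.hom } => pullbackHom α (.ofIsLeftAdjoint F)
    (.ofIsLeftAdjoint G) p.1.hom, fun A B i => ⟨fun h E D p hp => ?_, ?_⟩⟩
  · rw [pushoutProductLift_iff α (.ofIsLeftAdjoint F) (.ofIsLeftAdjoint G)]
    exact h _ (MorphismProperty.ofHoms.mk (⟨Arrow.mk p, hp⟩ : { p : Arrow 𝓑 // Q p.hom }))
  · rintro h _ _ _ ⟨p⟩
    exact (pushoutProductLift_iff α _ _ i p.1.hom).1 (h p.1.hom p.2)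

end Leibniz

/-- A monomorphism of simplicial sets has a left lifting property if the inclusions of the
boundaries of the cells which it attaches have it. -/
lemma llp_of_boundary (Q : MorphismProperty SSet.{u}) {X Y : SSet.{u}} (i : X ⟶ Y) [Mono i]
    (h : ∀ d, Nonempty (SSet.relativeCellComplexOfMono.Cell i d) →
      Q.llp (SSet.boundary.{u} d).ι) : Q.llp i := by
  let c := SSet.relativeCellComplexOfMono i
  refine MorphismProperty.transfiniteCompositionsOfShape_le Q.llp ℕ _
    ⟨{ toTransfiniteCompositionOfShape := c.toTransfiniteCompositionOfShape
       map_mem := fun d hd => ?_ }⟩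
  let a := c.attachCells d hd
  refine MorphismProperty.of_isPushout a.isPushout ?_
  have : a.m = a.isColimit₁.desc (Cocone.mk _ (Discrete.natTrans
      (F := Discrete.functor fun _ => ((SSet.boundary.{u} d ) : SSet.{u}))
      (G := Discrete.functor fun _ => (Δ[d] : SSet.{u}))
      (fun _ => (SSet.boundary.{u} d).ι) ≫ a.cofan₂.ι)) :=
    a.isColimit₁.hom_ext fun ⟨j⟩ => by rw [IsColimit.fac]; exact a.hm j
  rw [this]
  exact MorphismProperty.colimitsOfShape_le _
    ⟨_, _, _, _, a.isColimit₁, a.isColimit₂, _, fun j => h d ⟨j.as⟩⟩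
end

section
open Cardinal Simplicial

/-! ### Tensor products with simplicial sets -/

variable {R : Type (u + 1)} [CommRing R] {C : Type (u + 1)} [Category.{u} C]

variable (R C) in
/-- The functor `(K, M) ↦ R[K] ⊗ M`. -/
def tens : SSet.{u + 1} ⥤ SMod R C ⥤ SMod R C := linSMod R C ⋙ curriedTensor (SMod R C)

instance (T : SMod R C) : PreservesColimitsOfSize.{u + 1, u + 1} (tensorLeft T) := by
  refine preservesColimits_of_evaluation _ fun U => preservesColimits_of_evaluation _ fun n => ?_
  exact inferInstanceAs (PreservesColimitsOfSize.{u + 1, u + 1} ((evaluation _ _).obj U ⋙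
    (evaluation _ _).obj n ⋙ tensorLeft ((T.obj U).obj n)))

instance (T : SMod R C) : PreservesColimitsOfSize.{u + 1, u + 1} (tensorRight T) := by
  refine preservesColimits_of_evaluation _ fun U => preservesColimits_of_evaluation _ fun n => ?_
  exact inferInstanceAs (PreservesColimitsOfSize.{u + 1, u + 1} ((evaluation _ _).obj U ⋙
    (evaluation _ _).obj n ⋙ tensorRight ((T.obj U).obj n)))

instance (K : SSet.{u + 1}) : PreservesColimitsOfSize.{u + 1, u + 1} ((tens R C).obj K) :=
  inferInstanceAs (PreservesColimitsOfSize.{u + 1, u + 1} (tensorLeft _))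

instance : PreservesColimitsOfSize.{u + 1, u + 1} (linCoalg R ⋙ CoCAlg.forget R) :=
  have : PreservesColimitsOfSize.{u + 1, u + 1} (ModuleCat.free.{u + 1} R) :=
    (ModuleCat.adj R).leftAdjoint_preservesColimits
  preservesColimits_of_natIso (show ModuleCat.free R ≅ linCoalg R ⋙ CoCAlg.forget R from
    NatIso.ofComponents (fun _ => Iso.refl _) (by intros; rfl))

instance (M : SMod R C) : PreservesColimitsOfSize.{u + 1, u + 1} ((tens R C).flip.obj M) := by
  refine preservesColimits_of_evaluation _ fun U => preservesColimits_of_evaluation _ fun n => ?_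
  exact inferInstanceAs (PreservesColimitsOfSize.{u + 1, u + 1} ((evaluation _ _).obj n ⋙
    (linCoalg R ⋙ CoCAlg.forget R) ⋙ tensorRight ((M.obj U).obj n)))

/-- A cocontinuous functor on simplicial sets has a right adjoint. -/
lemma isLeftAdjoint_of_sset {𝓓 : Type (u + 2)} [Category.{u + 1} 𝓓]
    [HasColimitsOfSize.{u + 1, u + 1} 𝓓] (L : SSet.{u + 1} ⥤ 𝓓)
    [PreservesColimitsOfSize.{u + 1, u + 1} L] : L.IsLeftAdjoint := by
  have : PreservesColimitsOfSize.{0, u + 1} L :=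
    preservesColimitsOfSize_shrink.{u + 1, u + 1, 0, u + 1} L
  have : HasColimitsOfSize.{0, u + 1} 𝓓 := hasColimitsOfSizeShrink.{0, u + 1, u + 1, u + 1} 𝓓
  exact Presheaf.isLeftAdjoint_of_preservesColimits.{u + 1, 0, u + 1, 0, u + 2} L

instance (M : SMod R C) : ((tens R C).flip.obj M).IsLeftAdjoint := isLeftAdjoint_of_sset _

instance (T : SMod R C) : (tensorLeft T).IsLeftAdjoint :=
  (isCoalgebraic_id R C).isLeftAdjoint _

variable (R C) in
/-- `R[Δ[0]]` is the unit of the tensor product. -/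
def linSModPoint : (linSMod R C).obj Δ[0] ≅ 𝟙_ (SMod R C) :=
  (linSMod R C).mapIso (SSet.stdSimplex.isTerminalObj₀.uniqueUpToIso
    CartesianMonoidalCategory.isTerminalTensorUnit) ≪≫
    (SCoCAlg.forget R C).mapIso (Functor.Monoidal.εIso (linSCoCAlg R C)).symm

variable (R C) in
/-- The tensor product with a point is isomorphic to the identity. -/
def tensPoint : (tens R C).obj Δ[0] ≅ 𝟭 (SMod R C) :=
  NatIso.ofComponents (fun M => whiskerRightIso (linSModPoint R C) M ≪≫ λ_ M) (fun {M N} f => by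
    change (linSMod R C).obj Δ[0] ◁ f ≫ (linSModPoint R C).hom ▷ N ≫ (λ_ N).hom =
      ((linSModPoint R C).hom ▷ M ≫ (λ_ M).hom) ≫ f
    rw [whisker_exchange_assoc, leftUnitor_naturality, Category.assoc])

/-! ### Pushout-products of monomorphisms -/

/-- `T` consists of flat modules. -/
def IsFlat (T : SMod R C) : Prop := ∀ U n, Module.Flat R ((T.obj U).obj n)

/-- The modules of which `e` consists are inclusions of direct summands. -/
def IsSplit {S T : SMod R C} (e : S ⟶ T) : Prop :=
  ∀ U n, ∃ r : (T.obj U).obj n →ₗ[R] (S.obj U).obj n, r ∘ₗ ((e.app U).app n).hom = LinearMap.id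

lemma mono_whiskerLeft_of_isFlat {T : SMod R C} (hT : IsFlat T) {M N : SMod R C} (f : M ⟶ N)
    [Mono f] : Mono (T ◁ f) := by
  rw [mono_iff_app_injective]
  intro U n
  have := hT U n
  exact Module.Flat.lTensor_preserves_injective_linearMap ((f.app U).app n).hom
    ((mono_iff_app_injective f).1 inferInstance U n)

lemma rTensor_comp_rTensor_eq_id {S T M : Type*} [AddCommGroup S] [AddCommGroup T] [AddCommGroup M]
    [Module R S] [Module R T] [Module R M] {r : T →ₗ[R] S} {e : S →ₗ[R] T}
    (h : r ∘ₗ e = LinearMap.id) (x : S ⊗[R] M) : r.rTensor M (e.rTensor M x) = x := by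
  rw [← LinearMap.comp_apply, ← LinearMap.rTensor_comp, h, LinearMap.rTensor_id,
    LinearMap.id_apply]

lemma IsSplit.mono_whiskerRight {S T : SMod R C} {e : S ⟶ T} (he : IsSplit e) (M : SMod R C) :
    Mono (e ▷ M) := by
  rw [mono_iff_app_injective]
  intro U n
  obtain ⟨r, hr⟩ := he U n
  exact Function.LeftInverse.injective (g := r.rTensor _) (rTensor_comp_rTensor_eq_id hr)

lemma IsSplit.isFlat {S T : SMod R C} {e : S ⟶ T} (he : IsSplit e) (hT : IsFlat T) : IsFlat S :=
  fun U n => by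
    obtain ⟨r, hr⟩ := he U n
    have := hT U n
    exact Module.Flat.of_retract _ _ hr

/-- The algebraic content of `IsSplit.mono_of_isPushout`: the retraction `r` of `e` separates the
two summands of an element of the pushout. -/
lemma injective_of_pushoutProduct {S T M N P : Type*} [AddCommGroup S] [AddCommGroup T]
    [AddCommGroup M] [AddCommGroup N] [AddCommGroup P] [Module R S] [Module R T] [Module R M]
    [Module R N] [Module R P] {e : S →ₗ[R] T} {r : T →ₗ[R] S} (hre : r ∘ₗ e = LinearMap.id)
    {f : M →ₗ[R] N} (hf : Function.Injective (f.lTensor T)) (inl : S ⊗[R] N →ₗ[R] P)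
    (inr : T ⊗[R] M →ₗ[R] P) (j : P →ₗ[R] T ⊗[R] N) (hl : ∀ x, j (inl x) = e.rTensor N x)
    (hr : ∀ x, j (inr x) = f.lTensor T x)
    (hw : ∀ x, inl (f.lTensor S x) = inr (e.rTensor M x)) (hs : ∀ p, ∃ x y, p = inl x + inr y) :
    Function.Injective j := by
  refine (injective_iff_map_eq_zero j).2 fun p hp => ?_
  obtain ⟨x₂, x₃, rfl⟩ := hs p
  rw [map_add, hl, hr] at hp
  -- the component in `S ⊗ N` is determined by the one in `T ⊗ M`
  have h₂ : x₂ + f.lTensor S (r.rTensor M x₃) = 0 := by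
    have := congrArg (r.rTensor N) hp
    rw [map_add, map_zero, rTensor_comp_rTensor_eq_id hre] at this
    rw [← this, ← LinearMap.comp_apply, ← LinearMap.comp_apply, LinearMap.lTensor_comp_rTensor,
      LinearMap.rTensor_comp_lTensor]
  have h₃ : x₃ = e.rTensor M (r.rTensor M x₃) := by
    refine hf ?_
    have := congrArg (e.rTensor N) h₂
    rw [map_add, map_zero, ← hp, add_right_inj] at this
    have hc (y : S ⊗[R] M) : e.rTensor N (f.lTensor S y) = f.lTensor T (e.rTensor M y) := by
      rw [← LinearMap.comp_apply, ← LinearMap.comp_apply, LinearMap.lTensor_comp_rTensor,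
        LinearMap.rTensor_comp_lTensor]
    rw [← this, hc]
  rw [h₃, ← hw, ← map_add, h₂, map_zero]

/-- The pushout-product of a levelwise split monomorphism of flat modules and of
a monomorphism is a monomorphism. -/
lemma IsSplit.mono_of_isPushout {S T : SMod R C} {e : S ⟶ T} (he : IsSplit e) (hT : IsFlat T)
    {M N P : SMod R C} {f : M ⟶ N} [Mono f] {inl : S ⊗ N ⟶ P} {inr : T ⊗ M ⟶ P}
    (h : IsPushout (S ◁ f) (e ▷ M) inl inr) (j : P ⟶ T ⊗ N) (hl : inl ≫ j = e ▷ N)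
    (hr : inr ≫ j = T ◁ f) : Mono j := by
  have hTf := (mono_iff_app_injective _).1 (mono_whiskerLeft_of_isFlat hT f)
  rw [mono_iff_app_injective]
  intro U n
  obtain ⟨r, hre⟩ := he U n
  exact injective_of_pushoutProduct hre (hTf U n) ((inl.app U).app n).hom ((inr.app U).app n).hom
    ((j.app U).app n).hom (fun x => congr((($hl).app U).app n x))
    (fun x => congr((($hr).app U).app n x)) (fun x => congr((($(h.w)).app U).app n x))
    (exists_of_isPushout ((h.map ((evaluation _ _).obj U)).map ((evaluation _ _).obj n)))

lemma isFlat_linSMod (K : SSet.{u + 1}) : IsFlat ((linSMod R C).obj K) := fun _ n =>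
  inferInstanceAs (Module.Flat R (K.obj n →₀ R))

lemma isSplit_linSMod {K L : SSet.{u + 1}} (i : K ⟶ L) [Mono i] :
    IsSplit ((linSMod R C).map i) := fun U n => by
  have hi : Function.Injective (i.app n) := by
    have := (NatTrans.mono_iff_mono_app i).1 inferInstance n
    exact (CategoryTheory.mono_iff_injective _).1 this
  refine ⟨Finsupp.lcomapDomain (i.app n) hi, Finsupp.lhom_ext' fun x => LinearMap.ext_ring ?_⟩
  exact Finsupp.comapDomain_mapDomain _ hi (Finsupp.single x 1)

/-! ### Cylinders -/

lemma isColimit_binaryCofan_exists {X Y Z : SMod R C} {a : X ⟶ Z} {b : Y ⟶ Z}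
    (h : IsColimit (BinaryCofan.mk a b)) {U : Cᵒᵖ} {n} (z : (Z.obj U).obj n) :
    ∃ x y, z = (a.app U).app n x + (b.app U).app n y := by
  obtain ⟨y, x, h⟩ := exists_of_isPushout (((IsPushout.of_isColimit_binaryCofan_of_isInitial h
    initialIsInitial).map ((evaluation _ _).obj U)).map ((evaluation _ _).obj n)) z
  exact ⟨x, y, h.trans (add_comm _ _)⟩

variable {𝓓 : Type (u + 2)} [Category.{u + 1} 𝓓]

/-- An additive map on a sum of `X` and `Y` is injective if `ρ` and `σ` recover the two components
of an element from its image. -/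
lemma injective_of_orthogonal {X Y D Z : Type*} [AddCommGroup X] [AddCommGroup Y] [AddCommGroup D]
    [AddCommGroup Z] (p : X →+ D) (q : Y →+ D) (j : D →+ Z) (hs : ∀ d, ∃ x y, d = p x + q y)
    (ρ : Z →+ X) (σ : Z →+ Y) (h₁ : ∀ x, ρ (j (p x)) = x) (h₂ : ∀ y, ρ (j (q y)) = 0)
    (h₃ : ∀ y, σ (j (q y)) = y) : Function.Injective j := by
  refine (injective_iff_map_eq_zero j).2 fun d hd => ?_
  obtain ⟨x, y, rfl⟩ := hs d
  have hx : x = 0 := by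
    have := congrArg ρ hd
    rwa [map_add, map_add, h₁, h₂, add_zero, map_zero] at this
  subst hx
  rw [map_zero, zero_add] at hd ⊢
  rw [← h₃ y, hd, map_zero, map_zero]

/-- The linear maps `R[Δ[1]] ⟶ R[Δ[0]]` which vanish on the simplices which do not belong to a
vertex of `Δ[1]`. -/
lemma exists_retraction (e : Fin 2) (n : SimplexCategoryᵒᵖ) :
    ∃ ρ : ((Δ[1] : SSet.{u + 1}).obj n →₀ R) →ₗ[R] ((Δ[0] : SSet.{u + 1}).obj n →₀ R),
      (ρ ∘ₗ Finsupp.lmapDomain R R ((SSet.stdSimplex.{u + 1}.map (SimplexCategory.δ e)).app n) =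
        LinearMap.id) ∧ ∀ e', e' ≠ e →
      ρ ∘ₗ Finsupp.lmapDomain R R ((SSet.stdSimplex.{u + 1}.map (SimplexCategory.δ e')).app n) =
        0 := by
  have hi : Function.Injective ((SSet.stdSimplex.{u + 1}.map (SimplexCategory.δ e)).app n) :=
    fun x y _ => SSet.stdSimplex.objEquiv.injective (SimplexCategory.Hom.ext _ _
      (OrderHom.ext _ _ (funext fun j => Subsingleton.elim (α := Fin 1) _ _)))
  refine ⟨Finsupp.lcomapDomain _ hi, Finsupp.lhom_ext' fun x => LinearMap.ext_ring
    (Finsupp.comapDomain_mapDomain _ hi (Finsupp.single x 1)), fun e' he =>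
    Finsupp.lhom_ext' fun x => LinearMap.ext_ring (Finsupp.ext fun y => ?_)⟩
  change Finsupp.mapDomain _ (Finsupp.single x (1 : R)) _ = 0
  rw [Finsupp.mapDomain_single, Finsupp.single_apply_eq_zero]
  intro h
  have h := congr(SSet.stdSimplex.asOrderHom $h 0)
  have key : ∀ (e e' : Fin 2) (a b : Fin 1), e' ≠ e → e.succAbove a ≠ e'.succAbove b := by decide
  exact (key e e' _ _ he h).elim

/-- If `R[Δ[1]] ⊗ U X` with the inclusions of its two ends and its projection to `U X` comes from
`𝓓`, then it is a cylinder of `X`. -/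
lemma hasCylinders_of_tens [HasBinaryCoproducts 𝓓] (U : 𝓓 ⥤ SMod R C)
    [PreservesColimitsOfSize.{u + 1, u + 1} U]
    (h : ∀ X : 𝓓, ∃ (Z : 𝓓) (i : Fin 2 → (X ⟶ Z)) (r : Z ⟶ X), (∀ e, i e ≫ r = 𝟙 X) ∧
      ∃ (φ : U.obj X ≅ ((tens R C).obj Δ[0]).obj (U.obj X))
        (ψ : ((tens R C).obj Δ[1]).obj (U.obj X) ≅ U.obj Z), ∀ e, U.map (i e) = φ.hom ≫
          ((tens R C).map (SSet.stdSimplex.{u + 1}.map (SimplexCategory.δ e))).app (U.obj X) ≫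
            ψ.hom) : HasCylinders U := by
  intro X
  have : PreservesColimitsOfSize.{0, 0} U :=
    preservesColimitsOfSize_shrink.{0, u + 1, 0, u + 1} U
  obtain ⟨Z, i, r, hr, φ, ψ, hi⟩ := h X
  refine ⟨Z, i 0, i 1, r, hr 0, hr 1, ?_, ?_⟩
  · rw [mono_iff_app_injective]
    intro V n
    have hc := isColimitOfHasBinaryCoproductOfPreservesColimit U X X
    obtain ⟨ρ, hρ, hρ'⟩ := exists_retraction (R := R) 0 n
    obtain ⟨σ, hσ, -⟩ := exists_retraction (R := R) 1 n
    have h₀ : U.map coprod.inl ≫ U.map (coprod.desc (i 0) (i 1)) = U.map (i 0) := by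
      rw [← CategoryTheory.Functor.map_comp, coprod.inl_desc]
    have h₁ : U.map coprod.inr ≫ U.map (coprod.desc (i 0) (i 1)) = U.map (i 1) := by
      rw [← CategoryTheory.Functor.map_comp, coprod.inr_desc]
    rw [hi] at h₀ h₁
    have h₀' : U.map coprod.inl ≫ U.map (coprod.desc (i 0) (i 1)) ≫ ψ.inv = φ.hom ≫
        ((tens R C).map (SSet.stdSimplex.{u + 1}.map (SimplexCategory.δ 0))).app (U.obj X) := by
      rw [reassoc_of% h₀, ψ.hom_inv_id, Category.comp_id]
    have h₁' : U.map coprod.inr ≫ U.map (coprod.desc (i 0) (i 1)) ≫ ψ.inv = φ.hom ≫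
        ((tens R C).map (SSet.stdSimplex.{u + 1}.map (SimplexCategory.δ 1))).app (U.obj X) := by
      rw [reassoc_of% h₁, ψ.hom_inv_id, Category.comp_id]
    let Y := ((U.obj X).obj V).obj n
    have hφ (x) : ((φ.inv.app V).app n).hom (((φ.hom.app V).app n).hom x) = x :=
      congr((($(φ.hom_inv_id)).app V).app n x)
    refine injective_of_orthogonal (((U.map coprod.inl).app V).app n).hom.toAddMonoidHom
      (((U.map coprod.inr).app V).app n).hom.toAddMonoidHom
      (((U.map (coprod.desc (i 0) (i 1))).app V).app n).hom.toAddMonoidHom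
      (isColimit_binaryCofan_exists hc)
      (((φ.inv.app V).app n).hom ∘ₗ ρ.rTensor Y ∘ₗ ((ψ.inv.app V).app n).hom).toAddMonoidHom
      (((φ.inv.app V).app n).hom ∘ₗ σ.rTensor Y ∘ₗ ((ψ.inv.app V).app n).hom).toAddMonoidHom
      (fun x => ?_) (fun x => ?_) (fun x => ?_)
    · refine Eq.trans ?_ (hφ x)
      refine congrArg ((φ.inv.app V).app n).hom ?_
      refine Eq.trans ?_ (rTensor_comp_rTensor_eq_id hρ _)
      exact congrArg (ρ.rTensor Y) congr((($h₀').app V).app n x)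
    · refine Eq.trans ?_ (map_zero ((φ.inv.app V).app n).hom)
      refine congrArg ((φ.inv.app V).app n).hom ?_
      refine (congrArg (ρ.rTensor Y) congr((($h₁').app V).app n x)).trans ?_
      refine (LinearMap.congr_fun (LinearMap.rTensor_comp Y ρ _).symm _).trans ?_
      refine (LinearMap.congr_fun (congrArg (LinearMap.rTensor Y) (hρ' 1 (by decide))) _).trans ?_
      exact LinearMap.congr_fun (LinearMap.rTensor_zero Y) _
    · refine Eq.trans ?_ (hφ x)
      refine congrArg ((φ.inv.app V).app n).hom ?_
      refine Eq.trans ?_ (rTensor_comp_rTensor_eq_id hσ _)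
      exact congrArg (σ.rTensor Y) congr((($h₁').app V).app n x)
  · intro V
    rw [hi]
    have h := linEquivalences_stdSimplex_map_δ (R := R) 0 ((U.obj X).obj V)
    refine MorphismProperty.comp_mem _ (φ.hom.app V) _ (fun n => inferInstance)
      (MorphismProperty.comp_mem _ _ (ψ.hom.app V) h fun n => inferInstance)

variable (R C) in
/-- The cylinder of `M` is `R[Δ[1]] ⊗ M`. -/
lemma hasCylinders_id : HasCylinders (𝟭 (SMod R C)) := by
  refine hasCylinders_of_tens _ fun M => ⟨((tens R C).obj Δ[1]).obj M, fun e =>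
    (tensPoint R C).inv.app M ≫ ((tens R C).map (SSet.stdSimplex.map (SimplexCategory.δ e))).app M,
    ((tens R C).map (SSet.stdSimplex.map (SimplexCategory.σ 0))).app M ≫
      (tensPoint R C).hom.app M, fun e => ?_, ((tensPoint R C).app M).symm, Iso.refl _,
    fun e => ?_⟩
  · have : SSet.stdSimplex.{u + 1}.map (SimplexCategory.δ e) ≫
        SSet.stdSimplex.map (SimplexCategory.σ 0) = 𝟙 _ := SSet.stdSimplex.isTerminalObj₀.hom_ext _ _
    have h : ((tens R C).map (SSet.stdSimplex.{u + 1}.map (SimplexCategory.δ e))).app M ≫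
        ((tens R C).map (SSet.stdSimplex.map (SimplexCategory.σ 0))).app M = 𝟙 _ := by
      refine (congr_app ((tens R C).map_comp _ _).symm M).trans ?_
      rw [this, CategoryTheory.Functor.map_id]
      rfl
    rw [Category.assoc, reassoc_of% h]
    exact (tensPoint R C).inv_hom_id_app M
  · rfl

variable (R C) in
/-- The cylinder of a coalgebra `G` is `Δ[1] ⊗ G`; its projection to `G` is a morphism of
coalgebras since it is induced by a map of simplicial sets. -/
lemma hasCylinders_forget [HasBinaryCoproducts (SCoCAlg R C)] :
    HasCylinders (SCoCAlg.forget R C) := by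
  have := (isCoalgebraic_forget R C).preservesColimits
  refine hasCylinders_of_tens _ fun G => ?_
  let ε : 𝟙_ SSet.{u + 1} ≅ Δ[0] := CartesianMonoidalCategory.isTerminalTensorUnit.uniqueUpToIso
    SSet.stdSimplex.isTerminalObj₀
  let a {K L : SSet.{u + 1}} (i : K ⟶ L) := MonoidalLeftActionStruct.actionHomLeft i G
  let l := MonoidalLeftActionStruct.actionUnitIso (C := SSet.{u + 1}) G
  have ha {K L L' : SSet.{u + 1}} (i : K ⟶ L) (j : L ⟶ L') : a (i ≫ j) = a i ≫ a j :=
    MonoidalLeftAction.comp_actionHomLeft i j G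
  have ha' (K : SSet.{u + 1}) : a (𝟙 K) = 𝟙 _ := MonoidalLeftAction.id_actionHomLeft K G
  let φ : G ≅ MonoidalLeftActionStruct.actionObj Δ[0] G :=
    l.symm ≪≫ ⟨a ε.hom, a ε.inv, by rw [← ha, ε.hom_inv_id, ha'], by
      rw [← ha, ε.inv_hom_id, ha']⟩
  refine ⟨MonoidalLeftActionStruct.actionObj Δ[1] G, fun e =>
    φ.hom ≫ a (SSet.stdSimplex.map (SimplexCategory.δ e)),
    a (SSet.stdSimplex.map (SimplexCategory.σ 0)) ≫ φ.inv, fun e => ?_,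
    (SCoCAlg.forget R C).mapIso φ, Iso.refl _, fun e => ?_⟩
  · have : SSet.stdSimplex.{u + 1}.map (SimplexCategory.δ e) ≫
        SSet.stdSimplex.map (SimplexCategory.σ 0) = 𝟙 _ := SSet.stdSimplex.isTerminalObj₀.hom_ext _ _
    rw [Category.assoc, ← Category.assoc (a _), ← ha, this, ha', Category.id_comp, φ.hom_inv_id]
  · rw [CategoryTheory.Functor.map_comp]
    rfl
end

section
open Cardinal Simplicial

/-! ### The pushout-product axiom -/

variable {R : Type (u + 1)} [CommRing R] {C : Type (u + 1)} [Category.{u} C]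

/-- The part of `IsAdmissible` which does not involve cardinals: the monomorphisms in `W` are
the trivial cofibrations of a localization of the object-wise weak equivalences. -/
structure IsPreadmissible (W : MorphismProperty (SMod R C)) : Prop where
  twoOutOfThree : W.HasTwoOutOfThreeProperty
  saturated : IsWeaklySaturated.{u + 1} (MorphismProperty.monomorphisms _ ⊓ W)
  of_objectwise {A B : SMod R C} (f : A ⟶ B) [Mono f] (hf : objectwiseWeakEquivalences R C f) : W f

lemma IsAdmissible.isPreadmissible {W : MorphismProperty (SMod R C)} (hW : IsAdmissible W) :
    IsPreadmissible W :=
  ⟨hW.twoOutOfThree, hW.saturated, fun f _ hf => hW.of_objectwise f hf⟩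

namespace IsPreadmissible

variable {W : MorphismProperty (SMod R C)} (hW : IsPreadmissible W)
include hW

lemma pushout {A B A' B' : SMod R C} {f : A ⟶ A'} {i : A ⟶ B} {i' : A' ⟶ B'} {f' : B ⟶ B'}
    (h : IsPushout f i i' f') (hi : Mono i) (hiW : W i) : Mono i' ∧ W i' :=
  have := hW.saturated.cobaseChange
  MorphismProperty.of_isPushout (P := MorphismProperty.monomorphisms _ ⊓ W) h ⟨hi, hiW⟩

variable {S T : SMod R C} {e : S ⟶ T} (he : IsSplit e) (hT : IsFlat T)
include he hT

/-- The pushout-product of `e` and `f` is in `W` if `S ⊗ f` and `T ⊗ f` are. -/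
lemma of_isPushout_of_right {M N P : SMod R C} {f : M ⟶ N} [Mono f] {inl : S ⊗ N ⟶ P}
    {inr : T ⊗ M ⟶ P} (h : IsPushout (S ◁ f) (e ▷ M) inl inr) (j : P ⟶ T ⊗ N)
    (hr : inr ≫ j = T ◁ f) (hS : W (S ◁ f)) (hTf : W (T ◁ f)) : W j := by
  have := hW.twoOutOfThree
  exact MorphismProperty.of_precomp _ inr _
    (hW.pushout h.flip (mono_whiskerLeft_of_isFlat (he.isFlat hT) f) hS).2 (hr ▸ hTf)

/-- The pushout-product of `e` and `f` is in `W` if `e ⊗ M` and `e ⊗ N` are. -/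
lemma of_isPushout_of_left {M N P : SMod R C} {f : M ⟶ N} {inl : S ⊗ N ⟶ P}
    {inr : T ⊗ M ⟶ P} (h : IsPushout (S ◁ f) (e ▷ M) inl inr) (j : P ⟶ T ⊗ N)
    (hl : inl ≫ j = e ▷ N) (hM : W (e ▷ M)) (hN : W (e ▷ N)) : W j := by
  have := hW.twoOutOfThree
  exact MorphismProperty.of_precomp _ inl _ (hW.pushout h (he.mono_whiskerRight M) hM).2 (hl ▸ hN)

omit he hT

lemma tens_map_app_of_linEquivalences {K L : SSet.{u + 1}} (i : K ⟶ L) [Mono i]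
    (hi : linEquivalences R i) (M : SMod R C) : W (((tens R C).map i).app M) := by
  have : Mono (((tens R C).map i).app M) := (isSplit_linSMod i).mono_whiskerRight M
  exact hW.of_objectwise _ fun U => hi (M.obj U)

lemma of_isIso {M N : SMod R C} (f : M ⟶ N) [IsIso f] : W f :=
  hW.of_objectwise f fun _ _ => inferInstance

/-- The inclusion of the vertex `k` of a simplex. -/
abbrev _root_.MotivicCoalgebra.vertex {n : ℕ} (k : Fin (n + 1)) : (Δ[0] : SSet.{w}) ⟶ Δ[n] :=
  SSet.stdSimplex.map (SimplexCategory.const ⦋0⦌ ⦋n⦌ k)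

omit hW in
lemma _root_.MotivicCoalgebra.linEquivalences_vertex {n : ℕ} (k : Fin (n + 1)) :
    linEquivalences R (vertex.{u + 1} k) := by
  refine linEquivalences_of_homologyEq _ (SSet.stdSimplex.isTerminalObj₀.from _)
    (fun Z => ?_) fun Z => ?_
  · rw [SSet.stdSimplex.isTerminalObj₀.hom_ext (vertex k ≫ _) (𝟙 _), CategoryTheory.Functor.map_id]
    exact fun _ => rfl
  · exact homologyEq_simplexConst k Z

omit hW in
instance _root_.MotivicCoalgebra.mono_vertex {n : ℕ} (k : Fin (n + 1)) :
    Mono (vertex.{w} k) := by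
  have : IsSplitMono (vertex.{w} k) := ⟨⟨SSet.stdSimplex.isTerminalObj₀.from _,
    SSet.stdSimplex.isTerminalObj₀.hom_ext _ _⟩⟩
  infer_instance

/-- The functors `R[Δ[n]] ⊗ -` preserve weak equivalences, since the vertices of `Δ[n]` induce weak
equivalences. -/
lemma tens_stdSimplex_map {M N : SMod R C} (f : M ⟶ N) (hf : W f) (n : ℕ) :
    W (((tens R C).obj Δ[n]).map f) := by
  have := hW.twoOutOfThree
  have h₀ : W (((tens R C).obj Δ[0]).map f) := by
    have h : ((tens R C).obj Δ[0]).map f =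
        ((tensPoint R C).hom.app M ≫ f) ≫ (tensPoint R C).inv.app N :=
      (Iso.eq_comp_inv ((tensPoint R C).app N)).2 ((tensPoint R C).hom.naturality f)
    rw [h, Category.assoc]
    exact MorphismProperty.comp_mem _ _ _ (hW.of_isIso _)
      (MorphismProperty.comp_mem _ _ _ hf (hW.of_isIso _))
  have hv (M : SMod R C) := hW.tens_map_app_of_linEquivalences _
    (linEquivalences_vertex (n := n) 0) M
  refine MorphismProperty.of_precomp W (((tens R C).map (vertex 0)).app M) _ (hv M) ?_
  rw [← ((tens R C).map (vertex 0)).naturality]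
  exact MorphismProperty.comp_mem _ _ _ h₀ (hv N)

end IsPreadmissible

variable {W : MorphismProperty (SMod R C)}

/-- The pushout-product with `∅ ⟶ K` is the tensor product with `R[K]`. -/
lemma hasLiftingProperty_of_pushoutProductLift {K : SSet.{u + 1}} {M N : SMod R C} {f : M ⟶ N}
    {E D : SMod R C} (p : E ⟶ D)
    (h : PushoutProductLift ((tens R C).flip.map f) (initial.to K) p) :
    HasLiftingProperty (((tens R C).obj K).map f) p := by
  have hi : IsInitial (((tens R C).flip.obj N).obj (⊥_ _)) := initialIsInitial.isInitialObj _ _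
  have hi' : IsInitial (((tens R C).flip.obj M).obj (⊥_ _)) := initialIsInitial.isInitialObj _ _
  refine ⟨fun {a d} sq => ?_⟩
  obtain ⟨l, -, h₁, h₂⟩ := h (hi.to _) a d (hi'.hom_ext _ _) (hi.hom_ext _ _) sq.w
  exact ⟨⟨⟨l, h₁, h₂⟩⟩⟩

/-- If the monomorphisms in `W` are defined by a left lifting property, then the functors `R[K] ⊗ -`
preserve them: by an induction on the cells, this follows from the case where `K` is a simplex. -/
lemma IsPreadmissible.tens_obj_map (hW : IsPreadmissible W) {Q : MorphismProperty (SMod R C)}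
    (hQ : MorphismProperty.monomorphisms _ ⊓ W = Q.llp) {M N : SMod R C} (f : M ⟶ N)
    (hfm : Mono f) (hf : W f) (K : SSet.{u + 1}) : W (((tens R C).obj K).map f) := by
  obtain ⟨Q', hQ'⟩ := exists_llp_iff_pushoutProductLift ((tens R C).flip.map f) Q
  have key (K : SSet.{u + 1}) (h : Q'.llp (initial.to K)) : W (((tens R C).obj K).map f) := by
    have : Q.llp (((tens R C).obj K).map f) := fun E D p hp =>
      hasLiftingProperty_of_pushoutProductLift p ((hQ' _).1 h p hp)
    rw [← hQ] at this
    exact this.2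
  have hb (n : ℕ) : Q'.llp (SSet.boundary.{u + 1} n).ι := by
    induction n using Nat.strong_induction_on with
    | _ n ih =>
      have hK := key (SSet.boundary.{u + 1} n : SSet) (llp_of_boundary _ _ fun d ⟨c⟩ =>
        ih d ((SSet.boundary.{u + 1} n : SSet).dim_lt_of_nonDegenerate
          ⟨c.simplex, c.nonDegenerate⟩ n))
      rw [hQ']
      intro E D p hp
      have sq := IsPushout.of_hasPushout
        (((tens R C).flip.obj M).map (SSet.boundary.{u + 1} n).ι)
        (((tens R C).flip.map f).app (SSet.boundary.{u + 1} n : SSet))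
      rw [← hasLiftingProperty_iff_pushoutProductLift _ _ p sq (sq.desc
        (((tens R C).flip.map f).app Δ[n]) (((tens R C).flip.obj N).map (SSet.boundary n).ι)
        (((tens R C).flip.map f).naturality _)) (sq.inl_desc _ _ _) (sq.inr_desc _ _ _)]
      have hs := isSplit_linSMod (R := R) (C := C) (SSet.boundary.{u + 1} n).ι
      have : (MorphismProperty.monomorphisms _ ⊓ W) (sq.desc
          (((tens R C).flip.map f).app Δ[n]) (((tens R C).flip.obj N).map (SSet.boundary n).ι)
          (((tens R C).flip.map f).naturality _)) :=
        ⟨hs.mono_of_isPushout (isFlat_linSMod _) sq.flip _ (sq.inr_desc _ _ _) (sq.inl_desc _ _ _),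
          hW.of_isPushout_of_right hs (isFlat_linSMod _) sq.flip _ (sq.inl_desc _ _ _) hK
            (hW.tens_stdSimplex_map f hf n)⟩
      rw [hQ] at this
      exact this p hp
  exact key K (llp_of_boundary _ _ fun d _ => hb d)

/-- Anodyne extensions induce weak equivalences, since horn inclusions do. -/
lemma IsPreadmissible.tens_map_app_of_anodyne (hW : IsPreadmissible W) {K L : SSet.{u + 1}}
    (i : K ⟶ L) (hi : SSet.anodyneExtensions i) (M : SMod R C) :
    W (((tens R C).map i).app M) := by
  rw [SSet.anodyneExtensions_eq_llp_rlp] at hi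
  refine ((hW.saturated.inverseImage ((tens R C).flip.obj M)).llp_rlp_le ?_ _ hi).2
  intro K L i hi
  simp only [SSet.modelCategoryQuillen.J, MorphismProperty.iSup_iff] at hi
  obtain ⟨n, ⟨i⟩⟩ := hi
  exact ⟨(isSplit_linSMod _).mono_whiskerRight M,
    hW.tens_map_app_of_linEquivalences _ (linEquivalences_horn_ι i) M⟩

instance (K : SSet.{u + 1}) : PreservesColimitsOfSize.{u + 1, u + 1}
    ((MonoidalLeftAction.curriedAction SSet.{u + 1} (SCoCAlg R C)).obj K) := by
  have hU := isCoalgebraic_forget R C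
  have := hU.hasColimits
  have := hU.preservesColimits
  have := hU.reflectsIsomorphisms
  have : ReflectsColimitsOfSize.{u + 1, u + 1} (SCoCAlg.forget R C) :=
    reflectsColimits_of_reflectsIsomorphisms
  have : PreservesColimitsOfSize.{u + 1, u + 1}
      ((MonoidalLeftAction.curriedAction SSet.{u + 1} (SCoCAlg R C)).obj K ⋙ SCoCAlg.forget R C) :=
    inferInstanceAs (PreservesColimitsOfSize.{u + 1, u + 1}
      (SCoCAlg.forget R C ⋙ (tens R C).obj K))
  exact preservesColimits_of_reflects_of_preserves _ (SCoCAlg.forget R C)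

instance (G : SCoCAlg R C) : PreservesColimitsOfSize.{u + 1, u + 1}
    ((MonoidalLeftAction.curriedAction SSet.{u + 1} (SCoCAlg R C)).flip.obj G) := by
  have hU := isCoalgebraic_forget R C
  have := hU.hasColimits
  have := hU.preservesColimits
  have := hU.reflectsIsomorphisms
  have : ReflectsColimitsOfSize.{u + 1, u + 1} (SCoCAlg.forget R C) :=
    reflectsColimits_of_reflectsIsomorphisms
  have : PreservesColimitsOfSize.{u + 1, u + 1}
      ((MonoidalLeftAction.curriedAction SSet.{u + 1} (SCoCAlg R C)).flip.obj G ⋙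
        SCoCAlg.forget R C) :=
    inferInstanceAs (PreservesColimitsOfSize.{u + 1, u + 1}
      ((tens R C).flip.obj ((SCoCAlg.forget R C).obj G)))
  exact preservesColimits_of_reflects_of_preserves _ (SCoCAlg.forget R C)

lemma forget_map_curriedAction_map_app {K L : SSet.{u + 1}} (i : K ⟶ L) (X : SCoCAlg R C) :
    (SCoCAlg.forget R C).map
      (((MonoidalLeftAction.curriedAction SSet.{u + 1} (SCoCAlg R C)).map i).app X) =
    (linSMod R C).map i ▷ (SCoCAlg.forget R C).obj X := rfl

lemma forget_map_curriedAction_obj_map (K : SSet.{u + 1}) {X Y : SCoCAlg R C} (j : X ⟶ Y) :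
    (SCoCAlg.forget R C).map
      (((MonoidalLeftAction.curriedAction SSet.{u + 1} (SCoCAlg R C)).obj K).map j) =
    (linSMod R C).obj K ◁ (SCoCAlg.forget R C).map j := rfl

set_option maxHeartbeats 2000000 in
lemma isPushout_map_forget {K L : SSet.{u + 1}} (i : K ⟶ L) {X Y : SCoCAlg R C} (j : X ⟶ Y)
    (sq : (MonoidalLeftAction.curriedAction SSet.{u + 1} (SCoCAlg R C)).PushoutObjObj i j) :
    ∃ (P : SMod R C) (inl : (linSMod R C).obj K ⊗ (SCoCAlg.forget R C).obj Y ⟶ P)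
      (inr : (linSMod R C).obj L ⊗ (SCoCAlg.forget R C).obj X ⟶ P)
      (ι : P ⟶ (linSMod R C).obj L ⊗ (SCoCAlg.forget R C).obj Y),
      IsPushout ((linSMod R C).obj K ◁ (SCoCAlg.forget R C).map j)
        ((linSMod R C).map i ▷ (SCoCAlg.forget R C).obj X) inl inr ∧
      inl ≫ ι = (linSMod R C).map i ▷ (SCoCAlg.forget R C).obj Y ∧
      inr ≫ ι = (linSMod R C).obj L ◁ (SCoCAlg.forget R C).map j ∧
      ∀ Q : MorphismProperty (SMod R C), Q ι → Q ((SCoCAlg.forget R C).map sq.ι) := by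
  have hU := isCoalgebraic_forget R C
  have := hU.preservesColimits
  have : PreservesColimitsOfSize.{0, 0} (SCoCAlg.forget R C) :=
    preservesColimitsOfSize_shrink.{0, u + 1, 0, u + 1} _
  have h := (sq.isPushout.map (SCoCAlg.forget R C)).flip
  have hl := ((SCoCAlg.forget R C).map_comp _ _).symm.trans
    (congrArg (SCoCAlg.forget R C).map sq.inr_ι)
  have hr := ((SCoCAlg.forget R C).map_comp _ _).symm.trans
    (congrArg (SCoCAlg.forget R C).map sq.inl_ι)
  rw [forget_map_curriedAction_obj_map, forget_map_curriedAction_map_app] at h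
  rw [forget_map_curriedAction_map_app] at hl
  rw [forget_map_curriedAction_obj_map] at hr
  exact ⟨_, _, _, _, h, hl, hr, fun Q => id⟩

/-- The pushout-product axiom for presheaves of simplicial coalgebras. -/
theorem isSimplicialModelCategory [ModelCategory (SCoCAlg R C)] (hW : IsPreadmissible W)
    {Q : MorphismProperty (SMod R C)} (hQ : MorphismProperty.monomorphisms _ ⊓ W = Q.llp)
    (hc : cofibrations (SCoCAlg R C) = monos (SCoCAlg.forget R C))
    (hw : weakEquivalences (SCoCAlg R C) = W.inverseImage (SCoCAlg.forget R C)) :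
    IsSimplicialModelCategory.{u + 1} (SCoCAlg R C) := by
  have hU := isCoalgebraic_forget R C
  have := hU.hasColimits
  refine ⟨fun K => hU.isLeftAdjoint _, fun G => isLeftAdjoint_of_sset _, ?_, ?_⟩
  · intro K L i X Y j sq hi hj
    rw [hc] at hj ⊢
    have : Mono ((SCoCAlg.forget R C).map j) := hj
    obtain ⟨P, inl, inr, ι, h, hl, hr, hQ⟩ := isPushout_map_forget i j sq
    exact hQ (MorphismProperty.monomorphisms _)
      ((isSplit_linSMod i).mono_of_isPushout (isFlat_linSMod _) h ι hl hr)
  · intro K L i X Y j sq hi hj hij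
    rw [hc] at hj
    rw [hw] at hij ⊢
    have : Mono ((SCoCAlg.forget R C).map j) := hj
    obtain ⟨P, inl, inr, ι, h, hl, hr, hQ'⟩ := isPushout_map_forget i j sq
    refine hQ' W ?_
    rcases hij with hij | hij
    · exact hW.of_isPushout_of_left (isSplit_linSMod i) (isFlat_linSMod _) h ι hl
        (hW.tens_map_app_of_anodyne i hij _) (hW.tens_map_app_of_anodyne i hij _)
    · exact hW.of_isPushout_of_right (isSplit_linSMod i) (isFlat_linSMod _) h ι hr
        (hW.tens_obj_map hQ _ hj hij K) (hW.tens_obj_map hQ _ hj hij L)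
end

section
open Cardinal Simplicial

/-! ### The complex of the free modules on the simplices -/

variable {R : Type (u + 1)} [CommRing R] {C : Type (u + 1)} [Category.{u} C]

/-- Whiskering is additive. -/
def whiskerRightHom {S T : SMod R C} (M : SMod R C) : (S ⟶ T) →+ (S ⊗ M ⟶ T ⊗ M) where
  toFun f := f ▷ M
  map_zero' := by
    refine NatTrans.ext (funext fun U => NatTrans.ext (funext fun n => ?_))
    change (0 : (S.obj U).obj n ⟶ (T.obj U).obj n) ▷ _ = 0
    exact MonoidalPreadditive.zero_whiskerRight
  map_add' f g := by
    refine NatTrans.ext (funext fun U => NatTrans.ext (funext fun n => ?_))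
    exact MonoidalPreadditive.add_whiskerRight _ _

variable (R C) in
/-- `R[Δ[n]]`. -/
abbrev simplexMod (n : ℕ) : SMod R C := (linSMod R C).obj Δ[n]

variable (R C) in
/-- The morphism `R[Δ[n]] ⟶ R[Δ[n + 1]]` induced by the face `i`. -/
abbrev face (n : ℕ) (i : Fin (n + 2)) : simplexMod R C n ⟶ simplexMod R C (n + 1) :=
  (linSMod R C).map (SSet.stdSimplex.{u + 1}.map (SimplexCategory.δ i))

variable (R C) in
/-- The alternating sum of the faces. -/
def faceSum (n : ℕ) : simplexMod R C n ⟶ simplexMod R C (n + 1) :=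
  ∑ i : Fin (n + 2), ((-1 : ℤ) ^ (i : ℕ)) • face R C n i

variable (R C) in
/-- The alternating sum of the faces into `R[Δ[n]]`, which is zero for `n = 0`. -/
def facePrev (n : ℕ) : simplexMod R C (n - 1) ⟶ simplexMod R C n :=
  Nat.casesOn (motive := fun n => simplexMod R C (n - 1) ⟶ simplexMod R C n) n 0 (faceSum R C)

variable (R C) in
/-- The linear map on `R[Δ[n]_m]` induced by the face `i`. -/
abbrev faceLin (m : SimplexCategoryᵒᵖ) (n : ℕ) (i : Fin (n + 2)) :
    ((Δ[n] : SSet.{u + 1}).obj m →₀ R) →ₗ[R] ((Δ[n + 1] : SSet.{u + 1}).obj m →₀ R) :=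
  Finsupp.lmapDomain R R ((SSet.stdSimplex.{u + 1}.map (SimplexCategory.δ i)).app m)

lemma stdSimplex_map_δ_injective (m : SimplexCategoryᵒᵖ) (n : ℕ) (i : Fin (n + 2)) :
    Function.Injective ((SSet.stdSimplex.{w}.map (SimplexCategory.δ i)).app m) := by
  intro x y h
  refine SSet.stdSimplex.objEquiv.injective (SimplexCategory.Hom.ext _ _
    (OrderHom.ext _ _ (funext fun j => Fin.succAbove_right_injective (p := i) ?_)))
  exact congr(SSet.stdSimplex.asOrderHom $h j)

/-- A simplex belongs to the zeroth face if and only if `0` is not one of its vertices. -/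
lemma mem_range_stdSimplex_map_δ_zero (m : SimplexCategoryᵒᵖ) (n : ℕ)
    (x : (Δ[n + 1] : SSet.{w}).obj m) :
    x ∈ Set.range ((SSet.stdSimplex.{w}.map (SimplexCategory.δ (0 : Fin (n + 2)))).app m) ↔
      ∀ j, SSet.stdSimplex.asOrderHom x j ≠ 0 := by
  constructor
  · rintro ⟨y, rfl⟩ j
    exact Fin.succAbove_ne 0 _
  · intro h
    refine ⟨SSet.stdSimplex.objMk ⟨fun j => (SSet.stdSimplex.asOrderHom x j).pred (h j),
      fun i j hij => Fin.pred_le_pred_iff.2 ((SSet.stdSimplex.asOrderHom x).monotone hij)⟩, ?_⟩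
    refine SSet.stdSimplex.objEquiv.injective (SimplexCategory.Hom.ext _ _
      (OrderHom.ext _ _ (funext fun j => ?_)))
    exact (Fin.succAbove_zero_apply _).trans (Fin.succ_pred _ (h j))

variable (R) in
/-- The contraction which keeps the simplices of the zeroth face. -/
abbrev contraction (m : SimplexCategoryᵒᵖ) (n : ℕ) :
    ((Δ[n + 1] : SSet.{u + 1}).obj m →₀ R) →ₗ[R] ((Δ[n] : SSet.{u + 1}).obj m →₀ R) :=
  Finsupp.lcomapDomain _ (stdSimplex_map_δ_injective m n 0)

lemma contraction_comp_faceLin_zero (m : SimplexCategoryᵒᵖ) (n : ℕ) :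
    contraction R m n ∘ₗ faceLin R m n 0 = LinearMap.id :=
  Finsupp.lhom_ext' fun x => LinearMap.ext_ring
    (Finsupp.comapDomain_mapDomain _ (stdSimplex_map_δ_injective m n 0) (Finsupp.single x 1))

lemma contraction_single_of_notMem (m : SimplexCategoryᵒᵖ) (n : ℕ)
    (x : (Δ[n + 1] : SSet.{u + 1}).obj m) (j) (hx : SSet.stdSimplex.asOrderHom x j = 0) :
    contraction R m n (Finsupp.single x 1) = 0 := by
  ext y
  change Finsupp.single x (1 : R) _ = 0
  rw [Finsupp.single_apply_eq_zero]
  intro h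
  exact ((mem_range_stdSimplex_map_δ_zero m n x).1 ⟨y, h⟩ j hx).elim

lemma contraction_comp_faceLin_succ (m : SimplexCategoryᵒᵖ) (n : ℕ) (i : Fin (n + 2)) :
    contraction R m (n + 1) ∘ₗ faceLin R m (n + 1) i.succ =
      faceLin R m n i ∘ₗ contraction R m n := by
  refine Finsupp.lhom_ext' fun x => LinearMap.ext_ring ?_
  have h₁ : faceLin R m (n + 1) i.succ (Finsupp.single x 1) = Finsupp.single _ 1 :=
    Finsupp.mapDomain_single
  change contraction R m (n + 1) (faceLin R m (n + 1) i.succ (Finsupp.single x 1)) =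
    faceLin R m n i (contraction R m n (Finsupp.single x 1))
  by_cases hx : ∀ j, SSet.stdSimplex.asOrderHom x j ≠ 0
  · obtain ⟨y, rfl⟩ := (mem_range_stdSimplex_map_δ_zero m n x).2 hx
    have h₂ : faceLin R m n 0 (Finsupp.single y 1) = Finsupp.single _ 1 :=
      Finsupp.mapDomain_single
    have h₃ : faceLin R m (n + 1) i.succ (faceLin R m n 0 (Finsupp.single y 1)) =
        faceLin R m (n + 1) 0 (faceLin R m n i (Finsupp.single y 1)) := by
      rw [← LinearMap.comp_apply, ← LinearMap.comp_apply, ← Finsupp.lmapDomain_comp,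
        ← Finsupp.lmapDomain_comp]
      congr 2
      funext z
      refine SSet.stdSimplex.objEquiv.injective (SimplexCategory.Hom.ext _ _
        (OrderHom.ext _ _ (funext fun j => ?_)))
      change i.succ.succAbove (Fin.succAbove 0 _) = Fin.succAbove 0 (i.succAbove _)
      rw [Fin.succAbove_zero_apply, Fin.succAbove_zero_apply, Fin.succ_succAbove_succ]
      rfl
    rw [← h₂, h₃, ← LinearMap.comp_apply, ← LinearMap.comp_apply (contraction R m n),
      contraction_comp_faceLin_zero, contraction_comp_faceLin_zero]
    rfl
  · push Not at hx
    obtain ⟨j, hj⟩ := hx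
    rw [h₁, contraction_single_of_notMem m n x j hj, map_zero]
    refine contraction_single_of_notMem m (n + 1) _ j ?_
    change i.succ.succAbove (SSet.stdSimplex.asOrderHom x j) = 0
    rw [hj, Fin.succ_succAbove_zero]

lemma contraction_comp_faceLin_one (m : SimplexCategoryᵒᵖ) :
    contraction R m 0 ∘ₗ faceLin R m 0 1 = 0 := by
  refine Finsupp.lhom_ext' fun x => LinearMap.ext_ring ?_
  have h₁ : faceLin R m 0 1 (Finsupp.single x 1) = Finsupp.single _ 1 := Finsupp.mapDomain_single
  change contraction R m 0 (faceLin R m 0 1 (Finsupp.single x 1)) = 0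
  rw [h₁]
  refine contraction_single_of_notMem m 0 _ 0 ?_
  change Fin.succAbove 1 (SSet.stdSimplex.asOrderHom x 0) = 0
  have h (k : Fin 1) : (1 : Fin 2).succAbove k = 0 := by revert k; decide
  exact h _

variable (R) in
/-- The alternating sum of the faces, in terms of linear maps. -/
def faceSumLin (m : SimplexCategoryᵒᵖ) (n : ℕ) :
    ((Δ[n] : SSet.{u + 1}).obj m →₀ R) →ₗ[R] ((Δ[n + 1] : SSet.{u + 1}).obj m →₀ R) :=
  ∑ i : Fin (n + 2), ((-1 : ℤ) ^ (i : ℕ)) • faceLin R m n i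

variable (C) in
lemma faceSum_app_app (n : ℕ) (U : Cᵒᵖ) (m : SimplexCategoryᵒᵖ) :
    (((faceSum R C n).app U).app m).hom = faceSumLin R m n := by
  let φ : (simplexMod R C n ⟶ simplexMod R C (n + 1)) →+
      (((Δ[n] : SSet.{u + 1}).obj m →₀ R) →ₗ[R] ((Δ[n + 1] : SSet.{u + 1}).obj m →₀ R)) :=
    { toFun f := ((f.app U).app m).hom
      map_zero' := rfl
      map_add' _ _ := rfl }
  change φ (faceSum R C n) = _
  rw [faceSum, map_sum, faceSumLin]
  exact Finset.sum_congr rfl fun i _ => map_zsmul φ _ _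

lemma comp_alternatingSum_two {A B : Type*} [AddCommGroup A] [AddCommGroup B] [Module R A]
    [Module R B] {c : B →ₗ[R] A} {f : Fin 2 → A →ₗ[R] B} (h₀ : c ∘ₗ f 0 = LinearMap.id)
    (h₁ : c ∘ₗ f 1 = 0) : c ∘ₗ ∑ i : Fin 2, ((-1 : ℤ) ^ (i : ℕ)) • f i = LinearMap.id := by
  refine LinearMap.ext fun x => ?_
  have h₀ : c (f 0 x) = x := LinearMap.congr_fun h₀ x
  have h₁ : c (f 1 x) = 0 := LinearMap.congr_fun h₁ x
  simp [Fin.sum_univ_two, h₀, h₁]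

lemma comp_alternatingSum {A B D : Type*} [AddCommGroup A] [AddCommGroup B] [AddCommGroup D]
    [Module R A] [Module R B] [Module R D] {c : D →ₗ[R] B} {c' : B →ₗ[R] A} {n : ℕ}
    {f : Fin (n + 3) → B →ₗ[R] D} {g : Fin (n + 2) → A →ₗ[R] B} (h₀ : c ∘ₗ f 0 = LinearMap.id)
    (hs : ∀ i, c ∘ₗ f (Fin.succ i) = g i ∘ₗ c') :
    c ∘ₗ ∑ i : Fin (n + 3), ((-1 : ℤ) ^ (i : ℕ)) • f i =
      LinearMap.id - (∑ i : Fin (n + 2), ((-1 : ℤ) ^ (i : ℕ)) • g i) ∘ₗ c' := by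
  refine LinearMap.ext fun x => ?_
  have h₀ : c (f 0 x) = x := LinearMap.congr_fun h₀ x
  have hs (i) : c (f (Fin.succ i) x) = g i (c' x) := LinearMap.congr_fun (hs i) x
  simp only [LinearMap.comp_apply, LinearMap.sub_apply, LinearMap.sum_apply, LinearMap.smul_apply,
    map_sum, map_zsmul, LinearMap.id_apply]
  rw [Fin.sum_univ_succ]
  simp [hs, h₀, pow_succ, sub_eq_add_neg]

lemma contraction_comp_faceSumLin_zero (m : SimplexCategoryᵒᵖ) :
    contraction R m 0 ∘ₗ faceSumLin R m 0 = LinearMap.id :=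
  comp_alternatingSum_two (contraction_comp_faceLin_zero m 0) (contraction_comp_faceLin_one m)

lemma contraction_comp_faceSumLin_succ (n : ℕ) (m : SimplexCategoryᵒᵖ) :
    contraction R m (n + 1) ∘ₗ faceSumLin R m (n + 1) =
      LinearMap.id - faceSumLin R m n ∘ₗ contraction R m n :=
  comp_alternatingSum (contraction_comp_faceLin_zero m (n + 1))
    (contraction_comp_faceLin_succ m n)

lemma facePrev_comp_faceSum (n : ℕ) : facePrev R C n ≫ faceSum R C n = 0 := by
  cases n with
  | zero => exact zero_comp
  | succ n =>
    let X : SimplicialObject (SMod R C)ᵒᵖ := (SSet.stdSimplex ⋙ linSMod R C).op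
    have h (n : ℕ) : AlgebraicTopology.AlternatingFaceMapComplex.objD X n =
        (faceSum R C n).op := by
      refine Eq.trans ?_ (map_sum (opHom (simplexMod R C n) (simplexMod R C (n + 1))) _ _).symm
      exact Finset.sum_congr rfl fun i _ =>
        (map_zsmul (opHom (simplexMod R C n) (simplexMod R C (n + 1))) _ _).symm
    have := AlgebraicTopology.AlternatingFaceMapComplex.d_squared X n
    rw [h, h] at this
    exact Quiver.Hom.op_inj this

variable (R C) in
/-- The cokernel of `facePrev`. -/
def simplexCoker (n : ℕ) : SMod R C := cokernel (facePrev R C n)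

variable (R C) in
/-- The projection of `R[Δ[n]]` to `simplexCoker R C n`. -/
def cokerProj (n : ℕ) : simplexMod R C n ⟶ simplexCoker R C n := cokernel.π _

variable (R C) in
/-- The morphism from the cokernel of `R[Δ[n - 1]] ⟶ R[Δ[n]]` to `R[Δ[n + 1]]`. -/
def cokerIncl (n : ℕ) : simplexCoker R C n ⟶ simplexMod R C (n + 1) :=
  cokernel.desc _ (faceSum R C n) (facePrev_comp_faceSum n)

instance (n : ℕ) : Epi (cokerProj R C n) := inferInstanceAs (Epi (cokernel.π _))

lemma cokerProj_comp_cokerIncl (n : ℕ) :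
    cokerProj R C n ≫ cokerIncl R C n = faceSum R C n := cokernel.π_desc _ _ _

lemma facePrev_comp_cokerProj (n : ℕ) : facePrev R C n ≫ cokerProj R C n = 0 :=
  cokernel.condition _

variable (R C) in
/-- The components of `cokerProj`. -/
def cokerProjLin (n : ℕ) (U : Cᵒᵖ) (m : SimplexCategoryᵒᵖ) :
    ((Δ[n] : SSet.{u + 1}).obj m →₀ R) →ₗ[R] ((simplexCoker R C n).obj U).obj m :=
  (((cokerProj R C n).app U).app m).hom

lemma cokerProjLin_contraction (n : ℕ) (U : Cᵒᵖ) (m : SimplexCategoryᵒᵖ) :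
    cokerProjLin R C n U m ∘ₗ contraction R m n ∘ₗ faceSumLin R m n = cokerProjLin R C n U m := by
  cases n with
  | zero => rw [contraction_comp_faceSumLin_zero, LinearMap.comp_id]
  | succ n =>
    have h : cokerProjLin R C (n + 1) U m ∘ₗ faceSumLin R m n = 0 :=
      (congrArg (cokerProjLin R C (n + 1) U m ∘ₗ ·) (faceSum_app_app C n U m)).symm.trans
        congr(((($(facePrev_comp_cokerProj (R := R) (C := C) (n + 1))).app U).app m).hom)
    rw [contraction_comp_faceSumLin_succ, LinearMap.comp_sub, ← LinearMap.comp_assoc, h,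
      LinearMap.zero_comp, sub_zero, LinearMap.comp_id]

lemma comp_eq_id_of_contraction {A B Q : Type*} [AddCommGroup A] [AddCommGroup B] [AddCommGroup Q]
    [Module R A] [Module R B] [Module R Q] {c : B →ₗ[R] A} {d : A →ₗ[R] B} {π : A →ₗ[R] Q}
    {i : Q →ₗ[R] B} (hπ : Function.Surjective π) (hi : i ∘ₗ π = d) (h : π ∘ₗ c ∘ₗ d = π) :
    (π ∘ₗ c) ∘ₗ i = LinearMap.id := by
  refine LinearMap.ext fun x => ?_
  obtain ⟨x, rfl⟩ := hπ x
  have := LinearMap.congr_fun h x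
  rwa [← hi] at this

/-- The complex of the free modules on the simplices is levelwise contractible. -/
lemma isSplit_cokerIncl (n : ℕ) : IsSplit (cokerIncl R C n) := by
  intro U m
  have h₁ : (((cokerIncl R C n).app U).app m).hom ∘ₗ cokerProjLin R C n U m = faceSumLin R m n :=
    Eq.trans congr(((($(cokerProj_comp_cokerIncl (R := R) (C := C) n)).app U).app m).hom)
      (faceSum_app_app C n U m)
  exact ⟨cokerProjLin R C n U m ∘ₗ contraction R m n, comp_eq_id_of_contraction
    ((epi_iff_app_surjective (cokerProj R C n)).1 inferInstance U m) h₁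
    (cokerProjLin_contraction n U m)⟩

/-! ### Mapping spaces -/

variable {M N P : SMod R C}

instance : HasForget₂ AddCommGrpCat.{w} Ab.{w} := ⟨𝟭 _, rfl⟩

instance : (forget₂ AddCommGrpCat.{w} Ab.{w}).Additive :=
  inferInstanceAs (𝟭 AddCommGrpCat.{w}).Additive

instance : (forget₂ AddCommGrpCat.{w} Ab.{w}).PreservesHomology :=
  inferInstanceAs (𝟭 AddCommGrpCat.{w}).PreservesHomology

variable (M P) in
/-- The chain complex of the mapping space. -/
abbrev mapComplex : ChainComplex AddCommGrpCat.{u + 1} ℕ :=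
  (AlgebraicTopology.alternatingFaceMapComplex _).obj (mapSpace M P)

/-- An element of the mapping space, as a morphism. -/
abbrev mapComplexElt {n : ℕ} (g : simplexMod R C n ⊗ M ⟶ P) : (mapComplex M P).X n := g

lemma mapComplex_d {n : ℕ} (g : simplexMod R C (n + 1) ⊗ M ⟶ P) :
    (mapComplex M P).d (n + 1) n (mapComplexElt g) = mapComplexElt (faceSum R C n ▷ M ≫ g) := by
  let φ : ((mapSpace M P).obj (op ⦋n + 1⦌) ⟶ (mapSpace M P).obj (op ⦋n⦌)) →+
      (simplexMod R C n ⊗ M ⟶ P) :=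
    { toFun f := f (mapComplexElt g)
      map_zero' := rfl
      map_add' _ _ := rfl }
  have h : (mapComplex M P).d (n + 1) n = ∑ i : Fin (n + 2), (-1 : ℤ) ^ (i : ℕ) •
      SimplicialObject.δ (mapSpace M P) i :=
    AlgebraicTopology.AlternatingFaceMapComplex.obj_d_eq (mapSpace M P) n
  let ψ : (simplexMod R C n ⟶ simplexMod R C (n + 1)) →+ (simplexMod R C n ⊗ M ⟶ P) :=
    { toFun f := whiskerRightHom M f ≫ g
      map_zero' := by rw [map_zero, zero_comp]
      map_add' f f' := by rw [map_add, Preadditive.add_comp] }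
  change φ ((mapComplex M P).d (n + 1) n) = ψ (faceSum R C n)
  rw [h, faceSum, map_sum, map_sum]
  refine Finset.sum_congr rfl fun i _ => ?_
  refine (map_zsmul φ _ _).trans (Eq.trans ?_ (map_zsmul ψ _ _).symm)
  rfl

lemma mapComplex_d_prev {n : ℕ} (g : simplexMod R C n ⊗ M ⟶ P) :
    (mapComplex M P).d n (n - 1) (mapComplexElt g) = mapComplexElt (facePrev R C n ▷ M ≫ g) := by
  cases n with
  | zero =>
    rw [(mapComplex M P).shape 0 (0 - 1) (by simp)]
    exact (zero_comp.symm.trans (congrArg (· ≫ g) (map_zero (whiskerRightHom M)).symm))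
  | succ n => exact mapComplex_d g

/-- The morphism of simplicial groups induced by `f` is a surjective weak equivalence if and only if
lifting problems for `P` have solutions. -/
lemma mapSpacePrecomp_iff (f : M ⟶ N) (P : SMod R C) :
    (simplicialWeakEquivalences AddCommGrpCat.{u + 1} (mapSpacePrecomp f P) ∧
      ∀ n (y : simplexMod R C n ⊗ M ⟶ P), ∃ x, simplexMod R C n ◁ f ≫ x = y) ↔
    (∀ y : simplexMod R C 0 ⊗ M ⟶ P, ∃ x, simplexMod R C 0 ◁ f ≫ x = y) ∧
    ∀ n (y : simplexMod R C (n + 1) ⊗ M ⟶ P) (x : simplexMod R C n ⊗ N ⟶ P),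
      facePrev R C n ▷ N ≫ x = 0 → simplexMod R C n ◁ f ≫ x = faceSum R C n ▷ M ≫ y →
        ∃ x', simplexMod R C (n + 1) ◁ f ≫ x' = y ∧ faceSum R C n ▷ N ≫ x' = x := by
  rw [simplicialWeakEquivalences_iff]
  refine (quasiIso_and_surjective_iff ((AlgebraicTopology.alternatingFaceMapComplex _).map
    (mapSpacePrecomp f P))).trans (and_congr Iff.rfl (forall_congr' fun n =>
    forall₂_congr fun y x => ?_))
  refine imp_congr ?_ (imp_congr ?_ ?_)
  · exact Eq.congr_left (mapComplex_d_prev x)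
  · exact Eq.congr_right (mapComplex_d y)
  · refine exists_congr fun x' => and_congr Iff.rfl ?_
    exact Eq.congr_left (mapComplex_d x')

/-- A weak equivalence is surjective on the connected components. -/
lemma exists_of_mapSpacePrecomp {f : M ⟶ N} {P : SMod R C}
    (hf : simplicialWeakEquivalences AddCommGrpCat.{u + 1} (mapSpacePrecomp f P))
    (y : simplexMod R C 0 ⊗ M ⟶ P) :
    ∃ (x : simplexMod R C 0 ⊗ N ⟶ P) (c : simplexMod R C 1 ⊗ M ⟶ P),
      y = simplexMod R C 0 ◁ f ≫ x + faceSum R C 0 ▷ M ≫ c := by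
  rw [simplicialWeakEquivalences_iff] at hf
  obtain ⟨x, c, -, h⟩ := ((quasiIso_iff_elements _).1 hf).1 0 (mapComplexElt y) (by
    refine (mapComplex_d_prev y).trans ?_
    exact (congrArg (· ≫ y) (map_zero (whiskerRightHom M))).trans zero_comp)
  refine ⟨x, c, h.trans ?_⟩
  exact congrArg (_ + ·) (mapComplex_d (M := M) c)
end

section
open Cardinal Simplicial

/-! ### Lifting properties and mapping spaces -/

variable {R : Type (u + 1)} [CommRing R] {C : Type (u + 1)} [Category.{u} C]

instance (T : SMod R C) : (tensorRight T).IsLeftAdjoint :=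
  (isCoalgebraic_id R C).isLeftAdjoint _

instance (n : ℕ) (M : SMod R C) : Epi (cokerProj R C n ▷ M) :=
  inferInstanceAs (Epi ((tensorRight M).map (cokerProj R C n)))

lemma exists_cokerProj_desc (n : ℕ) {M P : SMod R C} (x : simplexMod R C n ⊗ M ⟶ P)
    (hx : facePrev R C n ▷ M ≫ x = 0) :
    ∃ x' : simplexCoker R C n ⊗ M ⟶ P, cokerProj R C n ▷ M ≫ x' = x := by
  have : PreservesColimitsOfSize.{0, 0} (tensorRight M) :=
    preservesColimitsOfSize_shrink.{0, u + 1, 0, u + 1} _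
  have h := CokernelCofork.mapIsColimit _ (cokernelIsCokernel (facePrev R C n)) (tensorRight M)
  obtain ⟨l, hl⟩ := CokernelCofork.IsColimit.desc' h x hx
  exact ⟨l, hl⟩

/-- The natural transformation `S ⊗ - ⟶ T ⊗ -`. -/
abbrev tensorNat {S T : SMod R C} (e : S ⟶ T) : tensorLeft S ⟶ tensorLeft T :=
  (curriedTensor (SMod R C)).map e

/-- The morphism from the pushout of `S ⊗ N ⟵ S ⊗ M ⟶ T ⊗ M` to `T ⊗ N`. -/
def pushoutProduct {S T M N : SMod R C} (e : S ⟶ T) (f : M ⟶ N) :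
    pushout (S ◁ f) (e ▷ M) ⟶ T ⊗ N :=
  pushout.desc (e ▷ N) (T ◁ f) (whisker_exchange e f)

lemma inl_pushoutProduct {S T M N : SMod R C} (e : S ⟶ T) (f : M ⟶ N) :
    pushout.inl _ _ ≫ pushoutProduct e f = e ▷ N := pushout.inl_desc _ _ _

lemma inr_pushoutProduct {S T M N : SMod R C} (e : S ⟶ T) (f : M ⟶ N) :
    pushout.inr _ _ ≫ pushoutProduct e f = T ◁ f := pushout.inr_desc _ _ _

lemma hasLiftingProperty_pushoutProduct_iff {S T M N : SMod R C} (e : S ⟶ T) (f : M ⟶ N)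
    {E D : SMod R C} (p : E ⟶ D) :
    HasLiftingProperty (pushoutProduct e f) p ↔ PushoutProductLift (tensorNat e) f p :=
  hasLiftingProperty_iff_pushoutProductLift (tensorNat e) f p
    (IsPushout.of_hasPushout (S ◁ f) (e ▷ M)) (pushoutProduct e f) (inl_pushoutProduct e f)
    (inr_pushoutProduct e f)

lemma IsSplit.mono_pushoutProduct {S T M N : SMod R C} {e : S ⟶ T} (he : IsSplit e)
    (hT : IsFlat T) (f : M ⟶ N) [Mono f] : Mono (pushoutProduct e f) :=
  he.mono_of_isPushout hT (IsPushout.of_hasPushout (S ◁ f) (e ▷ M)) _ (inl_pushoutProduct e f)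
    (inr_pushoutProduct e f)

/-- All morphisms to `P` extend along `i`. -/
def ExtendsAlong {A B : SMod R C} (i : A ⟶ B) (P : SMod R C) : Prop :=
  ∀ g : A ⟶ P, ∃ h : B ⟶ P, i ≫ h = g

lemma extendsAlong_iff {A B : SMod R C} (i : A ⟶ B) (P : SMod R C) :
    ExtendsAlong i P ↔ HasLiftingProperty i (terminal.from P) :=
  ⟨fun h => ⟨fun {g _} _ => by
    obtain ⟨l, hl⟩ := h g
    exact ⟨⟨⟨l, hl, terminal.hom_ext _ _⟩⟩⟩⟩,
  fun _ g => by
    have sq : CommSq g i (terminal.from P) (terminal.from B) := ⟨terminal.hom_ext _ _⟩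
    exact ⟨sq.lift, sq.fac_left⟩⟩

namespace IsPreadmissible

variable {W : MorphismProperty (SMod R C)} (hW : IsPreadmissible W)
include hW

lemma pushoutProduct_of_left {S T M N : SMod R C} {e : S ⟶ T} (he : IsSplit e) (hT : IsFlat T)
    (f : M ⟶ N) (hM : W (e ▷ M)) (hN : W (e ▷ N)) : W (pushoutProduct e f) :=
  hW.of_isPushout_of_left he hT (IsPushout.of_hasPushout (S ◁ f) (e ▷ M)) _
    (inl_pushoutProduct e f) hM hN

lemma pushoutProduct_of_right {S T M N : SMod R C} {e : S ⟶ T} (he : IsSplit e) (hT : IsFlat T)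
    (f : M ⟶ N) [Mono f] (hS : W (S ◁ f)) (hTf : W (T ◁ f)) : W (pushoutProduct e f) :=
  hW.of_isPushout_of_right he hT (IsPushout.of_hasPushout (S ◁ f) (e ▷ M)) _
    (inr_pushoutProduct e f) hS hTf

lemma simplexMod_whiskerLeft {M N : SMod R C} (f : M ⟶ N) (hf : W f) (n : ℕ) :
    W (simplexMod R C n ◁ f) := hW.tens_stdSimplex_map f hf n

/-- The functor `simplexCoker R C (n + 1) ⊗ -` takes `f` to a pushout of a pushout-product. -/
lemma simplexCoker_whiskerLeft {M N : SMod R C} (f : M ⟶ N) [hm : Mono f] (hf : W f) (n : ℕ) :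
    W (simplexCoker R C n ◁ f) := by
  have := hW.twoOutOfThree
  induction n with
  | zero =>
    have : IsIso (cokerProj R C 0) := inferInstanceAs (IsIso (cokernel.π (0 : _ ⟶ _)))
    refine MorphismProperty.of_precomp W (cokerProj R C 0 ▷ M) _ (hW.of_isIso _) ?_
    rw [← whisker_exchange]
    exact MorphismProperty.comp_mem _ _ _ (hW.simplexMod_whiskerLeft f hf 0) (hW.of_isIso _)
  | succ n ih =>
    have he := isSplit_cokerIncl (R := R) (C := C) n
    have hT : IsFlat (simplexMod R C (n + 1)) := isFlat_linSMod _
    have hj := hW.pushoutProduct_of_right he hT f ih (hW.simplexMod_whiskerLeft f hf (n + 1))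
    have hc : cokerIncl R C n ≫ cokerProj R C (n + 1) = 0 := by
      rw [← cancel_epi (cokerProj R C n), ← Category.assoc, cokerProj_comp_cokerIncl, comp_zero]
      exact facePrev_comp_cokerProj (n + 1)
    have hc' (M : SMod R C) : cokerIncl R C n ▷ M ≫ cokerProj R C (n + 1) ▷ M = 0 := by
      rw [← comp_whiskerRight, hc]
      exact map_zero (whiskerRightHom M)
    obtain ⟨d, hd₁, hd₂⟩ : ∃ d : Limits.pushout (simplexCoker R C n ◁ f) (cokerIncl R C n ▷ M) ⟶
        simplexCoker R C (n + 1) ⊗ M,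
        pushout.inl _ _ ≫ d = 0 ∧ pushout.inr _ _ ≫ d = cokerProj R C (n + 1) ▷ M :=
      ⟨pushout.desc 0 (cokerProj R C (n + 1) ▷ M) (by rw [comp_zero, hc']),
        pushout.inl_desc _ _ _, pushout.inr_desc _ _ _⟩
    have hp₁ := inl_pushoutProduct (cokerIncl R C n) f
    have hp₂ := inr_pushoutProduct (cokerIncl R C n) f
    have sq : IsPushout d (pushoutProduct (cokerIncl R C n) f) (simplexCoker R C (n + 1) ◁ f)
        (cokerProj R C (n + 1) ▷ N) := by
      have hdesc (s : PushoutCocone d (pushoutProduct (cokerIncl R C n) f)) :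
          ∃ l, cokerProj R C (n + 1) ▷ N ≫ l = s.inr := by
        refine exists_cokerProj_desc (n + 1) s.inr ?_
        have := pushout.inl _ _ ≫= s.condition
        rw [reassoc_of% hd₁, zero_comp, reassoc_of% hp₁] at this
        change faceSum R C n ▷ N ≫ s.inr = 0
        rw [← cokerProj_comp_cokerIncl, comp_whiskerRight, Category.assoc, ← this, comp_zero]
      choose l hl using hdesc
      refine ⟨⟨pushout.hom_ext ?_ ?_⟩, ⟨PushoutCocone.IsColimit.mk _ l (fun s => ?_) hl
          fun s m _ h => ?_⟩⟩
      · rw [reassoc_of% hd₁, reassoc_of% hp₁, zero_comp, hc']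
      · rw [reassoc_of% hd₂, reassoc_of% hp₂, whisker_exchange]
      · rw [← cancel_epi (cokerProj R C (n + 1) ▷ M), ← whisker_exchange_assoc, hl]
        have := pushout.inr _ _ ≫= s.condition
        rw [reassoc_of% hd₂, reassoc_of% hp₂] at this
        exact this.symm
      · rw [← cancel_epi (cokerProj R C (n + 1) ▷ N), hl, h]
    exact (hW.pushout sq (he.mono_pushoutProduct hT f) hj).2

end IsPreadmissible

/-- The lifting properties with respect to `P` which mean that `f` induces a surjective weak
equivalence from the mapping space of its target to that of its source. -/
def MapTrivial {M N : SMod R C} (f : M ⟶ N) (P : SMod R C) : Prop :=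
  ExtendsAlong (simplexMod R C 0 ◁ f) P ∧ ∀ n, ExtendsAlong (pushoutProduct (cokerIncl R C n) f) P

/-- The two conditions of `MapTrivial` are the lifting property of the map of chain complexes
induced by `f` against the inclusions of spheres into disks, translated through the complex of the
`R[Δ[n]]`. -/
lemma mapTrivial_iff {M N : SMod R C} (f : M ⟶ N) (P : SMod R C) :
    MapTrivial f P ↔ simplicialWeakEquivalences AddCommGrpCat.{u + 1} (mapSpacePrecomp f P) ∧
      ∀ n, ExtendsAlong (simplexMod R C n ◁ f) P := by
  refine (and_congr Iff.rfl (forall_congr' fun n => ?_)).trans (mapSpacePrecomp_iff f P).symm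
  rw [extendsAlong_iff, hasLiftingProperty_pushoutProduct_iff]
  constructor
  · intro h y x hx hxy
    obtain ⟨x, rfl⟩ := exists_cokerProj_desc n x hx
    obtain ⟨l, h₁, h₂, -⟩ := h y x (terminal.from _) (by
      rw [← cancel_epi (cokerProj R C n ▷ M)]
      refine (whisker_exchange_assoc (cokerProj R C n) f x).symm.trans (hxy.trans ?_)
      rw [← cokerProj_comp_cokerIncl, comp_whiskerRight, Category.assoc]
      rfl) (terminal.hom_ext _ _) (terminal.hom_ext _ _)
    refine ⟨l, h₁, ?_⟩
    rw [← cokerProj_comp_cokerIncl, comp_whiskerRight, Category.assoc]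
    exact congrArg _ h₂
  · intro h y x d hxy _ _
    obtain ⟨l, h₁, h₂⟩ := h y (cokerProj R C n ▷ N ≫ x) (by
      rw [← comp_whiskerRight_assoc, facePrev_comp_cokerProj]
      exact (congrArg (· ≫ x) (map_zero (whiskerRightHom N))).trans zero_comp) (by
      rw [whisker_exchange_assoc, ← cokerProj_comp_cokerIncl, comp_whiskerRight, Category.assoc]
      exact congrArg _ hxy)
    refine ⟨l, h₁, ?_, terminal.hom_ext _ _⟩
    rw [← cancel_epi (cokerProj R C n ▷ N), ← h₂, ← cokerProj_comp_cokerIncl, comp_whiskerRight,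
      Category.assoc]
    rfl

/-- The morphisms which induce surjective weak equivalences between mapping spaces to `P` are
defined by a left lifting property. -/
lemma isWeaklySaturated_mapTrivial (P : SMod R C) :
    IsWeaklySaturated.{u + 1} (fun _ _ f => MapTrivial f P : MorphismProperty (SMod R C)) := by
  have h (n : ℕ) := exists_llp_iff_pushoutProductLift (tensorNat (cokerIncl R C n))
    (.ofHoms fun _ : Unit => terminal.from P)
  choose Q hQ using h
  have : (fun _ _ f => MapTrivial f P : MorphismProperty (SMod R C)) =
      ((MorphismProperty.ofHoms fun _ : Unit => terminal.from P).llp.inverseImage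
        (tensorLeft (simplexMod R C 0))) ⊓ ⨅ n, (Q n).llp := by
    ext M N f
    refine and_congr ?_ ?_
    · rw [extendsAlong_iff]
      exact ⟨fun h _ _ _ ⟨_⟩ => h, fun h => h _ ⟨()⟩⟩
    · rw [MorphismProperty.iInf_iff]
      refine forall_congr' fun n => ?_
      rw [hQ, extendsAlong_iff, hasLiftingProperty_pushoutProduct_iff]
      exact ⟨fun h _ _ _ ⟨_⟩ => h, fun h => h _ ⟨()⟩⟩
  rw [this]
  exact ((IsWeaklySaturated.llp _).inverseImage _).inf (.iInf fun n => .llp _)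

/-- `P` is fibrant with respect to `W`. -/
def IsFibrantFor (W : MorphismProperty (SMod R C)) (P : SMod R C) : Prop :=
  ∀ ⦃A B : SMod R C⦄ (i : A ⟶ B), Mono i → W i → ExtendsAlong i P

/-- Trivial cofibrations induce surjective weak equivalences between mapping spaces to fibrant
objects. -/
lemma IsPreadmissible.mapTrivial {W : MorphismProperty (SMod R C)} (hW : IsPreadmissible W)
    {P : SMod R C} (hP : IsFibrantFor W P) {M N : SMod R C} (f : M ⟶ N) [Mono f] (hf : W f) :
    MapTrivial f P :=
  ⟨hP _ (mono_whiskerLeft_of_isFlat (isFlat_linSMod _) f) (hW.simplexMod_whiskerLeft f hf 0),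
    fun n => hP _ ((isSplit_cokerIncl n).mono_pushoutProduct (isFlat_linSMod _) f)
      (hW.pushoutProduct_of_right (isSplit_cokerIncl n) (isFlat_linSMod _) f
        (hW.simplexCoker_whiskerLeft f hf n) (hW.simplexMod_whiskerLeft f hf (n + 1)))⟩

lemma mono_of_point {K : SSet.{w}} (v : Δ[0] ⟶ K) : Mono v := by
  have : IsSplitMono v := ⟨⟨SSet.stdSimplex.isTerminalObj₀.from _,
    SSet.stdSimplex.isTerminalObj₀.hom_ext _ _⟩⟩
  infer_instance

/-- Homotopy extension and lifting. -/
lemma IsPreadmissible.pushoutProduct_point {W : MorphismProperty (SMod R C)}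
    (hW : IsPreadmissible W) {K : SSet.{u + 1}} (v : Δ[0] ⟶ K) (hv : linEquivalences R v)
    {M N : SMod R C} (f : M ⟶ N) [Mono f] :
    Mono (pushoutProduct ((linSMod R C).map v) f) ∧ W (pushoutProduct ((linSMod R C).map v) f) :=
  have := mono_of_point v
  ⟨(isSplit_linSMod v).mono_pushoutProduct (isFlat_linSMod _) f,
    hW.pushoutProduct_of_left (isSplit_linSMod v) (isFlat_linSMod _) f
      (hW.tens_map_app_of_linEquivalences v hv M) (hW.tens_map_app_of_linEquivalences v hv N)⟩

variable (R C) in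
/-- The projection `R[Δ[1]] ⟶ R[Δ[0]]`. -/
abbrev degen : simplexMod R C 1 ⟶ simplexMod R C 0 :=
  (linSMod R C).map (SSet.stdSimplex.map (SimplexCategory.σ 0))

lemma face_comp_degen (e : Fin 2) : face R C 0 e ≫ degen R C = 𝟙 _ := by
  refine ((linSMod R C).map_comp _ _).symm.trans ?_
  refine (congrArg _ (SSet.stdSimplex.isTerminalObj₀.hom_ext _ (𝟙 _))).trans ?_
  exact (linSMod R C).map_id _

lemma face_degen (e : Fin 2) {M P : SMod R C} (g : simplexMod R C 0 ⊗ M ⟶ P) :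
    face R C 0 e ▷ M ≫ degen R C ▷ M ≫ g = g := by
  rw [← comp_whiskerRight_assoc, face_comp_degen, id_whiskerRight, Category.id_comp]

lemma faceSum_zero_whiskerRight (M : SMod R C) :
    faceSum R C 0 ▷ M = face R C 0 0 ▷ M - face R C 0 1 ▷ M := by
  have : faceSum R C 0 = face R C 0 0 - face R C 0 1 := by
    rw [faceSum, Fin.sum_univ_two]
    simp [sub_eq_add_neg]
  rw [this]
  exact map_sub (whiskerRightHom M) _ _

/-- If `P` is fibrant, then a monomorphism which induces a weak equivalence between the mapping
spaces to `P` induces a surjective one. -/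
lemma IsPreadmissible.mapTrivial_of_mapSpacePrecomp {W : MorphismProperty (SMod R C)}
    (hW : IsPreadmissible W) {P : SMod R C} (hP : IsFibrantFor W P) {M N : SMod R C} (f : M ⟶ N)
    [Mono f] (hf : simplicialWeakEquivalences AddCommGrpCat.{u + 1} (mapSpacePrecomp f P)) :
    MapTrivial f P := by
  have key {n : ℕ} (v : Δ[0] ⟶ Δ[n]) (hv : linEquivalences R v) (h : simplexMod R C n ⊗ M ⟶ P)
      (g : simplexMod R C 0 ⊗ N ⟶ P) (hg : simplexMod R C 0 ◁ f ≫ g = (linSMod R C).map v ▷ M ≫ h) :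
      ∃ k, simplexMod R C n ◁ f ≫ k = h ∧ (linSMod R C).map v ▷ N ≫ k = g := by
    have := hW.pushoutProduct_point v hv f
    have := hP _ this.1 this.2
    rw [extendsAlong_iff, hasLiftingProperty_pushoutProduct_iff] at this
    obtain ⟨l, h₁, h₂, -⟩ := this h g (terminal.from _) hg (terminal.hom_ext _ _)
      (terminal.hom_ext _ _)
    exact ⟨l, h₁, h₂⟩
  have h₀ : ExtendsAlong (simplexMod R C 0 ◁ f) P := by
    intro y
    obtain ⟨x, c, hy⟩ := exists_of_mapSpacePrecomp hf y
    rw [faceSum_zero_whiskerRight, Preadditive.sub_comp] at hy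
    -- a homotopy from the restriction of `x` to `y`
    let z : simplexMod R C 1 ⊗ M ⟶ P :=
      degen R C ▷ M ≫ (face R C 0 0 ▷ M ≫ c + simplexMod R C 0 ◁ f ≫ x) - c
    have hz₀ : face R C 0 0 ▷ M ≫ z = simplexMod R C 0 ◁ f ≫ x := by
      rw [Preadditive.comp_sub, face_degen, add_sub_cancel_left]
    have hz₁ : face R C 0 1 ▷ M ≫ z = y := by
      rw [Preadditive.comp_sub, face_degen, hy]
      abel
    obtain ⟨k, hk, -⟩ := key _ (linEquivalences_stdSimplex_map_δ 0) z x hz₀.symm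
    refine ⟨face R C 0 1 ▷ N ≫ k, ?_⟩
    rw [whisker_exchange_assoc, hk, hz₁]
  refine (mapTrivial_iff f P).2 ⟨hf, fun n y => ?_⟩
  obtain ⟨x, hx⟩ := h₀ ((linSMod R C).map (vertex 0) ▷ M ≫ y)
  obtain ⟨k, hk, -⟩ := key (vertex 0) (linEquivalences_vertex 0) y x hx
  exact ⟨k, hk⟩
end

section
open Cardinal Simplicial

/-! ### Left Bousfield localization -/

variable {R : Type (u + 1)} [CommRing R] {C : Type (u + 1)} [Category.{u} C]

lemma mapSpacePrecomp_comp {L M N : SMod R C} (f : L ⟶ M) (g : M ⟶ N) (P : SMod R C) :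
    mapSpacePrecomp (f ≫ g) P = mapSpacePrecomp g P ≫ mapSpacePrecomp f P := by
  refine NatTrans.ext (funext fun n => ?_)
  refine (congrArg (fun k => (preadditiveYoneda.obj P).map (Quiver.Hom.op k))
    (MonoidalCategory.whiskerLeft_comp _ f g)).trans ?_
  exact (preadditiveYoneda.obj P).map_comp _ _

lemma mapSpacePrecomp_id (M P : SMod R C) : mapSpacePrecomp (𝟙 M) P = 𝟙 _ := by
  refine NatTrans.ext (funext fun n => ?_)
  refine (congrArg (fun k => (preadditiveYoneda.obj P).map (Quiver.Hom.op k))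
    (MonoidalCategory.whiskerLeft_id _ M)).trans ?_
  exact (preadditiveYoneda.obj P).map_id _

/-- The contravariant functor `Map(-, P)`. -/
def mapSpaceFunctor (P : SMod R C) :
    (SMod R C)ᵒᵖ ⥤ SimplexCategoryᵒᵖ ⥤ AddCommGrpCat.{u + 1} where
  obj M := mapSpace M.unop P
  map f := mapSpacePrecomp f.unop P
  map_id M := mapSpacePrecomp_id M.unop P
  map_comp f g := mapSpacePrecomp_comp g.unop f.unop P

section

variable (W : MorphismProperty (SMod R C)) {ι : Type (u + 1)} {A B : ι → SMod R C}
  (m : ∀ i, A i ⟶ B i)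

/-- The objects which are fibrant with respect to `W` and local with respect to the morphisms
`m i`. -/
def IsLocalFor (P : SMod R C) : Prop :=
  IsFibrantFor W P ∧
    ∀ i, simplicialWeakEquivalences AddCommGrpCat.{u + 1} (mapSpacePrecomp (m i) P)

/-- The weak equivalences of the left Bousfield localization of `W` at the morphisms `m i`. -/
def bousfield : MorphismProperty (SMod R C) :=
  fun _ _ f => ∀ P, IsLocalFor W m P →
    simplicialWeakEquivalences AddCommGrpCat.{u + 1} (mapSpacePrecomp f P)

instance : (bousfield W m).IsStableUnderRetracts where
  of_retract h hg P hP := ((((simplicialWeakEquivalences AddCommGrpCat.{u + 1}).inverseImage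
      (mapSpaceFunctor P)).unop).of_retract h (hg P hP) :)

instance : (bousfield W m).HasTwoOutOfThreeProperty where
  comp_mem f g hf hg P hP := (((simplicialWeakEquivalences AddCommGrpCat.{u + 1}).inverseImage
      (mapSpaceFunctor P)).unop.comp_mem f g (hf P hP) (hg P hP) :)
  of_postcomp f g hg hfg P hP := MorphismProperty.of_postcomp
    ((simplicialWeakEquivalences AddCommGrpCat.{u + 1}).inverseImage (mapSpaceFunctor P)).unop
    (W' := ((simplicialWeakEquivalences AddCommGrpCat.{u + 1}).inverseImage
      (mapSpaceFunctor P)).unop) f g (hg P hP) (hfg P hP)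
  of_precomp f g hg hfg P hP := MorphismProperty.of_precomp
    ((simplicialWeakEquivalences AddCommGrpCat.{u + 1}).inverseImage (mapSpaceFunctor P)).unop
    (W' := ((simplicialWeakEquivalences AddCommGrpCat.{u + 1}).inverseImage
      (mapSpaceFunctor P)).unop) f g (hg P hP) (hfg P hP)

variable {W}

/-- On monomorphisms, the weak equivalences of the localization are defined by a lifting property. -/
lemma bousfield_iff (hW : IsPreadmissible W) {M N : SMod R C} (f : M ⟶ N) [Mono f] :
    bousfield W m f ↔ ∀ P, IsLocalFor W m P → MapTrivial f P :=
  forall₂_congr fun P hP => ⟨hW.mapTrivial_of_mapSpacePrecomp hP.1 f,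
    fun h => ((mapTrivial_iff f P).1 h).1⟩

/-- Lifting properties are stable under the operations of a weakly saturated class. -/
lemma IsPreadmissible.bousfield (hW : IsPreadmissible W) : IsPreadmissible (bousfield W m) where
  twoOutOfThree := inferInstance
  saturated := by
    have : MorphismProperty.monomorphisms _ ⊓ MotivicCoalgebra.bousfield W m =
        MorphismProperty.monomorphisms _ ⊓ ⨅ P : Subtype (IsLocalFor W m),
          (fun _ _ f => MapTrivial f P.1 : MorphismProperty (SMod R C)) := by
      ext M N f
      refine and_congr_right fun (_ : Mono f) => ?_
      refine (bousfield_iff m hW f).trans (.trans ?_ (MorphismProperty.iInf_iff _ f).symm)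
      exact ⟨fun h P => h P.1 P.2, fun h P hP => h ⟨P, hP⟩⟩
    rw [this]
    exact isWeaklySaturated_monomorphisms.inf (.iInf fun P => isWeaklySaturated_mapTrivial P.1)
  of_objectwise f _ hf :=
    (bousfield_iff m hW f).2 fun _ hP => hW.mapTrivial hP.1 f (hW.of_objectwise f hf)

lemma IsPreadmissible.le_bousfield (hW : IsPreadmissible W) {M N : SMod R C} (f : M ⟶ N) [Mono f]
    (hf : W f) : MotivicCoalgebra.bousfield W m f :=
  (bousfield_iff m hW f).2 fun _ hP => hW.mapTrivial hP.1 f hf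

end

/-- A trivial fibration induces weak equivalences between mapping spaces to fibrant objects,
since it has a section which is a trivial cofibration. -/
lemma IsPreadmissible.mapSpacePrecomp_of_section {W : MorphismProperty (SMod R C)}
    (hW : IsPreadmissible W) {P : SMod R C} (hP : IsFibrantFor W P) {M N : SMod R C}
    (p : M ⟶ N) (hp : W p) (s : N ⟶ M) (hs : s ≫ p = 𝟙 N) :
    simplicialWeakEquivalences AddCommGrpCat.{u + 1} (mapSpacePrecomp p P) := by
  have := hW.twoOutOfThree
  have : IsSplitMono s := ⟨⟨p, hs⟩⟩
  have hsW : W s := MorphismProperty.of_postcomp W s p hp (by rw [hs]; exact hW.of_isIso _)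
  refine MorphismProperty.of_postcomp _ _ (mapSpacePrecomp s P)
    ((mapTrivial_iff s P).1 (hW.mapTrivial hP s hsW)).1 ?_
  rw [← mapSpacePrecomp_comp, hs, mapSpacePrecomp_id]
  intro n
  infer_instance

/-- The factorization of a morphism into a cofibration and a trivial fibration; the latter has a
section since all objects are cofibrant. -/
lemma IsAdmissible.exists_mono_fac {W : MorphismProperty (SMod R C)} (hW : IsAdmissible W)
    {M N : SMod R C} (f : M ⟶ N) :
    ∃ (Z : SMod R C) (i : M ⟶ Z) (p : Z ⟶ N) (s : N ⟶ Z), i ≫ p = f ∧ Mono i ∧ W p ∧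
      s ≫ p = 𝟙 N := by
  obtain ⟨_, hc, hw, -⟩ := (isCoalgebraic_id R C).exists_modelCategory hW (hasCylinders_id R C)
  have F := MorphismProperty.factorizationData (cofibrations (SMod R C))
    (trivialFibrations (SMod R C)) f
  have : Cofibration (initial.to N) := (cofibration_iff _).2 (by
    rw [hc]
    exact (isCoalgebraic_id R C).mono_map_initial N)
  have sq : CommSq (initial.to F.Z) (initial.to N) F.p (𝟙 _) := ⟨initial.hom_ext _ _⟩
  have : Fibration F.p := ⟨F.hp.1⟩
  have : WeakEquivalence F.p := ⟨F.hp.2⟩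
  exact ⟨F.Z, F.i, F.p, sq.lift, F.fac, (hc.le _ F.hi : _), (hw.le _ F.hp.2 : _), sq.fac_right⟩

/-- A set of trivial cofibrations which detects the fibrations. -/
lemma IsAdmissible.exists_trivialCofibrations {W : MorphismProperty (SMod R C)}
    (hW : IsAdmissible W) : ∃ J : MorphismProperty (SMod R C),
      MorphismProperty.IsSmall.{u + 1} J ∧ J ≤ MorphismProperty.monomorphisms _ ⊓ W ∧
      J.rlp ≤ (MorphismProperty.monomorphisms _ ⊓ W).rlp := by
  obtain ⟨_, hc, hw, -, J, -, hJ, -, hJ'⟩ := (isCoalgebraic_id R C).exists_modelCategory hW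
    (hasCylinders_id R C)
  have htc : trivialCofibrations (SMod R C) = MorphismProperty.monomorphisms _ ⊓ W :=
    congr($hc ⊓ $hw)
  obtain ⟨κ, _, _, h⟩ := hJ.exists_cardinal
  refine ⟨J, h.isSmall, htc ▸ hJ'.le, ?_⟩
  rw [← htc, ← MorphismProperty.le_llp_iff_le_rlp]
  exact hJ'.minimal _ (.llp _) J.le_llp_rlp

/-- The local objects of a left Bousfield localization are detected by a set of trivial
cofibrations. -/
lemma IsAdmissible.exists_bousfield {W : MorphismProperty (SMod R C)} (hW : IsAdmissible W)
    {ι : Type (u + 1)} {A B : ι → SMod R C} (m : ∀ i, A i ⟶ B i) :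
    ∃ J : MorphismProperty (SMod R C), MorphismProperty.IsSmall.{u + 1} J ∧
      J ≤ MorphismProperty.monomorphisms _ ⊓ bousfield W m ∧
      J.rlp ≤ (MorphismProperty.monomorphisms _ ⊓ W).rlp ∧
      ∀ P, J.rlp (terminal.from P) → IsLocalFor W m P := by
  obtain ⟨J₀, _, hJW, hJr⟩ := hW.exists_trivialCofibrations
  have hpW := hW.isPreadmissible
  have hloc := hpW.bousfield m
  have hfib {P : SMod R C} (hP : J₀.rlp (terminal.from P)) : IsFibrantFor W P := fun A B i hi hiW =>
    (extendsAlong_iff i P).2 (hJr _ hP _ ⟨hi, hiW⟩)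
  choose Z m' p s hfac hm' hpW' hs using fun i => hW.exists_mono_fac (m i)
  have hp i {P : SMod R C} (hP : IsFibrantFor W P) :
      simplicialWeakEquivalences AddCommGrpCat.{u + 1} (mapSpacePrecomp (m i) P) ↔
        simplicialWeakEquivalences AddCommGrpCat.{u + 1} (mapSpacePrecomp (m' i) P) := by
    rw [← hfac, mapSpacePrecomp_comp]
    exact MorphismProperty.precomp_iff _ _ _
      (hpW.mapSpacePrecomp_of_section hP (p i) (hpW' i) (s i) (hs i))
  have hmi i : bousfield W m (m' i) := fun P hP => (hp i hP.1).1 (hP.2 i)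
  have hsup (I J : MorphismProperty (SMod R C)) [MorphismProperty.IsSmall.{u + 1} I]
      [MorphismProperty.IsSmall.{u + 1} J] : MorphismProperty.IsSmall.{u + 1} (I ⊔ J) :=
    ⟨inferInstanceAs (Small.{u + 1} (I.toSet ∪ J.toSet : Set (Arrow (SMod R C))))⟩
  refine ⟨J₀ ⊔ (.ofHoms (fun i => simplexMod R C 0 ◁ m' i) ⊔
    .ofHoms fun x : ι × ℕ => pushoutProduct (cokerIncl R C x.2) (m' x.1)), ?_, ?_, ?_, ?_⟩
  · have h₁ : MorphismProperty.IsSmall.{u + 1}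
        (.ofHoms fun i => simplexMod R C 0 ◁ m' i) :=
      have : Small.{u + 1} ι := small_self ι
      MorphismProperty.isSmall_ofHoms.{u + 1} _
    have h₂ : MorphismProperty.IsSmall.{u + 1}
        (.ofHoms fun x : ι × ℕ => pushoutProduct (cokerIncl R C x.2) (m' x.1)) :=
      have : Small.{u + 1} (ι × ℕ) := small_self _
      MorphismProperty.isSmall_ofHoms.{u + 1} _
    have h₃ := @hsup _ _ h₁ h₂
    exact @hsup _ _ ‹_› h₃
  · refine sup_le (fun X Y f hf => ⟨(hJW _ hf).1, ?_⟩) (sup_le ?_ ?_)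
    · have : Mono f := (hJW _ hf).1
      exact hpW.le_bousfield m f (hJW _ hf).2
    · rintro _ _ _ ⟨i⟩
      exact ⟨mono_whiskerLeft_of_isFlat (isFlat_linSMod _) _,
        hloc.simplexMod_whiskerLeft _ (hmi i) 0⟩
    · rintro _ _ _ ⟨i, n⟩
      exact ⟨(isSplit_cokerIncl n).mono_pushoutProduct (isFlat_linSMod _) _,
        hloc.pushoutProduct_of_right (isSplit_cokerIncl n) (isFlat_linSMod _) _
          (hloc.simplexCoker_whiskerLeft _ (hmi i) n)
          (hloc.simplexMod_whiskerLeft _ (hmi i) (n + 1))⟩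
  · exact (MorphismProperty.antitone_rlp le_sup_left).trans hJr
  · intro P hP
    have hP₀ := hfib (MorphismProperty.antitone_rlp le_sup_left _ hP)
    refine ⟨hP₀, fun i => (hp i hP₀).2 ((mapTrivial_iff _ P).1 ⟨?_, fun n => ?_⟩).1⟩
    · exact (extendsAlong_iff _ _).2 (hP _ (Or.inr (Or.inl ⟨i⟩)))
    · exact (extendsAlong_iff _ _).2 (hP _ (Or.inr (Or.inr ⟨(i, n)⟩)))
end

section
open Cardinal Simplicial

/-! ### Small subobjects of cell complexes -/

variable {R : Type (u + 1)} [CommRing R] {C : Type (u + 1)} [Category.{u} C]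

section Colimits

variable {J : Type (u + 1)} [SmallCategory J] [IsFiltered J]

lemma exists_El_of_isColimit {F : J ⥤ SMod R C} {c : Cocone F} (hc : IsColimit c) (x : El c.pt) :
    ∃ (j : J) (y : El (F.obj j)), El.map (c.ι.app j) y = x := by
  obtain ⟨j, y, hy⟩ := exists_rep_of_isColimit
    (isColimitOfPreserves ((evaluation _ _).obj x.1.1) hc) x.1.2 x.2
  exact ⟨j, El.mk y, El.mk_inj.2 hy⟩

lemma exists_El_map_eq_of_isColimit {F : J ⥤ SMod R C} {c : Cocone F} (hc : IsColimit c) {j : J}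
    {x y : El (F.obj j)} (h : El.map (c.ι.app j) x = El.map (c.ι.app j) y) :
    ∃ (k : J) (g : j ⟶ k), El.map (F.map g) x = El.map (F.map g) y := by
  obtain ⟨⟨U, n⟩, x⟩ := x
  obtain ⟨⟨V, m⟩, y⟩ := y
  obtain ⟨rfl, rfl⟩ : U = V ∧ n = m := Prod.ext_iff.1 (congrArg Sigma.fst h)
  obtain ⟨k, g, hg⟩ := exists_map_eq_of_isColimit
    (isColimitOfPreserves ((evaluation _ _).obj U) hc) n x y (El.mk_inj.1 h)
  exact ⟨k, g, El.mk_inj.2 hg⟩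

/-- Recognition of filtered colimits in terms of elements. -/
lemma nonempty_isColimit_of_elements {F : J ⥤ SMod R C} (c : Cocone F)
    (h : ∀ x : El c.pt, ∃ (j : J) (y : El (F.obj j)), El.map (c.ι.app j) y = x)
    (h' : ∀ (j : J) (x y : El (F.obj j)), El.map (c.ι.app j) x = El.map (c.ι.app j) y →
      ∃ (k : J) (g : j ⟶ k), El.map (F.map g) x = El.map (F.map g) y) : Nonempty (IsColimit c) := by
  refine ⟨evaluationJointlyReflectsColimits _ fun U => evaluationJointlyReflectsColimits _
    fun n => isColimitOfReflects (forget (ModuleCat.{u + 1} R)) ?_⟩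
  refine Types.FilteredColimit.isColimitOf' _ _ (fun x => ?_) fun j x y hxy => ?_
  · obtain ⟨j, ⟨⟨V, m⟩, y⟩, hy⟩ := h (El.mk x)
    obtain ⟨rfl, rfl⟩ : V = U ∧ m = n := Prod.ext_iff.1 (congrArg Sigma.fst hy)
    exact ⟨j, y, (El.mk_inj.1 hy).symm⟩
  · obtain ⟨k, g, hg⟩ := h' j (El.mk x) (El.mk y) (El.mk_inj.2 hxy)
    exact ⟨k, g, El.mk_inj.1 hg⟩

/-- Filtered colimits are universal: the base change of a filtered colimit to a subobject is a
colimit. -/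
lemma nonempty_isColimit_of_cartesian {F G : J ⥤ SMod R C} (α : F ⟶ G) [∀ j, Mono (α.app j)]
    (c : Cocone F) {d : Cocone G} (hd : IsColimit d) (n : c.pt ⟶ d.pt) (hm : Mono n)
    (hn : ∀ j, c.ι.app j ≫ n = α.app j ≫ d.ι.app j)
    (hα : ∀ (j : J) (y : El (G.obj j)), El.map (d.ι.app j) y ∈ Set.range (El.map n) →
      y ∈ Set.range (El.map (α.app j))) : Nonempty (IsColimit c) := by
  have hn' (j) (z : El (F.obj j)) : El.map n (El.map (c.ι.app j) z) =
      El.map (d.ι.app j) (El.map (α.app j) z) := by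
    rw [← El.map_comp, hn, El.map_comp]
  refine nonempty_isColimit_of_elements c (fun x => ?_) fun j x y hxy => ?_
  · obtain ⟨j, y, hy⟩ := exists_El_of_isColimit hd (El.map n x)
    obtain ⟨z, rfl⟩ := hα j y ⟨x, hy.symm⟩
    exact ⟨j, z, El.map_injective n ((hn' j z).trans hy)⟩
  · obtain ⟨k, g, hg⟩ := exists_El_map_eq_of_isColimit hd (x := El.map (α.app j) x)
      (y := El.map (α.app j) y) (by rw [← hn', ← hn', hxy])
    refine ⟨k, g, El.map_injective (α.app k) ?_⟩
    rw [← El.map_comp, ← El.map_comp, α.naturality, El.map_comp, El.map_comp, hg]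

end Colimits

namespace Sub

variable {J : Type*} [Category* J]

lemma lift_mem {M N : SMod R C} (S : Sub N) (f : M ⟶ N) (h : ∀ x, El.map f x ∈ S.set) :
    ∀ U n x, (f.app U).app n x ∈ S.carrier U n := fun _ _ x => h (El.mk x)

lemma ι_mem {M : SMod R C} (S : Sub M) (x : El S.toSMod) : El.map S.ι x ∈ S.set := x.2.2

lemma range_ι {M : SMod R C} (S : Sub M) : Set.range (El.map S.ι) = S.set := by
  ext x
  exact ⟨fun ⟨y, hy⟩ => hy ▸ S.ι_mem y, fun hx => ⟨El.mk (⟨x.2, hx⟩ : S.carrier x.1.1 x.1.2), rfl⟩⟩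

/-- The functor of inverse images of a subobject of the vertex of a cocone. -/
def functor {F : J ⥤ SMod R C} {c : Cocone F} (S : Sub c.pt) : J ⥤ SMod R C where
  obj j := (S.comap (c.ι.app j)).toSMod
  map {i j} g := (S.comap (c.ι.app j)).lift ((S.comap (c.ι.app i)).ι ≫ F.map g)
    (lift_mem _ _ fun x => by
      rw [set_comap, Set.mem_preimage, ← El.map_comp, Category.assoc, c.w, El.map_comp]
      exact ι_mem _ x)
  map_id j := by
    rw [← cancel_mono (S.comap (c.ι.app j)).ι, lift_ι, CategoryTheory.Functor.map_id,
      Category.comp_id, Category.id_comp]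
  map_comp {i j k} g h := by
    rw [← cancel_mono (S.comap (c.ι.app k)).ι, lift_ι, Category.assoc, lift_ι,
      ← Category.assoc, lift_ι, Category.assoc, CategoryTheory.Functor.map_comp]

/-- The inclusion of the functor of inverse images. -/
def functorι {F : J ⥤ SMod R C} {c : Cocone F} (S : Sub c.pt) : S.functor ⟶ F where
  app j := (S.comap (c.ι.app j)).ι
  naturality _ _ _ := rfl

/-- The cocone given by the functor of inverse images. -/
def cocone {F : J ⥤ SMod R C} {c : Cocone F} (S : Sub c.pt) : Cocone S.functor where
  pt := S.toSMod
  ι :=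
    { app j := S.comapHom (c.ι.app j)
      naturality i j g := by
        have : Mono S.ι := inferInstance
        refine (cancel_mono S.ι).1 ?_
        change (S.comap (c.ι.app i)).ι ≫ F.map g ≫ c.ι.app j = (S.comap (c.ι.app i)).ι ≫ c.ι.app i
        rw [c.w] }

end Sub

section

variable (W : MorphismProperty (SMod R C)) (κ : Cardinal.{u + 1})

/-- The monomorphisms which restrict to morphisms in `W` over club many subobjects of their
target. -/
def clubMonos : MorphismProperty (SMod R C) := fun _ B f => Mono f ∧
  HasClub κ (fun S : Set (El B) => ∃ N : Sub B, N.set = S ∧ W (N.comapHom f))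

end
end

section
open Cardinal Simplicial

variable {R : Type (u + 1)} [CommRing R] {C : Type (u + 1)} [Category.{u} C]

lemma HasClub.of_unary' {α : Type w} {κ : Cardinal.{w}} (hκ : 1 < κ) (F : α → α) :
    HasClub κ (fun S => ∀ x ∈ S, F x ∈ S) :=
  (HasClub.of_unary (fun x => {F x}) (fun x => by simpa using hκ) (zero_lt_one.trans hκ)).mono
    fun S hS x hx => hS x hx rfl

namespace Sub

/-- If the target of `f` retracts onto a subobject `N`, compatibly with an endomorphism of
the source of `f`, then `f` retracts onto its restriction to `N`. -/
lemma comapHom_mem_of_retraction {W : MorphismProperty (SMod R C)} [W.IsStableUnderRetracts]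
    {A B : SMod R C} (f : A ⟶ B) [Mono f] (hf : W f) (N : Sub B) (a : A ⟶ A) (b : B ⟶ B)
    (h : a ≫ f = f ≫ b) (hb : ∀ y, El.map b y ∈ N.set) (hN : N.ι ≫ b = N.ι) :
    W (N.comapHom f) := by
  have ha (x : El A) : El.map a x ∈ (N.comap f).set := by
    rw [set_comap, Set.mem_preimage, ← El.map_comp, h, El.map_comp]
    exact hb _
  have hr : RetractArrow (N.comapHom f) f :=
    { i := Arrow.homMk (N.comap f).ι N.ι rfl
      r := Arrow.homMk ((N.comap f).lift a ((N.comap f).lift_mem a ha))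
        (N.lift b (N.lift_mem b hb)) (by
          refine (cancel_mono N.ι).1 ?_
          change a ≫ f = f ≫ b
          exact h)
      retract := by
        refine Arrow.hom_ext _ _ ?_ ?_
        · refine (cancel_mono ((N.comap f).ι ≫ f)).1 ?_
          change (N.comap f).ι ≫ a ≫ f = (N.comap f).ι ≫ f
          rw [h]
          exact (comapHom_ι f N) ▸ congr(N.comapHom f ≫ $hN)
        · refine (cancel_mono N.ι).1 ?_
          exact hN }
  exact W.of_retract hr hf

end Sub

/-- Each element of a coproduct is supported by finitely many summands. -/
lemma exists_finset_of_isColimit {ι : Type (u + 1)} {F : Discrete ι ⥤ SMod R C} {c : Cocone F}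
    (hc : IsColimit c) (U : Cᵒᵖ) (n : SimplexCategoryᵒᵖ) (y : (c.pt.obj U).obj n) :
    ∃ (s : Finset ι) (x : ∀ i, ((F.obj ⟨i⟩).obj U).obj n),
      y = ∑ i ∈ s, ((c.ι.app ⟨i⟩).app U).app n (x i) := by
  let E : SMod R C ⥤ ModuleCat R := (evaluation _ _).obj U ⋙ (evaluation _ _).obj n
  have hc' := (IsColimit.precomposeInvEquiv (Discrete.natIsoFunctor (F := F ⋙ E))
    (E.mapCocone c)).symm (isColimitOfPreserves E hc)
  obtain ⟨s, x, hx⟩ := exists_of_isColimit_cofan hc' y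
  exact ⟨s, x, hx⟩

/-- The projection of a coproduct onto a part of its summands. -/
lemma exists_projection {ι : Type (u + 1)} {F : Discrete ι ⥤ SMod R C} {c : Cocone F}
    (hc : IsColimit c) (p : ι → Prop) : ∃ a : c.pt ⟶ c.pt,
      (∀ i, p i → c.ι.app ⟨i⟩ ≫ a = c.ι.app ⟨i⟩) ∧ ∀ i, ¬ p i → c.ι.app ⟨i⟩ ≫ a = 0 := by
  classical
  let d : Cocone F := Cocone.mk c.pt
    { app i := if p i.as then c.ι.app i else 0
      naturality := by
        rintro ⟨i⟩ ⟨j⟩ ⟨⟨h : i = j⟩⟩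
        subst h
        refine (congrArg (· ≫ _) (F.map_id _)).trans ?_
        exact (Category.id_comp _).trans (Category.comp_id _).symm }
  exact ⟨hc.desc d, fun i hi => (hc.fac d ⟨i⟩).trans (if_pos hi),
    fun i hi => (hc.fac d ⟨i⟩).trans (if_neg hi)⟩

namespace clubMonos

variable {W : MorphismProperty (SMod R C)} {κ : Cardinal.{u + 1}} (hκ : IsLarge R C κ)
include hκ

lemma one_lt : 1 < κ := one_lt_aleph0.trans hκ.aleph0_lt

/-- A subobject of `Y` which is stable under the idempotent of `Y` with image `B` restricts to a
subobject of `B` over which `f` is a retract of the restriction of `g`. -/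
lemma of_retract [W.IsStableUnderRetracts] {A B X Y : SMod R C} {f : A ⟶ B} {g : X ⟶ Y}
    (h : RetractArrow f g) (hg : clubMonos W κ g) : clubMonos W κ f := by
  have hf : Mono f := (MorphismProperty.monomorphisms _).of_retract h hg.1
  have : Mono h.i.right := h.right.splitMono.mono
  refine ⟨hf, ((hg.2.and hκ.isRegular (HasClub.of_unary' (one_lt hκ)
    (El.map (h.r.right ≫ h.i.right)))).restrict (El.map_injective h.i.right)).mono ?_⟩
  rintro S ⟨_, rfl, ⟨M, rfl, hM⟩, he⟩
  refine ⟨M.comap h.i.right, rfl, ?_⟩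
  have hil (x : El A) (hx : El.map f x ∈ (M.comap h.i.right).set) :
      El.map h.i.left x ∈ (M.comap g).set := by
    rw [Sub.set_comap, Set.mem_preimage, ← El.map_comp] at hx ⊢
    rwa [show h.i.left ≫ g = f ≫ h.i.right from h.i.w]
  have hrr (y : El Y) (hy : y ∈ M.set) : El.map h.r.right y ∈ (M.comap h.i.right).set := by
    rw [Sub.set_comap, Set.mem_preimage, ← El.map_comp]
    exact he y hy
  have hrl (x : El X) (hx : El.map g x ∈ M.set) :
      El.map h.r.left x ∈ ((M.comap h.i.right).comap f).set := by
    rw [Sub.set_comap, Set.mem_preimage, ← El.map_comp, show h.r.left ≫ f = g ≫ h.r.right from h.r.w,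
      El.map_comp]
    exact hrr _ hx
  have hr : RetractArrow ((M.comap h.i.right).comapHom f) (M.comapHom g) :=
    { i := Arrow.homMk ((M.comap g).lift (((M.comap h.i.right).comap f).ι ≫ h.i.left)
          (Sub.lift_mem _ _ fun x => by rw [El.map_comp]; exact hil _ x.2.2))
          (M.comapHom h.i.right) (by
            refine (cancel_mono M.ι).1 ?_
            change ((M.comap h.i.right).comap f).ι ≫ h.i.left ≫ g =
              ((M.comap h.i.right).comap f).ι ≫ f ≫ h.i.right
            rw [show h.i.left ≫ g = f ≫ h.i.right from h.i.w])
      r := Arrow.homMk (((M.comap h.i.right).comap f).lift ((M.comap g).ι ≫ h.r.left)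
          (Sub.lift_mem _ _ fun x => by rw [El.map_comp]; exact hrl _ x.2.2))
          ((M.comap h.i.right).lift (M.ι ≫ h.r.right)
            (Sub.lift_mem _ _ fun x => by rw [El.map_comp]; exact hrr _ x.2.2)) (by
            refine (cancel_mono (M.comap h.i.right).ι).1 ?_
            change (M.comap g).ι ≫ h.r.left ≫ f = (M.comap g).ι ≫ g ≫ h.r.right
            rw [show h.r.left ≫ f = g ≫ h.r.right from h.r.w])
      retract := by
        refine Arrow.hom_ext _ _ ?_ ?_
        · refine (cancel_mono ((M.comap h.i.right).comap f).ι).1 ?_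
          change ((M.comap h.i.right).comap f).ι ≫ h.i.left ≫ h.r.left = _
          rw [show h.i.left ≫ h.r.left = 𝟙 _ from h.retract_left]
          exact (Category.comp_id _).trans (Category.id_comp _).symm
        · refine (cancel_mono (M.comap h.i.right).ι).1 ?_
          change (M.comap h.i.right).ι ≫ h.i.right ≫ h.r.right = _
          rw [show h.i.right ≫ h.r.right = 𝟙 _ from h.retract_right]
          exact (Category.comp_id _).trans (Category.id_comp _).symm }
  exact W.of_retract hr hM

/-- The restrictions of `f` are in `W` if those of `g` and of `f ≫ g` are, by the two-out-of-three
property. -/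
lemma of_comp [W.HasTwoOutOfThreeProperty] {A B L : SMod R C} {f : A ⟶ B} {g : B ⟶ L}
    [Mono f] (hg : clubMonos W κ g) (hfg : clubMonos W κ (f ≫ g)) : clubMonos W κ f := by
  have : Mono g := hg.1
  refine ⟨inferInstance, ((hg.2.and hκ.isRegular hfg.2).restrict (El.map_injective g)).mono ?_⟩
  rintro S ⟨_, rfl, ⟨M, rfl, hM⟩, M', hM', hM''⟩
  obtain rfl := Sub.ext_set hM'
  exact ⟨M'.comap g, rfl, W.of_postcomp ((M'.comap g).comapHom f) (M'.comapHom g) hM hM''⟩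

/-- A subobject `N` of the pushout which is generated by its traces on `A` and on `Y` is the
pushout of these traces. -/
lemma of_isPushout (hW : IsPreadmissible W) {X Y A B : SMod R C} {a : X ⟶ A} {j : X ⟶ Y}
    {f : A ⟶ B} {b : Y ⟶ B} (sq : IsPushout a j f b) (hj : clubMonos W κ j) :
    clubMonos W κ f := by
  have : Mono j := hj.1
  have hf : Mono f := isWeaklySaturated_monomorphisms.cobaseChange.of_isPushout sq hj.1
  have sq' (U : Cᵒᵖ) (n : SimplexCategoryᵒᵖ) :=
    (sq.map ((evaluation _ _).obj U)).map ((evaluation _ _).obj n)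
  have hz (z : El B) : ∃ (y : (Y.obj z.1.1).obj z.1.2) (x : (A.obj z.1.1).obj z.1.2),
      z.2 = (f.app z.1.1).app z.1.2 x + (b.app z.1.1).app z.1.2 y := by
    obtain ⟨x, y, h⟩ := exists_of_isPushout (sq' z.1.1 z.1.2) z.2
    exact ⟨y, x, h⟩
  choose y x hz using hz
  let F : El B ⊕ El Y → El B ⊕ El Y := Sum.elim (fun z => .inr (El.mk (y z)))
    fun y => .inl (El.map b y)
  refine ⟨hf, (((((Sub.hasClub hκ B).preimage hκ.isRegular Sum.inl_injective).and hκ.isRegular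
    (hj.2.preimage hκ.isRegular Sum.inr_injective)).and hκ.isRegular
      (HasClub.of_unary' (one_lt hκ) F)).restrict Sum.inl_injective).mono ?_⟩
  rintro S ⟨S', rfl, ⟨⟨N, hN⟩, M, hM, hMW⟩, hS'⟩
  refine ⟨N, hN, ?_⟩
  have hb (y : El Y) (hy : y ∈ M.set) : El.map b y ∈ N.set := by
    rw [hN]
    exact hS' (.inr y) (hM ▸ hy :)
  have ha (x : El X) (hx : El.map j x ∈ M.set) : El.map a x ∈ (N.comap f).set := by
    rw [Sub.set_comap, Set.mem_preimage, ← El.map_comp, sq.w, El.map_comp]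
    exact hb _ hx
  have hy (z : El B) (h : z ∈ N.set) : El.mk (y z) ∈ M.set := by
    rw [hM]
    exact hS' (.inl z) (hN ▸ h :)
  let b' : M.toSMod ⟶ N.toSMod := N.lift (M.ι ≫ b)
    (Sub.lift_mem _ _ fun x => by rw [El.map_comp]; exact hb _ x.2.2)
  let a' : (M.comap j).toSMod ⟶ (N.comap f).toSMod := (N.comap f).lift ((M.comap j).ι ≫ a)
    (Sub.lift_mem _ _ fun x => by rw [El.map_comp]; exact ha _ x.2.2)
  have w : a' ≫ N.comapHom f = M.comapHom j ≫ b' := by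
    refine (cancel_mono N.ι).1 ?_
    change (M.comap j).ι ≫ a ≫ f = (M.comap j).ι ≫ j ≫ b
    rw [sq.w]
  refine (hW.pushout (f := a') (i := M.comapHom j) (i' := N.comapHom f) (f' := b')
    (.of_forall_isPushout_app fun U => .of_forall_isPushout_app fun n =>
      isPushout_of_elements ?_ ?_ ?_) inferInstance hMW).2
  · exact congr(($w).app U |>.app n)
  · intro z
    have h : z.1 = (f.app U).app n (x (El.mk z.1)) + (b.app U).app n (y (El.mk z.1)) :=
      hz (El.mk z.1)
    have h₁ : (b.app U).app n (y (El.mk z.1)) ∈ N.carrier U n :=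
      hb _ (hy (El.mk z.1) z.2)
    have h₂ : (f.app U).app n (x (El.mk z.1)) ∈ N.carrier U n := by
      rw [← add_sub_cancel_right ((f.app U).app n (x (El.mk z.1)))
        ((b.app U).app n (y (El.mk z.1)))]
      exact sub_mem (by rw [← h]; exact z.2) h₁
    exact ⟨⟨x (El.mk z.1), h₂⟩, ⟨y (El.mk z.1), hy (El.mk z.1) z.2⟩, Subtype.ext h⟩
  · intro x₂ x₃ h
    obtain ⟨x₁, h₁, h₂⟩ := exists_of_isPushout_of_eq_zero (sq' U n) x₂.1 x₃.1
      congr(($h).1)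
    refine ⟨⟨x₁, ?_⟩, Subtype.ext h₁, Subtype.ext h₂⟩
    change (j.app U).app n x₁ ∈ M.carrier U n
    exact (h₂ ▸ neg_mem x₃.2 :)

/-- A coproduct of small monomorphisms retracts onto each of its partial coproducts. -/
lemma of_coproducts (hW : IsPreadmissible W) [W.IsStableUnderRetracts]
    {I : MorphismProperty (SMod R C)} (hI : I ≤ MorphismProperty.monomorphisms _ ⊓ W)
    (hI' : ∀ ⦃A B : SMod R C⦄ (f : A ⟶ B), I f → #(El B) < κ) {X Y : SMod R C} (j : X ⟶ Y)
    (hj : MorphismProperty.coproducts.{u + 1} I j) : clubMonos W κ j := by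
  classical
  have hjW : (MorphismProperty.monomorphisms _ ⊓ W) j := by
    have := hW.saturated.coproducts
    exact MorphismProperty.coproducts_le (MorphismProperty.monomorphisms _ ⊓ W) _
      (MorphismProperty.coproducts_monotone hI _ hj)
  obtain ⟨ι, hj⟩ := (MorphismProperty.coproducts_iff _ _).1 hj
  have hjm : Mono j := hjW.1
  refine ⟨hjm, ?_⟩
  obtain ⟨X₁, X₂, c₁, c₂, h₁, h₂, f, hf⟩ := hj
  let j := h₁.desc (Cocone.mk _ (f ≫ c₂.ι))
  have hj i : c₁.ι.app i ≫ j = f.app i ≫ c₂.ι.app i := h₁.fac _ i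
  choose s x hx using fun y : El c₂.pt => exists_finset_of_isColimit h₂ y.1.1 y.1.2 y.2
  refine ((Sub.hasClub hκ c₂.pt).and hκ.isRegular (HasClub.of_unary
    (fun y => Set.range fun z : Σ i : ULift.{u + 1} (s y), El (X₂.obj ⟨i.down.1⟩) =>
      El.map (c₂.ι.app _) z.2) (fun y => ?_) hκ.pos)).mono ?_
  · exact mk_range_le.trans_lt (hκ.sigma_lt ((lt_aleph0_of_finite _).trans hκ.aleph0_lt)
      fun i => hI' _ (hf ⟨_⟩))
  rintro _ ⟨⟨N, rfl⟩, hN⟩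
  refine ⟨N, rfl, ?_⟩
  let p (i : ι) : Prop := Set.range (El.map (c₂.ι.app ⟨i⟩)) ⊆ N.set
  obtain ⟨a, ha, ha'⟩ := exists_projection h₁ p
  obtain ⟨b, hb, hb'⟩ := exists_projection h₂ p
  refine N.comapHom_mem_of_retraction j hjW.2 a b (h₁.hom_ext ?_) ?_ ?_
  · rintro ⟨i⟩
    by_cases hi : p i
    · rw [reassoc_of% ha i hi, hj, reassoc_of% hj, hb i hi]
    · rw [reassoc_of% ha' i hi, zero_comp, reassoc_of% hj, hb' i hi, comp_zero]
  · rintro ⟨⟨U, n⟩, y⟩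
    change (b.app U).app n y ∈ N.carrier U n
    rw [show y = _ from hx (El.mk y), map_sum]
    refine sum_mem fun i _ => ?_
    by_cases hi : p i
    · have := congr(NatTrans.app (NatTrans.app $(hb i hi) U) n (x (El.mk y) i))
      refine Set.mem_of_eq_of_mem this ?_
      exact hi ⟨El.mk (x (El.mk y) i), rfl⟩
    · have := congr(NatTrans.app (NatTrans.app $(hb' i hi) U) n (x (El.mk y) i))
      exact Set.mem_of_eq_of_mem this (zero_mem _)
  · refine NatTrans.ext (funext fun U => NatTrans.ext (funext fun n => ModuleCat.hom_ext
      (LinearMap.ext fun y => ?_)))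
    change (b.app U).app n y.1 = y.1
    conv_lhs => rw [show y.1 = _ from hx (El.mk y.1), map_sum]
    refine Eq.trans (Finset.sum_congr rfl fun i hi => ?_) (hx (El.mk y.1)).symm
    have hi : p i := by
      rintro _ ⟨z, rfl⟩
      exact hN (El.mk y.1) y.2 ⟨⟨⟨i, hi⟩, z⟩, rfl⟩
    exact congr(NatTrans.app (NatTrans.app $(hb i hi) U) n (x (El.mk y.1) i))

end clubMonos
end

section
open Cardinal Simplicial

variable {R : Type (u + 1)} [CommRing R] {C : Type (u + 1)} [Category.{u} C]

lemma Sub.mono_ι {M : SMod R C} (S : Sub M) : Mono S.ι := inferInstance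

lemma Sub.mono_lift {M N : SMod R C} (S : Sub N) (f : M ⟶ N) (_ : Mono f) (h) : Mono (S.lift f h) :=
  have : Mono (S.lift f h ≫ S.ι) := by rwa [S.lift_ι]
  mono_of_mono _ S.ι

/-- The inverse image of a subobject by an isomorphism. -/
def Sub.comapIso {M N : SMod R C} (e : M ≅ N) {S : Sub M} {T : Sub N} (h : S = T.comap e.hom) :
    S.toSMod ≅ T.toSMod where
  hom := T.lift (S.ι ≫ e.hom) (lift_mem _ _ fun x => by
    rw [El.map_comp]
    exact (congrArg Sub.set h).subset (S.ι_mem x))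
  inv := S.lift (T.ι ≫ e.inv) (lift_mem _ _ fun x => by
    rw [El.map_comp, h, set_comap, Set.mem_preimage, ← El.map_comp e.inv, e.inv_hom_id]
    exact T.ι_mem x)
  hom_inv_id := by
    refine (cancel_mono S.ι).1 ?_
    change S.ι ≫ e.hom ≫ e.inv = S.ι
    rw [e.hom_inv_id, Category.comp_id]
  inv_hom_id := by
    refine (cancel_mono T.ι).1 ?_
    change T.ι ≫ e.inv ≫ e.hom = T.ι
    rw [e.inv_hom_id, Category.comp_id]

namespace clubMonos

variable {W : MorphismProperty (SMod R C)} {κ : Cardinal.{u + 1}} (hκ : IsLarge R C κ)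

lemma lift_mem_of_comapHom_mem {A B : SMod R C} (f : A ⟶ B) (N : Sub B) (N' : Sub A)
    (h : N' = N.comap f) (hW : W (N.comapHom f)) (h') : W (N.lift (N'.ι ≫ f) h') := by
  subst h
  exact hW

include hκ

/-- The inverse images of a subobject of the colimit of a transfinite composition form
a transfinite composition, since filtered colimits are universal. -/
lemma of_transfiniteComposition (hW : IsPreadmissible W) {J : Type (u + 1)} [LinearOrder J]
    [SuccOrder J] [OrderBot J] [WellFoundedLT J] (hJ : #J < κ) {A B : SMod R C} {f : A ⟶ B}
    (h : (clubMonos W κ).TransfiniteCompositionOfShape J f) : clubMonos W κ f := by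
  have hm := isWeaklySaturated_monomorphisms (R := R) (C := C).transfinite
  let h' : (MorphismProperty.monomorphisms (SMod R C)).TransfiniteCompositionOfShape J f :=
    h.ofLE fun _ _ _ hf => hf.1
  have hf : Mono f := MorphismProperty.transfiniteCompositionsOfShape_le _ J _ h'.mem
  have hincl (j : J) : Mono (h.incl.app j) := h'.mem_incl_app j
  let c : Cocone h.F := Cocone.mk B h.incl
  refine ⟨hf, ((Sub.hasClub hκ B).and hκ.isRegular (HasClub.forall_of_lt hκ.isRegular hJ
    (P := fun j S => ¬ IsMax j → ∃ N : Sub (h.F.obj (Order.succ j)),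
      N.set = El.map (h.incl.app (Order.succ j)) ⁻¹' S ∧
        W (N.comapHom (h.F.map (homOfLE (Order.le_succ j))))) fun j => ?_)).mono ?_⟩
  · by_cases hj : IsMax j
    · exact HasClub.of_forall hκ.pos fun S h => (h hj).elim
    · exact ((h.map_mem j hj).2.preimage hκ.isRegular
        (El.map_injective (h.incl.app (Order.succ j)))).mono fun S h _ => h
  rintro _ ⟨⟨N, rfl⟩, hN⟩
  refine ⟨N, rfl, ?_⟩
  have hcomap {i j : J} (g : i ⟶ j) :
      N.comap (h.incl.app i) = (N.comap (h.incl.app j)).comap (h.F.map g) := by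
    refine Sub.ext_set ?_
    ext x
    rw [Sub.set_comap, Sub.set_comap, Sub.set_comap, Set.mem_preimage, Set.mem_preimage,
      Set.mem_preimage, ← El.map_comp, show h.F.map g ≫ h.incl.app j = h.incl.app i from c.w g]
  have hcomap' : N.comap (h.incl.app ⊥) = (N.comap f).comap h.isoBot.hom := by
    refine Sub.ext_set ?_
    ext x
    rw [Sub.set_comap, Sub.set_comap, Sub.set_comap, Set.mem_preimage, Set.mem_preimage,
      Set.mem_preimage, ← El.map_comp,
      show h.isoBot.hom ≫ f = h.incl.app ⊥ from (Iso.inv_comp_eq _).1 h.fac |>.symm]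
  let N' : Sub c.pt := N
  have hcart {i j : J} (g : i ⟶ j) (x : El (h.F.obj i))
      (hx : El.map (h.F.map g) x ∈ Set.range (El.map (N.comap (h.incl.app j)).ι)) :
      x ∈ Set.range (El.map (N.comap (h.incl.app i)).ι) := by
    rw [Sub.range_ι] at hx ⊢
    rw [hcomap g]
    exact hx
  have : N'.functor.IsWellOrderContinuous := ⟨fun m hm => by
    have : Nonempty (Set.Iio m) := hm.nonempty_Iio.to_subtype
    have (j : Set.Iio m) : Mono (((Set.principalSegIio m).monotone.functor.whiskerLeft
        N'.functorι).app j) := inferInstanceAs (Mono (N.comap (h.incl.app j.1)).ι)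
    refine nonempty_isColimit_of_cartesian ((Set.principalSegIio m).monotone.functor.whiskerLeft
      N'.functorι) ((Set.principalSegIio m).cocone N'.functor)
        (h.F.isColimitOfIsWellOrderContinuous m hm) (N.comap (h.incl.app m)).ι (Sub.mono_ι _)
          (fun _ => rfl) ?_
    exact fun j x hx => hcart _ x hx⟩
  have (j : J) : Mono (N'.functorι.app j) := inferInstanceAs (Mono (N.comap (h.incl.app j)).ι)
  obtain ⟨hc⟩ := nonempty_isColimit_of_cartesian N'.functorι N'.cocone h.isColimit N'.ι N'.mono_ι
    (fun _ => rfl) fun j x hx => by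
      change El.map (h.incl.app j) x ∈ Set.range (El.map N.ι) at hx
      change x ∈ Set.range (El.map (N.comap (h.incl.app j)).ι)
      rw [Sub.range_ι] at hx ⊢
      exact hx
  have ht := hW.saturated.transfinite
  have : (MorphismProperty.monomorphisms _ ⊓ W) (N.comapHom f) := by
    refine MorphismProperty.transfiniteCompositionsOfShape_le _ J _ ⟨{
      F := N'.functor
      isoBot := Sub.comapIso h.isoBot hcomap'
      incl := N'.cocone.ι
      isColimit := hc
      fac := by
        refine (cancel_mono N.ι).1 ?_
        change (N.comap f).ι ≫ h.isoBot.inv ≫ h.incl.app ⊥ = (N.comap f).ι ≫ f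
        rw [h.fac]
      map_mem j hj := by
        obtain ⟨M, hM, hMW⟩ := hN j hj
        obtain rfl : M = N.comap (h.incl.app (Order.succ j)) := Sub.ext_set hM
        have : Mono (h.F.map (homOfLE (Order.le_succ j))) := h'.map_mem j hj
        exact ⟨Sub.mono_lift _ _ (mono_comp (N.comap (h.incl.app j)).ι _) _,
          lift_mem_of_comapHom_mem _ _ _ (hcomap _) hMW _⟩ }⟩
  exact this.2

end clubMonos

/-- The relative cell complexes whose cells are small morphisms in `W`, and their retracts,
restrict to morphisms in `W` over club many subobjects of their target. -/
lemma IsPreadmissible.exists_llp_rlp_le_clubMonos {W : MorphismProperty (SMod R C)}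
    (hW : IsPreadmissible W) [W.IsStableUnderRetracts] (I : MorphismProperty (SMod R C))
    [MorphismProperty.IsSmall.{u + 1} I] (hI : I ≤ MorphismProperty.monomorphisms _ ⊓ W) :
    ∃ κ₀ : Cardinal.{u + 1}, ∀ κ : Cardinal.{u + 1}, κ.IsRegular → κ₀ ≤ κ →
      I.rlp.llp ≤ clubMonos W κ := by
  have : MorphismProperty.HasSmallObjectArgument.{u + 1} I :=
    (isCoalgebraic_id R C).hasSmallObjectArgument I
  obtain ⟨κ₁, h₁⟩ := exists_isLarge (R := R) (C := C)
  let c : Cardinal.{u + 1} := iSup fun f : Shrink.{u + 1} I.toSet =>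
    #(El ((equivShrink I.toSet).symm f).1.right)
  refine ⟨max κ₁ (Order.succ (max c #(I.smallObjectκ.ord.ToType))), fun κ hκ h => ?_⟩
  have hκ' := h₁ κ hκ (le_of_max_le_left h)
  have h₂ := Order.succ_le_iff.1 (le_of_max_le_right h)
  have hI' ⦃A B : SMod R C⦄ (f : A ⟶ B) (hf : I f) : #(El B) < κ := by
    refine lt_of_le_of_lt ?_ ((le_max_left _ _).trans_lt h₂)
    have := le_ciSup (f := fun f : Shrink.{u + 1} I.toSet =>
      #(El ((equivShrink I.toSet).symm f).1.right)) bddAbove_of_small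
      (equivShrink I.toSet ⟨Arrow.mk f, hf⟩)
    rw [Equiv.symm_apply_apply] at this
    exact this
  rw [MorphismProperty.llp_rlp_of_hasSmallObjectArgument']
  rintro A B f ⟨X, Y, g, hr, ⟨hg⟩⟩
  refine clubMonos.of_retract hκ' hr (clubMonos.of_transfiniteComposition hκ' hW
    ((le_max_right _ _).trans_lt h₂) (hg.ofLE ?_))
  rintro _ _ _ ⟨_, _, _, _, _, hj, sq⟩
  exact clubMonos.of_isPushout hκ' hW sq (clubMonos.of_coproducts hκ' hW hI hI' _ hj)
end

section
open Cardinal Simplicial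

/-! ### Admissibility of left Bousfield localizations -/

variable {R : Type (u + 1)} [CommRing R] {C : Type (u + 1)} [Category.{u} C]
  {W : MorphismProperty (SMod R C)}

/-- If `q` is a fibration and the monomorphism `j = i ≫ q` induces surjective weak equivalences
between the mapping spaces to the source and to the target of `q`, then `j` is a retract of `i`:
there is a morphism `s` with `j ≫ s = i` such that `s ≫ q` is homotopic to the identity relative
to `j`, and such a homotopy lifts to a homotopy from `s` to a section of `q`. -/
lemma IsPreadmissible.exists_section (hW : IsPreadmissible W) {A E L : SMod R C} (i : A ⟶ E)
    (q : E ⟶ L) [Mono (i ≫ q)] (hq : (MorphismProperty.monomorphisms _ ⊓ W).rlp q)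
    (hE : MapTrivial (i ≫ q) E) (hL : MapTrivial (i ≫ q) L) :
    ∃ s : L ⟶ E, s ≫ q = 𝟙 L ∧ (i ≫ q) ≫ s = i := by
  let θ (M : SMod R C) : simplexMod R C 0 ⊗ M ≅ M := (tensPoint R C).app M
  obtain ⟨j, hj⟩ : ∃ j, j = i ≫ q := ⟨_, rfl⟩
  have hθ : simplexMod R C 0 ◁ j ≫ (θ L).hom = (θ A).hom ≫ j := (tensPoint R C).hom.naturality j
  rw [← hj] at hE hL ‹Mono (i ≫ q)› ⊢
  obtain ⟨s, hs⟩ := hE.1 ((θ A).hom ≫ i)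
  obtain ⟨-, h⟩ := (mapSpacePrecomp_iff j L).1 ((mapTrivial_iff j L).1 hL)
  obtain ⟨c, hc, hc'⟩ := h 0 0 (s ≫ q - (θ L).hom)
    ((congrArg (· ≫ _) (map_zero (whiskerRightHom L))).trans zero_comp) (by
      rw [Preadditive.comp_sub, reassoc_of% hs, hθ, hj, sub_self, comp_zero])
  rw [faceSum_zero_whiskerRight, Preadditive.sub_comp] at hc'
  -- the homotopy `c`, corrected so that it ends at the identity
  let k : simplexMod R C 1 ⊗ L ⟶ L := c + degen R C ▷ L ≫ ((θ L).hom - face R C 0 1 ▷ L ≫ c)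
  have hk₀ : face R C 0 0 ▷ L ≫ k = s ≫ q := by
    rw [Preadditive.comp_add, face_degen]
    have : s ≫ q = face R C 0 0 ▷ L ≫ c - face R C 0 1 ▷ L ≫ c + (θ L).hom :=
      eq_add_of_sub_eq hc'.symm
    rw [this]
    abel
  have hk₁ : face R C 0 1 ▷ L ≫ k = (θ L).hom := by
    rw [Preadditive.comp_add, face_degen, add_sub_cancel]
  have hk : simplexMod R C 1 ◁ j ≫ k = degen R C ▷ A ≫ (θ A).hom ≫ j := by
    rw [Preadditive.comp_add, hc, zero_add, whisker_exchange_assoc, Preadditive.comp_sub, hθ,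
      whisker_exchange_assoc, hc, comp_zero, sub_zero]
  have hp := hW.pushoutProduct_point _ (linEquivalences_stdSimplex_map_δ 0) j
  obtain ⟨l, h₁, h₂, h₃⟩ := (hasLiftingProperty_pushoutProduct_iff (face R C 0 0) j q).1 (hq _ hp)
    (degen R C ▷ A ≫ (θ A).hom ≫ i) s k (by
      change simplexMod R C 0 ◁ j ≫ s = face R C 0 0 ▷ A ≫ _
      rw [hs, face_degen]) (by
      change _ = simplexMod R C 1 ◁ j ≫ k
      rw [hk, hj, Category.assoc, Category.assoc]) hk₀.symm
  refine ⟨(θ L).inv ≫ face R C 0 1 ▷ L ≫ l, ?_, ?_⟩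
  · rw [Category.assoc, Category.assoc, h₃, hk₁, Iso.inv_hom_id]
  · have hθ' : j ≫ (θ L).inv = (θ A).inv ≫ simplexMod R C 0 ◁ j :=
      (tensPoint R C).inv.naturality j
    have h₁ : simplexMod R C 1 ◁ j ≫ l = degen R C ▷ A ≫ (θ A).hom ≫ i := h₁
    rw [reassoc_of% hθ', whisker_exchange_assoc, h₁, face_degen, Iso.inv_hom_id_assoc]

/-- A left Bousfield localization at a set of morphisms is admissible. Let `B ⟶ L` be a cell
complex with local target, built from a set of trivial cofibrations which detects the local
objects. Factor `A ⟶ B ⟶ L` as a cell complex `A ⟶ E` followed by a fibration; `E` is local too.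
If `A ⟶ B` is a trivial cofibration of the localization, then `A ⟶ L` is a retract of `A ⟶ E` by
`exists_section`. So the restrictions of both `A ⟶ L` and `B ⟶ L` to club many subobjects
are weak equivalences, and those of `A ⟶ B` are as well. -/
lemma IsAdmissible.bousfield (hW : IsAdmissible W) {ι : Type (u + 1)} {A B : ι → SMod R C}
    (m : ∀ i, A i ⟶ B i) : IsAdmissible (bousfield W m) := by
  have hpW := hW.isPreadmissible
  have hloc := hpW.bousfield m
  refine ⟨hloc.twoOutOfThree, inferInstance, hloc.saturated, fun A B f _ hf =>
    hloc.of_objectwise f hf, ?_⟩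
  obtain ⟨J, _, hJ, hJr, hJl⟩ := hW.exists_bousfield m
  have : MorphismProperty.HasSmallObjectArgument.{u + 1} J :=
    (isCoalgebraic_id R C).hasSmallObjectArgument J
  obtain ⟨κ₁, h₁⟩ := hloc.exists_llp_rlp_le_clubMonos J hJ
  obtain ⟨κ₂, h₂⟩ := exists_isLarge (R := R) (C := C)
  have hJW := hloc.saturated.llp_rlp_le hJ
  refine ⟨max κ₁ κ₂, fun κ hκ h A B f _ hf => ?_⟩
  have hκJ := h₁ κ hκ (le_of_max_le_left h)
  have hκ' := h₂ κ hκ (le_of_max_le_right h)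
  let FB := MorphismProperty.factorizationData J.rlp.llp J.rlp (terminal.from B)
  have hbm : Mono FB.i := (hJW _ FB.hi).1
  have hL : J.rlp (terminal.from FB.Z) :=
    (terminal.hom_ext FB.p (terminal.from FB.Z)) ▸ FB.hp
  let FA := MorphismProperty.factorizationData J.rlp.llp J.rlp (f ≫ FB.i)
  have hE : J.rlp (terminal.from FA.Z) :=
    (terminal.hom_ext (FA.p ≫ terminal.from FB.Z) (terminal.from FA.Z)) ▸
      MorphismProperty.comp_mem _ _ _ FA.hp hL
  have hfac : FA.i ≫ FA.p = f ≫ FB.i := FA.fac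
  have hjm : Mono (FA.i ≫ FA.p) := by rw [hfac]; infer_instance
  have hjW : MotivicCoalgebra.bousfield W m (FA.i ≫ FA.p) := by
    rw [hfac]
    exact MorphismProperty.comp_mem _ _ _ hf (hJW _ FB.hi).2
  have hj := (bousfield_iff m hpW _).1 hjW
  obtain ⟨s, hs, hs'⟩ := hpW.exists_section FA.i FA.p (hJr _ FA.hp) (hj _ (hJl _ hE))
    (hj _ (hJl _ hL))
  have hr : RetractArrow (FA.i ≫ FA.p) FA.i :=
    { i := Arrow.homMk (𝟙 _) s ((Category.id_comp _).trans hs'.symm)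
      r := Arrow.homMk (𝟙 _) FA.p (Category.id_comp _)
      retract := Arrow.hom_ext _ _ (Category.id_comp _) hs }
  have hj' := clubMonos.of_retract hκ' hr (hκJ _ FA.hi)
  rw [hfac] at hj'
  exact (clubMonos.of_comp hκ' (hκJ _ FB.hi) hj').2

/-! ### The three model structures -/

variable {F : Type u} [Field F]

/-- The `𝔸¹`-local weak equivalences are by definition those of the left Bousfield localization of
the local weak equivalences at the projections `X × 𝔸¹ ⟶ X`. -/
lemma isAdmissible_a1WeakEquivalences (R : Type (u + 1)) [CommRing R]
    (τ : GrothendieckTopology (Sm F)) : IsAdmissible (a1WeakEquivalences R τ) :=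
  (isAdmissible_local τ).bousfield fun X : Sm F => (freeRepresentable F R).map (projA1 X)
end

section
open Cardinal Simplicial

section

variable {R : Type (u + 1)} [CommRing R] {C : Type (u + 1)} [Category.{u} C]

/-- An admissible class of morphisms is the class of weak equivalences of a model structure on
presheaves of simplicial modules, which induces a combinatorial simplicial model structure
on presheaves of simplicial coalgebras. -/
theorem IsAdmissible.exists_modelCategories {W : MorphismProperty (SMod R C)}
    (hW : IsAdmissible W) :
    ∃ (_ : ModelCategory (SMod R C)) (_ : ModelCategory (SCoCAlg R C)),
      cofibrations (SMod R C) = MorphismProperty.monomorphisms (SMod R C) ∧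
      weakEquivalences (SMod R C) = W ∧
      HasLimitsOfSize.{u + 1, u + 1} (SCoCAlg R C) ∧
      HasColimitsOfSize.{u + 1, u + 1} (SCoCAlg R C) ∧
      IsLeftInduced (SCoCAlg.forget R C) ∧
      weakEquivalences (SCoCAlg R C) = W.inverseImage (SCoCAlg.forget R C) ∧
      IsCofibrantlyGenerated.{u + 1} (SCoCAlg R C) ∧
      IsSimplicialModelCategory.{u + 1} (SCoCAlg R C) ∧
      ∃ κ₀ : Cardinal.{u + 1}, ∀ (κ : Cardinal.{u + 1}) [Fact κ.IsRegular], κ₀ ≤ κ →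
        ObjectProperty.EssentiallySmall.{u + 1} (isCardinalPresentable (SCoCAlg R C) κ) ∧
        IsGeneratedBy.{u + 1}
          (fun X Y f => IsCardinalPresentable X κ ∧ IsCardinalPresentable Y κ ∧
            Mono ((SCoCAlg.forget R C).map f))
          (cofibrations (SCoCAlg R C)) := by
  have hU := isCoalgebraic_forget R C
  have := hU.hasColimits
  have := hU.preservesColimits
  have : HasColimitsOfSize.{0, 0} (SCoCAlg R C) := hasColimitsOfSizeShrink.{0, 0, u + 1, u + 1} _
  obtain ⟨hM, hc, hw, -⟩ := (isCoalgebraic_id R C).exists_modelCategory hW (hasCylinders_id R C)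
  obtain ⟨hM', hc', hw', hg⟩ := hU.exists_modelCategory hW (hasCylinders_forget R C)
  have hQ : MorphismProperty.monomorphisms _ ⊓ W = (fibrations (SMod R C)).llp :=
    congr($hc ⊓ $hw).symm.trans (fibrations_llp _).symm
  refine ⟨hM, hM', hc, hw, hU.hasLimits, hU.hasColimits, ⟨hU.isLeftAdjoint _, ?_, ?_⟩, hw', hg,
    isSimplicialModelCategory hW.isPreadmissible hQ hc' hw', ?_⟩
  · rw [hc', hc]
    rfl
  · rw [hw', hw]
    rfl
  · rw [hc']
    exact hU.exists_isGeneratedBy_monos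

end
end

end MotivicCoalgebra
end


theorem mainTheorem4 (F : Type u) [Field F] (R : Type (u + 1)) [CommRing R]
    (τ : GrothendieckTopology (Sm F)) (hτ : τ = nisnevichTopology F ∨ τ = etaleTopology F)
    (W : MorphismProperty (SMod R (Sm F)))
    (hW : W = objectwiseWeakEquivalences R (Sm F) ∨ W = localWeakEquivalences R τ ∨
      W = a1WeakEquivalences R τ) :
    ∃ (_ : ModelCategory (SMod R (Sm F))) (_ : ModelCategory (SCoCAlg R (Sm F))),
      cofibrations (SMod R (Sm F)) = MorphismProperty.monomorphisms (SMod R (Sm F)) ∧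
      weakEquivalences (SMod R (Sm F)) = W ∧
      HasLimitsOfSize.{u + 1, u + 1} (SCoCAlg R (Sm F)) ∧
      HasColimitsOfSize.{u + 1, u + 1} (SCoCAlg R (Sm F)) ∧
      IsLeftInduced (SCoCAlg.forget R (Sm F)) ∧
      weakEquivalences (SCoCAlg R (Sm F)) = W.inverseImage (SCoCAlg.forget R (Sm F)) ∧
      IsCofibrantlyGenerated.{u + 1} (SCoCAlg R (Sm F)) ∧
      IsSimplicialModelCategory.{u + 1} (SCoCAlg R (Sm F)) ∧
      ∃ κ₀ : Cardinal.{u + 1}, ∀ (κ : Cardinal.{u + 1}) [Fact κ.IsRegular], κ₀ ≤ κ →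
        ObjectProperty.EssentiallySmall.{u + 1}
          (isCardinalPresentable (SCoCAlg R (Sm F)) κ) ∧
        IsGeneratedBy.{u + 1}
          (fun X Y f => IsCardinalPresentable X κ ∧ IsCardinalPresentable Y κ ∧
            Mono ((SCoCAlg.forget R (Sm F)).map f))
          (cofibrations (SCoCAlg R (Sm F))) := by
  have hA : IsAdmissible W := by
    rcases hW with rfl | rfl | rfl
    · exact isAdmissible_objectwise
    · exact isAdmissible_local τ
    · exact isAdmissible_a1WeakEquivalences R τ
  exact hA.exists_modelCategories
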